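/- There exists a universal constant $c>0$ such that the following holds. Let $V=D^2\times S^1$ be a solid torus ($D^2$ the closed unit disc), and let $h$ be a smooth flat Riemannian metric on the torus $\partial V$, of area $A$. Let $\mu=\partial D^2\times\{\mathrm{pt}\}\subset\partial V$ be the meridian, and suppose that a closed $h$-geodesic on $\partial V$ freely homotopic to $\mu$ has length $\ell>2\pi$. Then there exists a Riemannian metric $g$ on $V$, smooth up to the boundary, with the following properties. (1) The metric $g$ is a hyperbolic cusp metric in a collar of $\partial V$, the boundary $\partial V$ is a horospherical section of the cusp, and $g$ restricts to $h$ on $\partial V$. Precisely: for some $\delta>0$ there is a diffeomorphism $\Psi$ from $\partial V\times(-\delta,0]$ onto a neighbourhood of $\partial V$ in $V$ with $\Psi(x,0)=x$ for all $x\in\partial V$ and $\Psi^*g=dr^2+e^{2r}h$, where $r\in(-\delta,0]$ is the second coordinate. (2) If $S_g$ denotes the scalar curvature of $g$, then $$\int_V\left(\frac{|S_g|}{6}\right)^{3/2}\,d\mathrm{vol}_g\;\le\;\frac{A}{2}\left(1-\frac{\pi^2}{\ell^2}\right)\left(1+c\,\frac{\pi^4}{\ell^4}\right).$$ -/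

import Mathlib

open scoped ContDiff Topology

noncomputable section

namespace TubeMetric

/-- A field of `n × n` matrices on `ℝⁿ`: the coefficients `g i j` of a bilinear form on each
tangent space, in the standard coordinates. -/
abbrev MetricField (n : ℕ) := (Fin n → ℝ) → Matrix (Fin n) (Fin n) ℝ

/-- The standard basis vector `e i` of `ℝⁿ`. -/
def e {n : ℕ} (i : Fin n) : Fin n → ℝ := Pi.single i 1

/-- `i`-th partial derivative, at `x`, of a function on the domain `S`. The domains used below are
all of `ℝⁿ`, open sets, and convex sets with non-empty interior (with part of the boundary), where
derivatives within the domain are unique; at a boundary point it is the one-sided derivative. -/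
def partialD {n : ℕ} (S : Set (Fin n → ℝ)) (f : (Fin n → ℝ) → ℝ) (i : Fin n)
    (x : Fin n → ℝ) : ℝ :=
  fderivWithin ℝ f S x (e i)

/-- `g` is a smooth Riemannian metric on the domain `S ⊆ ℝⁿ`, smooth up to the part of the
boundary that belongs to `S`. -/
structure IsRiemannianMetricOn {n : ℕ} (S : Set (Fin n → ℝ)) (g : MetricField n) : Prop where
  smooth : ∀ i j, ContDiffOn ℝ ∞ (fun x => g x i j) S
  posDef : ∀ x ∈ S, (g x).PosDef

/-- Christoffel symbol `Γᵏᵢⱼ` of `g`. -/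
def christoffel {n : ℕ} (S : Set (Fin n → ℝ)) (g : MetricField n) (k i j : Fin n)
    (x : Fin n → ℝ) : ℝ :=
  (1 / 2 : ℝ) * ∑ l, (g x)⁻¹ k l *
    (partialD S (fun y => g y j l) i x + partialD S (fun y => g y i l) j x
      - partialD S (fun y => g y i j) l x)

/-- Ricci tensor: `∂ᵢ Γⁱⱼₖ - ∂ⱼ Γⁱᵢₖ + Γⁱᵢₚ Γᵖⱼₖ - Γⁱⱼₚ Γᵖᵢₖ`, summed over `i` and `p`. -/
def ricci {n : ℕ} (S : Set (Fin n → ℝ)) (g : MetricField n) (j k : Fin n)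
    (x : Fin n → ℝ) : ℝ :=
  ∑ i, (partialD S (christoffel S g i j k) i x - partialD S (christoffel S g i i k) j x
    + ∑ p, (christoffel S g i i p x * christoffel S g p j k x
      - christoffel S g i j p x * christoffel S g p i k x))

/-- Scalar curvature of `g`: the trace of the Ricci tensor with respect to `g`. -/
def scalarCurvature {n : ℕ} (S : Set (Fin n → ℝ)) (g : MetricField n) (x : Fin n → ℝ) : ℝ :=
  ∑ j, ∑ k, (g x)⁻¹ j k * ricci S g j k x

/-- Density of the Riemannian measure of `g` with respect to Lebesgue measure. -/
def volDensity {n : ℕ} (g : MetricField n) (x : Fin n → ℝ) : ℝ := Real.sqrt (g x).det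

/-- Pullback `f^* g` of `g` along `f`, where `f` is a map defined on the domain `S`. -/
def pullback {m n : ℕ} (S : Set (Fin m → ℝ)) (f : (Fin m → ℝ) → (Fin n → ℝ))
    (g : MetricField n) : MetricField m :=
  fun x => Matrix.of fun i j =>
    ∑ a, ∑ b, g (f x) a b * partialD S (fun y => f y a) i x * partialD S (fun y => f y b) j x

/-! ### Flat metrics on the boundary torus

The closed solid cylinder `D² × ℝ` is the universal cover of the solid torus `V = D² × S¹`
(`S¹ = ℝ / ℤ`), with deck group generated by the translation `p ↦ p + e 2`. Objects on `V` are
represented by their lifts to the cylinder. The universal cover of the torus `∂V` is `ℝ²` with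
deck group `ℤ²`; its covering map is induced by `boundaryMap`, and the translation by `e 0` is the
class of the meridian `∂D² × {pt}`. -/

/-- The closed solid cylinder `D² × ℝ`, `D²` the closed unit disc. -/
def solidCylinder : Set (Fin 3 → ℝ) := {p | p 0 ^ 2 + p 1 ^ 2 ≤ 1}

/-- A fundamental domain of the solid torus `V = (D² × ℝ) / ℤ`. -/
def fundamentalDomain : Set (Fin 3 → ℝ) := {p | p ∈ solidCylinder ∧ 0 ≤ p 2 ∧ p 2 < 1}

/-- The map `ℝ² → ∂D² × ℝ` that lifts the universal covering of the torus `∂V`. -/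
def boundaryMap (x : Fin 2 → ℝ) : Fin 3 → ℝ :=
  ![Real.cos (2 * Real.pi * x 0), Real.sin (2 * Real.pi * x 0), x 1]

/-- `h` is (the lift to `ℝ²` of) a smooth flat Riemannian metric on the torus `∂V = ℝ² / ℤ²`.
Flat means: locally isometric to the Euclidean plane. -/
structure IsFlatBoundaryMetric (h : MetricField 2) : Prop where
  isMetric : IsRiemannianMetricOn Set.univ h
  periodic : ∀ x i, h (x + e i) = h x
  flat : ∀ x, ∃ U : Set (Fin 2 → ℝ), IsOpen U ∧ x ∈ U ∧
    ∃ f : (Fin 2 → ℝ) → (Fin 2 → ℝ), ContDiffOn ℝ ∞ f U ∧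
      ∀ y ∈ U, pullback U f (fun _ => 1) y = h y

/-- Area of the torus `∂V` with the metric `h`. -/
def boundaryArea (h : MetricField 2) : ℝ :=
  ∫ x in {x : Fin 2 → ℝ | ∀ i, 0 ≤ x i ∧ x i < 1}, volDensity h x

/-- `γ` is (the lift to `ℝ²` of) a closed geodesic of `(∂V, h)` in the free homotopy class of the
meridian: the loop `γ|[0,1]` lifts a representative of the class of the translation `e 0`. -/
structure IsMeridianGeodesic (h : MetricField 2) (γ : ℝ → Fin 2 → ℝ) : Prop where
  smooth : ContDiff ℝ ∞ γ
  meridian : ∀ u, γ (u + 1) = γ u + e 0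
  geodesic : ∀ u k, deriv (deriv fun v => γ v k) u +
    ∑ i, ∑ j, christoffel Set.univ h k i j (γ u) *
      deriv (fun v => γ v i) u * deriv (fun v => γ v j) u = 0

/-- Length of the loop `γ|[0,1]` with respect to `h`. -/
def loopLength (h : MetricField 2) (γ : ℝ → Fin 2 → ℝ) : ℝ :=
  ∫ u in (0 : ℝ)..1, Real.sqrt (∑ i, ∑ j, h (γ u) i j *
    deriv (fun v => γ v i) u * deriv (fun v => γ v j) u)

/-! ### Metrics on the solid torus -/

/-- `g` is (the lift to `D² × ℝ` of) a Riemannian metric on the solid torus `V`, smooth up to the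
boundary. -/
structure IsSolidTorusMetric (g : MetricField 3) : Prop where
  isMetric : IsRiemannianMetricOn solidCylinder g
  periodic : ∀ p ∈ solidCylinder, g (p + e 2) = g p

/-- The domain `ℝ² × (-δ, 0]`, with coordinates `(x 0, x 1, r)`. -/
def slab (δ : ℝ) : Set (Fin 3 → ℝ) := {q | -δ < q 2 ∧ q 2 ≤ 0}

/-- The cusp metric `dr² + e^{2r} h` on `ℝ² × ℝ`. It is hyperbolic when `h` is flat, the slices
`r = const` are horospherical, and the cusp is at `r → -∞`. -/
def cuspMetric (h : MetricField 2) : MetricField 3 := fun q =>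
  !![Real.exp (2 * q 2) * h ![q 0, q 1] 0 0, Real.exp (2 * q 2) * h ![q 0, q 1] 0 1, 0;
     Real.exp (2 * q 2) * h ![q 0, q 1] 1 0, Real.exp (2 * q 2) * h ![q 0, q 1] 1 1, 0;
     0, 0, 1]

/-- `Ψ` is (the lift of) a smooth collar `∂V × (-δ, 0] → V` of `∂V`, which is the identity on
`∂V × {0}` and in which `g` is the cusp metric `dr² + e^{2r} h`. (Being isometric, `Ψ` is an
immersion; so it is a diffeomorphism onto a neighbourhood of `∂V`.) -/
structure IsCuspCollar (h : MetricField 2) (g : MetricField 3) (δ : ℝ)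
    (Ψ : (Fin 3 → ℝ) → (Fin 3 → ℝ)) : Prop where
  pos : 0 < δ
  smooth : ContDiffOn ℝ ∞ Ψ (slab δ)
  mapsTo : Set.MapsTo Ψ (slab δ) solidCylinder
  /-- `Ψ` descends to a map of `∂V × (-δ, 0]` to `V`. -/
  equivariant : ∀ q ∈ slab δ, Ψ (q + e 0) = Ψ q ∧ Ψ (q + e 1) = Ψ q + e 2
  /-- The induced map on `∂V × (-δ, 0]` is injective. -/
  injective : ∀ q ∈ slab δ, ∀ q' ∈ slab δ, ∀ m : ℤ, Ψ q' = Ψ q + (m : ℝ) • e 2 →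
    ∃ k : ℤ, q' = q + (k : ℝ) • e 0 + (m : ℝ) • e 1
  /-- Its image is a neighbourhood of `∂V` in `V`. -/
  nhds : ∀ x, Ψ '' slab δ ∈ 𝓝[solidCylinder] (boundaryMap x)
  boundary : ∀ x : Fin 2 → ℝ, Ψ ![x 0, x 1, 0] = boundaryMap x
  isometric : ∀ q ∈ slab δ, pullback (slab δ) Ψ g q = cuspMetric h q

/-- The integrand of `∫_V (|S_g| / 6)^{3/2} dvol_g` in the coordinates of `D² × ℝ`. -/
def scalarIntegrand (g : MetricField 3) (p : Fin 3 → ℝ) : ℝ :=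
  (|scalarCurvature solidCylinder g p| / 6) ^ (3 / 2 : ℝ) * volDensity g p

end TubeMetric

end

open scoped ContDiff Topology

noncomputable section

namespace TubeMetric

/-! Put q = π/ℓ. A flat torus whose meridian geodesic has length ℓ is ℂ modulo the lattice spanned
by ℓ and some τ + iκ, and A = ℓκ. In flat coordinates (a, b), with a along the meridian, the tube
carries the metric dr² + f(r)² da² + k(r)² db², where f = eʳ − q²u, k = eʳ + q²u and u is a cut-off
of e⁻ʳ. For r ≥ −1/4 both profiles are eʳ, and this is the cusp with its boundary at r = 0. For r ≤
−1/2 they are 2q sinh(r − log q) and 2q cosh(r − log q): a hyperbolic tube whose core is at r = log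
q. It is smooth there because the meridian at height r has length fℓ = 2π sinh(r − log q). Since ℓ >
2π means q < 1/2, we have log q < −1/2, so the core lies below the transition region.

The terms of order q² cancel both in fk and in f''k + fk'' + f'k'. Hence the scalar curvature is −6
+ O(q⁴) in the transition region, and the curvature integrand is at most (1 + Kq⁴)e²ʳ
(`exists_profile_bound`). Integrating over log q < r < 0 gives the factor (1 − q²)/2
(`integral_exp_radial`), which is the asserted bound.

The metric must restrict to the given h in the given coordinates of ∂V, not just to an isometric
metric. `IsFlatBoundaryMetric.exists_structure` develops h into the plane and writes it as the
pullback of a linear metric by a ℤ²-equivariant map Φ with positive Jacobian. To extend Φ over the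
solid torus it is joined to the identity through equivariant immersions (`exists_isotopy`), and this
isotopy is spread over the Euclidean radii between 1/2 and 3/4. The curvature does not see it,
because the metric stays locally a pullback of the warped product (`scalarCurvature_warped`).
Neither does the integral, because the Jacobian of each slice has mean one
(`TubeData.cellInt_jacG`).

The isotopy comes from the Beltrami equation. If μ is the Beltrami coefficient of Φ, then ∂̄F = tμ
∂F is solved on the torus for 0 ≤ t ≤ 1 by inverting a contraction on Fourier coefficients, in a
weighted space that provides decay (`exists_beltrami_path`). The derivative ∂F has no zeros, since
it is a constant multiple of the exponential of a solution of another linear equation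
(`exists_beltrami_log`). Truncating the series makes the family jointly smooth, a real linear map
restores the period lattice, and uniqueness identifies the solution at t = 1 with Φ up to a
constant. -/

variable {E : Type*} [NormedAddCommGroup E] [NormedSpace ℝ E]

/-! ### Calculus on the unit square: divergence theorem and mean of the Jacobian. -/

/-- `i`-th partial derivative of a function on `ℝⁿ`. -/
def pd {n : ℕ} (i : Fin n) (F : (Fin n → ℝ) → E) (x : Fin n → ℝ) : E := fderiv ℝ F x (e i)

/-- Integral over the unit square. -/
def cellInt (F : (Fin 2 → ℝ) → E) : E := ∫ x in (0 : ℝ)..1, ∫ y in (0 : ℝ)..1, F ![x, y]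

theorem e_zero_two : (e 0 : Fin 2 → ℝ) = ![1, 0] := by ext i; fin_cases i <;> simp [e]
theorem e_one_two : (e 1 : Fin 2 → ℝ) = ![0, 1] := by ext i; fin_cases i <;> simp [e]

theorem ContDiff.pd {n : ℕ} {F : (Fin n → ℝ) → E} {k m : WithTop ℕ∞} (hF : ContDiff ℝ k F)
    (h : m + 1 ≤ k) (i : Fin n) : ContDiff ℝ m (pd i F) :=
  (hF.fderiv_right h).clm_apply contDiff_const

theorem continuous_pd {n : ℕ} {F : (Fin n → ℝ) → E} (hF : ContDiff ℝ 1 F) (i : Fin n) :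
    Continuous (pd i F) :=
  (hF.continuous_fderiv (by norm_num)).clm_apply continuous_const

theorem pd_add_period {n : ℕ} {F : (Fin n → ℝ) → E} {v : Fin n → ℝ} {a : E}
    (h : ∀ x, F (x + v) = F x + a) (i : Fin n) (x : Fin n → ℝ) : pd i F (x + v) = pd i F x := by
  have h2 : (fun y => F (y + v)) = fun y => F y + a := funext h
  have := congrArg (fun G => fderiv ℝ G x (e i)) h2
  simpa [pd, fderiv_comp_add_right] using this

/-- Divergence theorem on the unit square. -/
theorem cellInt_divergence [CompleteSpace E] {F G : (Fin 2 → ℝ) → E} (hF : ContDiff ℝ 1 F)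
    (hG : ContDiff ℝ 1 G) :
    cellInt (fun x => pd 0 F x + pd 1 G x) =
      (((∫ x in (0 : ℝ)..1, G ![x, 1]) - ∫ x in (0 : ℝ)..1, G ![x, 0]) +
        ∫ y in (0 : ℝ)..1, F ![1, y]) - ∫ y in (0 : ℝ)..1, F ![0, y] := by
  let κ : ℝ × ℝ →L[ℝ] (Fin 2 → ℝ) := (ContinuousLinearEquiv.finTwoArrow ℝ ℝ).symm
  have hκ : ∀ x y : ℝ, κ (x, y) = ![x, y] := fun x y => rfl
  have hd : ∀ {H : (Fin 2 → ℝ) → E}, ContDiff ℝ 1 H → ∀ p, HasFDerivAt (fun q => H (κ q))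
      ((fderiv ℝ H (κ p)).comp κ) p := fun hH p =>
    ((hH.differentiable (by norm_num)).differentiableAt.hasFDerivAt).comp p κ.hasFDerivAt
  have := MeasureTheory.integral2_divergence_prod_of_hasFDerivAt_off_countable
    (fun p => F (κ p)) (fun p => G (κ p)) (fun p => (fderiv ℝ F (κ p)).comp κ)
    (fun p => (fderiv ℝ G (κ p)).comp κ) 0 0 1 1 ∅ Set.countable_empty
    (hF.continuous.comp κ.continuous).continuousOn (hG.continuous.comp κ.continuous).continuousOn
    (fun p _ => hd hF p) (fun p _ => hd hG p) (by
      refine ContinuousOn.integrableOn_compact (isCompact_uIcc.prod isCompact_uIcc) ?_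
      refine Continuous.continuousOn ?_
      have c1 := hF.continuous_fderiv (by norm_num)
      have c2 := hG.continuous_fderiv (by norm_num)
      simp only [ContinuousLinearMap.comp_apply]
      exact ((c1.comp κ.continuous).clm_apply continuous_const).add
        ((c2.comp κ.continuous).clm_apply continuous_const))
  simpa only [ContinuousLinearMap.comp_apply, hκ, cellInt, pd, e_zero_two, e_one_two] using this

/-- The derivatives of a doubly periodic function have mean zero. -/
theorem cellInt_pd_zero [CompleteSpace E] {F : (Fin 2 → ℝ) → E} (hF : ContDiff ℝ 1 F)
    (hp : ∀ x i, F (x + e i) = F x) (i : Fin 2) : cellInt (pd i F) = 0 := by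
  have h0 : ∀ y : ℝ, F ![1, y] = F ![0, y] := fun y => by
    rw [← hp ![0, y] 0, e_zero_two]; simp
  have h1 : ∀ x : ℝ, F ![x, 1] = F ![x, 0] := fun x => by
    rw [← hp ![x, 0] 1, e_one_two]; simp
  have hz : ∀ j, pd j (fun _ : Fin 2 → ℝ => (0 : E)) = fun _ => 0 := fun j => by
    ext x; simp [pd]
  fin_cases i
  · have := cellInt_divergence hF (contDiff_const (c := (0 : E)))
    simpa [hz, h0] using this
  · have := cellInt_divergence (contDiff_const (c := (0 : E))) hF
    simpa [hz, h1] using this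

/-- The Jacobian determinant of a map from the plane to `ℂ`. -/
def jac (Φ : (Fin 2 → ℝ) → ℂ) (x : Fin 2 → ℝ) : ℝ :=
  (starRingEnd ℂ (pd 0 Φ x) * pd 1 Φ x).im

theorem pd_comm {n : ℕ} {F : (Fin n → ℝ) → E} (hF : ContDiff ℝ 2 F) (i j : Fin n)
    (x : Fin n → ℝ) : pd i (pd j F) x = pd j (pd i F) x := by
  have hd : DifferentiableAt ℝ (fderiv ℝ F) x :=
    ((hF.fderiv_right (m := 1) (by norm_num)).differentiable (by norm_num)).differentiableAt
  have h : ∀ i j, pd i (pd j F) x = fderiv ℝ (fderiv ℝ F) x (e i) (e j) := fun i j => by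
    have : HasFDerivAt (pd j F) _ x := hd.hasFDerivAt.clm_apply (hasFDerivAt_const (e j) x)
    rw [pd, this.fderiv]; simp
  rw [h, h]
  exact (hF.contDiffAt.isSymmSndFDerivAt (by simp)) _ _

theorem pd_mul_real {n : ℕ} {F G : (Fin n → ℝ) → ℝ} {x : Fin n → ℝ}
    (hF : DifferentiableAt ℝ F x) (hG : DifferentiableAt ℝ G x) (i : Fin n) :
    pd i (fun y => F y * G y) x = F x * pd i G x + pd i F x * G x := by
  have := congrArg (fun L => L (e i)) (hF.hasFDerivAt.mul hG.hasFDerivAt).fderiv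
  simp only [add_apply, smul_apply, smul_eq_mul] at this
  rw [pd]; refine Eq.trans this ?_; simp only [pd]; ring

theorem cellInt_add [CompleteSpace E] {F G : (Fin 2 → ℝ) → E} (hF : Continuous F)
    (hG : Continuous G) : cellInt (fun x => F x + G x) = cellInt F + cellInt G := by
  have hc : ∀ {H : (Fin 2 → ℝ) → E}, Continuous H →
      Continuous fun x : ℝ => ∫ y in (0 : ℝ)..1, H ![x, y] := fun hH =>
    intervalIntegral.continuous_parametric_intervalIntegral_of_continuous' (by fun_prop) _ _
  unfold cellInt
  rw [← intervalIntegral.integral_add ((hc hF).intervalIntegrable _ _)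
    ((hc hG).intervalIntegrable _ _)]
  congr 1; ext x
  rw [intervalIntegral.integral_add] <;>
  exact Continuous.intervalIntegrable (by fun_prop) _ _

/-- The Jacobian determinant of a map of the plane that is equivariant with respect to `ℤ²`
integrates to the determinant of the translations. -/
theorem cellInt_jac {Φ : (Fin 2 → ℝ) → ℂ} (hΦ : ContDiff ℝ 2 Φ) {a b : ℂ}
    (ha : ∀ x, Φ (x + e 0) = Φ x + a) (hb : ∀ x, Φ (x + e 1) = Φ x + b) :
    cellInt (jac Φ) = (starRingEnd ℂ a * b).im := by
  set u : (Fin 2 → ℝ) → ℝ := fun x => (Φ x).re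
  set v : (Fin 2 → ℝ) → ℝ := fun x => (Φ x).im
  have hu : ContDiff ℝ 2 u := Complex.reCLM.contDiff.comp hΦ
  have hv : ContDiff ℝ 2 v := Complex.imCLM.contDiff.comp hΦ
  have hdΦ : Differentiable ℝ Φ := hΦ.differentiable (by norm_num)
  have hdu : Differentiable ℝ u := hu.differentiable (by norm_num)
  have pu : ∀ i x, pd i u x = (pd i Φ x).re := fun i x => by
    have : HasFDerivAt u (Complex.reCLM.comp (fderiv ℝ Φ x)) x :=
      Complex.reCLM.hasFDerivAt.comp x (hdΦ x).hasFDerivAt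
    rw [pd, this.fderiv]; rfl
  have pv : ∀ i x, pd i v x = (pd i Φ x).im := fun i x => by
    have : HasFDerivAt v (Complex.imCLM.comp (fderiv ℝ Φ x)) x :=
      Complex.imCLM.hasFDerivAt.comp x (hdΦ x).hasFDerivAt
    rw [pd, this.fderiv]; rfl
  have hv1 : ∀ i, ContDiff ℝ 1 (pd i v) := fun i => ContDiff.pd hv (by norm_num) i
  have hF : ContDiff ℝ 1 fun x => u x * pd 1 v x := (hu.of_le (by norm_num)).mul (hv1 1)
  have hG : ContDiff ℝ 1 fun x => -u x * pd 0 v x := (hu.of_le (by norm_num)).neg.mul (hv1 0)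
  -- This is du ∧ dv = d(u dv). Only boundary terms survive, and on opposite sides of the square
  -- they differ by the periods.
  have hj : jac Φ = fun x => pd 0 (fun x => u x * pd 1 v x) x +
      pd 1 (fun x => -u x * pd 0 v x) x := by
    ext x
    have h1 := (hv1 1).differentiable (by norm_num)
    have h0 := (hv1 0).differentiable (by norm_num)
    rw [pd_mul_real (hdu x) (h1 x), pd_mul_real (F := fun y => -u y) (hdu x).neg (h0 x), pd_comm hv 0 1]
    have : pd 1 (fun y => -u y) x = -pd 1 u x := by simp [pd]
    rw [this, pu, pu, pv, pv, jac]
    simp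
    ring
  rw [hj, cellInt_divergence hF hG]
  have e0 : ∀ y : ℝ, (![1, y] : Fin 2 → ℝ) = ![0, y] + e 0 := fun y => by simp [e_zero_two]
  have e1 : ∀ y : ℝ, (![y, 1] : Fin 2 → ℝ) = ![y, 0] + e 1 := fun y => by simp [e_one_two]
  have hua : ∀ x, u (x + e 0) = u x + a.re := fun x => by simp [u, ha]
  have hub : ∀ x, u (x + e 1) = u x + b.re := fun x => by simp [u, hb]
  have hva : ∀ x, v (x + e 0) = v x + a.im := fun x => by simp [v, ha]
  have hvb : ∀ x, v (x + e 1) = v x + b.im := fun x => by simp [v, hb]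
  have c1 : ∀ i, Continuous (pd i v) := fun i => (hv1 i).continuous
  have cu := hu.continuous
  have cont : ∀ {F : (Fin 2 → ℝ) → ℝ}, Continuous F →
      IntervalIntegrable (fun x : ℝ => F ![x, 0]) MeasureTheory.volume 0 1 := fun hF =>
    Continuous.intervalIntegrable (by fun_prop) _ _
  have cont' : ∀ {F : (Fin 2 → ℝ) → ℝ}, Continuous F →
      IntervalIntegrable (fun x : ℝ => F ![0, x]) MeasureTheory.volume 0 1 := fun hF =>
    Continuous.intervalIntegrable (by fun_prop) _ _
  have I1 : ∫ x in (0 : ℝ)..1, pd 0 v ![x, 0] = a.im := by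
    have : ∀ x ∈ Set.uIcc (0 : ℝ) 1, HasDerivAt (fun x : ℝ => v ![x, 0]) (pd 0 v ![x, 0]) x := by
      intro x _
      have h := ((hv.differentiable (by norm_num)) ![x, 0]).hasFDerivAt.comp_hasDerivAt x
        (f := fun x : ℝ => ![x, 0]) (f' := e 0) (by
          rw [hasDerivAt_pi]; intro i
          fin_cases i
          · simpa [e] using hasDerivAt_id' x
          · simpa [e] using hasDerivAt_const x (0 : ℝ))
      exact h
    rw [intervalIntegral.integral_eq_sub_of_hasDerivAt this (cont (c1 0)), e0, hva]; ring
  have I2 : ∫ y in (0 : ℝ)..1, pd 1 v ![0, y] = b.im := by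
    have : ∀ x ∈ Set.uIcc (0 : ℝ) 1, HasDerivAt (fun x : ℝ => v ![0, x]) (pd 1 v ![0, x]) x := by
      intro x _
      have h := ((hv.differentiable (by norm_num)) ![0, x]).hasFDerivAt.comp_hasDerivAt x
        (f := fun x : ℝ => ![0, x]) (f' := e 1) (by
          rw [hasDerivAt_pi]; intro i
          fin_cases i
          · simpa [e] using hasDerivAt_const x (0 : ℝ)
          · simpa [e] using hasDerivAt_id' x)
      exact h
    rw [intervalIntegral.integral_eq_sub_of_hasDerivAt this (cont' (c1 1)), e1, hvb]; ring
  simp only [e0, e1, pd_add_period hva, pd_add_period hvb, hua, hub]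
  rw [← intervalIntegral.integral_sub, add_sub_assoc, ← intervalIntegral.integral_sub]
  · have r1 : ∀ x : ℝ, -(u ![x, 0] + b.re) * pd 0 v ![x, 0] - -u ![x, 0] * pd 0 v ![x, 0]
        = -b.re * pd 0 v ![x, 0] := fun x => by ring
    have r2 : ∀ y : ℝ, (u ![0, y] + a.re) * pd 1 v ![0, y] - u ![0, y] * pd 1 v ![0, y]
        = a.re * pd 1 v ![0, y] := fun x => by ring
    simp only [r1, r2, intervalIntegral.integral_const_mul, I1, I2]
    simp; ring
  all_goals exact Continuous.intervalIntegrable (by fun_prop) _ _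

/-! ### Weighted convolution operators on square-summable sequences. -/

/-- Square-summable sequences indexed by `ℤ²`. -/
abbrev SqSum := lp (fun _ : Fin 2 → ℤ => ℂ) 2

/-- The weighted composition operator `a ↦ (n ↦ d n * a (τ n))`. -/
def weightedComp (τ : Equiv.Perm (Fin 2 → ℤ)) (d : (Fin 2 → ℤ) → ℂ) (C : ℝ)
    (h : ∀ n, ‖d n‖ ≤ C) : SqSum →L[ℂ] SqSum :=
  LinearMap.mkContinuous
    { toFun := fun a => ⟨fun n => d n * a (τ n), by
        have ha : Summable fun n => ‖a n‖ ^ (2 : ENNReal).toReal :=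
          (lp.memℓp a).summable (by norm_num)
        have ha' := (τ.summable_iff.2 ha).mul_left (C ^ (2 : ENNReal).toReal)
        refine memℓp_gen (ha'.of_nonneg_of_le (fun n => by positivity) fun n => ?_)
        rw [norm_mul, Real.mul_rpow (norm_nonneg _) (norm_nonneg _)]
        simp only [Function.comp_apply]
        have := h n
        gcongr⟩
      map_add' := fun a b => by ext n; simp only [lp.coeFn_add, Pi.add_apply, mul_add]
      map_smul' := fun c a => by ext n; simp [mul_left_comm] } C (fun a => by
    have hC : 0 ≤ C := (norm_nonneg _).trans (h 0)
    refine lp.norm_le_of_tsum_le (by norm_num) (by positivity) ?_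
    have ha : HasSum (fun n => ‖a n‖ ^ (2 : ENNReal).toReal) (‖a‖ ^ (2 : ENNReal).toReal) :=
      lp.hasSum_norm (by norm_num) a
    have hb := (τ.hasSum_iff.2 ha).mul_left (C ^ (2 : ENNReal).toReal)
    rw [Real.mul_rpow hC (norm_nonneg _), ← hb.tsum_eq]
    have hle : ∀ n, ‖d n * a (τ n)‖ ^ (2 : ENNReal).toReal ≤
        C ^ (2 : ENNReal).toReal * ((fun n => ‖a n‖ ^ (2 : ENNReal).toReal) ∘ τ) n := fun n => by
      rw [norm_mul, Real.mul_rpow (norm_nonneg _) (norm_nonneg _)]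
      simp only [Function.comp_apply]
      have := h n
      gcongr
    exact Summable.tsum_le_tsum hle (hb.summable.of_nonneg_of_le (fun n => by positivity) hle)
      hb.summable)

@[simp] theorem weightedComp_apply (τ : Equiv.Perm (Fin 2 → ℤ)) (d : (Fin 2 → ℤ) → ℂ) (C : ℝ)
    (h : ∀ n, ‖d n‖ ≤ C) (a : SqSum) (n : Fin 2 → ℤ) :
    weightedComp τ d C h a n = d n * a (τ n) := rfl

theorem norm_weightedComp_le (τ : Equiv.Perm (Fin 2 → ℤ)) (d : (Fin 2 → ℤ) → ℂ) (C : ℝ)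
    (h : ∀ n, ‖d n‖ ≤ C) : ‖weightedComp τ d C h‖ ≤ C :=
  LinearMap.mkContinuous_norm_le _ ((norm_nonneg _).trans (h 0)) _

/-- Evaluation at an index, as a continuous linear form. -/
def evalAt (n : Fin 2 → ℤ) : SqSum →L[ℂ] ℂ :=
  lp.evalCLM ℂ (fun _ : Fin 2 → ℤ => ℂ) 2 n

@[simp] theorem evalAt_apply (n : Fin 2 → ℤ) (a : SqSum) : evalAt n a = a n := rfl

/-- The weight `(1 + δ|n₀|)⁴ (1 + δ|n₁|)⁴`. -/
def weight (δ : ℝ) (n : Fin 2 → ℤ) : ℝ := (1 + δ * |(n 0 : ℝ)|) ^ 4 * (1 + δ * |(n 1 : ℝ)|) ^ 4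

theorem one_le_weight {δ : ℝ} (hδ : 0 ≤ δ) (n : Fin 2 → ℤ) : 1 ≤ weight δ n := by
  have h0 : 1 ≤ 1 + δ * |(n 0 : ℝ)| := by have := mul_nonneg hδ (abs_nonneg (n 0 : ℝ)); linarith
  have h1 : 1 ≤ 1 + δ * |(n 1 : ℝ)| := by have := mul_nonneg hδ (abs_nonneg (n 1 : ℝ)); linarith
  exact one_le_mul_of_one_le_of_one_le (one_le_pow₀ h0) (one_le_pow₀ h1)

theorem weight_pos {δ : ℝ} (hδ : 0 ≤ δ) (n : Fin 2 → ℤ) : 0 < weight δ n :=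
  zero_lt_one.trans_le (one_le_weight hδ n)

/-- Submultiplicativity bounds the ratio of the weights at n and n − j by a number that depends on j
only, so conjugated translations are bounded operators. -/
theorem weight_add_le {δ : ℝ} (hδ : 0 ≤ δ) (m n : Fin 2 → ℤ) :
    weight δ (m + n) ≤ weight δ m * weight δ n := by
  have key : ∀ x y : ℝ, 1 + δ * |x + y| ≤ (1 + δ * |x|) * (1 + δ * |y|) := fun x y => by
    have := mul_le_mul_of_nonneg_left (abs_add_le x y) hδ
    nlinarith [mul_nonneg (mul_nonneg hδ (abs_nonneg x)) (mul_nonneg hδ (abs_nonneg y))]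
  unfold weight
  simp only [Pi.add_apply, Int.cast_add]
  calc _ ≤ ((1 + δ * |(m 0 : ℝ)|) * (1 + δ * |(n 0 : ℝ)|)) ^ 4 *
        ((1 + δ * |(m 1 : ℝ)|) * (1 + δ * |(n 1 : ℝ)|)) ^ 4 := by
        gcongr
        · exact key _ _
        · exact key _ _
    _ = _ := by ring

theorem weight_neg (δ : ℝ) (n : Fin 2 → ℤ) : weight δ (-n) = weight δ n := by
  simp [weight]

theorem weight_mono {δ δ' : ℝ} (hδ : 0 ≤ δ) (h : δ ≤ δ') (n : Fin 2 → ℤ) :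
    weight δ n ≤ weight δ' n := by
  unfold weight; gcongr

/-- The ratio of weights at `n` and `n - j`. -/
def weightRatio (δ : ℝ) (j n : Fin 2 → ℤ) : ℝ := weight δ n / weight δ (n - j)

theorem weightRatio_le {δ : ℝ} (hδ : 0 ≤ δ) (j n : Fin 2 → ℤ) :
    weightRatio δ j n ≤ weight δ j := by
  rw [weightRatio, div_le_iff₀ (weight_pos hδ _)]
  simpa using weight_add_le hδ j (n - j)

theorem weightRatio_pos {δ : ℝ} (hδ : 0 ≤ δ) (j n : Fin 2 → ℤ) : 0 < weightRatio δ j n :=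
  div_pos (weight_pos hδ _) (weight_pos hδ _)

/-- With a the weight of j, submultiplicativity used twice puts the ratio between 1/a and a, and 1/a
≥ 2 − a. -/
theorem abs_weightRatio_sub_one_le {δ : ℝ} (hδ : 0 ≤ δ) (j n : Fin 2 → ℤ) :
    |weightRatio δ j n - 1| ≤ weight δ j - 1 := by
  have h1 := weightRatio_le hδ j n
  have h2 : 1 / weight δ j ≤ weightRatio δ j n := by
    rw [weightRatio, div_le_div_iff₀ (weight_pos hδ _) (weight_pos hδ _), one_mul]
    have := weight_add_le hδ (-j) n
    rw [weight_neg, neg_add_eq_sub] at this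
    linarith
  have h3 := one_le_weight hδ j
  have h4 : 2 - weight δ j ≤ 1 / weight δ j := by
    rw [le_div_iff₀ (weight_pos hδ _)]; nlinarith [sq_nonneg (weight δ j - 1)]
  rw [abs_le]; constructor <;> linarith

/-- Translation by `j` of a sequence, conjugated by the weight. -/
def shiftOp {δ : ℝ} (hδ : 0 ≤ δ) (j : Fin 2 → ℤ) : SqSum →L[ℂ] SqSum :=
  weightedComp (Equiv.subRight j) (fun n => (weightRatio δ j n : ℂ)) (weight δ j) fun n => by
    rw [Complex.norm_real, Real.norm_of_nonneg (weightRatio_pos hδ j n).le]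
    exact weightRatio_le hδ j n

theorem shiftOp_apply {δ : ℝ} (hδ : 0 ≤ δ) (j : Fin 2 → ℤ) (a : SqSum) (n : Fin 2 → ℤ) :
    shiftOp hδ j a n = weightRatio δ j n * a (n - j) := rfl

theorem norm_shiftOp_le {δ : ℝ} (hδ : 0 ≤ δ) (j : Fin 2 → ℤ) : ‖shiftOp hδ j‖ ≤ weight δ j :=
  norm_weightedComp_le _ _ _ _

/-- The weight with δ = 0 is constant, so `shiftOp le_rfl j` is the plain translation. The bound
tends to zero with δ, for each fixed j. -/
theorem norm_shiftOp_sub_le {δ : ℝ} (hδ : 0 ≤ δ) (j : Fin 2 → ℤ) :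
    ‖shiftOp hδ j - shiftOp le_rfl j‖ ≤ weight δ j - 1 := by
  have : shiftOp hδ j - shiftOp le_rfl j = weightedComp (Equiv.subRight j)
      (fun n => ((weightRatio δ j n - 1 : ℝ) : ℂ)) (weight δ j - 1) (fun n => by
        rw [Complex.norm_real]; exact abs_weightRatio_sub_one_le hδ j n) := by
    ext a n
    simp only [sub_apply, lp.coeFn_sub, Pi.sub_apply, shiftOp_apply,
      weightedComp_apply, Equiv.subRight_apply]
    have : weightRatio 0 j n = 1 := by simp [weightRatio, weight]
    rw [this]; push_cast; ring
  rw [this]; exact norm_weightedComp_le _ _ _ _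

/-- Convolution with `m`, conjugated by the weight. -/
def convOp (m : (Fin 2 → ℤ) → ℂ) {δ : ℝ} (hδ : 0 ≤ δ) : SqSum →L[ℂ] SqSum :=
  ∑' j, m j • shiftOp hδ j

theorem summable_convOp {m : (Fin 2 → ℤ) → ℂ} {δ : ℝ} (hδ : 0 ≤ δ)
    (hm : Summable fun j => ‖m j‖ * weight δ j) : Summable fun j => m j • shiftOp hδ j :=
  Summable.of_norm_bounded hm fun j => by
    rw [norm_smul]; gcongr; exact norm_shiftOp_le hδ j

theorem convOp_apply {m : (Fin 2 → ℤ) → ℂ} {δ : ℝ} (hδ : 0 ≤ δ)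
    (hm : Summable fun j => ‖m j‖ * weight δ j) (a : SqSum) (n : Fin 2 → ℤ) :
    HasSum (fun j => m j * (weightRatio δ j n * a (n - j))) (convOp m hδ a n) := by
  have h := (summable_convOp hδ hm).hasSum
  have h2 := ((evalAt n).comp (ContinuousLinearMap.apply ℂ SqSum a)).hasSum h
  simpa [convOp, shiftOp_apply] using h2

theorem summable_weight_of_le {m : (Fin 2 → ℤ) → ℂ} (hm : Summable fun j => ‖m j‖ * weight 1 j)
    {δ : ℝ} (hδ : 0 ≤ δ) (hδ1 : δ ≤ 1) : Summable fun j => ‖m j‖ * weight δ j :=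
  hm.of_nonneg_of_le (fun j => mul_nonneg (norm_nonneg _) (weight_pos hδ j).le) fun j => by
    have := weight_mono hδ hδ1 j
    gcongr

/-- If convolution with `m` has norm less than one on square-summable sequences, then so has
its conjugate by a sufficiently slowly varying weight. -/
theorem exists_norm_convOp_lt_one {m : (Fin 2 → ℤ) → ℂ}
    (hm : Summable fun j => ‖m j‖ * weight 1 j) {k : ℝ} (hk : k < 1)
    (hM : ‖convOp m le_rfl‖ ≤ k) :
    ∃ δ : ℝ, ∃ hδ : 0 < δ, δ ≤ 1 ∧ ‖convOp m hδ.le‖ < 1 := by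
  -- Each weight tends to 1 as δ → 0, and the weights with δ = 1 dominate. The sum bounds the
  -- distance in operator norm to the unweighted convolution, so it can be pushed below 1 − k.
  have hT : Filter.Tendsto (fun δ : ℝ => ∑' j, ‖m j‖ * (weight δ j - 1)) (𝓝[>] 0)
      (𝓝 (∑' j, ‖m j‖ * (weight 0 j - 1))) := by
    refine tendsto_tsum_of_dominated_convergence hm (fun j => ?_) ?_
    · have : Continuous fun δ : ℝ => ‖m j‖ * (weight δ j - 1) := by unfold weight; fun_prop
      exact (this.tendsto 0).mono_left nhdsWithin_le_nhds
    · filter_upwards [Ioo_mem_nhdsGT (zero_lt_one (α := ℝ))] with δ hδ j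
      have h1 := one_le_weight hδ.1.le j
      rw [Real.norm_of_nonneg (mul_nonneg (norm_nonneg _) (by linarith))]
      have := weight_mono hδ.1.le hδ.2.le j
      gcongr
      linarith
  have h0 : ∑' j, ‖m j‖ * (weight 0 j - 1) = 0 := by simp [weight]
  rw [h0] at hT
  obtain ⟨δ, hδ1, hδ2⟩ := ((hT.eventually (gt_mem_nhds (sub_pos.2 hk))).and
    (Ioo_mem_nhdsGT (zero_lt_one (α := ℝ)))).exists
  refine ⟨δ, hδ2.1, hδ2.2.le, ?_⟩
  have hs := summable_weight_of_le hm hδ2.1.le hδ2.2.le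
  have hs0 := summable_weight_of_le hm le_rfl zero_le_one
  have hd : ‖convOp m hδ2.1.le - convOp m le_rfl‖ ≤ ∑' j, ‖m j‖ * (weight δ j - 1) := by
    rw [convOp, convOp, ← (summable_convOp hδ2.1.le hs).tsum_sub (summable_convOp le_rfl hs0)]
    refine tsum_of_norm_bounded (Summable.hasSum ?_) fun j => ?_
    · simpa [mul_sub, weight] using hs.sub hs0
    · rw [← smul_sub, norm_smul]; gcongr; exact norm_shiftOp_sub_le hδ2.1.le j
  have := norm_le_norm_add_norm_sub' (convOp m hδ2.1.le) (convOp m le_rfl)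
  linarith

/-! ### Fourier series of doubly periodic functions. -/

/-- The character `x ↦ exp (2πi n·x)` of the torus. -/
def expChar (n : Fin 2 → ℤ) (x : Fin 2 → ℝ) : ℂ :=
  Complex.exp (2 * Real.pi * Complex.I * (n 0 * x 0 + n 1 * x 1))

/-- Fourier multiplier of the `i`-th partial derivative. -/
def freq (i : Fin 2) (n : Fin 2 → ℤ) : ℂ := 2 * Real.pi * Complex.I * n i

/-- Coordinate `i` as a complex valued linear form. -/
def coordC (i : Fin 2) : (Fin 2 → ℝ) →L[ℝ] ℂ :=
  Complex.ofRealCLM.comp (ContinuousLinearMap.proj i)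

@[simp] theorem coordC_apply (i : Fin 2) (x : Fin 2 → ℝ) : coordC i x = x i := rfl

theorem norm_expChar (n : Fin 2 → ℤ) (x : Fin 2 → ℝ) : ‖expChar n x‖ = 1 := by
  have : (2 * Real.pi * Complex.I * (n 0 * x 0 + n 1 * x 1) : ℂ) =
      ((2 * Real.pi * (n 0 * x 0 + n 1 * x 1) : ℝ) : ℂ) * Complex.I := by push_cast; ring
  rw [expChar, this, Complex.norm_exp_ofReal_mul_I]

theorem expChar_add (m n : Fin 2 → ℤ) (x : Fin 2 → ℝ) :
    expChar (m + n) x = expChar m x * expChar n x := by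
  simp only [expChar, ← Complex.exp_add, Pi.add_apply, Int.cast_add]; congr 1; ring

@[simp] theorem expChar_zero (x : Fin 2 → ℝ) : expChar 0 x = 1 := by simp [expChar]

theorem expChar_add_e (n : Fin 2 → ℤ) (x : Fin 2 → ℝ) (i : Fin 2) :
    expChar n (x + e i) = expChar n x := by
  have h : ∀ k : ℤ, Complex.exp (2 * Real.pi * Complex.I * k) = 1 := fun k =>
    Complex.exp_eq_one_iff.2 ⟨k, by ring⟩
  fin_cases i
  · have := h (n 0)
    simp only [expChar, Pi.add_apply, e, Fin.zero_eta, Pi.single_eq_same, ne_eq, one_ne_zero,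
      not_false_eq_true, Pi.single_eq_of_ne]
    push_cast
    rw [show (2 * Real.pi * Complex.I * (n 0 * (x 0 + 1) + n 1 * (x 1 + 0)) : ℂ) =
      2 * Real.pi * Complex.I * (n 0 * x 0 + n 1 * x 1) + 2 * Real.pi * Complex.I * n 0 by ring,
      Complex.exp_add, this, mul_one]
  · have := h (n 1)
    simp only [expChar, Pi.add_apply, e, Fin.mk_one, Pi.single_eq_same, ne_eq, zero_ne_one,
      not_false_eq_true, Pi.single_eq_of_ne]
    push_cast
    rw [show (2 * Real.pi * Complex.I * (n 0 * (x 0 + 0) + n 1 * (x 1 + 1)) : ℂ) =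
      2 * Real.pi * Complex.I * (n 0 * x 0 + n 1 * x 1) + 2 * Real.pi * Complex.I * n 1 by ring,
      Complex.exp_add, this, mul_one]

theorem hasFDerivAt_expChar (n : Fin 2 → ℤ) (x : Fin 2 → ℝ) :
    HasFDerivAt (expChar n)
      (expChar n x • (freq 0 n • coordC 0 + freq 1 n • coordC 1)) x := by
  have h := (((freq 0 n • coordC 0 + freq 1 n • coordC 1).hasFDerivAt (x := x))).cexp
  refine (h.congr_fderiv ?_).congr_of_eventuallyEq (Filter.Eventually.of_forall fun y => ?_)
  · congr 1
    simp [expChar, freq]; congr 1; ring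
  · simp [expChar, freq]; congr 1; ring

theorem contDiff_expChar (n : Fin 2 → ℤ) : ContDiff ℝ ∞ (expChar n) := by
  have h := (freq 0 n • coordC 0 + freq 1 n • coordC 1).contDiff (n := ∞)
  convert! Complex.contDiff_exp.comp h using 1
  ext x
  simp [expChar, freq]; congr 1; ring

theorem pd_expChar (n : Fin 2 → ℤ) (i : Fin 2) (x : Fin 2 → ℝ) :
    pd i (expChar n) x = freq i n * expChar n x := by
  rw [pd, (hasFDerivAt_expChar n x).fderiv]
  fin_cases i <;> simp [e, mul_comm]

/-- The sum of the Fourier series with coefficients `b`. -/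
def fsum (b : (Fin 2 → ℤ) → ℂ) (x : Fin 2 → ℝ) : ℂ := ∑' n, b n * expChar n x

/-- The coefficients `b` have a summable `k`-th moment. -/
def MomentSummable (k : ℕ) (b : (Fin 2 → ℤ) → ℂ) : Prop :=
  Summable fun n => ‖b n‖ * (1 + |(n 0 : ℝ)| + |(n 1 : ℝ)|) ^ k

theorem one_le_moment (n : Fin 2 → ℤ) : 1 ≤ 1 + |(n 0 : ℝ)| + |(n 1 : ℝ)| := by
  have := abs_nonneg (n 0 : ℝ)
  have := abs_nonneg (n 1 : ℝ)
  linarith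

theorem MomentSummable.mono {k l : ℕ} {b : (Fin 2 → ℤ) → ℂ} (h : MomentSummable k b)
    (hl : l ≤ k) : MomentSummable l b :=
  h.of_nonneg_of_le (fun n => mul_nonneg (norm_nonneg _) (pow_nonneg
    (zero_le_one.trans (one_le_moment n)) _)) fun n => by
      have := pow_le_pow_right₀ (one_le_moment n) hl
      gcongr

theorem MomentSummable.summable_norm {k : ℕ} {b : (Fin 2 → ℤ) → ℂ} (h : MomentSummable k b) :
    Summable fun n => ‖b n‖ := by
  simpa [MomentSummable] using h.mono (Nat.zero_le k)

theorem norm_freq_le (i : Fin 2) (n : Fin 2 → ℤ) :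
    ‖freq i n‖ ≤ 2 * Real.pi * (1 + |(n 0 : ℝ)| + |(n 1 : ℝ)|) := by
  have h0 := abs_nonneg (n 0 : ℝ)
  have h1 := abs_nonneg (n 1 : ℝ)
  have : ‖freq i n‖ = 2 * Real.pi * |(n i : ℝ)| := by
    simp [freq, abs_of_pos Real.pi_pos]
  rw [this]
  refine mul_le_mul_of_nonneg_left ?_ (by positivity)
  fin_cases i <;> simp <;> linarith

theorem MomentSummable.freq_mul {k : ℕ} {b : (Fin 2 → ℤ) → ℂ} (h : MomentSummable (k + 1) b)
    (i : Fin 2) : MomentSummable k fun n => freq i n * b n := by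
  refine (h.mul_left (2 * Real.pi)).of_nonneg_of_le (fun n => mul_nonneg (norm_nonneg _)
    (pow_nonneg (zero_le_one.trans (one_le_moment n)) _)) fun n => ?_
  have hn := zero_le_one.trans (one_le_moment n)
  rw [norm_mul, pow_succ]
  have := norm_freq_le i n
  calc ‖freq i n‖ * ‖b n‖ * (1 + |(n 0 : ℝ)| + |(n 1 : ℝ)|) ^ k
      ≤ (2 * Real.pi * (1 + |(n 0 : ℝ)| + |(n 1 : ℝ)|)) * ‖b n‖ *
        (1 + |(n 0 : ℝ)| + |(n 1 : ℝ)|) ^ k := by gcongr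
    _ = _ := by ring

theorem summable_fsum {b : (Fin 2 → ℤ) → ℂ} (h : Summable fun n => ‖b n‖) (x : Fin 2 → ℝ) :
    Summable fun n => b n * expChar n x :=
  Summable.of_norm (by simpa [norm_expChar] using h)

theorem norm_fsum_le {b : (Fin 2 → ℤ) → ℂ} (h : Summable fun n => ‖b n‖) (x : Fin 2 → ℝ) :
    ‖fsum b x‖ ≤ ∑' n, ‖b n‖ :=
  tsum_of_norm_bounded h.hasSum fun n => by simp [norm_expChar]

theorem fsum_add_e (b : (Fin 2 → ℤ) → ℂ) (x : Fin 2 → ℝ) (i : Fin 2) :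
    fsum b (x + e i) = fsum b x := by simp [fsum, expChar_add_e]

theorem fsum_const_mul (c : ℂ) (b : (Fin 2 → ℤ) → ℂ) (x : Fin 2 → ℝ) :
    fsum (fun n => c * b n) x = c * fsum b x := by
  simp only [fsum, mul_assoc, tsum_mul_left]

theorem fsum_add {a b : (Fin 2 → ℤ) → ℂ} (ha : Summable fun n => ‖a n‖)
    (hb : Summable fun n => ‖b n‖) (x : Fin 2 → ℝ) :
    fsum (fun n => a n + b n) x = fsum a x + fsum b x := by
  simp only [fsum, add_mul]
  exact (summable_fsum ha x).tsum_add (summable_fsum hb x)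

theorem hasFDerivAt_fsum {b : (Fin 2 → ℤ) → ℂ} (h : MomentSummable 1 b) (x : Fin 2 → ℝ) :
    HasFDerivAt (fsum b) (fsum (fun n => freq 0 n * b n) x • coordC 0 +
      fsum (fun n => freq 1 n * b n) x • coordC 1) x := by
  have h0 := (MomentSummable.freq_mul (k := 0) h 0).summable_norm
  have h1 := (MomentSummable.freq_mul (k := 0) h 1).summable_norm
  have hb : Summable fun n => ‖freq 0 n * b n‖ * ‖coordC 0‖ + ‖freq 1 n * b n‖ * ‖coordC 1‖ :=
    (h0.mul_right _).add (h1.mul_right _)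
  have hd : ∀ n y, HasFDerivAt (fun z => b n * expChar n z)
      ((freq 0 n * b n * expChar n y) • coordC 0 + (freq 1 n * b n * expChar n y) • coordC 1) y :=
    fun n y => by
      refine ((hasFDerivAt_expChar n y).const_mul (b n)).congr_fderiv ?_
      simp only [smul_add, smul_smul]
      congr 2 <;> ring
  have := hasFDerivAt_tsum (𝕜 := ℝ) hb hd (fun n y => ?_) (summable_fsum h.summable_norm 0) x
  · refine this.congr_fderiv ?_
    rw [Summable.tsum_add, Summable.tsum_smul_const, Summable.tsum_smul_const]
    · rfl
    all_goals first | exact summable_fsum h1 x | exact summable_fsum h0 x | skip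
    · exact (summable_fsum h0 x).smul_const _
    · exact (summable_fsum h1 x).smul_const _
  · refine (norm_add_le _ _).trans ?_
    simp [norm_smul, norm_expChar]

/-- Each derivative multiplies the coefficients by a frequency and so costs one moment. -/
theorem contDiff_fsum : ∀ (k : ℕ) {b : (Fin 2 → ℤ) → ℂ}, MomentSummable k b →
    ContDiff ℝ k (fsum b)
  | 0, b, h => by
    have : Continuous (fsum b) := continuous_tsum
      (fun n => continuous_const.mul (contDiff_expChar n).continuous) h.summable_norm
      (fun n x => by simp [norm_expChar])
    simpa using this
  | k + 1, b, h => by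
    have h1 : MomentSummable 1 b := h.mono (by omega)
    have hf : fderiv ℝ (fsum b) = fun x => fsum (fun n => freq 0 n * b n) x • coordC 0 +
        fsum (fun n => freq 1 n * b n) x • coordC 1 :=
      funext fun x => (hasFDerivAt_fsum h1 x).fderiv
    push_cast
    rw [contDiff_succ_iff_fderiv]
    refine ⟨fun x => (hasFDerivAt_fsum h1 x).differentiableAt, by simp, ?_⟩
    rw [hf]
    exact ((contDiff_fsum k (h.freq_mul 0)).smul contDiff_const).add
      ((contDiff_fsum k (h.freq_mul 1)).smul contDiff_const)

theorem pd_fsum {b : (Fin 2 → ℤ) → ℂ} (h : MomentSummable 1 b) (i : Fin 2) (x : Fin 2 → ℝ) :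
    pd i (fsum b) x = fsum (fun n => freq i n * b n) x := by
  rw [pd, (hasFDerivAt_fsum h x).fderiv]
  fin_cases i <;> simp [e]

/-- The change of variables `(n, j) ↦ (j, n - j)`. -/
def shearEquiv (G : Type*) [AddCommGroup G] : G × G ≃ G × G where
  toFun p := (p.2, p.1 - p.2)
  invFun p := (p.1 + p.2, p.1)
  left_inv p := by simp
  right_inv p := by simp

/-- Absolute convergence allows the double series to be reindexed by the shear (n, j) ↦ (j, n − j).
-/
theorem tsum_mul_tsum_convolution {G : Type*} [AddCommGroup G] {f g : G → ℂ}
    (hf : Summable fun n => ‖f n‖) (hg : Summable fun n => ‖g n‖) :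
    (∑' n, f n) * ∑' n, g n = ∑' n, ∑' j, f j * g (n - j) := by
  have hAB : Summable fun p : G × G => f p.1 * g p.2 := summable_mul_of_summable_norm hf hg
  rw [hf.of_norm.tsum_mul_tsum hg.of_norm hAB, ← (shearEquiv G).tsum_eq]
  exact ((shearEquiv G).summable_iff.2 hAB).tsum_prod

/-- The product of two Fourier series is the series of the convolution. -/
theorem fsum_mul_fsum {a b c : (Fin 2 → ℤ) → ℂ} (ha : Summable fun n => ‖a n‖)
    (hb : Summable fun n => ‖b n‖) (hc : ∀ n, c n = ∑' j, a j * b (n - j)) (x : Fin 2 → ℝ) :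
    fsum a x * fsum b x = fsum c x := by
  unfold fsum
  rw [tsum_mul_tsum_convolution (by simpa [norm_expChar] using ha)
    (by simpa [norm_expChar] using hb)]
  refine tsum_congr fun n => ?_
  rw [hc n, ← tsum_mul_right]
  refine tsum_congr fun j => ?_
  have : expChar n x = expChar j x * expChar (n - j) x := by rw [← expChar_add]; simp
  rw [this]; ring

theorem norm_cellInt_le {F : (Fin 2 → ℝ) → ℂ} {C : ℝ} (h : ∀ x, ‖F x‖ ≤ C) :
    ‖cellInt F‖ ≤ C := by
  have := intervalIntegral.norm_integral_le_of_norm_le_const (a := (0 : ℝ)) (b := 1) (C := C)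
    (f := fun x => ∫ y in (0 : ℝ)..1, F ![x, y]) fun x _ => by
      simpa using intervalIntegral.norm_integral_le_of_norm_le_const (a := (0 : ℝ)) (b := 1)
        (C := C) (f := fun y => F ![x, y]) fun y _ => h _
  simpa [cellInt] using this

/-- Fourier coefficients of a function on the plane. -/
def coef (u : (Fin 2 → ℝ) → ℂ) (n : Fin 2 → ℤ) : ℂ := cellInt fun x => expChar (-n) x * u x

theorem pd_mul_complex {n : ℕ} {F G : (Fin n → ℝ) → ℂ} {x : Fin n → ℝ}
    (hF : DifferentiableAt ℝ F x) (hG : DifferentiableAt ℝ G x) (i : Fin n) :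
    pd i (fun y => F y * G y) x = F x * pd i G x + pd i F x * G x := by
  have := congrArg (fun L => L (e i)) (hF.hasFDerivAt.mul hG.hasFDerivAt).fderiv
  simp only [add_apply, smul_apply, smul_eq_mul] at this
  rw [pd]; refine Eq.trans this ?_; simp only [pd]; ring

/-- Integration by parts: the derivative of the periodic function `expChar (-n) * u` has mean zero.
-/
theorem coef_pd {u : (Fin 2 → ℝ) → ℂ} (hu : ContDiff ℝ 1 u) (hp : ∀ x i, u (x + e i) = u x)
    (i : Fin 2) (n : Fin 2 → ℤ) : coef (pd i u) n = freq i n * coef u n := by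
  have he : ContDiff ℝ 1 (expChar (-n)) := (contDiff_expChar _).of_le (by exact_mod_cast le_top)
  have h := cellInt_pd_zero (he.mul hu) (fun x j => by simp [expChar_add_e, hp]) i
  have h2 : pd i (fun x => expChar (-n) x * u x) =
      fun x => expChar (-n) x * pd i u x + (-freq i n) * (expChar (-n) x * u x) := by
    ext x
    rw [pd_mul_complex (he.differentiable (by norm_num) x) (hu.differentiable (by norm_num) x),
      pd_expChar]
    have : freq i (-n) = -freq i n := by simp [freq]
    rw [this]; ring
  change cellInt (pd i (fun x => expChar (-n) x * u x)) = 0 at h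
  rw [h2, cellInt_add (F := fun x => expChar (-n) x * pd i u x)
    (G := fun x => -freq i n * (expChar (-n) x * u x)) (he.continuous.mul (continuous_pd hu i))
    (continuous_const.mul (he.continuous.mul hu.continuous))] at h
  have h3 : cellInt (fun x => (-freq i n) * (expChar (-n) x * u x)) = -freq i n * coef u n := by
    simp [cellInt, coef, intervalIntegral.integral_const_mul]
  rw [h3] at h
  rw [coef]; linear_combination h

theorem apply_add_zsmul_e {α : Type*} {n : ℕ} {u : (Fin n → ℝ) → α}
    (hp : ∀ x i, u (x + e i) = u x) (i : Fin n) (k : ℤ) (x : Fin n → ℝ) :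
    u (x + (k : ℝ) • e i) = u x := by
  induction k using Int.induction_on with
  | zero => simp
  | succ k ih =>
    have : x + (((k : ℤ) + 1 : ℤ) : ℝ) • e i = (x + ((k : ℤ) : ℝ) • e i) + e i := by
      push_cast; module
    rw [this, hp, ih]
  | pred k ih =>
    have : x + ((-(k : ℤ) : ℤ) : ℝ) • e i = (x + ((-(k : ℤ) - 1 : ℤ) : ℝ) • e i) + e i := by
      push_cast; module
    rw [← hp _ i, ← this, ih]

/-- A continuous doubly periodic function is bounded. -/
theorem exists_norm_le_of_periodic {E : Type*} [NormedAddCommGroup E] {u : (Fin 2 → ℝ) → E}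
    (hu : Continuous u) (hp : ∀ x i, u (x + e i) = u x) : ∃ C, ∀ x, ‖u x‖ ≤ C := by
  obtain ⟨C, hC⟩ := (isCompact_Icc (a := (0 : Fin 2 → ℝ)) (b := 1)).exists_bound_of_continuousOn
    hu.continuousOn
  have hz := apply_add_zsmul_e hp
  refine ⟨C, fun x => ?_⟩
  have h1 : u (fun i => Int.fract (x i)) = u x := by
    rw [← hz 0 ⌊x 0⌋, ← hz 1 ⌊x 1⌋]
    congr 1; ext i
    fin_cases i <;> simp [e]
  rw [← h1]
  exact hC _ ⟨fun i => Int.fract_nonneg _, fun i => (Int.fract_lt_one _).le⟩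

theorem summable_int_weight : Summable fun n : ℤ => 1 / (1 + |(n : ℝ)|) ^ 2 := by
  have h : Summable fun n : ℕ => 1 / (1 + (n : ℝ)) ^ 2 := by
    have := (summable_nat_add_iff 1).2 (Real.summable_one_div_nat_pow.2 one_lt_two)
    refine this.congr fun n => ?_
    push_cast; ring
  exact Summable.of_nat_of_neg (by simpa using h) (by simpa using h)

theorem summable_weight_inv :
    Summable fun n : Fin 2 → ℤ => 1 / ((1 + |(n 0 : ℝ)|) ^ 2 * (1 + |(n 1 : ℝ)|) ^ 2) := by
  have h := summable_int_weight.mul_of_nonneg summable_int_weight (fun n => by positivity)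
    fun n => by positivity
  have h2 := (finTwoArrowEquiv ℤ).summable_iff.2 h
  refine h2.congr fun n => ?_
  simp [finTwoArrowEquiv]
  ring

/-- A smooth doubly periodic function has rapidly decreasing Fourier coefficients. -/
theorem summable_coef_weight {u : (Fin 2 → ℝ) → ℂ} (hu : ContDiff ℝ ∞ u)
    (hp : ∀ x i, u (x + e i) = u x) : Summable fun n => ‖coef u n‖ * weight 1 n := by
  -- The operator 1 − ∂ᵢ²/4π² has multiplier 1 + nᵢ². Three applications in each variable gain (1 +
  -- |nᵢ|)⁶/8, which pays for the weight of degree 4 and leaves the summable factor of degree −2.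
  -- The constant 64 below is 8·8.
  let L : Fin 2 → ((Fin 2 → ℝ) → ℂ) → (Fin 2 → ℝ) → ℂ := fun i u x =>
    u x + (-(1 / (4 * Real.pi ^ 2) : ℝ) : ℂ) * pd i (pd i u) x
  have hL : ∀ i u, (ContDiff ℝ ∞ u ∧ ∀ x j, u (x + e j) = u x) →
      (ContDiff ℝ ∞ (L i u) ∧ ∀ x j, L i u (x + e j) = L i u x) ∧
      ∀ n, coef (L i u) n = (1 + (n i : ℂ) ^ 2) * coef u n := by
    rintro i u ⟨hu, hp⟩
    have h1 : ContDiff ℝ ∞ (pd i u) := ContDiff.pd hu (by simp) i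
    have h2 : ContDiff ℝ ∞ (pd i (pd i u)) := ContDiff.pd h1 (by simp) i
    have p1 : ∀ x j, pd i u (x + e j) = pd i u x := fun x j =>
      pd_add_period (a := 0) (fun x => by simp [hp]) i x
    have p2 : ∀ x j, pd i (pd i u) (x + e j) = pd i (pd i u) x := fun x j =>
      pd_add_period (a := 0) (fun x => by simp [p1]) i x
    refine ⟨⟨hu.add (contDiff_const.mul h2), fun x j => by simp only [L, hp, p2]⟩, fun n => ?_⟩
    have hc := (contDiff_expChar (-n)).continuous
    have e1 : coef (L i u) n =
        coef u n + (-(1 / (4 * Real.pi ^ 2) : ℝ) : ℂ) * coef (pd i (pd i u)) n := by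
      have : (fun x => expChar (-n) x * L i u x) = fun x => expChar (-n) x * u x +
          (-(1 / (4 * Real.pi ^ 2) : ℝ) : ℂ) * (expChar (-n) x * pd i (pd i u) x) := by
        ext x; simp only [L]; ring
      rw [coef, this, cellInt_add (F := fun x => expChar (-n) x * u x)
        (G := fun x => (-(1 / (4 * Real.pi ^ 2) : ℝ) : ℂ) * (expChar (-n) x * pd i (pd i u) x))
        (hc.mul hu.continuous) (continuous_const.mul (hc.mul h2.continuous))]
      simp [coef, cellInt, intervalIntegral.integral_const_mul]
    rw [e1, coef_pd (h1.of_le (by exact_mod_cast le_top)) p1,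
      coef_pd (hu.of_le (by exact_mod_cast le_top)) hp]
    have : (Real.pi : ℂ) ≠ 0 := by exact_mod_cast Real.pi_ne_zero
    simp only [freq]; push_cast; field_simp
    rw [Complex.I_sq]; ring
  have s0 := hL 0 u ⟨hu, hp⟩
  have s1 := hL 0 _ s0.1
  have s2 := hL 0 _ s1.1
  have s3 := hL 1 _ s2.1
  have s4 := hL 1 _ s3.1
  have s5 := hL 1 _ s4.1
  obtain ⟨C, hC⟩ := exists_norm_le_of_periodic s5.1.1.continuous s5.1.2
  refine (summable_weight_inv.mul_left (64 * C)).of_nonneg_of_le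
    (fun n => mul_nonneg (norm_nonneg _) (weight_pos zero_le_one n).le) fun n => ?_
  have h1 : ‖coef u n‖ * ((1 + (n 0 : ℝ) ^ 2) ^ 3 * (1 + (n 1 : ℝ) ^ 2) ^ 3) ≤ C := by
    have h := norm_cellInt_le (F := fun x => expChar (-n) x * L 1 (L 1 (L 1 (L 0 (L 0 (L 0 u))))) x)
      (C := C) fun x => by rw [norm_mul, norm_expChar, one_mul]; exact hC x
    rw [← coef, s5.2, s4.2, s3.2, s2.2, s1.2, s0.2] at h
    have e2 : ∀ i, ‖(1 + (n i : ℂ) ^ 2)‖ = 1 + (n i : ℝ) ^ 2 := fun i => by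
      have : (1 + (n i : ℂ) ^ 2) = ((1 + (n i : ℝ) ^ 2 : ℝ) : ℂ) := by push_cast; ring
      rw [this, Complex.norm_real, Real.norm_of_nonneg (by positivity)]
    simp only [norm_mul, e2] at h
    refine le_trans (le_of_eq ?_) h; ring
  have h2 : ∀ i, (1 + |(n i : ℝ)|) ^ 6 ≤ 8 * (1 + (n i : ℝ) ^ 2) ^ 3 := fun i => by
    have : (1 + |(n i : ℝ)|) ^ 2 ≤ 2 * (1 + (n i : ℝ) ^ 2) := by
      rw [← sq_abs (n i : ℝ)]; nlinarith [sq_nonneg (1 - |(n i : ℝ)|)]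
    calc (1 + |(n i : ℝ)|) ^ 6 = ((1 + |(n i : ℝ)|) ^ 2) ^ 3 := by ring
      _ ≤ (2 * (1 + (n i : ℝ) ^ 2)) ^ 3 := by gcongr
      _ = _ := by ring
  rw [mul_one_div, le_div_iff₀ (by positivity)]
  calc ‖coef u n‖ * weight 1 n * ((1 + |(n 0 : ℝ)|) ^ 2 * (1 + |(n 1 : ℝ)|) ^ 2)
      = ‖coef u n‖ * ((1 + |(n 0 : ℝ)|) ^ 6 * (1 + |(n 1 : ℝ)|) ^ 6) := by
        simp only [weight, one_mul]; ring
    _ ≤ ‖coef u n‖ * ((8 * (1 + (n 0 : ℝ) ^ 2) ^ 3) * (8 * (1 + (n 1 : ℝ) ^ 2) ^ 3)) := by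
        gcongr <;> exact h2 _
    _ = 64 * (‖coef u n‖ * ((1 + (n 0 : ℝ) ^ 2) ^ 3 * (1 + (n 1 : ℝ) ^ 2) ^ 3)) := by ring
    _ ≤ 64 * C := by gcongr

/-- The interval is left open to choice because `Set.Ioc` occurs in the Fourier coefficients on the
torus, and `Set.Ico` in the area of the boundary and in the polar cell. -/
theorem setIntegral_square_eq_cellInt {E : Type*} [NormedAddCommGroup E] [NormedSpace ℝ E]
    {G : (Fin 2 → ℝ) → E} (hG : Continuous G) {S : Set ℝ}
   (hS : S =ᵐ[MeasureTheory.volume] Set.Ioc (0 : ℝ) 1)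
    (hSI : S ⊆ Set.Icc 0 1) :
    ∫ x in {x : Fin 2 → ℝ | ∀ i, x i ∈ S}, G x = cellInt G := by
  have h1 := (MeasureTheory.volume_preserving_finTwoArrow ℝ).setIntegral_preimage_emb
    MeasurableEquiv.finTwoArrow.measurableEmbedding (fun p : ℝ × ℝ => G ![p.1, p.2]) (S ×ˢ S)
  have hpre : (MeasurableEquiv.finTwoArrow (α := ℝ)) ⁻¹' (S ×ˢ S) =
      {x : Fin 2 → ℝ | ∀ i, x i ∈ S} := by
    ext x; simp [MeasurableEquiv.finTwoArrow, Fin.forall_fin_two]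
  rw [hpre] at h1
  have hG2 : ∀ x : Fin 2 → ℝ, G ![(MeasurableEquiv.finTwoArrow x).1,
      (MeasurableEquiv.finTwoArrow x).2] = G x := fun x => by
    congr 1; ext i; fin_cases i <;> rfl
  simp only [hG2] at h1
  rw [h1, MeasureTheory.Measure.volume_eq_prod, MeasureTheory.setIntegral_prod]
  · simp only [MeasureTheory.setIntegral_congr_set hS, cellInt,
      intervalIntegral.integral_of_le zero_le_one]
  · have hc : Continuous fun p : ℝ × ℝ => G ![p.1, p.2] := by fun_prop
    exact (hc.continuousOn.integrableOn_compact
      (isCompact_Icc.prod isCompact_Icc)).mono_set (Set.prod_mono hSI hSI)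

/-! ### Parseval: multiplication operators on the torus become convolutions. -/

section Torus

open MeasureTheory UnitAddTorus

/-- The measure on `ℝ / ℤ` is normalised to have total volume 1. -/
local instance : MeasureSpace UnitAddCircle := ⟨AddCircle.haarAddCircle⟩

local instance : IsProbabilityMeasure (volume : Measure UnitAddCircle) :=
  inferInstanceAs (IsProbabilityMeasure AddCircle.haarAddCircle)

/-- The projection of the plane onto the torus. -/
def toTorus (x : Fin 2 → ℝ) : UnitAddTorus (Fin 2) := fun i => (x i : UnitAddCircle)

theorem mFourier_toTorus (n : Fin 2 → ℤ) (x : Fin 2 → ℝ) :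
    mFourier n (toTorus x) = expChar n x := by
  simp only [mFourier, toTorus, ContinuousMap.coe_mk, Fin.prod_univ_two, fourier_coe_apply,
    ← Complex.exp_add, expChar]
  congr 1; push_cast; ring

theorem isQuotientMap_toTorus : Topology.IsQuotientMap toTorus :=
  (IsOpenQuotientMap.piMap (f := fun (_ : Fin 2) (t : ℝ) => (t : UnitAddCircle))
    fun _ => QuotientAddGroup.isOpenQuotientMap_mk).isQuotientMap

/-- A continuous doubly periodic function descends to the torus. -/
theorem exists_torus_lift {u : (Fin 2 → ℝ) → ℂ} (hu : Continuous u)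
    (hp : ∀ x i, u (x + e i) = u x) :
    ∃ U : C(UnitAddTorus (Fin 2), ℂ), ∀ x, U (toTorus x) = u x := by
  have hz := apply_add_zsmul_e hp
  let q : C(Fin 2 → ℝ, UnitAddTorus (Fin 2)) := ⟨toTorus, isQuotientMap_toTorus.continuous⟩
  have hq : Topology.IsQuotientMap q := isQuotientMap_toTorus
  have hf : Function.FactorsThrough (⟨u, hu⟩ : C(Fin 2 → ℝ, ℂ)) q := fun x y hxy => by
    have h : ∀ i, ∃ k : ℤ, y i = x i + k := fun i => by
      have := congrFun hxy i
      obtain ⟨k, hk⟩ := AddSubgroup.mem_zmultiples_iff.1 (QuotientAddGroup.eq.1 this)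
      exact ⟨k, by simp at hk; linarith⟩
    obtain ⟨k, hk⟩ := h 0
    obtain ⟨l, hl⟩ := h 1
    have : y = x + (k : ℝ) • e 0 + (l : ℝ) • e 1 := by
      ext i; fin_cases i <;> simp [e, hk, hl]
    change u x = u y
    rw [this, hz, hz]
  refine ⟨hq.lift _ hf, fun x => ?_⟩
  exact DFunLike.congr_fun (hq.lift_comp _ hf) x

theorem mFourierCoeff_eq_coef {u : (Fin 2 → ℝ) → ℂ} (hu : Continuous u)
    {U : C(UnitAddTorus (Fin 2), ℂ)} (hU : ∀ x, U (toTorus x) = u x) (n : Fin 2 → ℤ) :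
    mFourierCoeff U n = coef u n := by
  rw [mFourierCoeff_eq_integral U n 0, coef,
    ← setIntegral_square_eq_cellInt (G := fun x => expChar (-n) x * u x) ((contDiff_expChar (-n)).continuous.mul hu) (S := Set.Ioc 0 1)
      (ae_eq_refl _) Set.Ioc_subset_Icc_self]
  simp only [Pi.zero_apply, zero_add, smul_eq_mul]
  refine integral_congr_ae (Filter.Eventually.of_forall fun x => ?_)
  change mFourier (-n) (toTorus x) * U (toTorus x) = _
  rw [mFourier_toTorus, hU]

/-- A smooth doubly periodic function is the sum of its Fourier series. -/
theorem fsum_coef {u : (Fin 2 → ℝ) → ℂ} (hu : ContDiff ℝ ∞ u) (hp : ∀ x i, u (x + e i) = u x)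
    (x : Fin 2 → ℝ) : fsum (coef u) x = u x := by
  obtain ⟨U, hU⟩ := exists_torus_lift hu.continuous hp
  have hc : mFourierCoeff U = coef u := funext (mFourierCoeff_eq_coef hu.continuous hU)
  have hs : Summable (mFourierCoeff U) := by
    rw [hc]
    refine Summable.of_norm ((summable_coef_weight hu hp).of_nonneg_of_le
      (fun n => norm_nonneg _) fun n => ?_)
    exact le_mul_of_one_le_right (norm_nonneg _) (one_le_weight zero_le_one n)
  have := (hasSum_mFourier_series_apply_of_summable hs (toTorus x)).tsum_eq
  rw [hU, hc] at this
  simpa [fsum, mFourier_toTorus] using this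

/-- Multiplication of square-integrable functions on the torus by a continuous function. -/
def mulTorus (V : Lp ℂ 2 (volume : Measure (UnitAddTorus (Fin 2)))) :
    C(UnitAddTorus (Fin 2), ℂ) →L[ℂ] Lp ℂ 2 (volume : Measure (UnitAddTorus (Fin 2))) :=
  LinearMap.mkContinuous
    { toFun := fun U => (ContinuousMap.toLp ⊤ volume ℂ U • V :
        Lp ℂ 2 (volume : Measure (UnitAddTorus (Fin 2))))
      map_add' := fun U W => by rw [map_add, Lp.smul_add]
      map_smul' := fun c U => by rw [map_smul, RingHom.id_apply, Lp.smul_assoc] }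
    ‖V‖ fun U => by
      rw [mul_comm]
      refine (Lp.norm_smul_le _ _).trans (mul_le_mul_of_nonneg_right ?_ (norm_nonneg _))
      have := Lp.norm_le_of_ae_bound (p := ⊤) (μ := (volume : Measure (UnitAddTorus (Fin 2))))
        (f := ContinuousMap.toLp ⊤ volume ℂ U) (norm_nonneg U) (by
          filter_upwards [ContinuousMap.coeFn_toLp (p := ⊤) (𝕜 := ℂ) volume U] with x hx
          rw [hx]; exact U.norm_coe_le_norm x)
      simpa using this

theorem norm_mulTorus_le (V : Lp ℂ 2 (volume : Measure (UnitAddTorus (Fin 2))))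
    (U : C(UnitAddTorus (Fin 2), ℂ)) : ‖mulTorus V U‖ ≤ ‖U‖ * ‖V‖ := by
  rw [mul_comm]
  exact (mulTorus V).le_of_opNorm_le (LinearMap.mkContinuous_norm_le _ (norm_nonneg _) _) U

theorem coeFn_mulTorus (V : Lp ℂ 2 (volume : Measure (UnitAddTorus (Fin 2))))
    (U : C(UnitAddTorus (Fin 2), ℂ)) : mulTorus V U =ᵐ[volume] fun x => U x * V x := by
  filter_upwards [Lp.coeFn_lpSMul (r := 2) (ContinuousMap.toLp ⊤ volume ℂ U) V,
    ContinuousMap.coeFn_toLp (p := ⊤) (𝕜 := ℂ) volume U] with x hx hx2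
  refine hx.trans ?_
  rw [Pi.smul_apply', hx2, smul_eq_mul]

/-- Multiplication by a character shifts the Fourier coefficients. By linearity and continuity,
multiplication by an absolutely convergent series becomes a convolution. -/
theorem repr_mulTorus_mFourier (V : Lp ℂ 2 (volume : Measure (UnitAddTorus (Fin 2))))
    (j n : Fin 2 → ℤ) : mFourierBasis.repr (mulTorus V (mFourier j)) n =
      mFourierBasis.repr V (n - j) := by
  rw [mFourierBasis_repr, mFourierBasis_repr, mFourierCoeff, mFourierCoeff]
  refine integral_congr_ae ?_
  filter_upwards [coeFn_mulTorus V (mFourier j)] with x hx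
  rw [hx, smul_eq_mul, smul_eq_mul, ← mul_assoc, ← mFourier_add]
  congr 3; abel

/-- Convolution with the Fourier coefficients of a function bounded by `k` has norm at most `k`. -/
theorem norm_convOp_le {m : (Fin 2 → ℤ) → ℂ} (hm : Summable fun j => ‖m j‖) {k : ℝ}
    (h : ∀ x, ‖fsum m x‖ ≤ k) : ‖convOp m le_rfl‖ ≤ k := by
  have hk : 0 ≤ k := (norm_nonneg _).trans (h 0)
  have hs : Summable fun j => m j • (mFourier j : C(UnitAddTorus (Fin 2), ℂ)) :=
    Summable.of_norm (by simpa [norm_smul, mFourier_norm] using hm)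
  set U : C(UnitAddTorus (Fin 2), ℂ) := ∑' j, m j • mFourier j with hUdef
  have hU : ∀ x, U (toTorus x) = fsum m x := fun x => by
    have := ((ContinuousMap.evalCLM ℂ (toTorus x)).hasSum hs.hasSum).tsum_eq
    simpa [fsum, mFourier_toTorus] using this.symm
  have hUk : ‖U‖ ≤ k := (ContinuousMap.norm_le _ hk).2 fun y => by
    obtain ⟨x, rfl⟩ := isQuotientMap_toTorus.surjective y
    rw [hU]; exact h x
  refine ContinuousLinearMap.opNorm_le_bound _ hk fun b => ?_
  set V := mFourierBasis.repr.symm b with hV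
  have hb : mFourierBasis.repr V = b := by simp [hV]
  -- Parseval's isometry conjugates the convolution to multiplication by the sum `U` of the series,
  -- whose operator norm is at most the supremum of |U|. A direct estimate by the sum of the |mⱼ|
  -- would not give a bound below one.
  have key : convOp m le_rfl b = mFourierBasis.repr (mulTorus V U) := by
    ext n
    have h1 := ((evalAt n).comp (mFourierBasis.repr.toContinuousLinearEquiv.toContinuousLinearMap.comp
      (mulTorus V))).hasSum hs.hasSum
    have h2 := convOp_apply (m := m) le_rfl (by simpa [weight] using hm) b n
    have h3 : (fun j => m j * (weightRatio 0 j n * b (n - j))) = fun j =>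
        ((evalAt n).comp (mFourierBasis.repr.toContinuousLinearEquiv.toContinuousLinearMap.comp
      (mulTorus V))) (m j • mFourier j) := by
      ext j
      rw [map_smul, smul_eq_mul]
      congr 1
      have : weightRatio 0 j n = 1 := by simp [weightRatio, weight]
      rw [this, Complex.ofReal_one, one_mul, ← hb]
      exact (repr_mulTorus_mFourier V j n).symm
    rw [h3] at h2
    exact h2.unique h1
  rw [key, LinearIsometryEquiv.norm_map]
  calc ‖mulTorus V U‖ ≤ ‖U‖ * ‖V‖ := norm_mulTorus_le V U
    _ ≤ k * ‖b‖ := by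
      rw [hV, LinearIsometryEquiv.norm_map]; gcongr

end Torus

/-! ### Wirtinger derivatives, their Fourier multipliers and the Beurling transform. -/

/-- The Wirtinger derivative `∂/∂z`. -/
def dz (F : (Fin 2 → ℝ) → ℂ) (x : Fin 2 → ℝ) : ℂ := (pd 0 F x - Complex.I * pd 1 F x) / 2

/-- The Wirtinger derivative `∂/∂z̄`. -/
def dzb (F : (Fin 2 → ℝ) → ℂ) (x : Fin 2 → ℝ) : ℂ := (pd 0 F x + Complex.I * pd 1 F x) / 2

/-- Fourier multiplier of `∂/∂z`. -/
def symZ (n : Fin 2 → ℤ) : ℂ := (freq 0 n - Complex.I * freq 1 n) / 2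

/-- Fourier multiplier of `∂/∂z̄`. -/
def symZb (n : Fin 2 → ℤ) : ℂ := (freq 0 n + Complex.I * freq 1 n) / 2

theorem jac_eq_dz (F : (Fin 2 → ℝ) → ℂ) (x : Fin 2 → ℝ) :
    jac F x = ‖dz F x‖ ^ 2 - ‖dzb F x‖ ^ 2 := by
  rw [← Complex.normSq_eq_norm_sq, ← Complex.normSq_eq_norm_sq, jac, dz, dzb]
  simp only [Complex.normSq_apply, Complex.mul_im, Complex.conj_re, Complex.conj_im,
    Complex.div_ofNat_re, Complex.div_ofNat_im, Complex.sub_re, Complex.sub_im, Complex.add_re,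
    Complex.add_im, Complex.mul_re, Complex.I_re, Complex.I_im]
  ring

theorem pd_zero_eq (F : (Fin 2 → ℝ) → ℂ) (x : Fin 2 → ℝ) : pd 0 F x = dz F x + dzb F x := by
  simp only [dz, dzb]; ring

theorem pd_one_eq (F : (Fin 2 → ℝ) → ℂ) (x : Fin 2 → ℝ) :
    pd 1 F x = Complex.I * (dz F x - dzb F x) := by
  simp only [dz, dzb]; linear_combination (pd 1 F x) * Complex.I_sq

theorem dz_mul {F G : (Fin 2 → ℝ) → ℂ} {x : Fin 2 → ℝ} (hF : DifferentiableAt ℝ F x)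
    (hG : DifferentiableAt ℝ G x) :
    dz (fun y => F y * G y) x = F x * dz G x + dz F x * G x := by
  simp only [dz, pd_mul_complex hF hG]; ring

theorem dzb_mul {F G : (Fin 2 → ℝ) → ℂ} {x : Fin 2 → ℝ} (hF : DifferentiableAt ℝ F x)
    (hG : DifferentiableAt ℝ G x) :
    dzb (fun y => F y * G y) x = F x * dzb G x + dzb F x * G x := by
  simp only [dzb, pd_mul_complex hF hG]; ring

theorem pd_add {n : ℕ} {E : Type*} [NormedAddCommGroup E] [NormedSpace ℝ E]
    {F G : (Fin n → ℝ) → E} {x : Fin n → ℝ} (hF : DifferentiableAt ℝ F x)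
    (hG : DifferentiableAt ℝ G x) (i : Fin n) :
    pd i (fun y => F y + G y) x = pd i F x + pd i G x := by
  have : HasFDerivAt (fun y => F y + G y) _ x := hF.hasFDerivAt.add hG.hasFDerivAt
  rw [pd, this.fderiv]; rfl

theorem pd_cexp {n : ℕ} {F : (Fin n → ℝ) → ℂ} {x : Fin n → ℝ} (hF : DifferentiableAt ℝ F x)
    (i : Fin n) : pd i (fun y => Complex.exp (F y)) x = Complex.exp (F x) * pd i F x := by
  rw [pd, (hF.hasFDerivAt.cexp).fderiv]; simp [pd]

theorem pd_neg {n : ℕ} {E : Type*} [NormedAddCommGroup E] [NormedSpace ℝ E]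
    (F : (Fin n → ℝ) → E) (x : Fin n → ℝ) (i : Fin n) :
    pd i (fun y => -F y) x = -pd i F x := by simp [pd]

theorem dz_cexp {F : (Fin 2 → ℝ) → ℂ} {x : Fin 2 → ℝ} (hF : DifferentiableAt ℝ F x) :
    dz (fun y => Complex.exp (F y)) x = Complex.exp (F x) * dz F x := by
  simp only [dz, pd_cexp hF]; ring

theorem dzb_cexp {F : (Fin 2 → ℝ) → ℂ} {x : Fin 2 → ℝ} (hF : DifferentiableAt ℝ F x) :
    dzb (fun y => Complex.exp (F y)) x = Complex.exp (F x) * dzb F x := by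
  simp only [dzb, pd_cexp hF]; ring

theorem dz_neg (F : (Fin 2 → ℝ) → ℂ) (x : Fin 2 → ℝ) : dz (fun y => -F y) x = -dz F x := by
  simp only [dz, pd_neg]; ring

theorem dzb_neg (F : (Fin 2 → ℝ) → ℂ) (x : Fin 2 → ℝ) : dzb (fun y => -F y) x = -dzb F x := by
  simp only [dzb, pd_neg]; ring

theorem dz_fsum {b : (Fin 2 → ℤ) → ℂ} (h : MomentSummable 1 b) (x : Fin 2 → ℝ) :
    dz (fsum b) x = fsum (fun n => symZ n * b n) x := by
  have h0 := (MomentSummable.freq_mul (k := 0) h 0).summable_norm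
  have h1 := (MomentSummable.freq_mul (k := 0) h 1).summable_norm
  have : (fun n => symZ n * b n) = fun n => (1 / 2 : ℂ) * (freq 0 n * b n) +
      (-Complex.I / 2) * (freq 1 n * b n) := by ext n; simp only [symZ]; ring
  rw [this, fsum_add, fsum_const_mul, fsum_const_mul, dz, pd_fsum h, pd_fsum h]
  · ring
  · simpa only [norm_mul] using h0.mul_left ‖(1 / 2 : ℂ)‖
  · simpa only [norm_mul] using h1.mul_left ‖(-Complex.I / 2 : ℂ)‖

theorem dzb_fsum {b : (Fin 2 → ℤ) → ℂ} (h : MomentSummable 1 b) (x : Fin 2 → ℝ) :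
    dzb (fsum b) x = fsum (fun n => symZb n * b n) x := by
  have h0 := (MomentSummable.freq_mul (k := 0) h 0).summable_norm
  have h1 := (MomentSummable.freq_mul (k := 0) h 1).summable_norm
  have : (fun n => symZb n * b n) = fun n => (1 / 2 : ℂ) * (freq 0 n * b n) +
      (Complex.I / 2) * (freq 1 n * b n) := by ext n; simp only [symZb]; ring
  rw [this, fsum_add, fsum_const_mul, fsum_const_mul, dzb, pd_fsum h, pd_fsum h]
  · ring
  · simpa only [norm_mul] using h0.mul_left ‖(1 / 2 : ℂ)‖
  · simpa only [norm_mul] using h1.mul_left ‖(Complex.I / 2 : ℂ)‖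

theorem cellInt_const_mul (c : ℂ) (F : (Fin 2 → ℝ) → ℂ) :
    cellInt (fun x => c * F x) = c * cellInt F := by
  simp [cellInt, intervalIntegral.integral_const_mul]

theorem cellInt_dz {F : (Fin 2 → ℝ) → ℂ} (hF : ContDiff ℝ 1 F) (hp : ∀ x i, F (x + e i) = F x) :
    cellInt (dz F) = 0 := by
  have : dz F = fun x => (1 / 2 : ℂ) * pd 0 F x + (-Complex.I / 2) * pd 1 F x := by
    ext x; simp only [dz]; ring
  rw [this, cellInt_add (F := fun x => (1 / 2 : ℂ) * pd 0 F x)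
    (G := fun x => (-Complex.I / 2) * pd 1 F x) (continuous_const.mul (continuous_pd hF 0))
    (continuous_const.mul (continuous_pd hF 1)), cellInt_const_mul, cellInt_const_mul,
    cellInt_pd_zero hF hp, cellInt_pd_zero hF hp]
  simp

theorem cellInt_dzb {F : (Fin 2 → ℝ) → ℂ} (hF : ContDiff ℝ 1 F)
    (hp : ∀ x i, F (x + e i) = F x) : cellInt (dzb F) = 0 := by
  have : dzb F = fun x => (1 / 2 : ℂ) * pd 0 F x + (Complex.I / 2) * pd 1 F x := by
    ext x; simp only [dzb]; ring
  rw [this, cellInt_add (F := fun x => (1 / 2 : ℂ) * pd 0 F x)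
    (G := fun x => (Complex.I / 2) * pd 1 F x) (continuous_const.mul (continuous_pd hF 0))
    (continuous_const.mul (continuous_pd hF 1)), cellInt_const_mul, cellInt_const_mul,
    cellInt_pd_zero hF hp, cellInt_pd_zero hF hp]
  simp

theorem apply_fract {α : Type*} {u : (Fin 2 → ℝ) → α} (hp : ∀ x i, u (x + e i) = u x)
    (x : Fin 2 → ℝ) : u ![Int.fract (x 0), Int.fract (x 1)] = u x := by
  rw [← apply_add_zsmul_e hp 0 ⌊x 0⌋, ← apply_add_zsmul_e hp 1 ⌊x 1⌋]
  congr 1; ext i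
  fin_cases i <;> simp [e, Matrix.vecHead, Matrix.vecTail]

/-- A continuous non-negative doubly periodic function with mean zero vanishes. -/
theorem eq_zero_of_cellInt_eq_zero {F : (Fin 2 → ℝ) → ℝ} (hF : Continuous F)
    (hp : ∀ x i, F (x + e i) = F x) (h0 : ∀ x, 0 ≤ F x) (h : cellInt F = 0) (x : Fin 2 → ℝ) :
    F x = 0 := by
  by_contra hx
  rw [← apply_fract hp x] at hx
  have hpos := lt_of_le_of_ne (h0 _) (Ne.symm hx)
  have hm : ∀ i, Int.fract (x i) ∈ Set.Icc (0 : ℝ) 1 := fun i =>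
    ⟨Int.fract_nonneg _, (Int.fract_lt_one _).le⟩
  have h1 : 0 < ∫ y in (0 : ℝ)..1, F ![Int.fract (x 0), y] :=
    intervalIntegral.integral_pos one_pos (by fun_prop) (fun _ _ => h0 _) ⟨_, hm 1, hpos⟩
  have h2 : 0 < cellInt F := intervalIntegral.integral_pos one_pos
    (intervalIntegral.continuous_parametric_intervalIntegral_of_continuous'
      (by fun_prop) _ _).continuousOn
    (fun _ _ => intervalIntegral.integral_nonneg zero_le_one fun _ _ => h0 _) ⟨_, hm 0, h1⟩
  exact h2.ne' h

theorem continuous_jac {Φ : (Fin 2 → ℝ) → ℂ} (hΦ : ContDiff ℝ 1 Φ) : Continuous (jac Φ) := by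
  unfold jac
  exact Complex.continuous_im.comp ((Complex.continuous_conj.comp (continuous_pd hΦ 0)).mul
    (continuous_pd hΦ 1))

theorem fderiv_eq_pd (F : (Fin 2 → ℝ) → ℂ) (x v : Fin 2 → ℝ) :
    fderiv ℝ F x v = v 0 • pd 0 F x + v 1 • pd 1 F x := by
  have : v = v 0 • e 0 + v 1 • e 1 := by ext i; fin_cases i <;> simp [e]
  conv_lhs => rw [this]
  simp only [map_add, map_smul, pd]

/-- Doubly periodic solutions of a Beltrami equation are constant. -/
theorem eq_const_of_beltrami {G ν : (Fin 2 → ℝ) → ℂ} (hG : ContDiff ℝ 2 G)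
    (hp : ∀ x i, G (x + e i) = G x) (hν : ∀ x, ‖ν x‖ < 1) (h : ∀ x, dzb G x = ν x * dz G x)
    (x y : Fin 2 → ℝ) : G x = G y := by
  have h1 : ContDiff ℝ 1 G := hG.of_le (by norm_num)
  have hj : ∀ x, jac G x = (1 - ‖ν x‖ ^ 2) * ‖dz G x‖ ^ 2 := fun x => by
    rw [jac_eq_dz, h, norm_mul]; ring
  have hν2 : ∀ x, 0 < 1 - ‖ν x‖ ^ 2 := fun x => by
    have := hν x; nlinarith [norm_nonneg (ν x)]
  -- The Beltrami equation makes the Jacobian non-negative, while periodicity makes its mean zero.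
  -- It therefore vanishes identically, and with it both derivatives of `G`.
  have hj0 : ∀ x, jac G x = 0 := eq_zero_of_cellInt_eq_zero (continuous_jac h1)
    (fun x i => by simp only [jac, pd_add_period (F := G) (a := 0) (v := e i) (by simp [hp])])
    (fun x => by rw [hj]; exact mul_nonneg (hν2 x).le (by positivity))
    (by rw [cellInt_jac hG (a := 0) (b := 0) (by simp [hp]) (by simp [hp])]; simp)
  have hz : ∀ x, dz G x = 0 := fun x => by
    have := hj0 x
    rw [hj, mul_eq_zero] at this
    rcases this with h | h
    · exact absurd h (hν2 x).ne'
    · simpa using h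
  refine is_const_of_fderiv_eq_zero (𝕜 := ℝ) (h1.differentiable (by norm_num)) (fun x => ?_) x y
  ext v
  rw [fderiv_eq_pd, pd_zero_eq, pd_one_eq, h, hz]
  simp

/-- The frequencies are purely imaginary. Hence ∂ and ∂̄ have symbols of equal modulus, and the
Beurling multiplier is unimodular away from zero. -/
theorem symZ_eq_neg_conj (n : Fin 2 → ℤ) : symZ n = -starRingEnd ℂ (symZb n) := by
  have : starRingEnd ℂ 2 = 2 := Complex.conj_ofReal 2
  simp [symZ, symZb, freq, Complex.conj_ofReal, this]; ring

theorem norm_symZ (n : Fin 2 → ℤ) : ‖symZ n‖ = ‖symZb n‖ := by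
  rw [symZ_eq_neg_conj, norm_neg, RCLike.norm_conj]

theorem symZb_eq (n : Fin 2 → ℤ) : symZb n = Real.pi * Complex.I * (n 0 + Complex.I * n 1) := by
  simp only [symZb, freq]; ring

/-- The symbol is πi times a Gaussian integer, and a non-zero Gaussian integer has modulus at least
one. Inverting ∂̄ therefore never enlarges coefficients. -/
theorem one_le_norm_symZb {n : Fin 2 → ℤ} (hn : n ≠ 0) : 1 ≤ ‖symZb n‖ := by
  have h : 1 ≤ ‖((n 0 : ℂ) + Complex.I * n 1)‖ := by
    have h0 : ∀ i, n i ≠ 0 → (1 : ℝ) ≤ |(n i : ℝ)| := fun i hi => by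
      exact_mod_cast Int.one_le_abs hi
    by_cases h1 : n 0 = 0
    · have h2 : n 1 ≠ 0 := fun h2 => hn (by ext i; fin_cases i <;> simp [h1, h2])
      refine (h0 1 h2).trans ?_
      simpa using Complex.abs_im_le_norm ((n 0 : ℂ) + Complex.I * n 1)
    · refine (h0 0 h1).trans ?_
      simpa using Complex.abs_re_le_norm ((n 0 : ℂ) + Complex.I * n 1)
  rw [symZb_eq, norm_mul, norm_mul, Complex.norm_I, mul_one, Complex.norm_real,
    Real.norm_of_nonneg Real.pi_pos.le]
  nlinarith [Real.pi_gt_three]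

theorem symZb_ne_zero {n : Fin 2 → ℤ} (hn : n ≠ 0) : symZb n ≠ 0 := fun h => by
  have := one_le_norm_symZb hn
  rw [h, norm_zero] at this
  linarith

@[simp] theorem symZ_zero : symZ 0 = 0 := by simp [symZ, freq]
@[simp] theorem symZb_zero : symZb 0 = 0 := by simp [symZb, freq]

/-- The unimodular multiplier `∂/∂z (∂/∂z̄)⁻¹`. -/
def beurling (n : Fin 2 → ℤ) : ℂ := symZ n / symZb n

@[simp] theorem beurling_zero : beurling 0 = 0 := by simp [beurling]

theorem norm_beurling_le (n : Fin 2 → ℤ) : ‖beurling n‖ ≤ 1 := by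
  rw [beurling, norm_div, norm_symZ]; exact div_self_le_one _

theorem symZb_mul_beurling (n : Fin 2 → ℤ) : symZb n * beurling n = symZ n := by
  by_cases hn : n = 0
  · simp [hn]
  · rw [beurling, mul_div_cancel₀ _ (symZb_ne_zero hn)]

/-- The summable function `(1 + |n₀|)⁻² (1 + |n₁|)⁻²`. -/
def decay (n : Fin 2 → ℤ) : ℝ := 1 / ((1 + |(n 0 : ℝ)|) ^ 2 * (1 + |(n 1 : ℝ)|) ^ 2)

theorem decay_pos (n : Fin 2 → ℤ) : 0 < decay n := by unfold decay; positivity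

theorem summable_decay : Summable decay := summable_weight_inv

/-- Replacing 1 + δx by δ(1 + x) costs the factor δ⁸. Half of the resulting degree 4 in each
variable controls the second moment, and the other half becomes `decay`. -/
theorem moment_le_weight {δ : ℝ} (hδ : 0 < δ) (hδ1 : δ ≤ 1) (n : Fin 2 → ℤ) :
    (1 + |(n 0 : ℝ)| + |(n 1 : ℝ)|) ^ 2 ≤ (δ ^ 8)⁻¹ * decay n * weight δ n := by
  have h : ∀ x : ℝ, 0 ≤ x → δ * (1 + x) ≤ 1 + δ * x := fun x _ => by linarith
  have h0 := abs_nonneg (n 0 : ℝ)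
  have h1 := abs_nonneg (n 1 : ℝ)
  have h2 : (1 + |(n 0 : ℝ)| + |(n 1 : ℝ)|) ≤ (1 + |(n 0 : ℝ)|) * (1 + |(n 1 : ℝ)|) := by
    nlinarith [mul_nonneg h0 h1]
  have h3 : δ ^ 8 * ((1 + |(n 0 : ℝ)|) ^ 4 * (1 + |(n 1 : ℝ)|) ^ 4) ≤ weight δ n := by
    calc _ = (δ * (1 + |(n 0 : ℝ)|)) ^ 4 * (δ * (1 + |(n 1 : ℝ)|)) ^ 4 := by ring
      _ ≤ _ := by
        unfold weight
        gcongr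
        · exact h _ h0
        · exact h _ h1
  calc _ ≤ ((1 + |(n 0 : ℝ)|) * (1 + |(n 1 : ℝ)|)) ^ 2 := by gcongr
    _ = (δ ^ 8)⁻¹ * decay n * (δ ^ 8 * ((1 + |(n 0 : ℝ)|) ^ 4 * (1 + |(n 1 : ℝ)|) ^ 4)) := by
      unfold decay; field_simp
    _ ≤ _ := by
      have := decay_pos n
      gcongr

/-- An absolutely summable sequence as a square-summable one. -/
def toSqSum (g : (Fin 2 → ℤ) → ℂ) (hg : Summable fun n => ‖g n‖) : SqSum :=
  ⟨g, by
    have h : Memℓp g 1 := memℓp_gen (by simpa using hg)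
    exact h.of_exponent_ge one_le_two⟩

@[simp] theorem toSqSum_apply (g : (Fin 2 → ℤ) → ℂ) (hg : Summable fun n => ‖g n‖)
    (n : Fin 2 → ℤ) : toSqSum g hg n = g n := rfl

/-! ### The Beltrami equation on the torus with coefficient tμ. -/

/-- Solutions of a linear equation with a contraction, depending analytically on a parameter. -/
theorem exists_resolvent {H : Type*} [NormedAddCommGroup H] [NormedSpace ℂ H] [CompleteSpace H]
    (T : H →L[ℂ] H) (hT : ‖T‖ < 1) (g : H) :
    ∃ a : ℂ → H, (∀ t, ‖t‖ ≤ 1 → a t = t • T (a t) + t • g) ∧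
      (∀ t, ‖t‖ ≤ 1 → AnalyticAt ℂ a t) ∧ ∃ C, ∀ t, ‖t‖ ≤ 1 → ‖a t‖ ≤ C * ‖t‖ := by
  have hu : ∀ t : ℂ, ‖t‖ ≤ 1 → ‖t • T‖ < 1 := fun t ht => by
    rw [norm_smul]; nlinarith [norm_nonneg T, norm_nonneg t]
  have heq : ∀ t : ℂ, ‖t‖ ≤ 1 → Ring.inverse (1 - t • T) (t • g) =
      t • T (Ring.inverse (1 - t • T) (t • g)) + t • g := fun t ht => by
    have h := Ring.mul_inverse_cancel _ (isUnit_one_sub_of_norm_lt_one (hu t ht))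
    have h2 := congrArg (fun L : H →L[ℂ] H => L (t • g)) h
    simp only [mul_apply_eq_comp, sub_apply, smul_apply,
      one_apply_eq_self] at h2
    rw [← sub_eq_iff_eq_add']; exact h2
  refine ⟨fun t => Ring.inverse (1 - t • T) (t • g), heq, fun t ht => ?_, ‖g‖ / (1 - ‖T‖),
    fun t ht => ?_⟩
  · have h1 : AnalyticAt ℂ (fun t : ℂ => (1 : H →L[ℂ] H) - t • T) t :=
      analyticAt_const.sub (analyticAt_id.smul analyticAt_const)
    obtain ⟨u, hu'⟩ := isUnit_one_sub_of_norm_lt_one (hu t ht)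
    have h2 : AnalyticAt ℂ (Ring.inverse : (H →L[ℂ] H) → _) (1 - t • T) := by
      rw [← hu']; exact analyticAt_inverse u
    have h3 : AnalyticAt ℂ (fun t : ℂ => Ring.inverse ((1 : H →L[ℂ] H) - t • T)) t :=
      AnalyticAt.comp (f := fun t : ℂ => (1 : H →L[ℂ] H) - t • T) h2 h1
    have h4 : AnalyticAt ℂ (fun t : ℂ => Ring.inverse ((1 : H →L[ℂ] H) - t • T) g) t :=
      ((ContinuousLinearMap.apply ℂ H g).analyticAt _).comp h3
    simp only [map_smul]
    exact analyticAt_id.smul h4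
  · set a := Ring.inverse (1 - t • T) (t • g) with ha
    have h1 : ‖a‖ ≤ ‖T‖ * ‖a‖ + ‖t‖ * ‖g‖ := by
      have h2 := heq t ht
      rw [← ha] at h2
      calc ‖a‖ = ‖t • T a + t • g‖ := congrArg norm h2
        _ ≤ ‖t • T a‖ + ‖t • g‖ := norm_add_le _ _
        _ ≤ 1 * (‖T‖ * ‖a‖) + ‖t‖ * ‖g‖ := by
          rw [norm_smul, norm_smul]; gcongr; exact T.le_opNorm a
        _ = _ := by ring
    rw [div_mul_eq_mul_div, le_div_iff₀ (by linarith)]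
    linarith

/-- Solutions of the Fourier side of an inhomogeneous Beltrami equation. -/
theorem exists_beltrami_coefficients {m g : (Fin 2 → ℤ) → ℂ}
    (hm : Summable fun j => ‖m j‖ * weight 1 j) (hg : Summable fun j => ‖g j‖ * weight 1 j)
    {k : ℝ} (hk : k < 1) (hmk : ∀ x, ‖fsum m x‖ ≤ k) (π : (Fin 2 → ℤ) → ℂ)
    (hπ : ∀ n, ‖π n‖ ≤ 1) :
    ∃ w : ℂ → (Fin 2 → ℤ) → ℂ,
      (∃ C, ∀ t, ‖t‖ ≤ 1 → ∀ n, ‖w t n‖ * (1 + |(n 0 : ℝ)| + |(n 1 : ℝ)|) ^ 2 ≤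
        C * ‖t‖ * decay n) ∧
      (∀ n t, ‖t‖ ≤ 1 → AnalyticAt ℂ (fun t => w t n) t) ∧
      (∀ n t, ‖t‖ ≤ 1 → AnalyticAt ℂ (fun t => ∑' j, m j * (beurling (n - j) * w t (n - j))) t) ∧
      ∀ t, ‖t‖ ≤ 1 → ∀ n,
        w t n = t * (π n * (g n + ∑' j, m j * (beurling (n - j) * w t (n - j)))) := by
  have hm0 : Summable fun j => ‖m j‖ := by
    simpa [weight] using summable_weight_of_le hm le_rfl zero_le_one
  obtain ⟨δ, hδ, hδ1, hK⟩ := exists_norm_convOp_lt_one hm hk (norm_convOp_le hm0 hmk)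
  have hmδ := summable_weight_of_le hm hδ.le hδ1
  have hgδ := summable_weight_of_le hg hδ.le hδ1
  -- The unknown is a = weight · w, for which the equation becomes a = t P(K S a + weight · g). The
  -- diagonal operators `S` and `P` commute with the weight and have norm at most one, so the
  -- contraction property rests on `K` alone.
  let S : SqSum →L[ℂ] SqSum := weightedComp (Equiv.refl _) beurling 1 norm_beurling_le
  let P : SqSum →L[ℂ] SqSum := weightedComp (Equiv.refl _) π 1 hπ
  have hS : ‖S‖ ≤ 1 := norm_weightedComp_le _ _ _ _
  have hP : ‖P‖ ≤ 1 := norm_weightedComp_le _ _ _ _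
  let K := convOp m hδ.le
  have hT : ‖P.comp (K.comp S)‖ < 1 := by
    refine lt_of_le_of_lt ?_ hK
    calc ‖P.comp (K.comp S)‖ ≤ ‖P‖ * (‖K‖ * ‖S‖) :=
          (P.opNorm_comp_le _).trans (by gcongr; exact K.opNorm_comp_le S)
      _ ≤ 1 * (‖K‖ * 1) := by gcongr
      _ = ‖K‖ := by ring
  have hG : Summable fun n => ‖(weight δ n : ℂ) * g n‖ := by
    refine hgδ.congr fun n => ?_
    rw [norm_mul, Complex.norm_real, Real.norm_of_nonneg (weight_pos hδ.le n).le, mul_comm]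
  obtain ⟨a, ha, han, C, hC⟩ := exists_resolvent _ hT (P (toSqSum _ hG))
  have hω : ∀ n, (weight δ n : ℂ) ≠ 0 := fun n => by
    exact_mod_cast (weight_pos hδ.le n).ne'
  have hconv : ∀ t n, ∑' j, m j * (beurling (n - j) * (a t (n - j) / weight δ (n - j))) =
      K (S (a t)) n / weight δ n := fun t n => by
    have := (convOp_apply hδ.le hmδ (S (a t)) n).div_const (weight δ n : ℂ)
    rw [← this.tsum_eq]
    refine tsum_congr fun j => ?_
    have h1 := hω n
    have h2 := hω (n - j)
    simp only [S, weightedComp_apply, Equiv.refl_apply, weightRatio]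
    push_cast
    field_simp
  have hev : ∀ (L : SqSum →L[ℂ] SqSum) n t, ‖t‖ ≤ 1 →
      AnalyticAt ℂ (fun t => L (a t) n / (weight δ n : ℂ)) t := fun L n t ht => by
    have h := ((evalAt n).comp L).analyticAt (a t)
    have h2 : AnalyticAt ℂ (fun t => ((evalAt n).comp L) (a t)) t := h.comp (han t ht)
    exact h2.div_const
  refine ⟨fun t n => a t n / weight δ n, ⟨(δ ^ 8)⁻¹ * C, fun t ht n => ?_⟩,
    fun n t ht => by simpa using hev (ContinuousLinearMap.id ℂ _) n t ht,
    fun n t ht => by simp only [hconv]; exact hev (K.comp S) n t ht, fun t ht n => ?_⟩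
  · have h1 := moment_le_weight hδ hδ1 n
    have h2 := weight_pos hδ.le n
    have h3 : ‖a t n‖ ≤ C * ‖t‖ := (lp.norm_apply_le_norm (by norm_num) (a t) n).trans (hC t ht)
    rw [norm_div, Complex.norm_real, Real.norm_of_nonneg h2.le, div_mul_eq_mul_div,
      div_le_iff₀ h2]
    have h4 := (norm_nonneg _).trans h3
    calc _ ≤ (C * ‖t‖) * ((δ ^ 8)⁻¹ * decay n * weight δ n) := by gcongr
      _ = _ := by ring
  · rw [hconv]
    have h1 := congrArg (fun b : SqSum => b n) (ha t ht)
    simp only [lp.coeFn_add, lp.coeFn_smul, Pi.add_apply, Pi.smul_apply, smul_eq_mul,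
      ContinuousLinearMap.comp_apply] at h1
    change a t n / _ = _
    rw [h1]
    have h2 := hω n
    simp only [P, weightedComp_apply, Equiv.refl_apply, toSqSum_apply]
    field_simp
    ring

theorem momentSummable_of_decay {b : (Fin 2 → ℤ) → ℂ} {C : ℝ}
    (h : ∀ n, ‖b n‖ * (1 + |(n 0 : ℝ)| + |(n 1 : ℝ)|) ^ 2 ≤ C * decay n) : MomentSummable 2 b :=
  (summable_decay.mul_left C).of_nonneg_of_le (fun _ => by positivity) h

theorem MomentSummable.mul_of_le {k : ℕ} {b s : (Fin 2 → ℤ) → ℂ} (h : MomentSummable k b)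
    (hs : ∀ n, ‖s n‖ ≤ 1) : MomentSummable k fun n => s n * b n :=
  h.of_nonneg_of_le (fun _ => by positivity) fun n => by
    rw [norm_mul]
    have := mul_le_of_le_one_left (norm_nonneg (b n)) (hs n)
    gcongr

theorem norm_le_of_moment {b : (Fin 2 → ℤ) → ℂ} {C : ℝ}
    (h : ∀ n, ‖b n‖ * (1 + |(n 0 : ℝ)| + |(n 1 : ℝ)|) ^ 2 ≤ C * decay n) (n : Fin 2 → ℤ) :
    ‖b n‖ ≤ C * decay n :=
  (le_mul_of_one_le_right (norm_nonneg _) (one_le_pow₀ (one_le_moment n))).trans (h n)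

theorem summable_norm_convolution {G : Type*} [AddCommGroup G] {f g : G → ℂ}
    (hf : Summable fun n => ‖f n‖) (hg : Summable fun n => ‖g n‖) :
    Summable fun n => ‖∑' j, f j * g (n - j)‖ := by
  have h : Summable fun p : G × G => ‖f p.1‖ * ‖g p.2‖ :=
    hf.mul_of_nonneg hg (fun _ => norm_nonneg _) fun _ => norm_nonneg _
  have h2 : Summable fun p : G × G => ‖f p.2‖ * ‖g (p.1 - p.2)‖ :=
    (shearEquiv G).summable_iff.2 h
  refine h2.prod.of_nonneg_of_le (fun _ => norm_nonneg _) fun n => ?_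
  have h3 := h2.prod_factor n
  exact tsum_of_norm_bounded h3.hasSum fun j => by rw [norm_mul]

theorem fsum_single : ∀ x, fsum (Pi.single 0 1) x = 1 := fun x => by
  rw [fsum, tsum_eq_single 0 (fun n hn => by simp [hn])]; simp

theorem contDiff_dz {F : (Fin 2 → ℝ) → ℂ} (hF : ContDiff ℝ ∞ F) : ContDiff ℝ ∞ (dz F) := by
  have h := fun i => ContDiff.pd hF (m := ∞) (by simp) i
  exact ((h 0).sub (contDiff_const.mul (h 1))).div_const _

theorem contDiff_dzb {F : (Fin 2 → ℝ) → ℂ} (hF : ContDiff ℝ ∞ F) : ContDiff ℝ ∞ (dzb F) := by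
  have h := fun i => ContDiff.pd hF (m := ∞) (by simp) i
  exact ((h 0).add (contDiff_const.mul (h 1))).div_const _

theorem dz_add_period {F : (Fin 2 → ℝ) → ℂ} {v : Fin 2 → ℝ} {a : ℂ}
    (h : ∀ x, F (x + v) = F x + a) (x : Fin 2 → ℝ) : dz F (x + v) = dz F x := by
  simp only [dz, pd_add_period h]

theorem dzb_add_period {F : (Fin 2 → ℝ) → ℂ} {v : Fin 2 → ℝ} {a : ℂ}
    (h : ∀ x, F (x + v) = F x + a) (x : Fin 2 → ℝ) : dzb F (x + v) = dzb F x := by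
  simp only [dzb, pd_add_period h]

theorem cellInt_const (c : ℂ) : cellInt (fun _ => c) = c := by simp [cellInt]

theorem summable_norm_of_weight {m : (Fin 2 → ℤ) → ℂ}
    (hm : Summable fun j => ‖m j‖ * weight 1 j) : Summable fun j => ‖m j‖ := by
  simpa [weight] using summable_weight_of_le hm le_rfl zero_le_one

/-- Logarithms of the `z`-derivatives of solutions of a Beltrami equation. -/
theorem exists_beltrami_log {μ : (Fin 2 → ℝ) → ℂ} (hμ : ContDiff ℝ ∞ μ)
    (hp : ∀ x i, μ (x + e i) = μ x) {k : ℝ} (hk : k < 1) (hμk : ∀ x, ‖μ x‖ ≤ k) (t : ℂ)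
    (ht : ‖t‖ ≤ 1) :
    ∃ σ : (Fin 2 → ℝ) → ℂ, ContDiff ℝ 2 σ ∧ (∀ x i, σ (x + e i) = σ x) ∧
      ∀ x, dzb σ x = t * (dz μ x + μ x * dz σ x) := by
  have hpz : ∀ x i, dz μ (x + e i) = dz μ x := fun x i =>
    dz_add_period (a := 0) (fun x => by rw [hp, add_zero]) x
  have hm := summable_coef_weight hμ hp
  have hg := summable_coef_weight (contDiff_dz hμ) hpz
  have hm0 := summable_norm_of_weight hm
  have hg0 := summable_norm_of_weight hg
  have hfm : ∀ x, fsum (coef μ) x = μ x := fsum_coef hμ hp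
  have hfg : ∀ x, fsum (coef (dz μ)) x = dz μ x := fsum_coef (contDiff_dz hμ) hpz
  have hg00 : coef (dz μ) 0 = 0 := by
    simpa [coef] using cellInt_dz (hμ.of_le (by exact_mod_cast le_top)) hp
  -- The solution `v` is to be ∂̄σ. The projection removes the zero mode, where the symbol of ∂̄
  -- vanishes, so that σ can be recovered by division.
  obtain ⟨v, ⟨C, hC⟩, -, hcan, hv⟩ := exists_beltrami_coefficients hm hg hk
    (fun x => by rw [hfm]; exact hμk x) (fun n => if n = 0 then 0 else 1)
    (fun n => by split_ifs <;> simp)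
  set c : ℂ → (Fin 2 → ℤ) → ℂ := fun t n =>
    ∑' j, coef μ j * (beurling (n - j) * v t (n - j)) with hcdef
  have hv0 : ∀ t, ‖t‖ ≤ 1 → v t 0 = 0 := fun t ht => by rw [hv t ht]; simp
  have hvm : ∀ t, ‖t‖ ≤ 1 → MomentSummable 2 (v t) := fun t ht => momentSummable_of_decay (hC t ht)
  have hinv : ∀ n, ‖(symZb n)⁻¹‖ ≤ 1 := fun n => by
    by_cases hn : n = 0
    · simp [hn]
    · rw [norm_inv]; exact inv_le_one_of_one_le₀ (one_le_norm_symZb hn)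
  set σ : ℂ → (Fin 2 → ℝ) → ℂ := fun t => fsum fun n => (symZb n)⁻¹ * v t n with hσdef
  have hσm : ∀ t, ‖t‖ ≤ 1 → MomentSummable 2 fun n => (symZb n)⁻¹ * v t n := fun t ht =>
    (hvm t ht).mul_of_le hinv
  have hσc : ∀ t, ‖t‖ ≤ 1 → ContDiff ℝ 2 (σ t) := fun t ht => contDiff_fsum 2 (hσm t ht)
  have hσp : ∀ t x i, σ t (x + e i) = σ t x := fun t x i => fsum_add_e _ x i
  have hσzb : ∀ t, ‖t‖ ≤ 1 → ∀ x, dzb (σ t) x = fsum (v t) x := fun t ht x => by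
    rw [hσdef, dzb_fsum ((hσm t ht).mono one_le_two)]
    congr 1; ext n
    by_cases hn : n = 0
    · simp [hn, hv0 t ht]
    · rw [mul_inv_cancel_left₀ (symZb_ne_zero hn)]
  have hσz : ∀ t, ‖t‖ ≤ 1 → ∀ x, dz (σ t) x = fsum (fun n => beurling n * v t n) x :=
    fun t ht x => by
      rw [hσdef, dz_fsum ((hσm t ht).mono one_le_two)]
      congr 1; ext n
      rw [beurling]; ring
  -- Since ∂μ has mean zero, the projection spoils the equation only by the mean of tμ ∂σ, which is
  -- the constant `t * c t 0`. The rest of the proof shows that this constant is zero.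
  have heq : ∀ t, ‖t‖ ≤ 1 → ∀ x,
      dzb (σ t) x = t * (dz μ x + μ x * dz (σ t) x) - t * c t 0 := fun t ht x => by
    have hb := ((hvm t ht).mul_of_le norm_beurling_le).summable_norm
    have hcs : Summable fun n => ‖c t n‖ :=
      summable_norm_convolution (g := fun n => beurling n * v t n) hm0 hb
    have hprod := fsum_mul_fsum (a := coef μ) (b := fun n => beurling n * v t n) (c := c t)
      hm0 hb (fun n => by rw [hcdef]) x
    rw [hσzb t ht, hσz t ht, ← hfm x, hprod, ← hfg x]
    have : v t = fun n => t * (coef (dz μ) n + c t n) + (-(t * c t 0)) * (Pi.single 0 1 : (Fin 2 → ℤ) → ℂ) n := by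
      ext n
      rw [hv t ht]
      by_cases hn : n = 0
      · subst hn; simp [hg00]
      · simp [hn, hcdef]
    have hs1 : Summable fun n => ‖coef (dz μ) n + c t n‖ :=
      (hg0.add hcs).of_nonneg_of_le (fun _ => norm_nonneg _) fun n => norm_add_le _ _
    have hs2 : Summable fun n : Fin 2 → ℤ => ‖(Pi.single 0 1 : (Fin 2 → ℤ) → ℂ) n‖ :=
      summable_of_ne_finset_zero (s := {0}) fun n hn => by
        rw [Finset.mem_singleton] at hn; simp [hn]
    rw [this, fsum_add (by simpa only [norm_mul] using hs1.mul_left ‖t‖)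
      (by simpa only [norm_mul] using hs2.mul_left ‖-(t * c t 0)‖), fsum_const_mul, fsum_const_mul,
      fsum_single, fsum_add hg0 hcs]
    ring
  -- Multiplication by e^σ puts the equation in divergence form, ∂̄e^σ = t ∂(μe^σ) − t c₀ e^σ.
  -- Integrating over the cell leaves only the last term.
  have hint : ∀ t, ‖t‖ ≤ 1 → t * c t 0 * cellInt (fun x => Complex.exp (σ t x)) = 0 :=
    fun t ht => by
      have hE : ContDiff ℝ 2 fun x => Complex.exp (σ t x) := (hσc t ht).cexp
      have hE1 := hE.of_le (m := 1) (by norm_num)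
      have hμ1 : ContDiff ℝ 1 μ := hμ.of_le (by exact_mod_cast le_top)
      have hμE : ContDiff ℝ 1 fun x => μ x * Complex.exp (σ t x) := hμ1.mul hE1
      have hdσ := (hσc t ht).differentiable (by norm_num)
      have i1 := cellInt_dzb hE1 fun x i => by rw [hσp]
      have i2 := cellInt_dz hμE fun x i => by rw [hσp, hp]
      have : dzb (fun x => Complex.exp (σ t x)) = fun x =>
          t * dz (fun x => μ x * Complex.exp (σ t x)) x + (-(t * c t 0)) * Complex.exp (σ t x) := by
        ext x
        rw [dzb_cexp (hdσ x), heq t ht, dz_mul (hμ1.differentiable (by norm_num) x)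
          (hE1.differentiable (by norm_num) x), dz_cexp (hdσ x)]
        ring
      have cz : Continuous (dz fun x => μ x * Complex.exp (σ t x)) := by
        unfold dz
        have := continuous_pd hμE
        fun_prop
      rw [this, cellInt_add (F := fun x => t * dz (fun x => μ x * Complex.exp (σ t x)) x)
        (G := fun x => (-(t * c t 0)) * Complex.exp (σ t x)) (continuous_const.mul cz)
        (continuous_const.mul hE.continuous), cellInt_const_mul, cellInt_const_mul, i2] at i1
      linear_combination -i1
  -- The solution is O(t), so near t = 0 we have |σ| ≤ 1/4 and |e^σ − 1| ≤ 1/2. The mean of e^σ is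
  -- then non-zero and the constant must vanish.
  have hsmall : ∀ᶠ t in 𝓝 (0 : ℂ), t * c t 0 = 0 := by
    set D := |C| * ∑' n, decay n with hD
    have hD0 : 0 ≤ D := mul_nonneg (abs_nonneg _) (tsum_nonneg fun n => (decay_pos n).le)
    have hε : (0 : ℝ) < min 1 (1 / (4 * (D + 1))) := by positivity
    filter_upwards [Metric.ball_mem_nhds (0 : ℂ) hε] with t ht
    rw [mem_ball_zero_iff, lt_min_iff] at ht
    have ht1 : ‖t‖ ≤ 1 := ht.1.le
    have hσ4 : ∀ x, ‖σ t x‖ ≤ 1 / 4 := fun x => by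
      have h1 : ∀ n, ‖(symZb n)⁻¹ * v t n‖ ≤ |C| * ‖t‖ * decay n := fun n => by
        rw [norm_mul]
        calc _ ≤ 1 * ‖v t n‖ := by gcongr; exact hinv n
          _ ≤ C * ‖t‖ * decay n := by rw [one_mul]; exact norm_le_of_moment (hC t ht1) n
          _ ≤ _ := by
            have := (decay_pos n).le
            gcongr
            exact le_abs_self C
      calc ‖σ t x‖ ≤ ∑' n, ‖(symZb n)⁻¹ * v t n‖ := norm_fsum_le (hσm t ht1).summable_norm x
        _ ≤ ∑' n, |C| * ‖t‖ * decay n := (hσm t ht1).summable_norm.tsum_le_tsum h1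
            (summable_decay.mul_left _)
        _ = D * ‖t‖ := by rw [tsum_mul_left, hD]; ring
        _ ≤ (D + 1) * (1 / (4 * (D + 1))) := by gcongr; linarith; exact ht.2.le
        _ = 1 / 4 := by field_simp
    have hne : cellInt (fun x => Complex.exp (σ t x)) ≠ 0 := fun h0 => by
      have hc := (hσc t ht1).continuous
      have h1 := norm_cellInt_le (F := fun x => Complex.exp (σ t x) + (-1)) (C := 1 / 2) fun x => by
        have := Complex.norm_exp_sub_one_le (x := σ t x) ((hσ4 x).trans (by norm_num))
        rw [← sub_eq_add_neg]
        linarith [hσ4 x]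
      rw [cellInt_add (F := fun x => Complex.exp (σ t x)) (G := fun _ => -1) hc.cexp
        continuous_const, h0, cellInt_const] at h1
      norm_num at h1
    exact (mul_eq_zero.1 (hint t ht1)).resolve_right hne
  -- For larger t the mean of e^σ is not controlled directly. The constant is analytic in t, so the
  -- identity theorem carries its vanishing to the whole disc.
  have han : AnalyticOnNhd ℂ (fun t => t * c t 0) (Metric.closedBall 0 1) := fun t ht =>
    analyticAt_id.mul (hcan 0 t (by simpa using ht))
  have hzero := han.eqOn_zero_of_preconnected_of_eventuallyEq_zero
    (convex_closedBall (0 : ℂ) 1).isPreconnected (by simp) hsmall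
  refine ⟨σ t, hσc t ht, hσp t, fun x => ?_⟩
  have := hzero (show t ∈ Metric.closedBall (0 : ℂ) 1 by simpa using ht)
  rw [heq t ht, show t * c t 0 = 0 from this, sub_zero]

/-- Solutions of the Beltrami equations with coefficients `t μ` on the torus: the Fourier
coefficients of the `z̄`-derivatives, which depend analytically on `t`. The `z`-derivatives have
no zeros. -/
theorem exists_beltrami_path {μ : (Fin 2 → ℝ) → ℂ} (hμ : ContDiff ℝ ∞ μ)
    (hp : ∀ x i, μ (x + e i) = μ x) {k : ℝ} (hk : k < 1) (hμk : ∀ x, ‖μ x‖ ≤ k) :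
    ∃ w : ℂ → (Fin 2 → ℤ) → ℂ,
      (∃ C, ∀ t, ‖t‖ ≤ 1 → ∀ n, ‖w t n‖ * (1 + |(n 0 : ℝ)| + |(n 1 : ℝ)|) ^ 2 ≤ C * decay n) ∧
      (∀ n t, ‖t‖ ≤ 1 → AnalyticAt ℂ (fun t => w t n) t) ∧ (∀ n, w 0 n = 0) ∧
      ∀ t, ‖t‖ ≤ 1 → ∀ x,
        fsum (w t) x = t * μ x * (1 + fsum (fun n => beurling n * w t n) x) ∧
        1 + fsum (fun n => beurling n * w t n) x ≠ 0 := by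
  have hm := summable_coef_weight hμ hp
  have hm0 := summable_norm_of_weight hm
  have hfm : ∀ x, fsum (coef μ) x = μ x := fsum_coef hμ hp
  obtain ⟨w, ⟨C, hC⟩, han, -, hw⟩ := exists_beltrami_coefficients hm hm hk
    (fun x => by rw [hfm]; exact hμk x) (fun _ => 1) (fun n => by simp)
  have hC' : ∀ t, ‖t‖ ≤ 1 → ∀ n, ‖w t n‖ * (1 + |(n 0 : ℝ)| + |(n 1 : ℝ)|) ^ 2 ≤ |C| * decay n :=
    fun t ht n => (hC t ht n).trans <| by
      have := (decay_pos n).le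
      have h1 : C * ‖t‖ ≤ |C| :=
        (mul_le_mul_of_nonneg_right (le_abs_self C) (norm_nonneg t)).trans
          (mul_le_of_le_one_right (abs_nonneg C) ht)
      gcongr
  refine ⟨w, ⟨|C|, hC'⟩, han,
    fun n => by rw [hw 0 (by simp)]; simp, fun t ht => ?_⟩
  have hwm := momentSummable_of_decay (hC' t ht)
  have hbm := hwm.mul_of_le norm_beurling_le
  have heq : ∀ x, fsum (w t) x = t * μ x * (1 + fsum (fun n => beurling n * w t n) x) := fun x => by
    set c : (Fin 2 → ℤ) → ℂ := fun n => ∑' j, coef μ j * (beurling (n - j) * w t (n - j)) with hcdef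
    have hcs : Summable fun n => ‖c n‖ :=
      summable_norm_convolution (g := fun n => beurling n * w t n) hm0 hbm.summable_norm
    have hprod := fsum_mul_fsum (a := coef μ) (b := fun n => beurling n * w t n) (c := c)
      hm0 hbm.summable_norm (fun n => by rw [hcdef]) x
    have : w t = fun n => t * (coef μ n + c n) := by
      ext n; rw [hw t ht, one_mul]
    conv_lhs => rw [this]
    rw [fsum_const_mul, fsum_add hm0 hcs, ← hprod, hfm]
    ring
  -- Both e^σ and F = 1 + B solve ∂̄X = t ∂(μX), so their quotient `G` solves the homogeneous
  -- Beltrami equation and is constant. Hence F is a constant multiple of e^σ.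
  obtain ⟨σ, hσ, hσp, hσe⟩ := exists_beltrami_log hμ hp hk hμk t ht
  set B : (Fin 2 → ℝ) → ℂ := fsum fun n => beurling n * w t n with hB
  have hBc : ContDiff ℝ 2 B := contDiff_fsum 2 hbm
  set F : (Fin 2 → ℝ) → ℂ := fun x => 1 + B x with hF
  have hFc : ContDiff ℝ 2 F := contDiff_const.add hBc
  have hFp : ∀ x i, F (x + e i) = F x := fun x i => by simp only [hF, hB, fsum_add_e]
  have hμ2 : ContDiff ℝ 2 μ := contDiff_infty.1 hμ 2
  have dF := hFc.differentiable (by norm_num)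
  have dμ := hμ2.differentiable (by norm_num)
  have dσ := hσ.differentiable (by norm_num)
  have hFpd : ∀ i x, pd i F x = pd i B x := fun i x => by simp [pd, hF]
  -- On the Fourier side ∂̄ composed with the Beurling transform is ∂, so ∂̄F = ∂(tμF).
  have hFzb : ∀ x, dzb F x = t * (dz μ x * F x + μ x * dz F x) := fun x => by
    have h1 : dzb F x = fsum (fun n => symZ n * w t n) x := by
      simp only [dzb, hFpd]
      change dzb B x = _
      rw [hB, dzb_fsum (hbm.mono one_le_two)]
      congr 1; ext n
      rw [← mul_assoc, symZb_mul_beurling]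
    have h2 : fsum (w t) = fun x => t * (μ x * F x) := funext fun x => by rw [heq, mul_assoc]
    rw [h1, ← dz_fsum (hwm.mono one_le_two), h2]
    have h3 : dz (fun x => t * (μ x * F x)) x = t * dz (fun x => μ x * F x) x := by
      rw [dz_mul (F := fun _ => t) (G := fun x => μ x * F x) (differentiableAt_const t) ((dμ x).mul (dF x))]
      simp [dz, pd]
    rw [h3, dz_mul (dμ x) (dF x)]
    ring
  set G : (Fin 2 → ℝ) → ℂ := fun x => F x * Complex.exp (-σ x) with hG
  have hGc : ContDiff ℝ 2 G := hFc.mul hσ.neg.cexp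
  have hGe : ∀ x, dzb G x = t * μ x * dz G x := fun x => by
    have dE : DifferentiableAt ℝ (fun x => Complex.exp (-σ x)) x := (dσ x).neg.cexp
    rw [hG, dzb_mul (dF x) dE, dz_mul (dF x) dE, dzb_cexp (F := fun x => -σ x) (dσ x).neg,
      dz_cexp (F := fun x => -σ x) (dσ x).neg, dzb_neg, dz_neg, hFzb, hσe]
    ring
  have hGconst := eq_const_of_beltrami hGc (fun x i => by simp only [hG, hFp, hσp])
    (ν := fun x => t * μ x) (fun x => by
      rw [norm_mul]
      calc ‖t‖ * ‖μ x‖ ≤ 1 * ‖μ x‖ := by gcongr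
        _ < 1 := by rw [one_mul]; exact (hμk x).trans_lt hk) hGe
  -- F − 1 is the z-derivative of a periodic function. The mean being one excludes the possibility
  -- that the constant `G` is zero.
  have hmean : cellInt F = 1 := by
    have hinv : ∀ n, ‖(symZb n)⁻¹‖ ≤ 1 := fun n => by
      by_cases hn : n = 0
      · simp [hn]
      · rw [norm_inv]; exact inv_le_one_of_one_le₀ (one_le_norm_symZb hn)
    have hm2 := hwm.mul_of_le hinv
    have : B = dz (fsum fun n => (symZb n)⁻¹ * w t n) := by
      ext x
      rw [dz_fsum (hm2.mono one_le_two), hB]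
      congr 1; ext n; rw [beurling]; ring
    rw [hF, cellInt_add continuous_const hBc.continuous, cellInt_const, this,
      cellInt_dz ((contDiff_fsum 2 hm2).of_le (by norm_num)) fun x i => fsum_add_e _ x i, add_zero]
  refine fun x => ⟨heq x, fun h0 => ?_⟩
  have hG0 : ∀ y, G y = 0 := fun y => by
    rw [hGconst y x, hG]
    exact mul_eq_zero_of_left h0 _
  have hF0 : ∀ y, F y = 0 := fun y => (mul_eq_zero.1 (hG0 y)).resolve_right (Complex.exp_ne_zero _)
  have : cellInt F = 0 := by simp [cellInt, hF0]
  rw [this] at hmean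
  exact zero_ne_one hmean

/-! ### Equivariant immersions of the plane are isotopic to the identity. -/

/-- The plane as `ℂ`. -/
def planeC (x : Fin 2 → ℝ) : ℂ := x 0 + x 1 * Complex.I

/-- Equivariance with respect to the lattice `ℤ²`. -/
def LatticeEquivariant (Φ : (Fin 2 → ℝ) → ℂ) : Prop :=
  ∀ x, Φ (x + e 0) = Φ x + 1 ∧ Φ (x + e 1) = Φ x + Complex.I

/-- `Φ` and `Ψ` are joined by a smooth family of equivariant orientation preserving immersions. -/
def Isotopic (Φ Ψ : (Fin 2 → ℝ) → ℂ) : Prop :=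
  ∃ Y : (Fin 2 → ℝ) → ℝ → ℂ, ContDiff ℝ ∞ (fun p : (Fin 2 → ℝ) × ℝ => Y p.1 p.2) ∧
    (∀ s, LatticeEquivariant fun x => Y x s) ∧ (∀ s x, 0 < jac (fun x => Y x s) x) ∧
    (∀ s ≤ 0, ∀ x, Y x s = Φ x) ∧ ∀ s, 1 ≤ s → ∀ x, Y x s = Ψ x

/-- Both families are constant outside [0, 1], so Y(2s) + Z(2s − 1) − Y(1) equals one of them on
each half. It is smooth without any gluing argument. -/
theorem Isotopic.trans {Φ Ψ Θ : (Fin 2 → ℝ) → ℂ} (h1 : Isotopic Φ Ψ) (h2 : Isotopic Ψ Θ) :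
    Isotopic Φ Θ := by
  obtain ⟨Y, sY, eY, jY, Y0, Y1⟩ := h1
  obtain ⟨Z, sZ, eZ, jZ, Z0, Z1⟩ := h2
  have hl : ∀ s ≤ (1 / 2 : ℝ), (fun x => Y x (2 * s) + Z x (2 * s - 1) - Y x 1) =
      fun x => Y x (2 * s) := fun s hs => by
    ext x; rw [Z0 _ (by linarith), Y1 1 le_rfl]; ring
  have hr : ∀ s, (1 / 2 : ℝ) ≤ s → (fun x => Y x (2 * s) + Z x (2 * s - 1) - Y x 1) =
      fun x => Z x (2 * s - 1) := fun s hs => by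
    ext x; rw [Y1 _ (by linarith), Y1 1 le_rfl]; ring
  refine ⟨fun x s => Y x (2 * s) + Z x (2 * s - 1) - Y x 1, ?_, fun s => ?_, fun s => ?_,
    fun s hs x => ?_, fun s hs x => ?_⟩
  · have a1 : ContDiff ℝ ∞ fun p : (Fin 2 → ℝ) × ℝ => Y p.1 (2 * p.2) :=
      sY.comp (g := fun p : (Fin 2 → ℝ) × ℝ => Y p.1 p.2)
        (f := fun p : (Fin 2 → ℝ) × ℝ => (p.1, 2 * p.2)) (by fun_prop)
    have a2 : ContDiff ℝ ∞ fun p : (Fin 2 → ℝ) × ℝ => Z p.1 (2 * p.2 - 1) :=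
      sZ.comp (g := fun p : (Fin 2 → ℝ) × ℝ => Z p.1 p.2)
        (f := fun p : (Fin 2 → ℝ) × ℝ => (p.1, 2 * p.2 - 1)) (by fun_prop)
    have a3 : ContDiff ℝ ∞ fun p : (Fin 2 → ℝ) × ℝ => Y p.1 1 :=
      sY.comp (g := fun p : (Fin 2 → ℝ) × ℝ => Y p.1 p.2)
        (f := fun p : (Fin 2 → ℝ) × ℝ => (p.1, 1)) (by fun_prop)
    exact (a1.add a2).sub a3
  · rcases le_total s (1 / 2) with hs | hs
    · rw [hl s hs]; exact eY _
    · rw [hr s hs]; exact eZ _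
  · rcases le_total s (1 / 2) with hs | hs
    · rw [hl s hs]; exact jY _
    · rw [hr s hs]; exact jZ _
  · have := congrFun (hl s (by linarith)) x
    exact this.trans (Y0 _ (by linarith) x)
  · have := congrFun (hr s (by linarith)) x
    exact this.trans (Z1 _ (by linarith) x)

theorem pd_const_mul {n : ℕ} {F : (Fin n → ℝ) → ℂ} {x : Fin n → ℝ} (hF : DifferentiableAt ℝ F x)
    (c : ℂ) (i : Fin n) : pd i (fun y => c * F y) x = c * pd i F x := by
  rw [pd, (hF.hasFDerivAt.const_mul c).fderiv]; rfl

theorem dz_add {F G : (Fin 2 → ℝ) → ℂ} {x : Fin 2 → ℝ} (hF : DifferentiableAt ℝ F x)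
    (hG : DifferentiableAt ℝ G x) : dz (fun y => F y + G y) x = dz F x + dz G x := by
  simp only [dz, pd_add hF hG]; ring

theorem dzb_add {F G : (Fin 2 → ℝ) → ℂ} {x : Fin 2 → ℝ} (hF : DifferentiableAt ℝ F x)
    (hG : DifferentiableAt ℝ G x) : dzb (fun y => F y + G y) x = dzb F x + dzb G x := by
  simp only [dzb, pd_add hF hG]; ring

theorem dz_const_mul {F : (Fin 2 → ℝ) → ℂ} {x : Fin 2 → ℝ} (hF : DifferentiableAt ℝ F x)
    (c : ℂ) : dz (fun y => c * F y) x = c * dz F x := by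
  simp only [dz, pd_const_mul hF]; ring

theorem dzb_const_mul {F : (Fin 2 → ℝ) → ℂ} {x : Fin 2 → ℝ} (hF : DifferentiableAt ℝ F x)
    (c : ℂ) : dzb (fun y => c * F y) x = c * dzb F x := by
  simp only [dzb, pd_const_mul hF]; ring

/-- The difference of the squared norms is stable under small perturbations. -/
theorem norm_sq_sub_pos_of_close {a b a' b' : ℂ} {M c ε : ℝ} (ha : ‖a‖ ≤ M) (hb : ‖b‖ ≤ M)
    (hc : c ≤ ‖a‖ ^ 2 - ‖b‖ ^ 2) (haa : ‖a' - a‖ ≤ ε) (hbb : ‖b' - b‖ ≤ ε)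
    (hε : 4 * M * ε + ε ^ 2 < c) : 0 < ‖a'‖ ^ 2 - ‖b'‖ ^ 2 := by
  have hε0 := (norm_nonneg _).trans haa
  have h1 : ‖a‖ - ε ≤ ‖a'‖ := by
    have := norm_sub_norm_le a a'
    rw [norm_sub_rev] at this; linarith
  have h2 : ‖b'‖ ≤ ‖b‖ + ε := by
    have := norm_sub_norm_le b' b; linarith
  have h3 : ‖a‖ ^ 2 - 2 * M * ε ≤ ‖a'‖ ^ 2 := by
    rcases le_total ε ‖a‖ with h | h
    · nlinarith [norm_nonneg a', mul_le_mul_of_nonneg_right ha hε0]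
    · nlinarith [norm_nonneg a, norm_nonneg a', mul_le_mul_of_nonneg_right ha hε0,
        mul_le_mul_of_nonneg_left h (norm_nonneg a), sq_nonneg ‖a'‖]
  have h4 : ‖b'‖ ^ 2 ≤ ‖b‖ ^ 2 + 2 * M * ε + ε ^ 2 := by
    nlinarith [norm_nonneg b, norm_nonneg b', mul_le_mul_of_nonneg_right hb hε0]
  linarith

/-- The straight-line homotopy, slowed down by `Real.smoothTransition`, works: equivariance is an
affine condition, and closeness of the first derivatives keeps the Jacobian positive. -/
theorem isotopic_of_close {Φ Ψ : (Fin 2 → ℝ) → ℂ} (hΦ : ContDiff ℝ ∞ Φ) (hΨ : ContDiff ℝ ∞ Ψ)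
    (eΦ : LatticeEquivariant Φ) (eΨ : LatticeEquivariant Ψ) {M c ε : ℝ}
    (hM : ∀ x, ‖dz Ψ x‖ ≤ M) (hM' : ∀ x, ‖dzb Ψ x‖ ≤ M) (hc : ∀ x, c ≤ jac Ψ x)
    (h : ∀ x, ‖dz Φ x - dz Ψ x‖ ≤ ε) (h' : ∀ x, ‖dzb Φ x - dzb Ψ x‖ ≤ ε)
    (hε : 4 * M * ε + ε ^ 2 < c) : Isotopic Φ Ψ := by
  have dΦ : Differentiable ℝ Φ := hΦ.differentiable (by simp)
  have dΨ : Differentiable ℝ Ψ := hΨ.differentiable (by simp)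
  refine ⟨fun x s => ((1 - Real.smoothTransition s : ℝ) : ℂ) * Φ x +
    ((Real.smoothTransition s : ℝ) : ℂ) * Ψ x, ?_, fun s x => ?_, fun s x => ?_, fun s hs x => ?_,
    fun s hs x => ?_⟩
  · have hτ : ContDiff ℝ ∞ fun p : (Fin 2 → ℝ) × ℝ => Real.smoothTransition p.2 :=
      Real.smoothTransition.contDiff.comp contDiff_snd
    have h1 : ContDiff ℝ ∞ fun p : (Fin 2 → ℝ) × ℝ => ((Real.smoothTransition p.2 : ℝ) : ℂ) :=
      Complex.ofRealCLM.contDiff.comp hτ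
    have h2 : ContDiff ℝ ∞ fun p : (Fin 2 → ℝ) × ℝ => ((1 - Real.smoothTransition p.2 : ℝ) : ℂ) :=
      Complex.ofRealCLM.contDiff.comp (contDiff_const.sub hτ)
    exact (h2.mul (hΦ.comp contDiff_fst)).add (h1.mul (hΨ.comp contDiff_fst))
  · simp only [(eΦ x).1, (eΦ x).2, (eΨ x).1, (eΨ x).2]
    constructor <;> push_cast <;> ring
  · have ht0 := Real.smoothTransition.nonneg s
    have ht1 := Real.smoothTransition.le_one s
    set t := Real.smoothTransition s
    rw [jac_eq_dz, dz_add ((dΦ x).const_mul _) ((dΨ x).const_mul _),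
      dzb_add ((dΦ x).const_mul _) ((dΨ x).const_mul _), dz_const_mul (dΦ x), dz_const_mul (dΨ x),
      dzb_const_mul (dΦ x), dzb_const_mul (dΨ x)]
    have key : ∀ a b : ℂ, ‖a - b‖ ≤ ε → ‖((1 - t : ℝ) : ℂ) * a + (t : ℂ) * b - b‖ ≤ ε :=
      fun a b hab => by
        have : ((1 - t : ℝ) : ℂ) * a + (t : ℂ) * b - b = ((1 - t : ℝ) : ℂ) * (a - b) := by
          push_cast; ring
        rw [this, norm_mul, Complex.norm_real, Real.norm_of_nonneg (by linarith)]
        nlinarith [norm_nonneg (a - b)]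
    exact norm_sq_sub_pos_of_close (hM x) (hM' x) (by rw [← jac_eq_dz]; exact hc x)
      (key _ _ (h x)) (key _ _ (h' x)) hε
  · simp [Real.smoothTransition.zero_of_nonpos hs]
  · simp [Real.smoothTransition.one_of_one_le hs]

theorem contDiff_planeC : ContDiff ℝ ∞ planeC := by
  have h0 := (coordC 0).contDiff (n := ∞)
  have h1 := (coordC 1).contDiff (n := ∞)
  exact h0.add (h1.mul contDiff_const)

theorem pd_planeC (x : Fin 2 → ℝ) : pd 0 planeC x = 1 ∧ pd 1 planeC x = Complex.I := by
  have h : HasFDerivAt planeC (coordC 0 + Complex.I • coordC 1) x := by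
    have := (coordC 0 + Complex.I • coordC 1).hasFDerivAt (x := x)
    refine this.congr_of_eventuallyEq (Filter.Eventually.of_forall fun y => ?_)
    simp [planeC, mul_comm]
  constructor <;> rw [pd, h.fderiv] <;> simp [e]

theorem pd_conj {n : ℕ} {F : (Fin n → ℝ) → ℂ} {x : Fin n → ℝ} (hF : DifferentiableAt ℝ F x)
    (i : Fin n) : pd i (fun y => starRingEnd ℂ (F y)) x = starRingEnd ℂ (pd i F x) := by
  have : HasFDerivAt (fun y => starRingEnd ℂ (F y))
      ((Complex.conjCLE : ℂ →L[ℝ] ℂ).comp (fderiv ℝ F x)) x :=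
    (Complex.conjCLE : ℂ →L[ℝ] ℂ).hasFDerivAt.comp x hF.hasFDerivAt
  rw [pd, this.fderiv]; rfl

theorem dz_conj {F : (Fin 2 → ℝ) → ℂ} {x : Fin 2 → ℝ} (hF : DifferentiableAt ℝ F x) :
    dz (fun y => starRingEnd ℂ (F y)) x = starRingEnd ℂ (dzb F x) := by
  have : starRingEnd ℂ 2 = 2 := Complex.conj_ofReal 2
  simp only [dz, dzb, pd_conj hF, map_div₀, map_add, map_mul, Complex.conj_I, this]; ring

theorem dzb_conj {F : (Fin 2 → ℝ) → ℂ} {x : Fin 2 → ℝ} (hF : DifferentiableAt ℝ F x) :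
    dzb (fun y => starRingEnd ℂ (F y)) x = starRingEnd ℂ (dz F x) := by
  have : starRingEnd ℂ 2 = 2 := Complex.conj_ofReal 2
  simp only [dz, dzb, pd_conj hF, map_div₀, map_sub, map_mul, Complex.conj_I, this]; ring

theorem planeC_add_e (x : Fin 2 → ℝ) :
    planeC (x + e 0) = planeC x + 1 ∧ planeC (x + e 1) = planeC x + Complex.I := by
  constructor <;> simp [planeC, e] <;> ring

theorem dz_planeC (x : Fin 2 → ℝ) : dz planeC x = 1 ∧ dzb planeC x = 0 := by
  rw [dz, dzb, (pd_planeC x).1, (pd_planeC x).2]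
  constructor
  · rw [← sq, Complex.I_sq]; norm_num
  · rw [← sq, Complex.I_sq]; norm_num

/-- The map with `z̄`-derivative `fsum w`. -/
def potential (w : (Fin 2 → ℤ) → ℂ) (x : Fin 2 → ℝ) : ℂ :=
  planeC x + w 0 * starRingEnd ℂ (planeC x) + fsum (fun n => (symZb n)⁻¹ * w n) x

theorem norm_symZb_inv_le (n : Fin 2 → ℤ) : ‖(symZb n)⁻¹‖ ≤ 1 := by
  by_cases hn : n = 0
  · simp [hn]
  · rw [norm_inv]; exact inv_le_one_of_one_le₀ (one_le_norm_symZb hn)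

theorem contDiff_potential {k : ℕ} {w : (Fin 2 → ℤ) → ℂ} (hw : MomentSummable k w) :
    ContDiff ℝ k (potential w) := by
  have h1 : ContDiff ℝ k planeC := contDiff_infty.1 contDiff_planeC k
  exact (h1.add (contDiff_const.mul ((Complex.conjCLE : ℂ →L[ℝ] ℂ).contDiff.comp h1))).add
    (contDiff_fsum k (hw.mul_of_le norm_symZb_inv_le))

/-- The zero mode of ∂̄ cannot be produced by a periodic function, since `symZb 0 = 0`. It is
carried by the term w₀z̄, which in turn changes the periods. -/
theorem dz_potential {w : (Fin 2 → ℤ) → ℂ} (hw : MomentSummable 1 w) (x : Fin 2 → ℝ) :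
    dz (potential w) x = 1 + fsum (fun n => beurling n * w n) x ∧
    dzb (potential w) x = fsum w x := by
  have hm := hw.mul_of_le norm_symZb_inv_le
  have d1 : DifferentiableAt ℝ planeC x := contDiff_planeC.differentiable (by simp) x
  have d2 : DifferentiableAt ℝ (fun y => starRingEnd ℂ (planeC y)) x :=
    (Complex.conjCLE : ℂ →L[ℝ] ℂ).differentiableAt.comp x d1
  have d3 : DifferentiableAt ℝ (fsum fun n => (symZb n)⁻¹ * w n) x :=
    (hasFDerivAt_fsum hm x).differentiableAt
  have d4 : DifferentiableAt ℝ (fun y => planeC y + w 0 * starRingEnd ℂ (planeC y)) x :=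
    d1.add (d2.const_mul _)
  constructor
  · unfold potential
    rw [dz_add d4 d3, dz_add d1 (d2.const_mul _), dz_const_mul d2, dz_conj d1, (dz_planeC x).1,
      (dz_planeC x).2, map_zero, mul_zero, add_zero, dz_fsum hm]
    congr 2; ext n; rw [beurling]; ring
  · unfold potential
    rw [dzb_add d4 d3, dzb_add d1 (d2.const_mul _), dzb_const_mul d2, dzb_conj d1, (dz_planeC x).1,
      (dz_planeC x).2, map_one, mul_one, zero_add, dzb_fsum hm]
    have hs : w = fun n => symZb n * ((symZb n)⁻¹ * w n) +
        w 0 * (Pi.single 0 1 : (Fin 2 → ℤ) → ℂ) n := by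
      ext n
      by_cases hn : n = 0
      · subst hn; simp
      · rw [mul_inv_cancel_left₀ (symZb_ne_zero hn)]; simp [hn]
    have s1 : Summable fun n => ‖symZb n * ((symZb n)⁻¹ * w n)‖ :=
      hw.summable_norm.of_nonneg_of_le (fun _ => norm_nonneg _) fun n => by
        by_cases hn : n = 0
        · simp [hn]
        · rw [mul_inv_cancel_left₀ (symZb_ne_zero hn)]
    have s2 : Summable fun n : Fin 2 → ℤ => ‖w 0 * (Pi.single 0 1 : (Fin 2 → ℤ) → ℂ) n‖ :=
      summable_of_ne_finset_zero (s := {0}) fun n hn => by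
        rw [Finset.mem_singleton] at hn; simp [hn]
    conv_rhs => rw [hs]
    rw [fsum_add s1 s2, fsum_const_mul, fsum_single, mul_one, add_comm]

theorem potential_add_e (w : (Fin 2 → ℤ) → ℂ) (x : Fin 2 → ℝ) :
    potential w (x + e 0) = potential w x + (1 + w 0) ∧
    potential w (x + e 1) = potential w x + Complex.I * (1 - w 0) := by
  simp only [potential, fsum_add_e, (planeC_add_e x).1, (planeC_add_e x).2, map_add, map_one,
    Complex.conj_I]
  constructor <;> ring

theorem cellInt_nonneg {F : (Fin 2 → ℝ) → ℝ} (h : ∀ x, 0 ≤ F x) : 0 ≤ cellInt F :=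
  intervalIntegral.integral_nonneg zero_le_one fun _ _ =>
    intervalIntegral.integral_nonneg zero_le_one fun _ _ => h _

theorem jac_add_period {F : (Fin 2 → ℝ) → ℂ} {v : Fin 2 → ℝ} {a : ℂ}
    (h : ∀ x, F (x + v) = F x + a) (x : Fin 2 → ℝ) : jac F (x + v) = jac F x := by
  rw [jac, jac, pd_add_period h, pd_add_period h]

/-- The mean of the Jacobian is the determinant of the periods 1 + b and i(1 − b), which is 1 −
|b|². -/
theorem norm_lt_one_of_jac_pos {F : (Fin 2 → ℝ) → ℂ} {b : ℂ} (hF : ContDiff ℝ 2 F)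
    (h0 : ∀ x, F (x + e 0) = F x + (1 + b)) (h1 : ∀ x, F (x + e 1) = F x + Complex.I * (1 - b))
    (hj : ∀ x, 0 < jac F x) : ‖b‖ ^ 2 < 1 := by
  have hi := cellInt_jac hF h0 h1
  have he : (starRingEnd ℂ (1 + b) * (Complex.I * (1 - b))).im = 1 - ‖b‖ ^ 2 := by
    rw [Complex.sq_norm, Complex.normSq_apply]; simp; ring
  rw [he] at hi
  have hn := cellInt_nonneg fun x => (hj x).le
  rcases hn.lt_or_eq with hlt | heq
  · linarith
  · have hp : ∀ x i, jac F (x + e i) = jac F x := fun x i => by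
      fin_cases i
      · exact jac_add_period h0 x
      · exact jac_add_period h1 x
    have := eq_zero_of_cellInt_eq_zero (continuous_jac (hF.of_le (by norm_num))) hp
      (fun x => (hj x).le) heq.symm 0
    exact absurd this (hj 0).ne'

/-- Composition with the real linear map that carries the period lattice of `F` to `ℤ[i]`. -/
def normalize (b : ℂ) (F : (Fin 2 → ℝ) → ℂ) (x : Fin 2 → ℝ) : ℂ :=
  (1 - b * starRingEnd ℂ b)⁻¹ * (F x + -b * starRingEnd ℂ (F x))

theorem one_sub_mul_conj {b : ℂ} (hb : ‖b‖ ^ 2 < 1) :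
    1 - b * starRingEnd ℂ b = ((1 - ‖b‖ ^ 2 : ℝ) : ℂ) ∧ 1 - b * starRingEnd ℂ b ≠ 0 := by
  have : 1 - b * starRingEnd ℂ b = ((1 - ‖b‖ ^ 2 : ℝ) : ℂ) := by
    rw [Complex.mul_conj, Complex.normSq_eq_norm_sq]; push_cast; ring
  refine ⟨this, ?_⟩
  rw [this, Complex.ofReal_ne_zero]; linarith

theorem normalize_equivariant {F : (Fin 2 → ℝ) → ℂ} {b : ℂ} (hb : ‖b‖ ^ 2 < 1)
    (h0 : ∀ x, F (x + e 0) = F x + (1 + b)) (h1 : ∀ x, F (x + e 1) = F x + Complex.I * (1 - b)) :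
    LatticeEquivariant (normalize b F) := fun x => by
  have hd := (one_sub_mul_conj hb).2
  simp only [normalize, h0, h1, map_add, map_mul, map_sub, map_one, Complex.conj_I]
  constructor <;> field_simp <;> ring

/-- The map ζ ↦ ζ − bζ̄ multiplies |∂F|² − |∂̄F|² by 1 − |b|² > 0, and the scalar in front is
non-zero. -/
theorem jac_normalize_pos {F : (Fin 2 → ℝ) → ℂ} {b : ℂ} {x : Fin 2 → ℝ} (hb : ‖b‖ ^ 2 < 1)
    (hF : DifferentiableAt ℝ F x) (hj : 0 < jac F x) : 0 < jac (normalize b F) x := by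
  obtain ⟨hd, hd0⟩ := one_sub_mul_conj hb
  have hc : DifferentiableAt ℝ (fun y => starRingEnd ℂ (F y)) x :=
    (Complex.conjCLE : ℂ →L[ℝ] ℂ).differentiableAt.comp x hF
  have hs : DifferentiableAt ℝ (fun y => F y + -b * starRingEnd ℂ (F y)) x := hF.add (hc.const_mul _)
  have key : ∀ p q : ℂ, ‖p + -b * starRingEnd ℂ q‖ ^ 2 - ‖q + -b * starRingEnd ℂ p‖ ^ 2 =
      (1 - ‖b‖ ^ 2) * (‖p‖ ^ 2 - ‖q‖ ^ 2) := fun p q => by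
    simp only [Complex.sq_norm, Complex.normSq_apply, Complex.add_re, Complex.add_im,
      Complex.mul_re, Complex.mul_im, Complex.neg_re, Complex.neg_im, Complex.conj_re,
      Complex.conj_im]
    ring
  rw [jac_eq_dz] at hj ⊢
  unfold normalize
  rw [dz_const_mul hs, dzb_const_mul hs, dz_add hF (hc.const_mul _), dzb_add hF (hc.const_mul _),
    dz_const_mul hc, dzb_const_mul hc, dz_conj hF, dzb_conj hF, norm_mul, norm_mul, mul_pow,
    mul_pow, ← mul_sub, key]
  have : 0 < ‖(1 - b * starRingEnd ℂ b)⁻¹‖ := norm_pos_iff.2 (inv_ne_zero hd0)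
  have h3 : 0 < 1 - ‖b‖ ^ 2 := by linarith
  positivity

theorem norm_fsum_sub_le {a b : (Fin 2 → ℤ) → ℂ} (ha : Summable fun n => ‖a n‖)
    (hb : Summable fun n => ‖b n‖) {d : (Fin 2 → ℤ) → ℝ} {ε : ℝ} (hd : HasSum d ε)
    (h : ∀ n, ‖a n - b n‖ ≤ d n) (x : Fin 2 → ℝ) : ‖fsum a x - fsum b x‖ ≤ ε := by
  rw [fsum, fsum, ← (summable_fsum ha x).tsum_sub (summable_fsum hb x)]
  exact tsum_of_norm_bounded hd fun n => by
    rw [← sub_mul, norm_mul, norm_expChar, mul_one]; exact h n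

/-- Truncation of a family of coefficients. -/
def truncate (A : Finset (Fin 2 → ℤ)) (w : (Fin 2 → ℤ) → ℂ) (n : Fin 2 → ℤ) : ℂ :=
  open Classical in if n ∈ A then w n else 0

theorem MomentSummable.truncate {k : ℕ} {w : (Fin 2 → ℤ) → ℂ} (A : Finset (Fin 2 → ℤ)) :
    MomentSummable k (truncate A w) :=
  summable_of_ne_finset_zero (s := A) fun n hn => by simp [TubeMetric.truncate, hn]

theorem potential_truncate (A : Finset (Fin 2 → ℤ)) (hA : 0 ∈ A) (w : (Fin 2 → ℤ) → ℂ)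
    (x : Fin 2 → ℝ) : potential (truncate A w) x = planeC x + w 0 * starRingEnd ℂ (planeC x) +
      ∑ n ∈ A, (symZb n)⁻¹ * w n * expChar n x := by
  rw [potential, fsum, tsum_eq_sum (s := A) fun n hn => by simp [truncate, hn]]
  congr 1
  · simp [truncate, hA]
  · exact Finset.sum_congr rfl fun n hn => by simp [truncate, hn]

theorem exists_small_tail {g : (Fin 2 → ℤ) → ℝ} (hg : Summable g) {ε : ℝ} (hε : 0 < ε) :
    ∃ A : Finset (Fin 2 → ℤ), 0 ∈ A ∧ ∃ d : (Fin 2 → ℤ) → ℝ, ∃ ε', HasSum d ε' ∧ ε' ≤ ε ∧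
      ∀ n, d n = open Classical in if n ∈ A then 0 else g n := by
  classical
  have h1 := (hg.hasSum.eventually (Metric.ball_mem_nhds _ hε))
  obtain ⟨A, h2, h3⟩ := (h1.and (Filter.eventually_ge_atTop ({0} : Finset (Fin 2 → ℤ)))).exists
  refine ⟨A, h3 (by simp), fun n => if n ∈ A then 0 else g n, ∑' n, g n - ∑ n ∈ A, g n, ?_, ?_,
    fun n => by congr⟩
  · have h4 : HasSum (fun n => if n ∈ A then g n else 0) (∑ n ∈ A, g n) := by
      have : HasSum (fun n => if n ∈ A then g n else 0) (∑ n ∈ A, if n ∈ A then g n else 0) :=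
        hasSum_sum_of_ne_finset_zero fun n hn => by simp [hn]
      convert! this using 1
      exact Finset.sum_congr rfl fun n hn => by simp [hn]
    convert! hg.hasSum.sub h4 using 1
    ext n; split_ifs <;> simp
  · have h5 : |∑ n ∈ A, g n - ∑' n, g n| < ε := by
      simpa [Real.dist_eq] using h2
    have := neg_abs_le (∑ n ∈ A, g n - ∑' n, g n)
    linarith

/-- A finite sum of characters with coefficients analytic in t is smooth in position and time
together. The periods move with the zero mode, and `normalize` brings them back to 1 and i; at t = 1
no correction is left because `w 1 0 = 0`. -/
theorem exists_isotopy_truncate {w : ℂ → (Fin 2 → ℤ) → ℂ} {A : Finset (Fin 2 → ℤ)} (hA : 0 ∈ A)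
    (han : ∀ n t, ‖t‖ ≤ 1 → AnalyticAt ℂ (fun t => w t n) t) (hw0 : ∀ n, w 0 n = 0)
    (hj : ∀ t : ℝ, 0 ≤ t → t ≤ 1 → ∀ x, 0 < jac (potential (truncate A (w t))) x)
    (hw1 : w 1 0 = 0) : Isotopic planeC (potential (truncate A (w 1))) := by
  let τ := Real.smoothTransition
  have ht : ∀ s, ‖((τ s : ℝ) : ℂ)‖ ≤ 1 := fun s => by
    rw [Complex.norm_real, Real.norm_of_nonneg (Real.smoothTransition.nonneg s)]
    exact Real.smoothTransition.le_one s
  have hwA : ∀ t, truncate A (w t) 0 = w t 0 := fun t => by simp [truncate, hA]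
  have hP : ∀ t, ContDiff ℝ 2 (potential (truncate A (w t))) := fun t =>
    contDiff_potential (k := 2) (MomentSummable.truncate A)
  have e0 : ∀ t x, potential (truncate A (w t)) (x + e 0) =
      potential (truncate A (w t)) x + (1 + w t 0) := fun t x => by
    rw [(potential_add_e _ x).1, hwA]
  have e1 : ∀ t x, potential (truncate A (w t)) (x + e 1) =
      potential (truncate A (w t)) x + Complex.I * (1 - w t 0) := fun t x => by
    rw [(potential_add_e _ x).2, hwA]
  have hb : ∀ s, ‖w (τ s : ℝ) 0‖ ^ 2 < 1 := fun s =>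
    norm_lt_one_of_jac_pos (hP _) (e0 _) (e1 _)
      (hj _ (Real.smoothTransition.nonneg s) (Real.smoothTransition.le_one s))
  have hs : ∀ n, ContDiff ℝ ∞ fun p : (Fin 2 → ℝ) × ℝ => w (τ p.2 : ℝ) n := fun n => by
    have h1 : ContDiff ℝ ∞ fun s : ℝ => w (τ s : ℝ) n := contDiff_iff_contDiffAt.2 fun s => by
      have h2 : ContDiffAt ℝ ∞ (fun t => w t n) ((τ s : ℝ) : ℂ) :=
        ((han n _ (ht s)).contDiffAt (n := ∞)).restrict_scalars ℝ
      exact h2.comp s (Complex.ofRealCLM.contDiff.comp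
        Real.smoothTransition.contDiff).contDiffAt
    exact h1.comp contDiff_snd
  refine ⟨fun x s => normalize (w (τ s : ℝ) 0) (potential (truncate A (w (τ s : ℝ)))) x, ?_,
    fun s => normalize_equivariant (hb s) (e0 _) (e1 _),
    fun s x => jac_normalize_pos (hb s) ((hP _).differentiable (by simp) x)
      (hj _ (Real.smoothTransition.nonneg s) (Real.smoothTransition.le_one s) x),
    fun s hs x => ?_, fun s hs x => ?_⟩
  · have hz : ContDiff ℝ ∞ fun p : (Fin 2 → ℝ) × ℝ => planeC p.1 := contDiff_planeC.comp contDiff_fst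
    have hcj : ∀ {F : (Fin 2 → ℝ) × ℝ → ℂ}, ContDiff ℝ ∞ F →
        ContDiff ℝ ∞ fun p => starRingEnd ℂ (F p) := fun hF =>
      (Complex.conjCLE : ℂ →L[ℝ] ℂ).contDiff.comp hF
    have hp : ContDiff ℝ ∞ fun p : (Fin 2 → ℝ) × ℝ =>
        potential (truncate A (w (τ p.2 : ℝ))) p.1 := by
      simp only [potential_truncate A hA]
      refine (hz.add ((hs 0).mul (hcj hz))).add (ContDiff.sum fun n _ => ?_)
      exact (contDiff_const.mul (hs n)).mul ((contDiff_expChar n).comp contDiff_fst)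
    exact ((contDiff_const.sub ((hs 0).mul (hcj (hs 0)))).inv
      fun p => (one_sub_mul_conj (hb p.2)).2).mul (hp.add ((hs 0).neg.mul (hcj hp)))
  · have : τ s = 0 := Real.smoothTransition.zero_of_nonpos hs
    simp only [normalize, potential_truncate A hA, this, Complex.ofReal_zero, hw0]
    simp
  · have : τ s = 1 := Real.smoothTransition.one_of_one_le hs
    simp only [normalize, this, Complex.ofReal_one, hw1]
    simp

theorem exists_lt_one_of_norm_lt_one {μ : (Fin 2 → ℝ) → ℂ} (hμ : Continuous μ)
    (hp : ∀ x i, μ (x + e i) = μ x) (h : ∀ x, ‖μ x‖ < 1) : ∃ k < 1, ∀ x, ‖μ x‖ ≤ k := by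
  obtain ⟨C, hC⟩ := exists_norm_le_of_periodic (u := fun x => (1 - ‖μ x‖)⁻¹)
    ((continuous_const.sub hμ.norm).inv₀ fun x => (by linarith [h x] : (0 : ℝ) < 1 - ‖μ x‖).ne')
    fun x i => by simp [hp]
  have hpos : ∀ x, 0 < 1 - ‖μ x‖ := fun x => by linarith [h x]
  have hC' : ∀ x, (1 - ‖μ x‖)⁻¹ ≤ C := fun x => (le_abs_self _).trans (hC x)
  have hC0 : 0 < C := (inv_pos.2 (hpos 0)).trans_le (hC' 0)
  refine ⟨1 - C⁻¹, by linarith [inv_pos.2 hC0], fun x => ?_⟩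
  have := inv_anti₀ (inv_pos.2 (hpos x)) (hC' x)
  rw [inv_inv] at this
  linarith

theorem continuousOn_fsum_prod {w : ℂ → (Fin 2 → ℤ) → ℂ} {g : (Fin 2 → ℤ) → ℝ} (hg : Summable g)
    (hw : ∀ t, ‖t‖ ≤ 1 → ∀ n, ‖w t n‖ ≤ g n)
    (hc : ∀ n t, ‖t‖ ≤ 1 → ContinuousAt (fun t => w t n) t) :
    ContinuousOn (fun p : ℝ × (Fin 2 → ℝ) => fsum (w p.1) p.2) (Set.Icc 0 1 ×ˢ Set.univ) := by
  have ht : ∀ p : ℝ × (Fin 2 → ℝ), p ∈ Set.Icc (0 : ℝ) 1 ×ˢ (Set.univ : Set (Fin 2 → ℝ)) →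
      ‖(p.1 : ℂ)‖ ≤ 1 := fun p hp => by
    rw [Complex.norm_real, Real.norm_of_nonneg hp.1.1]; exact hp.1.2
  refine continuousOn_tsum (fun n p hp => ?_) hg fun n p hp => ?_
  · have h1 : ContinuousAt (fun p : ℝ × (Fin 2 → ℝ) => w (p.1 : ℂ) n) p :=
      ContinuousAt.comp (g := fun t => w t n) (hc n _ (ht p hp)) (by fun_prop)
    exact (h1.mul ((contDiff_expChar n).continuous.comp continuous_snd).continuousAt
      ).continuousWithinAt
  · rw [norm_mul, norm_expChar, mul_one]; exact hw _ (ht p hp) n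

theorem dz_add_const (F : (Fin 2 → ℝ) → ℂ) (c : ℂ) (x : Fin 2 → ℝ) :
    dz (fun y => F y + c) x = dz F x ∧ dzb (fun y => F y + c) x = dzb F x := by
  simp only [dz, dzb, pd, fderiv_add_const]; simp

/-- Two solutions of the same Beltrami equation whose translations differ by `b`, `-ib` differ by
a constant. -/
theorem sub_eq_const_of_beltrami {F G μ : (Fin 2 → ℝ) → ℂ} (hF : ContDiff ℝ 2 F)
    (hG : ContDiff ℝ 2 G) (hμ : ∀ x, ‖μ x‖ < 1) (bF : ∀ x, dzb F x = μ x * dz F x)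
    (bG : ∀ x, dzb G x = μ x * dz G x) {b : ℂ} (F0 : ∀ x, F (x + e 0) = F x + (1 + b))
    (F1 : ∀ x, F (x + e 1) = F x + Complex.I * (1 - b)) (eG : LatticeEquivariant G) :
    b = 0 ∧ ∃ c, ∀ x, F x = G x + c := by
  have dF : Differentiable ℝ F := hF.differentiable (by simp)
  have dG : Differentiable ℝ G := hG.differentiable (by simp)
  let D : (Fin 2 → ℝ) → ℂ := fun x => F x + (-1) * G x
  have hD : ContDiff ℝ 2 D := hF.add (contDiff_const.mul hG)
  have D0 : ∀ x, D (x + e 0) = D x + b := fun x => by simp only [D, F0, (eG x).1]; ring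
  have D1 : ∀ x, D (x + e 1) = D x + -(Complex.I * b) := fun x => by
    simp only [D, F1, (eG x).2]; ring
  have bD : ∀ x, dzb D x = μ x * dz D x := fun x => by
    simp only [D]
    rw [dz_add (dF x) ((dG x).const_mul _), dzb_add (dF x) ((dG x).const_mul _),
      dz_const_mul (dG x), dzb_const_mul (dG x), bF, bG]
    ring
  have hi := cellInt_jac hD D0 D1
  -- `D` solves the same Beltrami equation, so its Jacobian is non-negative. Its periods b and −ib
  -- give it the mean −|b|², so b = 0.
  have hn : 0 ≤ cellInt (jac D) := cellInt_nonneg fun x => by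
    rw [jac_eq_dz, bD, norm_mul]
    have h1 := (hμ x).le
    have := mul_le_of_le_one_left (norm_nonneg (dz D x)) h1
    nlinarith [norm_nonneg (dz D x), norm_nonneg (μ x),
      mul_nonneg (norm_nonneg (μ x)) (norm_nonneg (dz D x))]
  have he : (starRingEnd ℂ b * -(Complex.I * b)).im = -‖b‖ ^ 2 := by
    rw [Complex.sq_norm, Complex.normSq_apply]; simp
  rw [hi, he] at hn
  have hb : b = 0 := by
    have : ‖b‖ ^ 2 = 0 := le_antisymm (by linarith) (sq_nonneg _)
    simpa using this
  refine ⟨hb, D 0, fun x => ?_⟩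
  have hp : ∀ x i, D (x + e i) = D x := fun x i => by
    fin_cases i
    · simpa [hb] using D0 x
    · simpa [hb] using D1 x
  have := eq_const_of_beltrami hD hp hμ bD x 0
  rw [← this]; simp only [D]; ring

/-- An equivariant orientation preserving immersion of the plane is isotopic to the identity. -/
theorem exists_isotopy {Φ : (Fin 2 → ℝ) → ℂ} (hΦ : ContDiff ℝ ∞ Φ) (eΦ : LatticeEquivariant Φ)
    (hj : ∀ x, 0 < jac Φ x) : Isotopic planeC Φ := by
  have pΦ : ∀ x i, dz Φ (x + e i) = dz Φ x ∧ dzb Φ (x + e i) = dzb Φ x := fun x i => by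
    fin_cases i
    · exact ⟨dz_add_period (fun x => (eΦ x).1) x, dzb_add_period (fun x => (eΦ x).1) x⟩
    · exact ⟨dz_add_period (fun x => (eΦ x).2) x, dzb_add_period (fun x => (eΦ x).2) x⟩
  have hz0 : ∀ x, dz Φ x ≠ 0 := fun x h => by
    have := hj x
    rw [jac_eq_dz, h, norm_zero] at this
    nlinarith [sq_nonneg ‖dzb Φ x‖]
  -- Positivity of the Jacobian says |∂̄Φ| < |∂Φ|. By compactness of the torus |μ| is then bounded
  -- by some k < 1.
  let μ : (Fin 2 → ℝ) → ℂ := fun x => dzb Φ x / dz Φ x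
  have hμ : ContDiff ℝ ∞ μ := by
    simp only [μ, div_eq_mul_inv]
    exact (contDiff_dzb hΦ).mul ((contDiff_dz hΦ).inv hz0)
  have pμ : ∀ x i, μ (x + e i) = μ x := fun x i => by simp only [μ, (pΦ x i).1, (pΦ x i).2]
  have bΦ : ∀ x, dzb Φ x = μ x * dz Φ x := fun x => (div_mul_cancel₀ _ (hz0 x)).symm
  have hμ1 : ∀ x, ‖μ x‖ < 1 := fun x => by
    have := hj x
    rw [jac_eq_dz, sub_pos] at this
    rw [norm_div, div_lt_one (norm_pos_iff.2 (hz0 x))]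
    exact lt_of_pow_lt_pow_left₀ 2 (norm_nonneg _) this
  obtain ⟨k, hk, hμk⟩ := exists_lt_one_of_norm_lt_one hμ.continuous pμ hμ1
  obtain ⟨w, ⟨C, hC⟩, han, hw0, hw⟩ := exists_beltrami_path hμ pμ hk hμk
  have hm : ∀ t, ‖t‖ ≤ 1 → MomentSummable 2 (w t) := fun t ht => momentSummable_of_decay (hC t ht)
  have hwb : ∀ t, ‖t‖ ≤ 1 → ∀ n, ‖w t n‖ ≤ C * decay n := fun t ht => norm_le_of_moment (hC t ht)
  have hbb : ∀ t, ‖t‖ ≤ 1 → ∀ n, ‖beurling n * w t n‖ ≤ C * decay n := fun t ht n => by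
    rw [norm_mul]
    exact (mul_le_of_le_one_left (norm_nonneg _) (norm_beurling_le n)).trans (hwb t ht n)
  have hg : Summable fun n => C * decay n := summable_decay.mul_left C
  have hdz : ∀ t, ‖t‖ ≤ 1 → ∀ x, dz (potential (w t)) x = 1 + fsum (fun n => beurling n * w t n) x ∧
      dzb (potential (w t)) x = fsum (w t) x := fun t ht x =>
    dz_potential ((hm t ht).mono (by norm_num)) x
  have hreal : ∀ t : ℝ, 0 ≤ t → t ≤ 1 → ‖(t : ℂ)‖ ≤ 1 := fun t h0 h1 => by
    rw [Complex.norm_real, Real.norm_of_nonneg h0]; exact h1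
  -- a uniform lower bound of the Jacobian along the path
  obtain ⟨c, hc0, hc⟩ : ∃ c > 0, ∀ t : ℝ, 0 ≤ t → t ≤ 1 → ∀ x,
      c ≤ jac (potential (w t)) x := by
    let J : ℝ × (Fin 2 → ℝ) → ℝ := fun p => ‖1 + fsum (fun n => beurling n * w p.1 n) p.2‖ ^ 2 -
      ‖fsum (w p.1) p.2‖ ^ 2
    have hJc : ContinuousOn J (Set.Icc 0 1 ×ˢ Set.univ) :=
      ((continuousOn_const.add (continuousOn_fsum_prod (w := fun t n => beurling n * w t n) hg hbb
        fun n t ht => continuousAt_const.mul (han n t ht).continuousAt)).norm.pow 2).sub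
        ((continuousOn_fsum_prod hg hwb fun n t ht => (han n t ht).continuousAt).norm.pow 2)
    have hJ : ∀ t : ℝ, 0 ≤ t → t ≤ 1 → ∀ x, J (t, x) = jac (potential (w t)) x :=
      fun t h0 h1 x => by
        rw [jac_eq_dz, (hdz t (hreal t h0 h1) x).1, (hdz t (hreal t h0 h1) x).2]
    have hJ0 : ∀ t : ℝ, 0 ≤ t → t ≤ 1 → ∀ x, 0 < J (t, x) := fun t h0 h1 x => by
      have ht := hreal t h0 h1
      have h2 := (hw t ht x).2
      simp only [J]
      rw [(hw t ht x).1, norm_mul, mul_pow]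
      have h3 : 0 < ‖1 + fsum (fun n => beurling n * w t n) x‖ := norm_pos_iff.2 h2
      have h4 : ‖(t : ℂ) * μ x‖ < 1 := by
        rw [norm_mul]
        exact (mul_le_of_le_one_left (norm_nonneg _) ht).trans_lt (hμ1 x)
      have h5 : ‖(t : ℂ) * μ x‖ ^ 2 < 1 := by nlinarith [norm_nonneg ((t : ℂ) * μ x)]
      have : 0 < (1 - ‖(t : ℂ) * μ x‖ ^ 2) * ‖1 + fsum (fun n => beurling n * w t n) x‖ ^ 2 :=
        mul_pos (by linarith) (by positivity)
      linarith
    -- By periodicity a minimum over times in [0, 1] and points of the closed unit square bounds the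
    -- Jacobian everywhere.
    have hK : IsCompact (Set.Icc (0 : ℝ) 1 ×ˢ Set.Icc (0 : Fin 2 → ℝ) 1) :=
      isCompact_Icc.prod isCompact_Icc
    obtain ⟨p, hp, hmin⟩ := hK.exists_isMinOn ⟨(0, 0), by simp⟩
      (hJc.mono (Set.prod_mono le_rfl (Set.subset_univ _)))
    refine ⟨J p, hJ0 p.1 hp.1.1 hp.1.2 p.2, fun t h0 h1 x => ?_⟩
    have hper : ∀ y i, J (t, y + e i) = J (t, y) := fun y i => by simp only [J, fsum_add_e]
    rw [← hJ t h0 h1, show J (t, x) = J (t, ![Int.fract (x 0), Int.fract (x 1)]) from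
      (apply_fract (u := fun y => J (t, y)) hper x).symm]
    refine hmin ⟨⟨h0, h1⟩, ?_, ?_⟩ <;> intro i <;> fin_cases i <;>
      simp [Int.fract_nonneg, (Int.fract_lt_one _).le]
  let M := 1 + ∑' n, C * decay n
  have hM1 : ∀ t, ‖t‖ ≤ 1 → ∀ x, ‖dz (potential (w t)) x‖ ≤ M := fun t ht x => by
    rw [(hdz t ht x).1]
    refine (norm_add_le _ _).trans ?_
    rw [norm_one]
    have := tsum_of_norm_bounded (f := fun n => beurling n * w t n * expChar n x) hg.hasSum
      fun n => by rw [norm_mul, norm_expChar, mul_one]; exact hbb t ht n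
    exact add_le_add le_rfl this
  have hM2 : ∀ t, ‖t‖ ≤ 1 → ∀ x, ‖dzb (potential (w t)) x‖ ≤ M := fun t ht x => by
    rw [(hdz t ht x).2]
    have := tsum_of_norm_bounded (f := fun n => w t n * expChar n x) hg.hasSum
      fun n => by rw [norm_mul, norm_expChar, mul_one]; exact hwb t ht n
    exact this.trans (by simp only [M]; linarith)
  have hM0 : 0 ≤ M := (norm_nonneg _).trans (hM2 0 (by simp) 0)
  obtain ⟨ε, hε0, hε⟩ : ∃ ε > 0, 4 * M * ε + ε ^ 2 < c := by
    have h1 : Filter.Tendsto (fun ε : ℝ => 4 * M * ε + ε ^ 2) (𝓝[>] 0) (𝓝 0) := by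
      have : Continuous fun ε : ℝ => 4 * M * ε + ε ^ 2 := by fun_prop
      simpa using (this.tendsto 0).mono_left nhdsWithin_le_nhds
    obtain ⟨ε, h2, h3⟩ := ((h1.eventually (gt_mem_nhds hc0)).and self_mem_nhdsWithin).exists
    exact ⟨ε, h3, h2⟩
  -- The majorant C · `decay` does not depend on t, so one finite set of modes approximates the
  -- whole path within ε. It contains 0, so truncation does not change the periods.
  obtain ⟨A, hA0, d, ε', hd, hε', hdA⟩ := exists_small_tail hg hε0
  have hclose : ∀ t, ‖t‖ ≤ 1 → ∀ x,
      ‖dz (potential (truncate A (w t))) x - dz (potential (w t)) x‖ ≤ ε ∧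
      ‖dzb (potential (truncate A (w t))) x - dzb (potential (w t)) x‖ ≤ ε := fun t ht x => by
    have hs1 := MomentSummable.truncate (k := 1) (w := w t) A
    obtain ⟨q1, q2⟩ := dz_potential hs1 x
    have hsub : ∀ n, ‖truncate A (w t) n - w t n‖ ≤ d n := fun n => by
      rw [hdA, truncate]; split_ifs
      · simp
      · simpa using hwb t ht n
    rw [q1, q2, (hdz t ht x).1, (hdz t ht x).2, add_sub_add_left_eq_sub]
    constructor
    · refine (norm_fsum_sub_le (hs1.mul_of_le norm_beurling_le).summable_norm
        ((hm t ht).mul_of_le norm_beurling_le).summable_norm hd (fun n => ?_) x).trans hε'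
      rw [← mul_sub, norm_mul]
      exact (mul_le_of_le_one_left (norm_nonneg _) (norm_beurling_le n)).trans (hsub n)
    · exact (norm_fsum_sub_le hs1.summable_norm (hm t ht).summable_norm hd hsub x).trans hε'
  have hjA : ∀ t : ℝ, 0 ≤ t → t ≤ 1 → ∀ x, 0 < jac (potential (truncate A (w t))) x :=
    fun t h0 h1 x => by
      have ht := hreal t h0 h1
      rw [jac_eq_dz]
      exact norm_sq_sub_pos_of_close (hM1 t ht x) (hM2 t ht x)
        (by rw [← jac_eq_dz]; exact hc t h0 h1 x) (hclose t ht x).1 (hclose t ht x).2 hε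
  have h1 : ‖(1 : ℂ)‖ ≤ 1 := by simp
  have hP1 : ContDiff ℝ 2 (potential (w 1)) := contDiff_potential (k := 2) (hm 1 h1)
  -- At t = 1 the potential has the same Beltrami coefficient as Φ. Uniqueness shows that its zero
  -- mode vanishes and that the two maps differ by a translation.
  obtain ⟨hb, c', hc'⟩ := sub_eq_const_of_beltrami hP1 (contDiff_infty.1 hΦ 2) hμ1
    (fun x => by rw [(hdz 1 h1 x).1, (hdz 1 h1 x).2, (hw 1 h1 x).1, one_mul]) bΦ
    (fun x => (potential_add_e _ x).1) (fun x => (potential_add_e _ x).2) eΦ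
  have hPΦ : potential (w 1) = fun x => Φ x + c' := funext hc'
  have hdΦ : ∀ x, dz (potential (w 1)) x = dz Φ x ∧ dzb (potential (w 1)) x = dzb Φ x := fun x => by
    rw [hPΦ]; exact dz_add_const Φ c' x
  have hiso := exists_isotopy_truncate hA0 han hw0 hjA hb
  -- The last piece joins the truncated potential at t = 1 to Φ itself. The translation by `c'` does
  -- not affect derivatives, so the earlier estimates apply to Φ.
  refine hiso.trans (isotopic_of_close (M := M) (c := c) (ε := ε) ?_ hΦ (fun x => ?_) eΦ
    (fun x => ?_) (fun x => ?_) (fun x => ?_) (fun x => ?_) (fun x => ?_) hε)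
  · exact contDiff_infty.2 fun k => contDiff_potential (MomentSummable.truncate A)
  · have : truncate A (w 1) 0 = 0 := by simp [truncate, hb]
    rw [(potential_add_e _ x).1, (potential_add_e _ x).2, this]; simp
  · rw [← (hdΦ x).1]; exact hM1 1 h1 x
  · rw [← (hdΦ x).2]; exact hM2 1 h1 x
  · have := hc 1 zero_le_one le_rfl x
    rw [jac_eq_dz, Complex.ofReal_one, (hdΦ x).1, (hdΦ x).2] at this
    rw [jac_eq_dz]; exact this
  · rw [← (hdΦ x).1]; exact (hclose 1 h1 x).1
  · rw [← (hdΦ x).2]; exact (hclose 1 h1 x).2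

/-! ### Connection and scalar curvature in an orthonormal coframe. -/

/-- Entrywise partial derivative of a matrix valued function. -/
def matD {n : ℕ} (i : Fin n) (θ : MetricField n) : MetricField n :=
  fun x => Matrix.of fun a b => pd i (fun y => θ y a b) x

@[simp] theorem matD_apply {n : ℕ} (i : Fin n) (θ : MetricField n) (x : Fin n → ℝ) (a b : Fin n) :
    matD i θ x a b = pd i (fun y => θ y a b) x := rfl

/-- A matrix valued function with smooth entries. -/
def MatSmoothOn {n : ℕ} (U : Set (Fin n → ℝ)) (θ : MetricField n) : Prop :=
  ∀ a b, ContDiffOn ℝ ∞ (fun y => θ y a b) U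

theorem _root_.ContDiffOn.pd {n : ℕ} {E : Type*} [NormedAddCommGroup E] [NormedSpace ℝ E]
    {U : Set (Fin n → ℝ)} (hU : IsOpen U) {F : (Fin n → ℝ) → E} (hF : ContDiffOn ℝ ∞ F U)
    (i : Fin n) : ContDiffOn ℝ ∞ (pd i F) U :=
  (hF.fderiv_of_isOpen hU (by simp)).clm_apply contDiffOn_const

section MatSmoothOn

variable {n : ℕ} {U : Set (Fin n → ℝ)} {θ φ : MetricField n}

theorem MatSmoothOn.differentiableAt (h : MatSmoothOn U θ) (hU : IsOpen U) {x : Fin n → ℝ}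
    (hx : x ∈ U) (a b : Fin n) : DifferentiableAt ℝ (fun y => θ y a b) x :=
  ((h a b).contDiffAt (hU.mem_nhds hx)).differentiableAt (by simp)

theorem MatSmoothOn.mul (h : MatSmoothOn U θ) (h' : MatSmoothOn U φ) :
    MatSmoothOn U fun x => θ x * φ x := fun a b => by
  simp only [Matrix.mul_apply]
  exact ContDiffOn.sum fun c _ => (h a c).mul (h' c b)

theorem MatSmoothOn.add (h : MatSmoothOn U θ) (h' : MatSmoothOn U φ) :
    MatSmoothOn U fun x => θ x + φ x := fun a b => (h a b).add (h' a b)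

theorem MatSmoothOn.matD (h : MatSmoothOn U θ) (hU : IsOpen U) (i : Fin n) :
    MatSmoothOn U (matD i θ) := fun a b => (h a b).pd hU i

theorem MatSmoothOn.det (h : MatSmoothOn U θ) : ContDiffOn ℝ ∞ (fun x => (θ x).det) U := by
  simp only [Matrix.det_apply]
  exact ContDiffOn.sum fun σ _ => (contDiffOn_prod fun c _ => h (σ c) c).const_smul _

theorem MatSmoothOn.inv (h : MatSmoothOn U θ) (hd : ∀ x ∈ U, (θ x).det ≠ 0) :
    MatSmoothOn U fun x => (θ x)⁻¹ := fun a b => by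
  have : ∀ x, (θ x)⁻¹ a b = (θ x).det⁻¹ * ((θ x).updateRow b (Pi.single a 1)).det := fun x => by
    rw [Matrix.inv_def, Ring.inverse_eq_inv', Matrix.smul_apply, Matrix.adjugate_apply]; rfl
  simp only [this]
  refine (h.det.inv hd).mul (MatSmoothOn.det (θ := fun x => (θ x).updateRow b (Pi.single a 1))
    fun c d => ?_)
  by_cases hc : c = b
  · subst hc; simp only [Matrix.updateRow_self]; exact contDiffOn_const
  · simp only [Matrix.updateRow_ne hc]; exact h c d

theorem pd_congr {E : Type*} [NormedAddCommGroup E] [NormedSpace ℝ E] (hU : IsOpen U)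
    {F G : (Fin n → ℝ) → E} (h : Set.EqOn F G U) {x : Fin n → ℝ} (hx : x ∈ U) (i : Fin n) :
    pd i F x = pd i G x := by
  rw [pd, pd, (Filter.eventuallyEq_of_mem (hU.mem_nhds hx) h).fderiv_eq]

theorem matD_congr (hU : IsOpen U) (h : ∀ x ∈ U, θ x = φ x) {x : Fin n → ℝ} (hx : x ∈ U)
    (i : Fin n) : matD i θ x = matD i φ x := by
  ext a b; exact pd_congr hU (fun y hy => by simp only [h y hy]) hx i

theorem pd_sum {E ι : Type*} [NormedAddCommGroup E] [NormedSpace ℝ E] {F : ι → (Fin n → ℝ) → E}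
    (s : Finset ι) {x : Fin n → ℝ} (h : ∀ c ∈ s, DifferentiableAt ℝ (F c) x) (i : Fin n) :
    pd i (fun y => ∑ c ∈ s, F c y) x = ∑ c ∈ s, pd i (F c) x := by
  rw [pd, fderiv_fun_sum h, sum_apply]; rfl

theorem matD_mul (hU : IsOpen U) (h : MatSmoothOn U θ) (h' : MatSmoothOn U φ) {x : Fin n → ℝ}
    (hx : x ∈ U) (i : Fin n) :
    matD i (fun y => θ y * φ y) x = matD i θ x * φ x + θ x * matD i φ x := by
  ext a b
  simp only [matD_apply, Matrix.add_apply, Matrix.mul_apply]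
  rw [pd_sum (F := fun c y => θ y a c * φ y c b) _ fun c _ =>
    (h.differentiableAt hU hx a c).mul (h'.differentiableAt hU hx c b), ← Finset.sum_add_distrib]
  refine Finset.sum_congr rfl fun c _ => ?_
  rw [pd_mul_real (h.differentiableAt hU hx a c) (h'.differentiableAt hU hx c b), add_comm]

theorem matD_add (hU : IsOpen U) (h : MatSmoothOn U θ) (h' : MatSmoothOn U φ) {x : Fin n → ℝ}
    (hx : x ∈ U) (i : Fin n) : matD i (fun y => θ y + φ y) x = matD i θ x + matD i φ x := by
  ext a b
  exact pd_add (h.differentiableAt hU hx a b) (h'.differentiableAt hU hx a b) i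

theorem pd_comm_of_contDiffOn {E : Type*} [NormedAddCommGroup E] [NormedSpace ℝ E] (hU : IsOpen U)
    {F : (Fin n → ℝ) → E} (hF : ContDiffOn ℝ ∞ F U) {x : Fin n → ℝ} (hx : x ∈ U) (i j : Fin n) :
    pd i (pd j F) x = pd j (pd i F) x := by
  have hF' := hF.contDiffAt (hU.mem_nhds hx)
  have hs : IsSymmSndFDerivAt ℝ F x := (contDiffAt_infty.1 hF' 2).isSymmSndFDerivAt (by simp)
  have hd : DifferentiableAt ℝ (fderiv ℝ F) x :=
    ((hF.fderiv_of_isOpen (m := ∞) hU (by simp)).contDiffAt (hU.mem_nhds hx)).differentiableAt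
      (by simp)
  have key : ∀ i j, pd i (pd j F) x = fderiv ℝ (fderiv ℝ F) x (e i) (e j) := fun i j => by
    have := (hd.hasFDerivAt.clm_apply (hasFDerivAt_const (e j) x)).fderiv
    unfold pd
    rw [this]; simp
  rw [key, key, hs.eq]

theorem matD_comm (hU : IsOpen U) (h : MatSmoothOn U θ) {x : Fin n → ℝ} (hx : x ∈ U)
    (i j : Fin n) : matD i (matD j θ) x = matD j (matD i θ) x := by
  ext a b; exact pd_comm_of_contDiffOn hU (h a b) hx i j

theorem partialD_eq_pd {S : Set (Fin n → ℝ)} {x : Fin n → ℝ} (hS : S ∈ 𝓝 x)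
    (F : (Fin n → ℝ) → ℝ) (i : Fin n) : partialD S F i x = pd i F x := by
  rw [partialD, fderivWithin_of_mem_nhds hS]; rfl

/-- The Levi-Civita connection in an orthonormal coframe `θ` with connection forms `ϖ`. -/
theorem christoffel_of_frame {S : Set (Fin n → ℝ)} (hU : IsOpen U) (hUS : U ⊆ S)
    {g : MetricField n} (hθ : MatSmoothOn U θ) (hg : ∀ x ∈ U, g x = (θ x).transpose * θ x)
    (hdet : ∀ x ∈ U, (θ x).det ≠ 0) {ϖ : Fin n → MetricField n}
    (hskew : ∀ i, ∀ x ∈ U, (ϖ i x).transpose = -ϖ i x)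
    (htors : ∀ x ∈ U, ∀ i j a, (matD i θ x + ϖ i x * θ x) a j = (matD j θ x + ϖ j x * θ x) a i)
    {x : Fin n → ℝ} (hx : x ∈ U) (k i j : Fin n) :
    christoffel S g k i j x = ((θ x)⁻¹ * (matD i θ x + ϖ i x * θ x)) k j := by
  have hS : S ∈ 𝓝 x := Filter.mem_of_superset (hU.mem_nhds hx) hUS
  have hunit : IsUnit (θ x).det := isUnit_iff_ne_zero.2 (hdet x hx)
  -- `T i l j` is the Christoffel symbol with lowered index l. Vanishing torsion makes it symmetric
  -- in i and j, and skewness of the connection form gives ∂ᵢg = T i + (T i)ᵀ, so the Koszul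
  -- combination collapses to 2 `T i l j`.
  let T : Fin n → Matrix (Fin n) (Fin n) ℝ := fun i =>
    (θ x).transpose * (matD i θ x + ϖ i x * θ x)
  have hTs : ∀ i j l, T i l j = T j l i := fun i j l => by
    simp only [T, Matrix.mul_apply]
    exact Finset.sum_congr rfl fun a _ => by rw [htors x hx i j a]
  have hD : ∀ i j l, partialD S (fun y => g y j l) i x = T i j l + T i l j := fun i j l => by
    rw [partialD_eq_pd hS]
    have h1 : matD i g x = matD i (fun y => (θ y).transpose * θ y) x := matD_congr hU hg hx i
    have h2 := matD_mul (θ := fun y => (θ y).transpose) hU (fun a b => hθ b a) hθ hx i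
    have h3 : matD i (fun y => (θ y).transpose) x = (matD i θ x).transpose := rfl
    have h4 : matD i g x = T i + (T i).transpose := by
      rw [h1, h2, h3]
      simp only [T, Matrix.transpose_mul, Matrix.transpose_add, Matrix.transpose_transpose,
        hskew i x hx, Matrix.mul_add, Matrix.mul_neg, Matrix.neg_mul,
        Matrix.mul_assoc]
      abel
    have := congrFun (congrFun h4 j) l
    simpa using this
  have hsum : ∀ l, partialD S (fun y => g y j l) i x + partialD S (fun y => g y i l) j x
      - partialD S (fun y => g y i j) l x = 2 * T i l j := fun l => by
    rw [hD, hD, hD, hTs l j i, hTs l i j, hTs j i l]; ring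
  have hinv : (g x)⁻¹ * T i = (θ x)⁻¹ * (matD i θ x + ϖ i x * θ x) := by
    rw [hg x hx, Matrix.mul_inv_rev, Matrix.mul_assoc]
    simp only [T]
    rw [← Matrix.mul_assoc ((θ x).transpose⁻¹), Matrix.nonsing_inv_mul _
      (by rwa [Matrix.det_transpose]), Matrix.one_mul]
  rw [← hinv, christoffel, Matrix.mul_apply, Finset.mul_sum]
  refine Finset.sum_congr rfl fun l _ => ?_
  rw [hsum]; ring

/-- The curvature form of the connection form `ϖ`. -/
def curvatureForm (ϖ : Fin n → MetricField n) (i j : Fin n) (x : Fin n → ℝ) :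
    Matrix (Fin n) (Fin n) ℝ :=
  matD i (ϖ j) x - matD j (ϖ i) x + (ϖ i x * ϖ j x - ϖ j x * ϖ i x)

/-- The scalar curvature in terms of an orthonormal coframe and its curvature form. -/
theorem scalarCurvature_of_frame {S : Set (Fin n → ℝ)} (hU : IsOpen U) (hUS : U ⊆ S)
    {g : MetricField n} (hθ : MatSmoothOn U θ) (hg : ∀ x ∈ U, g x = (θ x).transpose * θ x)
    (hdet : ∀ x ∈ U, (θ x).det ≠ 0) {ϖ : Fin n → MetricField n} (hϖ : ∀ i, MatSmoothOn U (ϖ i))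
    (hskew : ∀ i, ∀ x ∈ U, (ϖ i x).transpose = -ϖ i x)
    (htors : ∀ x ∈ U, ∀ i j a, (matD i θ x + ϖ i x * θ x) a j = (matD j θ x + ϖ j x * θ x) a i)
    {x : Fin n → ℝ} (hx : x ∈ U) :
    scalarCurvature S g x =
      ∑ i, ∑ j, ((θ x)⁻¹ * curvatureForm ϖ i j x * (θ x)⁻¹.transpose) i j := by
  have hS : S ∈ 𝓝 x := Filter.mem_of_superset (hU.mem_nhds hx) hUS
  have hunit : ∀ y ∈ U, IsUnit (θ y).det := fun y hy => isUnit_iff_ne_zero.2 (hdet y hy)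
  let B : Fin n → MetricField n := fun i y => matD i θ y + ϖ i y * θ y
  let A : Fin n → MetricField n := fun i y => (θ y)⁻¹ * B i y
  have hB : ∀ i, MatSmoothOn U (B i) := fun i => (hθ.matD hU i).add ((hϖ i).mul hθ)
  have hA : ∀ i, MatSmoothOn U (A i) := fun i => (hθ.inv hdet).mul (hB i)
  have hΓ : ∀ y ∈ U, ∀ k i j, christoffel S g k i j y = A i y k j := fun y hy k i j =>
    christoffel_of_frame hU hUS hθ hg hdet hskew htors hy k i j
  have hθA : ∀ i, ∀ y ∈ U, θ y * A i y = B i y := fun i y hy => by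
    simp only [A]; rw [← Matrix.mul_assoc, Matrix.mul_nonsing_inv _ (hunit y hy), Matrix.one_mul]
  -- the derivative of `θ A = B`
  have hder : ∀ i j, θ x * matD j (A i) x = matD j (matD i θ) x + matD j (ϖ i) x * θ x +
      ϖ i x * matD j θ x - matD j θ x * A i x := fun i j => by
    have h1 := matD_mul hU hθ (hA i) hx j
    rw [matD_congr hU (hθA i) hx j] at h1
    have h2 : matD j (B i) x = matD j (matD i θ) x + (matD j (ϖ i) x * θ x + ϖ i x * matD j θ x) := by
      rw [← matD_mul hU (hϖ i) hθ hx j]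
      exact matD_add hU (hθ.matD hU i) ((hϖ i).mul hθ) hx j
    rw [h2] at h1
    rw [eq_sub_iff_add_eq, add_comm, ← h1]; abel
  have hpd : ∀ i, matD i θ x = θ x * A i x - ϖ i x * θ x := fun i => by
    rw [hθA i x hx]; simp only [B]; abel
  -- The Christoffel matrices `A` are the gauge transform θ⁻¹∂θ + θ⁻¹ϖθ of the connection form, so
  -- the two curvatures are conjugate by θ.
  have hR : ∀ i j, matD i (A j) x - matD j (A i) x + (A i x * A j x - A j x * A i x) =
      (θ x)⁻¹ * curvatureForm ϖ i j x * θ x := fun i j => by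
    have h : θ x * (matD i (A j) x - matD j (A i) x + (A i x * A j x - A j x * A i x)) =
        curvatureForm ϖ i j x * θ x := by
      rw [Matrix.mul_add, Matrix.mul_sub, hder, hder, matD_comm hU hθ hx j i, hpd i, hpd j,
        curvatureForm]
      noncomm_ring
    rw [Matrix.mul_assoc (θ x)⁻¹ (curvatureForm ϖ i j x), ← h, ← Matrix.mul_assoc (θ x)⁻¹ (θ x),
      Matrix.nonsing_inv_mul _ (hunit x hx),
      Matrix.one_mul]
  have hric : ∀ j k, ricci S g j k x =
      ∑ i, ((θ x)⁻¹ * curvatureForm ϖ i j x * θ x) i k := fun j k => by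
    refine Finset.sum_congr rfl fun i _ => ?_
    rw [← hR i j, partialD_eq_pd hS, partialD_eq_pd hS,
      pd_congr hU (fun y hy => hΓ y hy i j k) hx i, pd_congr hU (fun y hy => hΓ y hy i i k) hx j]
    simp only [hΓ x hx, Matrix.add_apply, Matrix.sub_apply, matD_apply, Matrix.mul_apply,
      Finset.sum_sub_distrib]
  have hgi : θ x * (g x)⁻¹ = (θ x)⁻¹.transpose := by
    rw [hg x hx, Matrix.mul_inv_rev, ← Matrix.mul_assoc, Matrix.mul_nonsing_inv _ (hunit x hx),
      Matrix.one_mul, Matrix.transpose_nonsing_inv]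
  have hgs : ∀ j k, (g x)⁻¹ j k = (g x)⁻¹ k j := fun j k => by
    have : (g x)⁻¹.transpose = (g x)⁻¹ := by
      rw [Matrix.transpose_nonsing_inv, hg x hx]; simp [Matrix.transpose_mul]
    exact congrFun (congrFun this k) j
  have : ∀ i j, ((θ x)⁻¹ * curvatureForm ϖ i j x * (θ x)⁻¹.transpose) i j =
      ∑ k, (g x)⁻¹ j k * ((θ x)⁻¹ * curvatureForm ϖ i j x * θ x) i k := fun i j => by
    rw [← hgi, ← Matrix.mul_assoc, Matrix.mul_apply]
    exact Finset.sum_congr rfl fun k _ => by rw [hgs j k]; ring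
  simp only [this, scalarCurvature, hric, Finset.mul_sum]
  conv_rhs => rw [Finset.sum_comm]
  exact Finset.sum_congr rfl fun j _ => Finset.sum_comm

end MatSmoothOn

/-! ### Scalar curvature of doubly warped products. -/

section Warped

variable {U : Set (Fin 3 → ℝ)} {c : Fin 3 → (Fin 3 → ℝ) → ℝ} {f k : ℝ → ℝ}

/-- The Jacobian matrix of the functions `c`. -/
def jacMatrix {n : ℕ} (c : Fin n → (Fin n → ℝ) → ℝ) : MetricField n :=
  fun x => Matrix.of fun a j => pd j (c a) x

/-- The coframe `dc₀, f(c₀) dc₁, k(c₀) dc₂`. -/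
def warpedFrame (c : Fin 3 → (Fin 3 → ℝ) → ℝ) (f k : ℝ → ℝ) : MetricField 3 :=
  fun x => Matrix.diagonal ![1, f (c 0 x), k (c 0 x)] * jacMatrix c x

/-- The connection form of `warpedFrame`. -/
def warpedForm (c : Fin 3 → (Fin 3 → ℝ) → ℝ) (f k : ℝ → ℝ) (i : Fin 3) : MetricField 3 :=
  fun x => !![0, -(deriv f (c 0 x) * pd i (c 1) x), -(deriv k (c 0 x) * pd i (c 2) x);
    deriv f (c 0 x) * pd i (c 1) x, 0, 0; deriv k (c 0 x) * pd i (c 2) x, 0, 0]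

theorem pd_const {n : ℕ} (i : Fin n) (a : ℝ) (x : Fin n → ℝ) : pd i (fun _ => a) x = 0 := by
  simp [pd]

theorem pd_comp_real {n : ℕ} {φ : ℝ → ℝ} {u : (Fin n → ℝ) → ℝ} {x : Fin n → ℝ}
    (hφ : Differentiable ℝ φ) (hu : DifferentiableAt ℝ u x) (i : Fin n) :
    pd i (fun y => φ (u y)) x = deriv φ (u x) * pd i u x := by
  have := ((hφ (u x)).hasDerivAt.comp_hasFDerivAt x hu.hasFDerivAt).fderiv
  rw [pd]; refine (congrArg (fun L => L (e i)) this).trans ?_; simp [pd]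

theorem warped_metric {U : Set (Fin 3 → ℝ)} {g : MetricField 3}
    (hg : ∀ x ∈ U, ∀ i j, g x i j = pd i (c 0) x * pd j (c 0) x +
      f (c 0 x) ^ 2 * (pd i (c 1) x * pd j (c 1) x) +
      k (c 0 x) ^ 2 * (pd i (c 2) x * pd j (c 2) x)) {x : Fin 3 → ℝ} (hx : x ∈ U) :
    g x = (warpedFrame c f k x).transpose * warpedFrame c f k x := by
  ext i j
  rw [hg x hx, Matrix.mul_apply, Fin.sum_univ_three]
  simp [warpedFrame, Matrix.diagonal_mul, jacMatrix]
  ring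

theorem det_warpedFrame (c : Fin 3 → (Fin 3 → ℝ) → ℝ) (f k : ℝ → ℝ) (x : Fin 3 → ℝ) :
    (warpedFrame c f k x).det = f (c 0 x) * k (c 0 x) * (jacMatrix c x).det := by
  rw [warpedFrame, Matrix.det_mul, Matrix.det_diagonal, Fin.prod_univ_three]; simp

/-- The sectional curvatures of the coframe planes are −f''/f, −k''/k and −f'k'/(fk), and the scalar
curvature is twice their sum. The functions `c` are needed only locally, so the formula also applies
to metrics twisted by an isotopy. -/
theorem scalarCurvature_warped {S : Set (Fin 3 → ℝ)} (hU : IsOpen U) (hUS : U ⊆ S)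
    {g : MetricField 3} (hc : ∀ a, ContDiffOn ℝ ∞ (c a) U) (hf : ContDiff ℝ ∞ f)
    (hk : ContDiff ℝ ∞ k) (hf0 : ∀ x ∈ U, f (c 0 x) ≠ 0) (hk0 : ∀ x ∈ U, k (c 0 x) ≠ 0)
    (hdet : ∀ x ∈ U, (jacMatrix c x).det ≠ 0)
    (hg : ∀ x ∈ U, ∀ i j, g x i j = pd i (c 0) x * pd j (c 0) x +
      f (c 0 x) ^ 2 * (pd i (c 1) x * pd j (c 1) x) +
      k (c 0 x) ^ 2 * (pd i (c 2) x * pd j (c 2) x)) {x : Fin 3 → ℝ} (hx : x ∈ U) :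
    scalarCurvature S g x = -2 * (deriv (deriv f) (c 0 x) / f (c 0 x) +
      deriv (deriv k) (c 0 x) / k (c 0 x) +
      deriv f (c 0 x) * deriv k (c 0 x) / (f (c 0 x) * k (c 0 x))) := by
  have hdf : ContDiff ℝ ∞ (deriv f) := ((contDiff_infty_iff_deriv).1 hf).2
  have hdk : ContDiff ℝ ∞ (deriv k) := ((contDiff_infty_iff_deriv).1 hk).2
  have hP : ∀ a i, ContDiffOn ℝ ∞ (pd i (c a)) U := fun a i => (hc a).pd hU i
  have dP : ∀ a i, ∀ y ∈ U, DifferentiableAt ℝ (pd i (c a)) y := fun a i y hy =>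
    ((hP a i).contDiffAt (hU.mem_nhds hy)).differentiableAt (by simp)
  have dc : ∀ y ∈ U, DifferentiableAt ℝ (c 0) y := fun y hy =>
    ((hc 0).contDiffAt (hU.mem_nhds hy)).differentiableAt (by simp)
  have hθ : MatSmoothOn U (warpedFrame c f k) := fun a j => by
    simp only [warpedFrame, Matrix.diagonal_mul, jacMatrix, Matrix.of_apply]
    refine ContDiffOn.mul ?_ (hP a j)
    fin_cases a
    · exact contDiffOn_const
    · exact hf.comp_contDiffOn (hc 0)
    · exact hk.comp_contDiffOn (hc 0)
  have hϖ : ∀ i, MatSmoothOn U (warpedForm c f k i) := fun i a b => by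
    have h1 : ContDiffOn ℝ ∞ (fun y => deriv f (c 0 y) * pd i (c 1) y) U :=
      (hdf.comp_contDiffOn (hc 0)).mul (hP 1 i)
    have h2 : ContDiffOn ℝ ∞ (fun y => deriv k (c 0 y) * pd i (c 2) y) U :=
      (hdk.comp_contDiffOn (hc 0)).mul (hP 2 i)
    fin_cases a <;> fin_cases b <;>
      first
      | exact contDiffOn_const
      | exact h1
      | exact h2
      | exact h1.neg
      | exact h2.neg
  have pmul : ∀ (φ : ℝ → ℝ), ContDiff ℝ ∞ φ → ∀ a j, ∀ y ∈ U, ∀ i,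
      pd i (fun z => φ (c 0 z) * pd j (c a) z) y =
        φ (c 0 y) * pd i (pd j (c a)) y + deriv φ (c 0 y) * pd i (c 0) y * pd j (c a) y :=
    fun φ hφ a j y hy i => by
      have hφ' : Differentiable ℝ φ := hφ.differentiable (by simp)
      rw [pd_mul_real (F := fun z => φ (c 0 z)) ((hφ' _).comp y (dc y hy)) (dP a j y hy),
        pd_comp_real hφ' (dc y hy)]
  have pcomm : ∀ a, ∀ y ∈ U, ∀ i j, pd i (pd j (c a)) y = pd j (pd i (c a)) y :=
    fun a y hy i j => pd_comm_of_contDiffOn hU (hc a) hy i j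
  have hdet' : ∀ y ∈ U, (warpedFrame c f k y).det ≠ 0 := fun y hy => by
    rw [det_warpedFrame]
    exact mul_ne_zero (mul_ne_zero (hf0 y hy) (hk0 y hy)) (hdet y hy)
  have hskew : ∀ i, ∀ y ∈ U, (warpedForm c f k i y).transpose = -warpedForm c f k i y :=
    fun i y _ => by
      ext a b
      fin_cases a <;> fin_cases b <;> simp [warpedForm]
  have htors : ∀ y ∈ U, ∀ i j a,
      (matD i (warpedFrame c f k) y + warpedForm c f k i y * warpedFrame c f k y) a j =
      (matD j (warpedFrame c f k) y + warpedForm c f k j y * warpedFrame c f k y) a i :=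
    fun y hy i j a => by
      simp only [Matrix.add_apply, Matrix.mul_apply, Fin.sum_univ_three, matD_apply, warpedFrame,
        jacMatrix, Matrix.of_apply, warpedForm]
      fin_cases a
      · simp [pcomm 0 y hy i j]; ring
      · simp [pmul f hf 1 _ y hy, pcomm 1 y hy i j]; ring
      · simp [pmul k hk 2 _ y hy, pcomm 2 y hy i j]; ring
  rw [scalarCurvature_of_frame hU hUS hθ (fun y hy => warped_metric hg hy) hdet' hϖ hskew htors hx]
  set l : Fin 3 → ℝ := ![1, f (c 0 x), k (c 0 x)] with hl
  set P := jacMatrix c x with hPdef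
  -- The entry (a, b) of the curvature form is κ_ab dc_a ∧ dc_b. The second derivatives of the
  -- coordinates cancel by symmetry.
  let κ : Matrix (Fin 3) (Fin 3) ℝ := !![0, -deriv (deriv f) (c 0 x), -deriv (deriv k) (c 0 x);
    -deriv (deriv f) (c 0 x), 0, -(deriv f (c 0 x) * deriv k (c 0 x));
    -deriv (deriv k) (c 0 x), -(deriv f (c 0 x) * deriv k (c 0 x)), 0]
  have hcurv : ∀ i j a b, curvatureForm (warpedForm c f k) i j x a b =
      κ a b * (P a i * P b j - P a j * P b i) := fun i j a b => by
    simp only [curvatureForm, Matrix.add_apply, Matrix.sub_apply, Matrix.mul_apply,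
      Fin.sum_univ_three, matD_apply, hPdef, jacMatrix, Matrix.of_apply, warpedForm, κ]
    fin_cases a <;> fin_cases b <;>
      simp [pmul _ hdf 1 _ x hx, pmul _ hdk 2 _ x hx, pcomm 1 x hx i j, pcomm 2 x hx i j,
        pd_const, pd_neg] <;> ring
  have hl0 : ∀ a, l a ≠ 0 := fun a => by
    fin_cases a
    · simp [hl]
    · exact hf0 x hx
    · exact hk0 x hx
  have hinv : ∀ i a, (warpedFrame c f k x)⁻¹ i a = P⁻¹ i a / l a := fun i a => by
    have : (Matrix.diagonal l)⁻¹ = Matrix.diagonal fun a => (l a)⁻¹ :=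
      Matrix.inv_eq_right_inv (by
        rw [Matrix.diagonal_mul_diagonal, ← Matrix.diagonal_one]
        congr 1; ext a; exact mul_inv_cancel₀ (hl0 a))
    rw [warpedFrame, Matrix.mul_inv_rev, this, Matrix.mul_diagonal, div_eq_mul_inv]
  have hPQ : ∀ a b, ∑ j, P a j * P⁻¹ j b = if a = b then 1 else 0 := fun a b => by
    rw [← Matrix.mul_apply, Matrix.mul_nonsing_inv _ (isUnit_iff_ne_zero.2 (hdet x hx)),
      Matrix.one_apply]
  -- In the trace the Jacobian matrix of the coordinates meets only its own inverse, so the choice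
  -- of coordinates drops out.
  have hsum : ∑ i, ∑ j, ((warpedFrame c f k x)⁻¹ * curvatureForm (warpedForm c f k) i j x *
      (warpedFrame c f k x)⁻¹.transpose) i j =
      ∑ a, ∑ b, κ a b / (l a * l b) * ((∑ i, P a i * P⁻¹ i a) * (∑ j, P b j * P⁻¹ j b) -
        (∑ j, P a j * P⁻¹ j b) * (∑ i, P b i * P⁻¹ i a)) := by
    simp only [Matrix.mul_apply, Matrix.transpose_apply, hcurv, hinv, Fin.sum_univ_three]
    have := hl0 0
    have := hl0 1
    have := hl0 2
    field_simp
    ring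
  rw [hsum]
  simp only [hPQ, Fin.sum_univ_three]
  have h1 := hf0 x hx
  have h2 := hk0 x hx
  simp [κ, hl]
  field_simp
  ring

end Warped

/-! ### Developing maps and holonomy of flat tori. -/

/-- Poincaré lemma in the plane. -/
theorem exists_primitive {E : Type*} [NormedAddCommGroup E] [NormedSpace ℝ E] [CompleteSpace E]
    {F : Fin 2 → (Fin 2 → ℝ) → E} (hF : ∀ i, ContDiff ℝ ∞ (F i))
    (hc : ∀ x, pd 0 (F 1) x = pd 1 (F 0) x) :
    ∃ P : (Fin 2 → ℝ) → E, ContDiff ℝ ∞ P ∧ ∀ i x, pd i P x = F i x := by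
  let pr : Fin 2 → (Fin 2 → ℝ) →L[ℝ] ℝ := fun i => ContinuousLinearMap.proj i
  let η : (Fin 2 → ℝ) → (Fin 2 → ℝ) →L[ℝ] E := fun x =>
    (pr 0).smulRight (F 0 x) + (pr 1).smulRight (F 1 x)
  have hη : ContDiff ℝ ∞ η := (contDiff_const.smulRight (hF 0)).add (contDiff_const.smulRight (hF 1))
  have hd : ∀ i x, HasFDerivAt (F i) (fderiv ℝ (F i) x) x := fun i x =>
    ((hF i).differentiable (by simp) x).hasFDerivAt
  have hη' : ∀ x v w, fderiv ℝ η x v w = w 0 • fderiv ℝ (F 0) x v + w 1 • fderiv ℝ (F 1) x v :=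
    fun x v w => by
      have h1 : HasFDerivAt (fun y => η y w)
          (w 0 • fderiv ℝ (F 0) x + w 1 • fderiv ℝ (F 1) x) x := by
        have := ((hd 0 x).const_smul (w 0)).add ((hd 1 x).const_smul (w 1))
        exact this
      have h2 := (hη.differentiable (by simp) x).hasFDerivAt.clm_apply (hasFDerivAt_const w x)
      have h3 := congrArg (fun L => L v) (h1.unique h2)
      simpa using h3.symm
  have hF2 : ∀ i x v, fderiv ℝ (F i) x v = v 0 • pd 0 (F i) x + v 1 • pd 1 (F i) x :=
    fun i x v => by
      have : v = v 0 • e 0 + v 1 • e 1 := by ext j; fin_cases j <;> simp [e]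
      conv_lhs => rw [this]
      rw [map_add, map_smul, map_smul]; rfl
  obtain ⟨P, hP⟩ := convex_univ.exists_forall_hasFDerivAt_of_fderiv_symmetric isOpen_univ
    (hη.differentiable (by simp)).differentiableOn fun x _ v w => by
      rw [hη', hη', hF2, hF2, hF2, hF2, hc x]
      simp only [smul_add, smul_smul]
      rw [mul_comm (w 0) (v 0), mul_comm (w 1) (v 1), mul_comm (w 0), mul_comm (w 1)]
      abel
  have hPd : fderiv ℝ P = η := funext fun x => (hP x trivial).fderiv
  refine ⟨P, contDiff_infty_iff_fderiv.2 ⟨fun x => (hP x trivial).differentiableAt, by rwa [hPd]⟩,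
    fun i x => ?_⟩
  rw [pd, hPd]
  fin_cases i <;> simp [η, pr, e]

theorem eq_zero_of_real_relation {a b : ℝ} {P Q : ℂ} (h : 0 < (starRingEnd ℂ P * Q).im)
    (hab : (a : ℂ) * Q = b * P) : a = 0 ∧ b = 0 := by
  have h1 := congrArg Complex.re hab
  have h2 := congrArg Complex.im hab
  simp at h h1 h2
  constructor
  · have : a * (P.re * Q.im - P.im * Q.re) = 0 := by linear_combination P.re * h2 - P.im * h1
    rcases mul_eq_zero.1 this with h3 | h3
    · exact h3
    · linarith
  · have : b * (P.re * Q.im - P.im * Q.re) = 0 := by linear_combination Q.re * h2 - Q.im * h1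
    rcases mul_eq_zero.1 this with h3 | h3
    · exact h3
    · linarith

/-- Differentiating ρρ̄ = 1 shows that ∂ρ · ρ̄ is purely imaginary. -/
theorem pd_unimodular {n : ℕ} {U : Set (Fin n → ℝ)} (hU : IsOpen U) {ρ : (Fin n → ℝ) → ℂ}
    (hρ : ∀ x ∈ U, ‖ρ x‖ = 1) {x : Fin n → ℝ} (hx : x ∈ U) (hd : DifferentiableAt ℝ ρ x)
    (j : Fin n) : ∃ a : ℝ, pd j ρ x = Complex.I * a * ρ x := by
  have hc : DifferentiableAt ℝ (fun y => starRingEnd ℂ (ρ y)) x :=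
    (Complex.conjCLE : ℂ →L[ℝ] ℂ).differentiableAt.comp x hd
  have h1 : ∀ y ∈ U, ρ y * starRingEnd ℂ (ρ y) = 1 := fun y hy => by
    rw [Complex.mul_conj, Complex.normSq_eq_norm_sq, hρ y hy]; simp
  have h2 : pd j (fun y => ρ y * starRingEnd ℂ (ρ y)) x = 0 := by
    rw [pd_congr hU (G := fun _ => (1 : ℂ)) h1 hx]; simp [pd]
  rw [pd_mul_complex hd hc, pd_conj hd] at h2
  refine ⟨(pd j ρ x * starRingEnd ℂ (ρ x)).im, ?_⟩
  have h3 : (pd j ρ x * starRingEnd ℂ (ρ x)).re = 0 := by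
    have := congrArg Complex.re h2
    simp at this ⊢; linarith
  have h4 : Complex.I * ((pd j ρ x * starRingEnd ℂ (ρ x)).im : ℂ) = pd j ρ x * starRingEnd ℂ (ρ x) := by
    apply Complex.ext <;> simp only [Complex.mul_re, Complex.mul_im, Complex.I_re, Complex.I_im,
      Complex.ofReal_re, Complex.ofReal_im, zero_mul, one_mul, mul_zero, sub_zero, zero_add]
    rw [← Complex.mul_re]; simp [h3]
  rw [h4, mul_assoc, mul_comm (starRingEnd ℂ _), h1 x hx, mul_one]

/-- Two oriented coframes of the plane with the same Gram matrix differ by a rotation. -/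
theorem rotation_of_gram_eq {p q P Q : ℂ} (h0 : ‖p‖ ^ 2 = ‖P‖ ^ 2) (h1 : ‖q‖ ^ 2 = ‖Q‖ ^ 2)
    (hr : (starRingEnd ℂ p * q).re = (starRingEnd ℂ P * Q).re) (hi : 0 < (starRingEnd ℂ p * q).im)
    (hI : 0 < (starRingEnd ℂ P * Q).im) : ‖p / P‖ = 1 ∧ p = p / P * P ∧ q = p / P * Q := by
  have hP : P ≠ 0 := fun h => by simp [h] at hI
  have hp : p ≠ 0 := fun h => by simp [h] at hi
  have hn : ‖p‖ = ‖P‖ := by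
    have := congrArg Real.sqrt h0
    rwa [Real.sqrt_sq (norm_nonneg _), Real.sqrt_sq (norm_nonneg _)] at this
  -- The products have the same modulus and real part, so their imaginary parts agree up to sign;
  -- the orientations fix the sign.
  have him : (starRingEnd ℂ p * q).im = (starRingEnd ℂ P * Q).im := by
    have e1 : (starRingEnd ℂ p * q).im ^ 2 = (starRingEnd ℂ P * Q).im ^ 2 := by
      have i1 : ‖starRingEnd ℂ p * q‖ ^ 2 = ‖starRingEnd ℂ P * Q‖ ^ 2 := by
        rw [norm_mul, norm_mul, mul_pow, mul_pow, RCLike.norm_conj, RCLike.norm_conj, h0, h1]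
      rw [Complex.sq_norm, Complex.sq_norm, Complex.normSq_apply, Complex.normSq_apply, hr] at i1
      nlinarith
    rcases sq_eq_sq_iff_eq_or_eq_neg.1 e1 with h | h
    · exact h
    · linarith
  have hpq : starRingEnd ℂ p * q = starRingEnd ℂ P * Q := Complex.ext hr him
  have hpp : starRingEnd ℂ p * p = starRingEnd ℂ P * P := by
    rw [mul_comm, Complex.mul_conj, mul_comm, Complex.mul_conj, Complex.normSq_eq_norm_sq,
      Complex.normSq_eq_norm_sq, hn]
  refine ⟨by rw [norm_div, hn, div_self (norm_ne_zero_iff.2 hP)], (div_mul_cancel₀ _ hP).symm, ?_⟩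
  have hcp : starRingEnd ℂ p ≠ 0 := by simpa using hp
  have : starRingEnd ℂ p * (q * P) = starRingEnd ℂ p * (p * Q) := by
    linear_combination P * hpq - Q * hpp
  have := mul_left_cancel₀ hcp this
  field_simp
  exact this

/-- If a map and a coframe induce the same metric, then the rotation `ρ` between them satisfies
`dρ = i a ρ` for a real form `a` determined by the coframe. -/
theorem exists_rotation_form {U : Set (Fin 2 → ℝ)} (hU : IsOpen U) {F : (Fin 2 → ℝ) → ℂ}
    {E : Fin 2 → (Fin 2 → ℝ) → ℂ} (hF : ContDiffOn ℝ ∞ F U) (hE : ∀ i, ContDiffOn ℝ ∞ (E i) U)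
    (hg : ∀ x ∈ U, ∀ i j, (starRingEnd ℂ (pd i F x) * pd j F x).re =
      (starRingEnd ℂ (E i x) * E j x).re)
    (hj : ∀ x ∈ U, 0 < jac F x) (hJ : ∀ x ∈ U, 0 < (starRingEnd ℂ (E 0 x) * E 1 x).im) :
    ∃ ρ : (Fin 2 → ℝ) → ℂ, ContDiffOn ℝ ∞ ρ U ∧ (∀ x ∈ U, ‖ρ x‖ = 1) ∧
      (∀ x ∈ U, ∀ j, pd j F x = ρ x * E j x) ∧ ∀ x ∈ U, ∃ a : Fin 2 → ℝ,
        (∀ j, pd j ρ x = Complex.I * a j * ρ x) ∧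
        Complex.I * a 0 * E 1 x + pd 0 (E 1) x = Complex.I * a 1 * E 0 x + pd 1 (E 0) x := by
  have hsq : ∀ z : ℂ, (starRingEnd ℂ z * z).re = ‖z‖ ^ 2 := fun z => by
    rw [mul_comm, Complex.mul_conj, Complex.normSq_eq_norm_sq, Complex.ofReal_re]
  have hE0 : ∀ x ∈ U, E 0 x ≠ 0 := fun x hx h => by have := hJ x hx; simp [h] at this
  have hrot : ∀ x ∈ U, ‖pd 0 F x / E 0 x‖ = 1 ∧ pd 0 F x = pd 0 F x / E 0 x * E 0 x ∧
      pd 1 F x = pd 0 F x / E 0 x * E 1 x := fun x hx =>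
    rotation_of_gram_eq (by have := hg x hx 0 0; rwa [hsq, hsq] at this)
      (by have := hg x hx 1 1; rwa [hsq, hsq] at this) (hg x hx 0 1) (hj x hx) (hJ x hx)
  have hpF := fun j => hF.pd hU j
  have hρ : ContDiffOn ℝ ∞ (fun x => pd 0 F x / E 0 x) U := by
    simp only [div_eq_mul_inv]
    exact (hpF 0).mul ((hE 0).inv hE0)
  have hdiff : ∀ {G : (Fin 2 → ℝ) → ℂ}, ContDiffOn ℝ ∞ G U → ∀ x ∈ U, DifferentiableAt ℝ G x :=
    fun hG x hx => (hG.contDiffAt (hU.mem_nhds hx)).differentiableAt (by simp)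
  have hd : ∀ x ∈ U, ∀ j, pd j F x = pd 0 F x / E 0 x * E j x := fun x hx j => by
    fin_cases j
    · exact (hrot x hx).2.1
    · exact (hrot x hx).2.2
  refine ⟨fun x => pd 0 F x / E 0 x, hρ, fun x hx => (hrot x hx).1, hd, fun x hx => ?_⟩
  choose a ha using fun j =>
    pd_unimodular hU (fun x hx => (hrot x hx).1) hx (hdiff hρ x hx) j
  refine ⟨a, ha, ?_⟩
  -- The relation sought is d(ρE) = ddF = 0, written out and divided by ρ.
  have hc := pd_comm_of_contDiffOn hU hF hx 0 1
  rw [pd_congr hU (fun y hy => hd y hy 1) hx, pd_congr hU (fun y hy => hd y hy 0) hx,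
    pd_mul_complex (F := fun x => pd 0 F x / E 0 x) (hdiff hρ x hx) (hdiff (hE 1) x hx),
    pd_mul_complex (F := fun x => pd 0 F x / E 0 x) (hdiff hρ x hx) (hdiff (hE 0) x hx),
    ha, ha] at hc
  have hρ0 : pd 0 F x / E 0 x ≠ 0 := norm_ne_zero_iff.1 (by rw [(hrot x hx).1]; exact one_ne_zero)
  apply mul_left_cancel₀ hρ0
  linear_combination hc

theorem eq_of_pd_eq_zero {F : (Fin 2 → ℝ) → ℂ} (hF : Differentiable ℝ F)
    (h : ∀ j x, pd j F x = 0) (x y : Fin 2 → ℝ) : F x = F y :=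
  is_const_of_fderiv_eq_zero hF (fun x => by
    ext v; rw [fderiv_eq_pd, h, h]; simp) x y

/-- The Gram matrix of the partial derivatives of a complex valued map. -/
def gram (F : Fin 2 → ℂ) : Matrix (Fin 2) (Fin 2) ℝ :=
  Matrix.of fun i j => (starRingEnd ℂ (F i) * F j).re

theorem gram_mul {u : ℂ} (hu : ‖u‖ = 1) (F : Fin 2 → ℂ) : gram (fun i => u * F i) = gram F := by
  ext i j
  have : starRingEnd ℂ u * u = 1 := by
    rw [mul_comm, Complex.mul_conj, Complex.normSq_eq_norm_sq, hu]; simp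
  simp only [gram, Matrix.of_apply, map_mul]
  congr 1
  linear_combination starRingEnd ℂ (F i) * F j * this

/-- The rotation between the two differentials satisfies dρ = iaρ with a real. Symmetry of the
second derivatives of `D` gives a₀ ∂₁D = a₁ ∂₀D, so a = 0 by linear independence and ρ is constant.
-/
theorem exists_rigid_motion {D D' : (Fin 2 → ℝ) → ℂ} (hD : ContDiff ℝ ∞ D)
    (hD' : ContDiff ℝ ∞ D') (hg : ∀ x, gram (fun i => pd i D' x) = gram fun i => pd i D x)
    (hj : ∀ x, 0 < jac D x) (hj' : ∀ x, 0 < jac D' x) :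
    ∃ u v : ℂ, ‖u‖ = 1 ∧ ∀ x, D' x = u * D x + v := by
  have hE : ∀ i, ContDiff ℝ ∞ (pd i D) := fun i => ContDiff.pd hD (by simp) i
  obtain ⟨ρ, hρ, hn, hd, ha⟩ := exists_rotation_form (E := fun i => pd i D) isOpen_univ
    hD'.contDiffOn (fun i => (hE i).contDiffOn)
    (fun x _ i j => congrFun (congrFun (hg x) i) j) (fun x _ => hj' x) (fun x _ => hj x)
  have hρd : Differentiable ℝ ρ := (contDiffOn_univ.1 hρ).differentiable (by simp)
  have hp : ∀ j x, pd j ρ x = 0 := fun j x => by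
    obtain ⟨a, h1, h2⟩ := ha x trivial
    have h3 : (a 0 : ℂ) * pd 1 D x = a 1 * pd 0 D x := by
      rw [pd_comm (contDiff_infty.1 hD 2) 0 1 x] at h2
      apply mul_left_cancel₀ Complex.I_ne_zero
      linear_combination h2
    obtain ⟨a0, a1⟩ := eq_zero_of_real_relation (hj x) h3
    rw [h1]
    fin_cases j
    · simp [a0]
    · simp [a1]
  have hc := eq_of_pd_eq_zero hρd hp
  have dD : Differentiable ℝ D := hD.differentiable (by simp)
  have dD' : Differentiable ℝ D' := hD'.differentiable (by simp)
  refine ⟨ρ 0, D' 0 + -ρ 0 * D 0, hn 0 trivial, fun x => ?_⟩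
  have := eq_of_pd_eq_zero (F := fun y => D' y + -ρ 0 * D y) (dD'.add (dD.const_mul _))
    (fun j y => by
      rw [pd_add (dD' y) ((dD y).const_mul _), pd_const_mul (dD y), hd y trivial j, hc y 0]; ring) x 0
  linear_combination this

/-- The developing map of a flat metric given by a global orthonormal coframe. -/
theorem exists_developing_map {E : Fin 2 → (Fin 2 → ℝ) → ℂ} (hE : ∀ i, ContDiff ℝ ∞ (E i))
    {r : (Fin 2 → ℝ) → ℝ} (hr : ∀ x, E 0 x = r x) (hr0 : ∀ x, 0 < r x)
    (hE1 : ∀ x, 0 < (E 1 x).im)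
    (hloc : ∀ x, ∃ U : Set (Fin 2 → ℝ), IsOpen U ∧ x ∈ U ∧ ∃ F : (Fin 2 → ℝ) → ℂ,
      ContDiffOn ℝ ∞ F U ∧ (∀ y ∈ U, gram (fun i => pd i F y) = gram fun i => E i y) ∧
      ∀ y ∈ U, 0 < jac F y) :
    ∃ D : (Fin 2 → ℝ) → ℂ, ContDiff ℝ ∞ D ∧ (∀ x, gram (fun i => pd i D x) = gram fun i => E i x) ∧
      ∀ x, 0 < jac D x := by
  have hrs : ContDiff ℝ ∞ r := by
    have : r = fun x => (E 0 x).re := by ext x; rw [hr]; simp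
    rw [this]; exact Complex.reCLM.contDiff.comp (hE 0)
  have hJ : ∀ x, 0 < (starRingEnd ℂ (E 0 x) * E 1 x).im := fun x => by
    rw [hr, Complex.conj_ofReal, Complex.im_ofReal_mul]; exact mul_pos (hr0 x) (hE1 x)
  have hpE : ∀ i j, ContDiff ℝ ∞ (pd j (E i)) := fun i j => ContDiff.pd (hE i) (by simp) j
  let c : (Fin 2 → ℝ) → ℂ := fun x => pd 0 (E 1) x - pd 1 (E 0) x
  have hc : ContDiff ℝ ∞ c := (hpE 1 0).sub (hpE 0 1)
  -- The structure equation c = i w₁ r − i w₀ E₁ is solved for real w. Because E₀ = r is real, the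
  -- real part determines w₀, and the imaginary part then gives w₁.
  let w0 : (Fin 2 → ℝ) → ℝ := fun x => (c x).re * ((E 1 x).im)⁻¹
  let w1 : (Fin 2 → ℝ) → ℝ := fun x => ((c x).im + w0 x * (E 1 x).re) * (r x)⁻¹
  let w : Fin 2 → (Fin 2 → ℝ) → ℝ := ![w0, w1]
  have hre : ∀ {G : (Fin 2 → ℝ) → ℂ}, ContDiff ℝ ∞ G → ContDiff ℝ ∞ fun x => (G x).re := fun hG =>
    Complex.reCLM.contDiff.comp hG
  have him : ∀ {G : (Fin 2 → ℝ) → ℂ}, ContDiff ℝ ∞ G → ContDiff ℝ ∞ fun x => (G x).im := fun hG =>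
    Complex.imCLM.contDiff.comp hG
  have hw0 : ContDiff ℝ ∞ w0 := (hre hc).mul ((him (hE 1)).inv fun x => (hE1 x).ne')
  have hw1 : ContDiff ℝ ∞ w1 := ((him hc).add (hw0.mul (hre (hE 1)))).mul
    (hrs.inv fun x => (hr0 x).ne')
  have hw : ∀ i, ContDiff ℝ ∞ (w i) := fun i => by
    fin_cases i
    · exact hw0
    · exact hw1
  have hwC : ∀ i, ContDiff ℝ ∞ fun x => ((w i x : ℝ) : ℂ) := fun i =>
    Complex.ofRealCLM.contDiff.comp (hw i)
  -- the connection form is determined by the coframe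
  have huniq : ∀ x (a : Fin 2 → ℝ), Complex.I * a 0 * E 1 x + pd 0 (E 1) x =
      Complex.I * a 1 * E 0 x + pd 1 (E 0) x → ∀ j, a j = w j x := fun x a h => by
    have hcx : c x = Complex.I * a 1 * r x - Complex.I * a 0 * E 1 x := by
      simp only [c]; rw [hr] at h; linear_combination h
    have h0 : a 0 = w0 x := by
      have : (c x).re = a 0 * (E 1 x).im := by rw [hcx]; simp
      simp only [w0]; rw [this, mul_assoc, mul_inv_cancel₀ (hE1 x).ne', mul_one]
    have h1 : a 1 = w1 x := by
      have : (c x).im = a 1 * r x - a 0 * (E 1 x).re := by rw [hcx]; simp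
      simp only [w1]; rw [this, ← h0, sub_add_cancel, mul_assoc, mul_inv_cancel₀ (hr0 x).ne', mul_one]
    intro j
    fin_cases j
    · exact h0
    · exact h1
  -- Here flatness enters. Locally dF = ρE for an isometric map F, uniqueness gives dρ = i w ρ, and
  -- symmetry of the second derivatives of ρ shows that w is closed.
  have hrel : ∀ x, (Complex.I * w 0 x * E 1 x + pd 0 (E 1) x =
      Complex.I * w 1 x * E 0 x + pd 1 (E 0) x) ∧ pd 0 (w 1) x = pd 1 (w 0) x := fun x => by
    obtain ⟨U, hU, hx, F, hF, hg, hj⟩ := hloc x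
    obtain ⟨ρ, hρ, hn, -, ha⟩ := exists_rotation_form hU hF (fun i => (hE i).contDiffOn)
      (fun y hy i j => congrFun (congrFun (hg y hy) i) j) hj (fun y _ => hJ y)
    have hpρ : ∀ y ∈ U, ∀ j, pd j ρ y = Complex.I * w j y * ρ y := fun y hy j => by
      obtain ⟨a, h1, h2⟩ := ha y hy
      rw [h1, huniq y a h2]
    constructor
    · obtain ⟨a, h1, h2⟩ := ha x hx
      have h3 := huniq x a h2
      rw [h3, h3] at h2; exact h2
    · have hρd : DifferentiableAt ℝ ρ x :=
        (hρ.contDiffAt (hU.mem_nhds hx)).differentiableAt (by simp)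
      have hwd : ∀ j, DifferentiableAt ℝ (fun y => ((w j y : ℝ) : ℂ)) x := fun j =>
        (hwC j).differentiable (by simp) x
      have hpw : ∀ i j, pd i (fun y => ((w j y : ℝ) : ℂ)) x = (pd i (w j) x : ℝ) := fun i j => by
        have : HasFDerivAt (fun y => ((w j y : ℝ) : ℂ)) (Complex.ofRealCLM.comp (fderiv ℝ (w j) x)) x :=
          Complex.ofRealCLM.hasFDerivAt.comp x ((hw j).differentiable (by simp) x).hasFDerivAt
        rw [pd, this.fderiv]; rfl
      have hpp : ∀ i j, pd i (pd j ρ) x = Complex.I * (pd i (w j) x : ℝ) * ρ x +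
          Complex.I * w j x * (Complex.I * w i x * ρ x) := fun i j => by
        rw [pd_congr hU (fun y hy => hpρ y hy j) hx,
          pd_mul_complex (F := fun y => Complex.I * w j y) ((hwd j).const_mul _) hρd,
          pd_const_mul (hwd j), hpw, hpρ x hx]
        ring
      have hcm := pd_comm_of_contDiffOn hU hρ hx 0 1
      rw [hpp, hpp] at hcm
      have hρ0 : ρ x ≠ 0 := norm_ne_zero_iff.1 (by rw [hn x hx]; exact one_ne_zero)
      have : ((pd 0 (w 1) x : ℝ) : ℂ) = (pd 1 (w 0) x : ℝ) := by
        apply mul_left_cancel₀ (mul_ne_zero Complex.I_ne_zero hρ0)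
        linear_combination hcm
      exact_mod_cast this
  obtain ⟨α, hα, hpα⟩ := exists_primitive hw fun x => (hrel x).2
  -- With dα = w, the rotation e^{iα} cancels the connection form, so uE is closed and has a
  -- primitive on the plane.
  let u : (Fin 2 → ℝ) → ℂ := fun x => Complex.exp (Complex.I * α x)
  have hαC : ContDiff ℝ ∞ fun x => Complex.I * ((α x : ℝ) : ℂ) :=
    contDiff_const.mul (Complex.ofRealCLM.contDiff.comp hα)
  have hu : ContDiff ℝ ∞ u := Complex.contDiff_exp.comp hαC
  have hu1 : ∀ x, ‖u x‖ = 1 := fun x => by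
    simp only [u]; rw [mul_comm]; exact Complex.norm_exp_ofReal_mul_I _
  have hpu : ∀ j x, pd j u x = u x * (Complex.I * w j x) := fun j x => by
    have h1 : HasFDerivAt (fun y => ((α y : ℝ) : ℂ)) (Complex.ofRealCLM.comp (fderiv ℝ α x)) x :=
      Complex.ofRealCLM.hasFDerivAt.comp x (hα.differentiable (by simp) x).hasFDerivAt
    have h2 : pd j (fun y => ((α y : ℝ) : ℂ)) x = (pd j α x : ℝ) := by
      rw [pd, h1.fderiv]; rfl
    simp only [u]
    rw [pd_cexp (hαC.differentiable (by simp) x), pd_const_mul h1.differentiableAt, h2, hpα]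
  have dE : ∀ i, Differentiable ℝ (E i) := fun i => (hE i).differentiable (by simp)
  have du : Differentiable ℝ u := hu.differentiable (by simp)
  obtain ⟨D, hD, hpD⟩ := exists_primitive (F := fun i x => u x * E i x) (fun i => hu.mul (hE i))
    fun x => by
      rw [pd_mul_complex (du x) (dE 1 x), pd_mul_complex (du x) (dE 0 x), hpu, hpu]
      linear_combination (u x) * (hrel x).1
  refine ⟨D, hD, fun x => ?_, fun x => ?_⟩
  · simp only [hpD]; exact gram_mul (hu1 x) _
  · have : starRingEnd ℂ (u x) * u x = 1 := by
      rw [mul_comm, Complex.mul_conj, Complex.normSq_eq_norm_sq, hu1]; simp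
    rw [jac, hpD, hpD, map_mul,
      show starRingEnd ℂ (u x) * starRingEnd ℂ (E 0 x) * (u x * E 1 x) =
        starRingEnd ℂ (E 0 x) * E 1 x by
          linear_combination starRingEnd ℂ (E 0 x) * E 1 x * this]
    exact hJ x

theorem pd_re {n : ℕ} {F : (Fin n → ℝ) → ℂ} {x : Fin n → ℝ} (hF : DifferentiableAt ℝ F x)
    (i : Fin n) : pd i (fun y => (F y).re) x = (pd i F x).re := by
  have : HasFDerivAt (fun y => (F y).re) (Complex.reCLM.comp (fderiv ℝ F x)) x :=
    Complex.reCLM.hasFDerivAt.comp x hF.hasFDerivAt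
  rw [pd, this.fderiv]; rfl

theorem pd_im {n : ℕ} {F : (Fin n → ℝ) → ℂ} {x : Fin n → ℝ} (hF : DifferentiableAt ℝ F x)
    (i : Fin n) : pd i (fun y => (F y).im) x = (pd i F x).im := by
  have : HasFDerivAt (fun y => (F y).im) (Complex.imCLM.comp (fderiv ℝ F x)) x :=
    Complex.imCLM.hasFDerivAt.comp x hF.hasFDerivAt
  rw [pd, this.fderiv]; rfl

theorem pd_ofReal {n : ℕ} {F : (Fin n → ℝ) → ℝ} {x : Fin n → ℝ} (hF : DifferentiableAt ℝ F x)
    (i : Fin n) : pd i (fun y => ((F y : ℝ) : ℂ)) x = (pd i F x : ℝ) := by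
  have : HasFDerivAt (fun y => ((F y : ℝ) : ℂ)) (Complex.ofRealCLM.comp (fderiv ℝ F x)) x :=
    Complex.ofRealCLM.hasFDerivAt.comp x hF.hasFDerivAt
  rw [pd, this.fderiv]; rfl

theorem det_gram (F : Fin 2 → ℂ) : (gram F).det = (starRingEnd ℂ (F 0) * F 1).im ^ 2 := by
  rw [Matrix.det_fin_two]; simp [gram]; ring

/-- A flat metric is locally induced by an oriented map to the plane. -/
theorem IsFlatBoundaryMetric.exists_local_map {h : MetricField 2} (hh : IsFlatBoundaryMetric h)
    (x : Fin 2 → ℝ) : ∃ U : Set (Fin 2 → ℝ), IsOpen U ∧ x ∈ U ∧ ∃ F : (Fin 2 → ℝ) → ℂ,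
      ContDiffOn ℝ ∞ F U ∧ (∀ y ∈ U, gram (fun i => pd i F y) = h y) ∧ ∀ y ∈ U, 0 < jac F y := by
  obtain ⟨U, hU, hx, f, hf, hfh⟩ := hh.flat x
  have hfa : ∀ a, ContDiffOn ℝ ∞ (fun y => f y a) U := contDiffOn_pi.1 hf
  let F : (Fin 2 → ℝ) → ℂ := fun y => (f y 0 : ℂ) + Complex.I * f y 1
  have hFr : ∀ a, ContDiffOn ℝ ∞ (fun y => ((f y a : ℝ) : ℂ)) U := fun a =>
    Complex.ofRealCLM.contDiff.comp_contDiffOn (hfa a)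
  have hF : ContDiffOn ℝ ∞ F U := (hFr 0).add (contDiffOn_const.mul (hFr 1))
  have hd : ∀ {E : Type} [NormedAddCommGroup E] [NormedSpace ℝ E] {G : (Fin 2 → ℝ) → E},
      ContDiffOn ℝ ∞ G U → ∀ y ∈ U, DifferentiableAt ℝ G y := fun hG y hy =>
    (hG.contDiffAt (hU.mem_nhds hy)).differentiableAt (by simp)
  have hpF : ∀ y ∈ U, ∀ i, pd i F y = (pd i (fun z => f z 0) y : ℝ) +
      Complex.I * (pd i (fun z => f z 1) y : ℝ) := fun y hy i => by
    simp only [F]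
    rw [pd_add (hd (hFr 0) y hy) ((hd (hFr 1) y hy).const_mul _), pd_const_mul (hd (hFr 1) y hy),
      pd_ofReal (hd (hfa 0) y hy), pd_ofReal (hd (hfa 1) y hy)]
  have hg : ∀ y ∈ U, gram (fun i => pd i F y) = h y := fun y hy => by
    rw [← hfh y hy]
    ext i j
    simp only [gram, pullback, Matrix.of_apply, hpF y hy, partialD_eq_pd (hU.mem_nhds hy),
      Fin.sum_univ_two]
    simp
  have hj0 : jac F x ≠ 0 := fun h0 => by
    have h1 := (hh.isMetric.posDef x trivial).det_pos
    rw [← hg x hx, det_gram] at h1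
    rw [jac] at h0
    simp only [h0] at h1; norm_num at h1
  -- The neighbourhood is shrunk to where the Jacobian is positive. If the given isometry reverses
  -- orientation at `x`, its complex conjugate is used instead.
  have main : ∀ G : (Fin 2 → ℝ) → ℂ, ContDiffOn ℝ ∞ G U →
      (∀ y ∈ U, gram (fun i => pd i G y) = h y) → 0 < jac G x → _ := fun G hG hg hp => by
    have hc : ContinuousOn (jac G) U := Complex.continuous_im.comp_continuousOn
      ((Complex.continuous_conj.comp_continuousOn (hG.pd hU 0).continuousOn).mul
        (hG.pd hU 1).continuousOn)
    exact (⟨U ∩ jac G ⁻¹' Set.Ioi 0, hc.isOpen_inter_preimage hU isOpen_Ioi, ⟨hx, hp⟩, G,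
      hG.mono Set.inter_subset_left, fun y hy => hg y hy.1, fun y hy => hy.2⟩ :
      ∃ U : Set (Fin 2 → ℝ), IsOpen U ∧ x ∈ U ∧ ∃ F : (Fin 2 → ℝ) → ℂ,
      ContDiffOn ℝ ∞ F U ∧ (∀ y ∈ U, gram (fun i => pd i F y) = h y) ∧ ∀ y ∈ U, 0 < jac F y)
  rcases lt_or_gt_of_ne hj0 with hlt | hgt
  · have hpc : ∀ y ∈ U, ∀ i, pd i (fun z => starRingEnd ℂ (F z)) y = starRingEnd ℂ (pd i F y) :=
      fun y hy i => pd_conj (hd hF y hy) i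
    refine main (fun z => starRingEnd ℂ (F z))
      ((Complex.conjCLE : ℂ →L[ℝ] ℂ).contDiff.comp_contDiffOn hF) (fun y hy => ?_) ?_
    · rw [← hg y hy]
      ext i j
      simp [gram, hpc y hy]
    · rw [jac, hpc x hx, hpc x hx]
      rw [jac] at hlt
      simp at hlt ⊢; linarith
  · exact main F hF hg hgt

theorem IsFlatBoundaryMetric.symm {h : MetricField 2} (hh : IsFlatBoundaryMetric h)
    (x : Fin 2 → ℝ) (i j : Fin 2) : h x i j = h x j i := by
  have := (hh.isMetric.posDef x trivial).isHermitian.apply j i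
  simpa using this

/-- Gram–Schmidt provides the global coframe E₀ = √h₀₀, E₁ = (h₀₁ + i √det h)/√h₀₀. -/
theorem IsFlatBoundaryMetric.exists_developing_map {h : MetricField 2}
    (hh : IsFlatBoundaryMetric h) : ∃ D : (Fin 2 → ℝ) → ℂ, ContDiff ℝ ∞ D ∧
      (∀ x, gram (fun i => pd i D x) = h x) ∧ ∀ x, 0 < jac D x := by
  have hs : ∀ i j, ContDiff ℝ ∞ fun x => h x i j := fun i j =>
    contDiffOn_univ.1 (hh.isMetric.smooth i j)
  have h00 : ∀ x, 0 < h x 0 0 := fun x => (hh.isMetric.posDef x trivial).diag_pos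
  have hdet : ∀ x, 0 < (h x).det := fun x => (hh.isMetric.posDef x trivial).det_pos
  have hdets : ContDiff ℝ ∞ fun x => (h x).det := by
    simp only [Matrix.det_fin_two]
    exact ((hs 0 0).mul (hs 1 1)).sub ((hs 0 1).mul (hs 1 0))
  let r : (Fin 2 → ℝ) → ℝ := fun x => Real.sqrt (h x 0 0)
  have hr : ContDiff ℝ ∞ r := (hs 0 0).sqrt fun x => (h00 x).ne'
  have hr0 : ∀ x, 0 < r x := fun x => Real.sqrt_pos.2 (h00 x)
  let d : (Fin 2 → ℝ) → ℝ := fun x => Real.sqrt (h x).det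
  have hd : ContDiff ℝ ∞ d := hdets.sqrt fun x => (hdet x).ne'
  have hd0 : ∀ x, 0 < d x := fun x => Real.sqrt_pos.2 (hdet x)
  let E1 : (Fin 2 → ℝ) → ℂ := fun x =>
    ((h x 0 1 * (r x)⁻¹ : ℝ) : ℂ) + Complex.I * ((d x * (r x)⁻¹ : ℝ) : ℂ)
  have hri : ContDiff ℝ ∞ fun x => (r x)⁻¹ := hr.inv fun x => (hr0 x).ne'
  let E : Fin 2 → (Fin 2 → ℝ) → ℂ := ![fun x => (r x : ℂ), E1]
  have hC : ∀ {G : (Fin 2 → ℝ) → ℝ}, ContDiff ℝ ∞ G → ContDiff ℝ ∞ fun x => ((G x : ℝ) : ℂ) :=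
    fun hG => Complex.ofRealCLM.contDiff.comp hG
  have hE : ∀ i, ContDiff ℝ ∞ (E i) := fun i => by
    fin_cases i
    · exact hC hr
    · exact (hC ((hs 0 1).mul hri)).add (contDiff_const.mul (hC (hd.mul hri)))
  have hgE : ∀ x, gram (fun i => E i x) = h x := fun x => by
    have hrr : r x * r x = h x 0 0 := Real.mul_self_sqrt (h00 x).le
    have hdd : d x * d x = h x 0 0 * h x 1 1 - h x 0 1 * h x 0 1 := by
      rw [show d x * d x = (h x).det from Real.mul_self_sqrt (hdet x).le, Matrix.det_fin_two,
        hh.symm x 1 0]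
    have hr1 := (hr0 x).ne'
    ext i j
    fin_cases i <;> fin_cases j
    · simpa [gram, E] using hrr
    · simp [gram, E, E1]; field_simp
    · simp [gram, E, E1]; rw [hh.symm x 1 0]; field_simp
    · have : h x 0 1 * (r x)⁻¹ * (h x 0 1 * (r x)⁻¹) + d x * (r x)⁻¹ * (d x * (r x)⁻¹) = h x 1 1 := by
        field_simp
        rw [sq (r x), hrr]; linear_combination hdd
      simpa [gram, E, E1] using this
  have := TubeMetric.exists_developing_map hE (r := r) (fun x => rfl) hr0
    (fun x => by simp [E, E1]; exact mul_pos (hd0 x) (inv_pos.2 (hr0 x))) fun x => by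
      obtain ⟨U, hU, hx, F, hF, hg, hj⟩ := hh.exists_local_map x
      exact ⟨U, hU, hx, F, hF, fun y hy => by rw [hg y hy, hgE], hj⟩
  simpa only [hgE] using this

/-- The holonomy of a developing map of a periodic metric consists of translations. -/
theorem exists_translations {h : MetricField 2} (hp : ∀ x i, h (x + e i) = h x)
    {D : (Fin 2 → ℝ) → ℂ} (hD : ContDiff ℝ ∞ D) (hg : ∀ x, gram (fun i => pd i D x) = h x)
    (hj : ∀ x, 0 < jac D x) : ∃ v : Fin 2 → ℂ, ∀ i x, D (x + e i) = D x + v i := by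
  have hpd : ∀ i j x, pd j (fun y => D (y + e i)) x = pd j D (x + e i) := fun i j x => by
    simp [pd, fderiv_comp_add_right]
  have hm : ∀ i, ∃ u v : ℂ, ‖u‖ = 1 ∧ ∀ x, D (x + e i) = u * D x + v := fun i =>
    exists_rigid_motion hD (hD.comp (contDiff_id.add contDiff_const))
      (fun x => by
        show gram (fun j => pd j (fun y => D (y + e i)) x) = _
        simp only [hpd]; rw [hg, hg, hp]) hj fun x => by
        show 0 < jac (fun y => D (y + e i)) x
        rw [jac, hpd, hpd]; exact hj _
  choose u v hu hv using hm
  -- A holonomy motion with a rotation part has a fixed point, and all holonomy motions fix it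
  -- because they commute. Measured from that point, the modulus of the developing map is periodic
  -- and attains a maximum, which an immersion allows only if it vanishes identically.
  have hu1 : ∀ i, u i = 1 := fun i => by
    by_contra hne
    have h1u : 1 - u i ≠ 0 := fun h0 => hne (by linear_combination -h0)
    let G : (Fin 2 → ℝ) → ℂ := fun x => D x + -(v i / (1 - u i))
    have hGj : ∀ j x, G (x + e j) = u j * G x := fun j x => by
      have hcomm : u i * (u j * D x + v j) + v i = u j * (u i * D x + v i) + v j := by
        rw [← hv, ← hv, ← hv, ← hv, add_right_comm]
      simp only [G, hv]
      field_simp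
      linear_combination -hcomm
    have hGs : ContDiff ℝ ∞ G := hD.add contDiff_const
    have hpG : ∀ j x, pd j G x = pd j D x := fun j x => by
      simp only [G, pd, fderiv_add_const]
    have hNp : ∀ x j, ‖G (x + e j)‖ = ‖G x‖ := fun x j => by rw [hGj, norm_mul, hu, one_mul]
    obtain ⟨x₀, -, hmax⟩ := (isCompact_Icc (a := (0 : Fin 2 → ℝ)) (b := 1)).exists_isMaxOn
      ⟨0, by simp⟩ (hGs.continuous.norm.continuousOn)
    have hmax' : ∀ x, ‖G x‖ ≤ ‖G x₀‖ := fun x => by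
      rw [← apply_fract (u := fun x => ‖G x‖) hNp x]
      refine hmax ⟨?_, ?_⟩ <;> intro k <;> fin_cases k <;>
        simp [Int.fract_nonneg, (Int.fract_lt_one _).le]
    have dG : DifferentiableAt ℝ G x₀ := hGs.differentiable (by simp) x₀
    have dGc : DifferentiableAt ℝ (fun y => starRingEnd ℂ (G y)) x₀ :=
      (Complex.conjCLE : ℂ →L[ℝ] ℂ).differentiableAt.comp x₀ dG
    have hcrit : ∀ j, (starRingEnd ℂ (G x₀) * pd j G x₀).re = 0 := fun j => by
      have hloc : IsLocalMax (fun y => (G y * starRingEnd ℂ (G y)).re) x₀ :=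
        Filter.Eventually.of_forall fun y => by
          simp only [Complex.mul_conj, Complex.ofReal_re, Complex.normSq_eq_norm_sq]
          have := hmax' y
          gcongr
      have h0 := hloc.fderiv_eq_zero
      have h1 := pd_re (F := fun y => G y * starRingEnd ℂ (G y)) (dG.mul dGc) j
      rw [pd, h0, pd_mul_complex dG dGc, pd_conj dG] at h1
      simp at h1 ⊢; linarith
    -- At the maximum G is orthogonal to both of its partial derivatives, which span the plane.
    have hG0 : G x₀ = 0 := by
      have hJ := hj x₀
      rw [jac, ← hpG, ← hpG] at hJ
      have c0 := hcrit 0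
      have c1 := hcrit 1
      simp at hJ c0 c1
      set p := pd 0 G x₀
      set q := pd 1 G x₀
      have r1 : (G x₀).re * (p.re * q.im - p.im * q.re) = 0 := by
        linear_combination q.im * c0 - p.im * c1
      have r2 : (G x₀).im * (p.re * q.im - p.im * q.re) = 0 := by
        linear_combination p.re * c1 - q.re * c0
      have hne : p.re * q.im - p.im * q.re ≠ 0 := by intro h9; linarith
      exact Complex.ext ((mul_eq_zero.1 r1).resolve_right hne)
        ((mul_eq_zero.1 r2).resolve_right hne)
    have hGz : G = fun _ => 0 := funext fun x => by
      have := hmax' x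
      rw [hG0, norm_zero] at this
      exact norm_le_zero_iff.1 this
    have := hj x₀
    rw [jac, ← hpG, ← hpG, hGz] at this
    simp [pd] at this
  exact ⟨v, fun i x => by rw [hv, hu1, one_mul]⟩

theorem fderiv_eq_sum_pd {n : ℕ} {E : Type*} [NormedAddCommGroup E] [NormedSpace ℝ E]
    (F : (Fin n → ℝ) → E) (x v : Fin n → ℝ) : fderiv ℝ F x v = ∑ j, v j • pd j F x := by
  conv_lhs => rw [← Finset.univ_sum_single v, map_sum]
  refine Finset.sum_congr rfl fun j _ => ?_
  have : (Pi.single j (v j) : Fin n → ℝ) = v j • e j := by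
    ext k; by_cases hk : k = j
    · subst hk; simp [e]
    · simp [e, hk]
  rw [this, map_smul]; rfl

theorem hasDerivAt_comp_curve {n : ℕ} {E : Type*} [NormedAddCommGroup E] [NormedSpace ℝ E]
    {F : (Fin n → ℝ) → E} {γ : ℝ → Fin n → ℝ} {u : ℝ} (hF : DifferentiableAt ℝ F (γ u))
    (hγ : DifferentiableAt ℝ γ u) :
    HasDerivAt (fun v => F (γ v)) (∑ j, deriv (fun v => γ v j) u • pd j F (γ u)) u := by
  have h1 := hF.hasFDerivAt.comp_hasDerivAt u hγ.hasDerivAt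
  rw [fderiv_eq_sum_pd] at h1
  have h2 : ∀ j, deriv (fun v => γ v j) u = deriv γ u j := fun j =>
    (hasDerivAt_pi.1 hγ.hasDerivAt j).deriv
  simp only [h2]; exact h1

theorem cellInt_pos {F : (Fin 2 → ℝ) → ℝ} (hF : Continuous F) (hp : ∀ x i, F (x + e i) = F x)
    (h : ∀ x, 0 < F x) : 0 < cellInt F := by
  rcases (cellInt_nonneg fun x => (h x).le).lt_or_eq with hlt | heq
  · exact hlt
  · exact absurd (eq_zero_of_cellInt_eq_zero hF hp (fun x => (h x).le) heq.symm 0) (h 0).ne'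

/-- A developing map sends geodesics to uniformly parametrised straight lines. -/
theorem deriv_deriv_developing_eq_zero {h : MetricField 2} {D : (Fin 2 → ℝ) → ℂ}
    (hD : ContDiff ℝ ∞ D) (hg : ∀ x, gram (fun i => pd i D x) = h x) (hj : ∀ x, 0 < jac D x)
    {γ : ℝ → Fin 2 → ℝ} (hγ : ContDiff ℝ ∞ γ)
    (hgeo : ∀ u k, deriv (deriv fun v => γ v k) u + ∑ i, ∑ j, christoffel Set.univ h k i j (γ u) *
      deriv (fun v => γ v i) u * deriv (fun v => γ v j) u = 0)
    (a : Fin 2) {c : Fin 2 → (Fin 2 → ℝ) → ℝ} (hc : c = ![fun x => (D x).re, fun x => (D x).im])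
    (u : ℝ) : HasDerivAt (fun u => ∑ j, deriv (fun v => γ v j) u • pd j (c a) (γ u)) 0 u := by
  have dD : Differentiable ℝ D := hD.differentiable (by simp)
  have hcs : ∀ a, ContDiff ℝ ∞ (c a) := fun a => by
    fin_cases a
    · rw [hc]; exact Complex.reCLM.contDiff.comp hD
    · rw [hc]; exact Complex.imCLM.contDiff.comp hD
  have hp0 : ∀ j x, pd j (c 0) x = (pd j D x).re := fun j x => by rw [hc]; exact pd_re (dD x) j
  have hp1 : ∀ j x, pd j (c 1) x = (pd j D x).im := fun j x => by rw [hc]; exact pd_im (dD x) j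
  have hθ : MatSmoothOn Set.univ (jacMatrix c) := fun a j =>
    (ContDiff.pd (hcs a) (by simp) j).contDiffOn
  have hdet : ∀ x, (jacMatrix c x).det = jac D x := fun x => by
    rw [Matrix.det_fin_two, jac]; simp [jacMatrix, hp0, hp1]; ring
  have hΓ : ∀ x k i j, christoffel Set.univ h k i j x =
      ((jacMatrix c x)⁻¹ * (matD i (jacMatrix c) x +
        (0 : Matrix (Fin 2) (Fin 2) ℝ) * jacMatrix c x)) k j := fun x k i j =>
    christoffel_of_frame (g := h) (ϖ := fun _ _ => 0) isOpen_univ subset_rfl hθ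
      (fun x _ => by
        rw [← hg x]; ext i j
        simp [gram, Matrix.mul_apply, Fin.sum_univ_two, jacMatrix, hp0, hp1])
      (fun x _ => by rw [hdet]; exact (hj x).ne') (fun _ _ _ => by simp)
      (fun x _ i j a => by
        simpa [jacMatrix] using pd_comm (contDiff_infty.1 (hcs a) 2) i j x) trivial k i j
  -- In a developed coordinate c the connection form is zero, so ∂ᵢ∂ⱼc = Γᵏᵢⱼ ∂ₖc. The geodesic
  -- equation then says exactly that (c ∘ γ)'' = 0.
  have hθΓ : ∀ x a i j, ∑ k, pd k (c a) x * christoffel Set.univ h k i j x =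
      pd i (pd j (c a)) x := fun x a i j => by
    have h1 : jacMatrix c x * ((jacMatrix c x)⁻¹ * matD i (jacMatrix c) x) =
        matD i (jacMatrix c) x := by
      rw [← Matrix.mul_assoc, Matrix.mul_nonsing_inv _
        (isUnit_iff_ne_zero.2 (by rw [hdet]; exact (hj x).ne')), Matrix.one_mul]
    have h2 := congrFun (congrFun h1 a) j
    rw [Matrix.mul_apply] at h2
    simp only [hΓ, Matrix.zero_mul, add_zero]
    exact h2
  have hγj : ∀ j, ContDiff ℝ ∞ fun v => γ v j := contDiff_pi.1 hγ
  have hdγ : ∀ j, Differentiable ℝ (deriv fun v => γ v j) := fun j =>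
    ((contDiff_infty_iff_deriv.1 (hγj j)).2).differentiable (by simp)
  have key : HasDerivAt (fun u => ∑ j, deriv (fun v => γ v j) u • pd j (c a) (γ u))
      (∑ j, (deriv (fun v => γ v j) u • (∑ i, deriv (fun v => γ v i) u • pd i (pd j (c a)) (γ u)) +
        deriv (deriv fun v => γ v j) u • pd j (c a) (γ u))) u :=
    HasDerivAt.fun_sum fun j _ => (hdγ j u).hasDerivAt.smul
      (hasDerivAt_comp_curve ((ContDiff.pd (m := ∞) (hcs a) (by simp) j).differentiable (by simp) _)
        (hγ.differentiable (by simp) u))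
  convert! key using 1
  have hk : ∀ k, deriv (deriv fun v => γ v k) u = -∑ i, ∑ j, christoffel Set.univ h k i j (γ u) *
      deriv (fun v => γ v i) u * deriv (fun v => γ v j) u := fun k => by linarith [hgeo u k]
  simp only [hk, ← hθΓ, Fin.sum_univ_two, smul_eq_mul]
  ring

/-- Coordinates adapted to a flat metric and to the class of the meridian. -/
theorem IsFlatBoundaryMetric.exists_structure {h : MetricField 2} (hh : IsFlatBoundaryMetric h)
    {γ : ℝ → Fin 2 → ℝ} (hγ : IsMeridianGeodesic h γ) :
    ∃ (τ κ : ℝ) (Φ : (Fin 2 → ℝ) → ℂ), 0 < loopLength h γ ∧ 0 < κ ∧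
      boundaryArea h = loopLength h γ * κ ∧ ContDiff ℝ ∞ Φ ∧ LatticeEquivariant Φ ∧
      (∀ x, 0 < jac Φ x) ∧ ∀ x i j, h x i j =
        (loopLength h γ * (pd i Φ x).re + τ * (pd i Φ x).im) *
          (loopLength h γ * (pd j Φ x).re + τ * (pd j Φ x).im) +
        κ * (pd i Φ x).im * (κ * (pd j Φ x).im) := by
  obtain ⟨D₀, hD₀, hg₀, hj₀⟩ := hh.exists_developing_map
  obtain ⟨v, hv⟩ := exists_translations hh.periodic hD₀ hg₀ hj₀
  have dD₀ : Differentiable ℝ D₀ := hD₀.differentiable (by simp)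
  have hjp : ∀ x i, jac D₀ (x + e i) = jac D₀ x := fun x i => jac_add_period (hv i) x
  have hcell := cellInt_jac (contDiff_infty.1 hD₀ 2) (hv 0) (hv 1)
  have hpos := cellInt_pos (continuous_jac (hD₀.of_le (by exact_mod_cast le_top))) hjp hj₀
  have hv0 : v 0 ≠ 0 := fun h0 => by rw [hcell, h0] at hpos; simp at hpos
  have hn0 : 0 < ‖v 0‖ := norm_pos_iff.2 hv0
  have hvol : ∀ x, volDensity h x = jac D₀ x := fun x => by
    rw [volDensity, ← hg₀, det_gram]; exact Real.sqrt_sq (hj₀ x).le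
  have harea : boundaryArea h = cellInt (jac D₀) := by
    rw [boundaryArea]
    simp only [hvol]
    exact setIntegral_square_eq_cellInt (S := Set.Ico 0 1)
      (continuous_jac (hD₀.of_le (by exact_mod_cast le_top))) MeasureTheory.Ico_ae_eq_Ioc
      Set.Ico_subset_Icc_self
  -- The developed geodesic has constant velocity. Integrating over one period identifies this
  -- velocity with the translation `v 0`, whose modulus is the speed.
  have hlen : loopLength h γ = ‖v 0‖ := by
    obtain ⟨c, hc⟩ : ∃ c : Fin 2 → (Fin 2 → ℝ) → ℝ,
      c = ![fun x => (D₀ x).re, fun x => (D₀ x).im] := ⟨_, rfl⟩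
    have hcs : ∀ a, ContDiff ℝ ∞ (c a) := fun a => by
      fin_cases a
      · rw [hc]; exact Complex.reCLM.contDiff.comp hD₀
      · rw [hc]; exact Complex.imCLM.contDiff.comp hD₀
    let w : Fin 2 → ℝ := ![(v 0).re, (v 0).im]
    have hcv : ∀ a x, c a (x + e 0) = c a x + w a := fun a x => by
      fin_cases a <;> simp [hc, w, hv]
    let V : Fin 2 → ℝ → ℝ := fun a u => ∑ j, deriv (fun v => γ v j) u • pd j (c a) (γ u)
    have hVc : ∀ a u, V a u = V a 0 := fun a u =>
      is_const_of_deriv_eq_zero (fun u => (deriv_deriv_developing_eq_zero hD₀ hg₀ hj₀ hγ.smooth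
        hγ.geodesic a hc u).differentiableAt) (fun u => (deriv_deriv_developing_eq_zero hD₀ hg₀ hj₀
        hγ.smooth hγ.geodesic a hc u).deriv) u 0
    have hder : ∀ a u, HasDerivAt (fun u => c a (γ u)) (V a 0) u := fun a u => by
      rw [← hVc a u]
      exact hasDerivAt_comp_curve ((hcs a).differentiable (by simp) _)
        (hγ.smooth.differentiable (by simp) u)
    have hVw : ∀ a, V a 0 = w a := fun a => by
      have h1 := intervalIntegral.integral_eq_sub_of_hasDerivAt (a := 0) (b := 1)
        (fun u _ => hder a u) (by simp)
      have h2 := hγ.meridian 0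
      rw [zero_add] at h2
      rw [h2, hcv] at h1
      simpa using h1
    have hsum : ∀ u, ∑ i, ∑ j, h (γ u) i j * deriv (fun v => γ v i) u * deriv (fun v => γ v j) u =
        ‖v 0‖ ^ 2 := fun u => by
      have e0 := (hVc 0 u).trans (hVw 0)
      have e1 := (hVc 1 u).trans (hVw 1)
      have q0 : ∀ j x, pd j (c 0) x = (pd j D₀ x).re := fun j x => by
        rw [hc]; exact pd_re (dD₀ x) j
      have q1 : ∀ j x, pd j (c 1) x = (pd j D₀ x).im := fun j x => by
        rw [hc]; exact pd_im (dD₀ x) j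
      simp only [V, w, q0, q1, Fin.sum_univ_two, smul_eq_mul, Matrix.cons_val_zero,
        Matrix.cons_val_one] at e0 e1
      rw [Complex.sq_norm, Complex.normSq_apply, ← e0, ← e1, ← hg₀]
      simp [gram, Fin.sum_univ_two]
      ring
    rw [loopLength]
    simp only [hsum, Real.sqrt_sq hn0.le]
    simp
  rw [hlen]
  -- rotate so that the meridian translation is real
  set ℓ := ‖v 0‖ with hℓ
  let u : ℂ := starRingEnd ℂ (v 0) / ℓ
  have hℓC : (ℓ : ℂ) ≠ 0 := by exact_mod_cast hn0.ne'
  have hu : ‖u‖ = 1 := by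
    simp only [u]
    rw [norm_div, RCLike.norm_conj, Complex.norm_real, Real.norm_of_nonneg hn0.le, ← hℓ,
      div_self hn0.ne']
  have huv0 : u * v 0 = ℓ := by
    simp only [u]
    rw [div_mul_eq_mul_div, div_eq_iff hℓC, mul_comm, Complex.mul_conj, Complex.normSq_eq_norm_sq]
    push_cast; rw [← hℓ]; ring
  let τ := (u * v 1).re
  let κ := (u * v 1).im
  have hArea : cellInt (jac D₀) = ℓ * κ := by
    rw [hcell]
    have : starRingEnd ℂ (v 0) * v 1 = (ℓ : ℂ) * (u * v 1) := by
      simp only [u]; field_simp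
    rw [this, Complex.im_ofReal_mul]
  have hκ : 0 < κ := by
    rw [hArea] at hpos
    exact pos_of_mul_pos_right hpos hn0.le
  let D : (Fin 2 → ℝ) → ℂ := fun x => u * D₀ x
  have hD : ContDiff ℝ ∞ D := contDiff_const.mul hD₀
  have dD : Differentiable ℝ D := hD.differentiable (by simp)
  have hpD : ∀ i x, pd i D x = u * pd i D₀ x := fun i x => pd_const_mul (dD₀ x) u i
  -- The real and imaginary parts of Φ are the coordinates of `D` in the real basis ℓ, τ + iκ of the
  -- plane, so the holonomy lattice becomes ℤ[i].
  let φ1 : (Fin 2 → ℝ) → ℝ := fun x => (D x).im * κ⁻¹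
  let φ0 : (Fin 2 → ℝ) → ℝ := fun x => ((D x).re - τ * φ1 x) * ℓ⁻¹
  have hφ1 : ContDiff ℝ ∞ φ1 := (Complex.imCLM.contDiff.comp hD).mul contDiff_const
  have hφ0 : ContDiff ℝ ∞ φ0 :=
    ((Complex.reCLM.contDiff.comp hD).sub (contDiff_const.mul hφ1)).mul contDiff_const
  let Φ : (Fin 2 → ℝ) → ℂ := fun x => (φ0 x : ℂ) + Complex.I * φ1 x
  have hΦ : ContDiff ℝ ∞ Φ := (Complex.ofRealCLM.contDiff.comp hφ0).add
    (contDiff_const.mul (Complex.ofRealCLM.contDiff.comp hφ1))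
  have dΦ : Differentiable ℝ Φ := hΦ.differentiable (by simp)
  have hDΦ : D = fun x => (ℓ : ℂ) * (((Φ x).re : ℝ) : ℂ) + (τ + Complex.I * κ) * (((Φ x).im : ℝ) : ℂ) := by
    ext x
    have r1 : (Φ x).re = φ0 x := by simp [Φ]
    have r2 : (Φ x).im = φ1 x := by simp [Φ]
    have t1 : (D x).re = ℓ * φ0 x + τ * φ1 x := by
      simp only [φ0]; field_simp; ring
    have t2 : (D x).im = κ * φ1 x := by simp only [φ1]; field_simp
    rw [r1, r2]
    apply Complex.ext
    · rw [t1]; simp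
    · rw [t2]; simp
  have dre : Differentiable ℝ fun x => (((Φ x).re : ℝ) : ℂ) := fun x =>
    (Complex.ofRealCLM.contDiff.comp (Complex.reCLM.contDiff.comp hΦ)).differentiable (n := ∞) (by simp) x
  have dim : Differentiable ℝ fun x => (((Φ x).im : ℝ) : ℂ) := fun x =>
    (Complex.ofRealCLM.contDiff.comp (Complex.imCLM.contDiff.comp hΦ)).differentiable (n := ∞) (by simp) x
  have hpDΦ : ∀ i x, pd i D x = (ℓ : ℂ) * ((pd i Φ x).re : ℝ) + (τ + Complex.I * κ) * ((pd i Φ x).im : ℝ) :=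
    fun i x => by
      rw [hDΦ, pd_add ((dre x).const_mul _) ((dim x).const_mul _), pd_const_mul (dre x),
        pd_const_mul (dim x),
        pd_ofReal (F := fun y => (Φ y).re) (Complex.reCLM.differentiableAt.comp x (dΦ x)),
        pd_ofReal (F := fun y => (Φ y).im) (Complex.imCLM.differentiableAt.comp x (dΦ x)),
        pd_re (dΦ x), pd_im (dΦ x)]
  have hgD : ∀ x, gram (fun i => pd i D x) = h x := fun x => by
    simp only [hpD]; rw [gram_mul hu, hg₀]
  have hjD : ∀ x, 0 < jac D x := fun x => by
    have hcu : starRingEnd ℂ u * u = 1 := by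
      rw [mul_comm, Complex.mul_conj, Complex.normSq_eq_norm_sq, hu]; simp
    have := hj₀ x
    rw [jac] at this ⊢
    rw [hpD, hpD, map_mul]
    convert! this using 2
    linear_combination starRingEnd ℂ (pd 0 D₀ x) * pd 1 D₀ x * hcu
  have hDv : ∀ i x, D (x + e i) = D x + u * v i := fun i x => by
    simp only [D, hv]; ring
  refine ⟨τ, κ, Φ, hn0, hκ, by rw [harea, hArea], hΦ, fun x => ⟨?_, ?_⟩, fun x => ?_,
    fun x i j => ?_⟩
  · have h1 := hDv 0 x
    rw [huv0] at h1
    have i1 : φ1 (x + e 0) = φ1 x := by simp only [φ1, h1]; simp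
    have i0 : φ0 (x + e 0) = φ0 x + 1 := by
      simp only [φ0, i1, h1]; simp; field_simp; ring
    simp only [Φ, i0, i1]; push_cast; ring
  · have h1 := hDv 1 x
    have i1 : φ1 (x + e 1) = φ1 x + 1 := by
      simp only [φ1, h1, Complex.add_im]
      rw [show (u * v 1).im = κ from rfl]; field_simp
    have i0 : φ0 (x + e 1) = φ0 x := by
      simp only [φ0, i1, h1, Complex.add_re]
      rw [show (u * v 1).re = τ from rfl]; ring
    simp only [Φ, i0, i1]; push_cast; ring
  · have h1 := hjD x
    rw [jac, hpDΦ, hpDΦ] at h1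
    have h2 : (starRingEnd ℂ ((ℓ : ℂ) * ((pd 0 Φ x).re : ℝ) + (τ + Complex.I * κ) * ((pd 0 Φ x).im : ℝ)) *
        ((ℓ : ℂ) * ((pd 1 Φ x).re : ℝ) + (τ + Complex.I * κ) * ((pd 1 Φ x).im : ℝ))).im =
        ℓ * κ * jac Φ x := by
      rw [jac]; simp; ring
    rw [h2] at h1
    exact pos_of_mul_pos_right h1 (by positivity)
  · rw [← hgD x]
    simp only [gram, Matrix.of_apply, hpDΦ]
    simp

/-! ### The profiles of the tube and their curvature bound. -/

/-- A smooth function that is `e⁻ʳ` for `r ≤ -1/2` and vanishes for `r ≥ -1/4`. -/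
def cutoffExp (r : ℝ) : ℝ := Real.smoothTransition (-1 - 4 * r) * Real.exp (-r)

/-- The circumference profile of the tube. -/
def profileF (q r : ℝ) : ℝ := Real.exp r - q ^ 2 * cutoffExp r

/-- The height profile of the tube. -/
def profileK (q r : ℝ) : ℝ := Real.exp r + q ^ 2 * cutoffExp r

theorem contDiff_cutoffExp : ContDiff ℝ ∞ cutoffExp :=
  (Real.smoothTransition.contDiff.comp (by fun_prop : ContDiff ℝ ∞ fun r : ℝ => -1 - 4 * r)).mul
    (Real.contDiff_exp.comp contDiff_neg)

theorem contDiff_profileF (q : ℝ) : ContDiff ℝ ∞ (profileF q) :=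
  Real.contDiff_exp.sub (contDiff_const.mul contDiff_cutoffExp)

theorem contDiff_profileK (q : ℝ) : ContDiff ℝ ∞ (profileK q) :=
  Real.contDiff_exp.add (contDiff_const.mul contDiff_cutoffExp)

theorem cutoffExp_of_le {r : ℝ} (h : r ≤ -(1 / 2)) : cutoffExp r = Real.exp (-r) := by
  rw [cutoffExp, Real.smoothTransition.one_of_one_le (by linarith), one_mul]

theorem cutoffExp_of_ge {r : ℝ} (h : -(1 / 4) ≤ r) : cutoffExp r = 0 := by
  rw [cutoffExp, Real.smoothTransition.zero_of_nonpos (by linarith), zero_mul]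

theorem cutoffExp_nonneg (r : ℝ) : 0 ≤ cutoffExp r :=
  mul_nonneg (Real.smoothTransition.nonneg _) (Real.exp_pos _).le

theorem cutoffExp_le (r : ℝ) : cutoffExp r ≤ Real.exp (-r) :=
  mul_le_of_le_one_left (Real.exp_pos _).le (Real.smoothTransition.le_one _)

theorem profileK_pos (q r : ℝ) : 0 < profileK q r :=
  add_pos_of_pos_of_nonneg (Real.exp_pos _) (mul_nonneg (sq_nonneg _) (cutoffExp_nonneg r))

/-- The cut-off only increases this profile: f ≥ eʳ − q²e⁻ʳ, which is positive when eʳ > q. -/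
theorem profileF_pos {q r : ℝ} (hq : 0 < q) (hr : Real.log q < r) : 0 < profileF q r := by
  have h1 : q < Real.exp r := (Real.log_lt_iff_lt_exp hq).1 hr
  have h2 : q ^ 2 * cutoffExp r ≤ q ^ 2 * Real.exp (-r) :=
    mul_le_mul_of_nonneg_left (cutoffExp_le r) (sq_nonneg q)
  have h3 : q ^ 2 * Real.exp (-r) < Real.exp r := by
    rw [Real.exp_neg, ← div_eq_mul_inv, div_lt_iff₀ (Real.exp_pos r)]
    nlinarith
  rw [profileF]; linarith

/-- Minus one sixth of the scalar curvature of the tube. -/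
def curvatureRatio (f k : ℝ → ℝ) (r : ℝ) : ℝ :=
  (deriv (deriv f) r / f r + deriv (deriv k) r / k r + deriv f r * deriv k r / (f r * k r)) / 3

/-- The perturbations of the two profiles are opposite, so the terms linear in q² cancel in f''k +
fk'' + f'k' and the first error is of order q⁴. -/
theorem curvatureRatio_profile {q r : ℝ} (hq : 0 < q) (hr : Real.log q < r) :
    curvatureRatio (profileF q) (profileK q) r * (profileF q r * profileK q r) =
      Real.exp r ^ 2 - q ^ 4 * (2 * cutoffExp r * deriv (deriv cutoffExp) r +
        deriv cutoffExp r ^ 2) / 3 := by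
  have hu : Differentiable ℝ cutoffExp := contDiff_cutoffExp.differentiable (by simp)
  have hu' : Differentiable ℝ (deriv cutoffExp) :=
    (contDiff_infty_iff_deriv.1 contDiff_cutoffExp).2.differentiable (by simp)
  have dF : deriv (profileF q) = fun r => Real.exp r - q ^ 2 * deriv cutoffExp r := funext fun r =>
    ((Real.hasDerivAt_exp r).sub ((hu r).hasDerivAt.const_mul _)).deriv
  have dK : deriv (profileK q) = fun r => Real.exp r + q ^ 2 * deriv cutoffExp r := funext fun r =>
    ((Real.hasDerivAt_exp r).add ((hu r).hasDerivAt.const_mul _)).deriv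
  have ddF : deriv (deriv (profileF q)) r = Real.exp r - q ^ 2 * deriv (deriv cutoffExp) r := by
    rw [dF]
    exact ((Real.hasDerivAt_exp r).sub ((hu' r).hasDerivAt.const_mul _)).deriv
  have ddK : deriv (deriv (profileK q)) r = Real.exp r + q ^ 2 * deriv (deriv cutoffExp) r := by
    rw [dK]
    exact ((Real.hasDerivAt_exp r).add ((hu' r).hasDerivAt.const_mul _)).deriv
  have hF := (profileF_pos hq hr).ne'
  have hK := (profileK_pos q r).ne'
  rw [curvatureRatio, ddF, ddK, dF, dK]
  field_simp
  rw [profileF, profileK]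
  ring

theorem profile_mul (q r : ℝ) :
    profileF q r * profileK q r = Real.exp r ^ 2 - q ^ 4 * cutoffExp r ^ 2 := by
  rw [profileF, profileK]; ring

theorem rpow_three_halves {x : ℝ} (hx : 0 ≤ x) : x ^ (3 / 2 : ℝ) = x * Real.sqrt x := by
  rw [Real.sqrt_eq_rpow, show (3 / 2 : ℝ) = 1 + 1 / 2 by norm_num,
    Real.rpow_add_of_nonneg hx zero_le_one (by norm_num), Real.rpow_one]

/-- The curvature integrand of the tube exceeds that of the cusp by `O(q⁴)`. -/
theorem exists_profile_bound : ∃ K : ℝ, 0 < K ∧ ∀ q r : ℝ, 0 < q → q < 1 / 2 → Real.log q < r →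
    r ≤ 0 → |curvatureRatio (profileF q) (profileK q) r| ^ (3 / 2 : ℝ) *
      (profileF q r * profileK q r) ≤ (1 + K * q ^ 4) * Real.exp (2 * r) := by
  have hu' : Continuous (deriv cutoffExp) :=
    (contDiff_infty_iff_deriv.1 contDiff_cutoffExp).2.continuous
  have hu'' : Continuous (deriv (deriv cutoffExp)) :=
    (contDiff_infty_iff_deriv.1 (contDiff_infty_iff_deriv.1 contDiff_cutoffExp).2).2.continuous
  have hm : Continuous fun r => 2 * cutoffExp r * deriv (deriv cutoffExp) r +
      deriv cutoffExp r ^ 2 :=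
    ((continuous_const.mul contDiff_cutoffExp.continuous).mul hu'').add (hu'.pow 2)
  obtain ⟨M, hM⟩ := (isCompact_Icc (a := (-(1 / 2) : ℝ)) (b := 0)).exists_bound_of_continuousOn
    hm.continuousOn
  have hM0 : 0 ≤ M := (norm_nonneg _).trans (hM 0 (by norm_num))
  -- The constant collects the coefficients of (1 + Mq⁴)(1 + (3M + 21)q⁴), using q⁴ ≤ 1 for the
  -- product term. `M` bounds the error of the curvature on the fixed interval [−1/2, 0], so it does
  -- not depend on q.
  refine ⟨M + (3 * M + 21) + M * (3 * M + 21), by positivity,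
    fun q r hq hq2 hr hr0 => ?_⟩
  set Q := curvatureRatio (profileF q) (profileK q) r
  have hF := profileF_pos hq hr
  have hK := profileK_pos q r
  have hFK := mul_pos hF hK
  have hQ := curvatureRatio_profile hq hr
  have hexp : Real.exp (2 * r) = Real.exp r ^ 2 := by rw [two_mul, Real.exp_add]; ring
  have hq4 : 0 < q ^ 4 := by positivity
  have hq41 : q ^ 4 ≤ 1 / 16 := by
    have : q ^ 4 ≤ (1 / 2) ^ 4 := by gcongr
    linarith
  rw [hexp, rpow_three_halves (abs_nonneg _)]
  set y := Real.exp r ^ 2 with hy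
  have hy0 : 0 < y := by positivity
  set K := M + (3 * M + 21) + M * (3 * M + 21)
  have hK0 : 0 ≤ K := by positivity
  rw [profile_mul] at hQ ⊢
  rw [profile_mul] at hFK
  rcases lt_or_ge r (-(1 / 2)) with h | h
  · have hev : ∀ s < -(1 / 2 : ℝ), cutoffExp =ᶠ[𝓝 s] fun s => Real.exp (-s) := fun s hs =>
      Filter.eventuallyEq_of_mem (Iio_mem_nhds hs) fun t ht => cutoffExp_of_le (le_of_lt ht)
    have hexpd : ∀ s : ℝ, HasDerivAt (fun s => Real.exp (-s)) (-Real.exp (-s)) s := fun s => by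
      simpa using (hasDerivAt_neg s).exp
    have h1 : ∀ s < -(1 / 2 : ℝ), deriv cutoffExp s = -Real.exp (-s) := fun s hs => by
      rw [(hev s hs).deriv_eq, (hexpd s).deriv]
    have h2 : deriv (deriv cutoffExp) r = Real.exp (-r) := by
      have : deriv cutoffExp =ᶠ[𝓝 r] fun s => -Real.exp (-s) :=
        Filter.eventuallyEq_of_mem (Iio_mem_nhds h) fun t ht => h1 t ht
      rw [this.deriv_eq, (hexpd r).fun_neg.deriv, neg_neg]
    rw [h1 r h, h2, cutoffExp_of_le h.le] at hQ
    rw [cutoffExp_of_le h.le] at hFK ⊢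
    -- Below the transition the tube is exactly hyperbolic, and its area density y − q⁴e⁻²ʳ is
    -- smaller than that of the cusp.
    have hQ1 : Q = 1 := by
      have : (Q - 1) * (y - q ^ 4 * Real.exp (-r) ^ 2) = 0 := by linear_combination hQ
      rcases mul_eq_zero.1 this with h3 | h3
      · linarith
      · exact absurd h3 hFK.ne'
    rw [hQ1, abs_one, Real.sqrt_one]
    nlinarith [mul_nonneg (mul_nonneg hK0 hq4.le) hy0.le,
      mul_nonneg hq4.le (sq_nonneg (Real.exp (-r)))]
  · have he3 : Real.exp 1 < 3 := Real.exp_one_lt_d9.trans (by norm_num)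
    have hyr : Real.exp 1 * y = Real.exp (1 + 2 * r) := by rw [Real.exp_add, hexp]
    have hy3 : 1 / 3 ≤ y := by
      have : 1 ≤ Real.exp (1 + 2 * r) := Real.one_le_exp (by linarith)
      nlinarith
    have hv : cutoffExp r ^ 2 ≤ 3 := by
      have h1 : cutoffExp r ^ 2 ≤ Real.exp (-r) ^ 2 := by
        have := cutoffExp_le r
        have := cutoffExp_nonneg r
        gcongr
      have h2 : Real.exp (-r) ^ 2 ≤ Real.exp 1 := by
        rw [← Real.exp_nat_mul]; exact Real.exp_le_exp.2 (by push_cast; linarith)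
      linarith
    have hm := abs_le.1 (hM r ⟨h, hr0⟩)
    set m := 2 * cutoffExp r * deriv (deriv cutoffExp) r + deriv cutoffExp r ^ 2
    set W := y - q ^ 4 * cutoffExp r ^ 2 with hW
    have hW1 : y - 3 * q ^ 4 ≤ W := by
      have := mul_le_mul_of_nonneg_left hv hq4.le
      rw [hW]; linarith
    -- This is 1/3 − 3/16, from y ≥ 1/3, u² ≤ 3 and q⁴ ≤ 1/16.
    have hW0 : 7 / 48 ≤ W := by linarith
    have hQW : |Q| * W ≤ y + q ^ 4 * M / 3 := by
      rw [← abs_of_pos hFK, ← abs_mul, hQ]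
      have h1 := mul_le_mul_of_nonneg_left hm.1 hq4.le
      have h2 := mul_le_mul_of_nonneg_left hm.2 hq4.le
      refine abs_le.2 ⟨?_, ?_⟩ <;> linarith
    -- The coefficient absorbs the loss after division by W: (3M + 21) · 7/48 exceeds M/3 + 3.
    have hQ1 : |Q| ≤ 1 + (3 * M + 21) * q ^ 4 := by
      have h1 : |Q| * W ≤ (1 + (3 * M + 21) * q ^ 4) * W := by
        have : (3 * M + 21) * q ^ 4 * (7 / 48) ≤ (3 * M + 21) * q ^ 4 * W := by gcongr
        have := mul_nonneg hM0 hq4.le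
        linarith
      exact le_of_mul_le_mul_right h1 hFK
    have hs : Real.sqrt |Q| ≤ 1 + (3 * M + 21) * q ^ 4 := by
      rw [Real.sqrt_le_left (by positivity)]
      have : 0 ≤ (3 * M + 21) * q ^ 4 := by positivity
      nlinarith
    have h5 : |Q| * W ≤ y * (1 + M * q ^ 4) := by
      have := mul_nonneg (mul_nonneg hM0 hq4.le) (sub_nonneg.2 hy3)
      linarith
    calc |Q| * Real.sqrt |Q| * W = (|Q| * W) * Real.sqrt |Q| := by ring
      _ ≤ (y * (1 + M * q ^ 4)) * (1 + (3 * M + 21) * q ^ 4) := by gcongr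
      _ = (1 + (M + (3 * M + 21) + M * (3 * M + 21) * q ^ 4) * q ^ 4) * y := by ring
      _ ≤ (1 + K * q ^ 4) * y := by
        have : M * (3 * M + 21) * q ^ 4 ≤ M * (3 * M + 21) :=
          mul_le_of_le_one_right (by positivity) (by linarith)
        simp only [K]
        gcongr

/-! ### The radial coordinate and cylindrical coordinates. -/

/-- Slope of the radial coordinate. -/
def slope (q : ℝ) : ℝ := (q⁻¹ - q) / 2

/-- The distance coordinate `r ∈ [log q, 0]` as a function of the Euclidean radius. -/
def radial (q ρ : ℝ) : ℝ := Real.log q + Real.arsinh (slope q * ρ)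

theorem slope_pos {q : ℝ} (hq : 0 < q) (hq1 : q < 1 / 2) : 0 < slope q := by
  have : 1 < q⁻¹ := (one_lt_inv₀ hq).2 (by linarith)
  rw [slope]; linarith

theorem contDiff_radial (q : ℝ) : ContDiff ℝ ∞ (radial q) :=
  contDiff_const.add (Real.contDiff_arsinh.comp (contDiff_const.mul contDiff_id))

theorem hasDerivAt_radial (q ρ : ℝ) :
    HasDerivAt (radial q) (slope q / Real.sqrt (1 + (slope q * ρ) ^ 2)) ρ := by
  have h1 : HasDerivAt (fun ρ => slope q * ρ) (slope q) ρ := by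
    simpa using (hasDerivAt_id ρ).const_mul (slope q)
  have := (h1.arsinh).const_add (Real.log q)
  rw [smul_eq_mul, inv_mul_eq_div] at this
  exact this

theorem exp_radial {q : ℝ} (hq : 0 < q) (ρ : ℝ) : Real.exp (radial q ρ) =
    q * (slope q * ρ + Real.sqrt (1 + (slope q * ρ) ^ 2)) := by
  rw [radial, Real.exp_add, Real.exp_log hq, Real.exp_arsinh]

theorem exp_neg_radial {q : ℝ} (hq : 0 < q) (ρ : ℝ) : q ^ 2 * Real.exp (-radial q ρ) =
    q * (Real.sqrt (1 + (slope q * ρ) ^ 2) - slope q * ρ) := by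
  have hs : Real.sqrt (1 + (slope q * ρ) ^ 2) ^ 2 = 1 + (slope q * ρ) ^ 2 :=
    Real.sq_sqrt (by positivity)
  have h1 := exp_radial hq ρ
  have hpos := Real.exp_pos (radial q ρ)
  rw [Real.exp_neg, mul_inv_eq_iff_eq_mul₀ hpos.ne', h1]
  linear_combination -q ^ 2 * hs

theorem log_lt_radial {q ρ : ℝ} (hq : 0 < q) (hq1 : q < 1 / 2) (hρ : 0 < ρ) :
    Real.log q < radial q ρ := by
  have := Real.arsinh_pos_iff.2 (mul_pos (slope_pos hq hq1) hρ)
  rw [radial]; linarith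

/-- The slope is sinh(−log q), chosen so that the unit circle lies at height r = 0. -/
theorem radial_one {q : ℝ} (hq : 0 < q) : radial q 1 = 0 := by
  have : slope q = Real.sinh (-Real.log q) := by
    rw [Real.sinh_eq, neg_neg, Real.exp_neg, Real.exp_log hq, slope]
  rw [radial, mul_one, this, Real.arsinh_sinh]; ring

theorem strictMono_radial {q : ℝ} (hq : 0 < q) (hq1 : q < 1 / 2) : StrictMono (radial q) :=
  fun _ _ h => add_lt_add_right (Real.arsinh_strictMono
    (mul_lt_mul_of_pos_left h (slope_pos hq hq1))) _

/-- The inverse of `radial`. -/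
def radius (q r : ℝ) : ℝ := Real.sinh (r - Real.log q) / slope q

theorem contDiff_radius (q : ℝ) : ContDiff ℝ ∞ (radius q) :=
  (Real.contDiff_sinh.comp (contDiff_id.sub contDiff_const)).div_const _

theorem radial_radius {q : ℝ} (hq : 0 < q) (hq1 : q < 1 / 2) (r : ℝ) :
    radial q (radius q r) = r := by
  rw [radial, radius, mul_div_cancel₀ _ (slope_pos hq hq1).ne', Real.arsinh_sinh]; ring

theorem radius_radial {q : ℝ} (hq : 0 < q) (hq1 : q < 1 / 2) (ρ : ℝ) :
    radius q (radial q ρ) = ρ := by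
  rw [radial, radius, add_sub_cancel_left, Real.sinh_arsinh,
    mul_div_cancel_left₀ _ (slope_pos hq hq1).ne']

/-- This is the integral of e²ʳ from log q to 0 after substitution. The part of the cusp cut off
below the core contributes the term q². -/
theorem integral_exp_radial {q : ℝ} (hq : 0 < q) :
    ∫ ρ in (0 : ℝ)..1, Real.exp (2 * radial q ρ) *
      (slope q / Real.sqrt (1 + (slope q * ρ) ^ 2)) = (1 - q ^ 2) / 2 := by
  have hd : ∀ ρ : ℝ, HasDerivAt (fun ρ => Real.exp (2 * radial q ρ) / 2) (Real.exp (2 * radial q ρ) *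
      (slope q / Real.sqrt (1 + (slope q * ρ) ^ 2))) ρ := fun ρ => by
    convert! (((hasDerivAt_radial q ρ).const_mul 2).exp.div_const 2) using 1
    ring
  have hc : Continuous fun ρ : ℝ => Real.exp (2 * radial q ρ) *
      (slope q / Real.sqrt (1 + (slope q * ρ) ^ 2)) := by
    refine (Real.continuous_exp.comp (continuous_const.mul (contDiff_radial q).continuous)).mul
      (continuous_const.div (by fun_prop) fun ρ => ?_)
    exact (Real.sqrt_pos.2 (by positivity)).ne'
  rw [intervalIntegral.integral_eq_sub_of_hasDerivAt (fun ρ _ => hd ρ)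
    (hc.intervalIntegrable _ _), radial_one hq]
  have : Real.exp (2 * radial q 0) = q ^ 2 := by
    rw [radial, mul_zero, Real.arsinh_zero, add_zero, two_mul, Real.exp_add, Real.exp_log hq]; ring
  rw [this]; simp; ring

/-- The projection of the cylinder to the disc, as a complex number. -/
def discC (p : Fin 3 → ℝ) : ℂ := p 0 + p 1 * Complex.I

/-- Distance to the axis. -/
def axisDist (p : Fin 3 → ℝ) : ℝ := Real.sqrt (p 0 ^ 2 + p 1 ^ 2)

/-- The cylindrical coordinates `(angle / 2π, height, distance)`. -/
def cyl (p : Fin 3 → ℝ) : Fin 3 → ℝ := ![Complex.arg (discC p) / (2 * Real.pi), p 2, axisDist p]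

/-- The point with given cylindrical coordinates. -/
def polar (v : Fin 3 → ℝ) : Fin 3 → ℝ :=
  ![v 2 * Real.cos (2 * Real.pi * v 0), v 2 * Real.sin (2 * Real.pi * v 0), v 1]

/-- The differential of the angle coordinate. -/
def angForm (p : Fin 3 → ℝ) : Fin 3 → ℝ :=
  ![-p 1 / (2 * Real.pi * axisDist p ^ 2), p 0 / (2 * Real.pi * axisDist p ^ 2), 0]

/-- The differential of the distance to the axis. -/
def radForm (p : Fin 3 → ℝ) : Fin 3 → ℝ := ![p 0 / axisDist p, p 1 / axisDist p, 0]

theorem norm_discC (p : Fin 3 → ℝ) : ‖discC p‖ = axisDist p := by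
  rw [axisDist, discC, Complex.norm_add_mul_I]

theorem axisDist_sq (p : Fin 3 → ℝ) : axisDist p ^ 2 = p 0 ^ 2 + p 1 ^ 2 :=
  Real.sq_sqrt (by positivity)

theorem axisDist_polar {v : Fin 3 → ℝ} (hv : 0 ≤ v 2) : axisDist (polar v) = v 2 := by
  have : (polar v 0) ^ 2 + (polar v 1) ^ 2 = v 2 ^ 2 := by
    simp only [polar, Matrix.cons_val_zero, Matrix.cons_val_one]
    linear_combination v 2 ^ 2 * Real.cos_sq_add_sin_sq (2 * Real.pi * v 0)
  rw [axisDist, this, Real.sqrt_sq hv]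

theorem discC_polar (v : Fin 3 → ℝ) :
    discC (polar v) = v 2 * Complex.exp (2 * Real.pi * v 0 * Complex.I) := by
  rw [Complex.exp_mul_I, discC, polar]
  simp only [Matrix.cons_val_zero, Matrix.cons_val_one]
  push_cast; ring

theorem polar_eq_iff {v p : Fin 3 → ℝ} : polar v = p ↔
    (v 2 * Complex.exp (2 * Real.pi * v 0 * Complex.I) = discC p ∧ v 1 = p 2) := by
  rw [← discC_polar]
  constructor
  · rintro rfl; exact ⟨rfl, rfl⟩
  · rintro ⟨h1, h2⟩
    have hre := congrArg Complex.re h1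
    have him := congrArg Complex.im h1
    simp [discC] at hre him
    ext i; fin_cases i
    · exact hre
    · exact him
    · exact h2

theorem polar_cyl (p : Fin 3 → ℝ) : polar (cyl p) = p := by
  rw [polar_eq_iff]
  refine ⟨?_, rfl⟩
  have h := Complex.norm_mul_exp_arg_mul_I (discC p)
  rw [norm_discC] at h
  simp only [cyl, Matrix.cons_val_zero, Matrix.cons_val]
  convert! h using 3
  have : (Real.pi : ℂ) ≠ 0 := by exact_mod_cast Real.pi_ne_zero
  push_cast; field_simp

theorem eq_of_polar_eq {v v' : Fin 3 → ℝ} (hv : 0 < v 2) (hv' : 0 < v' 2) (h : polar v' = polar v) :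
    ∃ n : ℤ, v' = v + (n : ℝ) • e 0 := by
  have h2 : v' 2 = v 2 := by rw [← axisDist_polar hv.le, ← axisDist_polar hv'.le, h]
  have h1 : v' 1 = v 1 := congrFun h 2
  have h0 := congrArg discC h
  rw [discC_polar, discC_polar, h2] at h0
  have h3 := mul_left_cancel₀ (by exact_mod_cast hv.ne' : ((v 2 : ℝ) : ℂ) ≠ 0) h0
  obtain ⟨n, hn⟩ := Complex.exp_eq_exp_iff_exists_int.1 h3
  have hn' : ((v' 0 : ℝ) : ℂ) = ((v 0 + n : ℝ) : ℂ) := by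
    have hpi : (2 * Real.pi * Complex.I : ℂ) ≠ 0 := Complex.two_pi_I_ne_zero
    apply mul_left_cancel₀ hpi
    push_cast; linear_combination hn
  refine ⟨n, ?_⟩
  ext i; fin_cases i
  · simpa [e] using (by exact_mod_cast hn' : v' 0 = v 0 + n)
  · simpa [e] using h1
  · simpa [e] using h2

theorem axisDist_cyl (p : Fin 3 → ℝ) : cyl p 2 = axisDist p := rfl

theorem cyl_polar {v : Fin 3 → ℝ} (hv : 0 < v 2) : ∃ n : ℤ, cyl (polar v) = v + (n : ℝ) • e 0 :=
  eq_of_polar_eq hv (by rw [axisDist_cyl, axisDist_polar hv.le]; exact hv) (polar_cyl _)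

theorem hasFDerivAt_discC (p : Fin 3 → ℝ) : HasFDerivAt discC
    (Complex.ofRealCLM.comp (ContinuousLinearMap.proj (0 : Fin 3)) +
      Complex.I • Complex.ofRealCLM.comp (ContinuousLinearMap.proj (1 : Fin 3))) p := by
  refine (ContinuousLinearMap.hasFDerivAt _).congr_of_eventuallyEq
    (Filter.Eventually.of_forall fun y => ?_)
  simp [discC, mul_comm]

theorem contDiff_discC : ContDiff ℝ ∞ discC :=
  (Complex.ofRealCLM.contDiff.comp (contDiff_apply ℝ ℝ 0)).add
    ((Complex.ofRealCLM.contDiff.comp (contDiff_apply ℝ ℝ 1)).mul contDiff_const)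

theorem continuous_discC : Continuous discC := by unfold discC; fun_prop

theorem continuous_axisDist : Continuous axisDist := by unfold axisDist; fun_prop

theorem contDiffAt_axisDist {p : Fin 3 → ℝ} (hp : axisDist p ≠ 0) : ContDiffAt ℝ ∞ axisDist p := by
  have h : ContDiffAt ℝ ∞ (fun p : Fin 3 → ℝ => p 0 ^ 2 + p 1 ^ 2) p := by fun_prop
  refine h.sqrt ?_
  rw [← axisDist_sq]; exact pow_ne_zero 2 hp

theorem pd_coord {n : ℕ} (i j : Fin n) (x : Fin n → ℝ) :
    pd i (fun y => y j) x = if i = j then 1 else 0 := by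
  rw [pd, (hasFDerivAt_apply j x).fderiv]
  simp [e, Pi.single_apply, eq_comm]

theorem pd_axisDist {p : Fin 3 → ℝ} (hp : axisDist p ≠ 0) (i : Fin 3) :
    pd i axisDist p = radForm p i := by
  have hd := (contDiffAt_axisDist hp).differentiableAt (by simp)
  have h1 : pd i (fun y => axisDist y * axisDist y) p = 2 * axisDist p * pd i axisDist p := by
    rw [pd_mul_real hd hd]; ring
  have h2 : (fun y => axisDist y * axisDist y) = fun y => y 0 * y 0 + y 1 * y 1 := by
    ext y; rw [← sq, axisDist_sq]; ring
  have hc : ∀ j : Fin 3, DifferentiableAt ℝ (fun y : Fin 3 → ℝ => y j) p := fun j => by fun_prop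
  rw [h2, pd_add (F := fun y => y 0 * y 0) (G := fun y => y 1 * y 1)
    ((hc 0).mul (hc 0)) ((hc 1).mul (hc 1)), pd_mul_real (hc 0) (hc 0),
    pd_mul_real (hc 1) (hc 1), pd_coord, pd_coord] at h1
  fin_cases i <;> simp [radForm] at h1 ⊢
  · field_simp; linarith
  · field_simp; linarith
  · exact h1.resolve_left hp

/-- A smooth local determination of the angle. -/
theorem exists_local_angle {p : Fin 3 → ℝ} (hp : axisDist p ≠ 0) :
    ∃ U : Set (Fin 3 → ℝ), IsOpen U ∧ p ∈ U ∧ (∀ y ∈ U, axisDist y ≠ 0) ∧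
      ∃ a : (Fin 3 → ℝ) → ℝ, ContDiffOn ℝ ∞ a U ∧
        ∀ y ∈ U, polar ![a y, y 2, axisDist y] = y ∧ ∀ i, pd i a y = angForm y i := by
  have hpn : ‖discC p‖ ≠ 0 := by rwa [norm_discC]
  have hp0 : discC p ≠ 0 := norm_ne_zero_iff.1 hpn
  set w := starRingEnd ℂ (discC p) with hw
  have hw0 : w ≠ 0 := by simpa [hw] using hp0
  have hpi : (2 * Real.pi : ℝ) ≠ 0 := by positivity
  -- Multiplication by the conjugate of `discC p` moves `p` to the positive real axis, away from the
  -- branch cut. Adding the argument of `discC p` afterwards restores the angle.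
  let L : (Fin 3 → ℝ) → ℂ := fun y => Complex.log (discC y * w)
  have hs : ∀ y, discC y * w ∈ Complex.slitPlane → axisDist y ≠ 0 := fun y hy h0 => by
    rw [← norm_discC, norm_eq_zero] at h0
    rw [h0, zero_mul] at hy
    exact Complex.zero_notMem_slitPlane hy
  have hL : ∀ y, discC y * w ∈ Complex.slitPlane → HasFDerivAt L ((discC y)⁻¹ •
      (Complex.ofRealCLM.comp (ContinuousLinearMap.proj (0 : Fin 3)) +
      Complex.I • Complex.ofRealCLM.comp (ContinuousLinearMap.proj (1 : Fin 3)))) y := fun y hy => by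
    have h1 : HasFDerivAt (fun y => discC y * w) _ y := (hasFDerivAt_discC y).mul_const w
    have h2 := ((Complex.hasStrictDerivAt_log hy).hasDerivAt.hasFDerivAt.restrictScalars ℝ).comp y h1
    refine h2.congr_fderiv ?_
    ext v
    simp only [ContinuousLinearMap.comp_apply, ContinuousLinearMap.coe_restrictScalars',
      ContinuousLinearMap.toSpanSingleton_apply, smul_apply, smul_eq_mul]
    field_simp
  have hopen : IsOpen {y | discC y * w ∈ Complex.slitPlane} :=
    Complex.isOpen_slitPlane.preimage (continuous_discC.mul continuous_const)
  have hLs : ContDiffOn ℝ ∞ L {y | discC y * w ∈ Complex.slitPlane} := fun y hy => by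
    have h1 : ContDiffAt ℝ ∞ (fun y => discC y * w) y :=
      (contDiff_discC.mul contDiff_const).contDiffAt
    have h2 : ContDiffAt ℝ ∞ Complex.log (discC y * w) :=
      (Complex.contDiffAt_log hy).restrict_scalars ℝ
    exact (h2.comp y h1).contDiffWithinAt
  refine ⟨{y | discC y * w ∈ Complex.slitPlane}, hopen, ?_, hs,
    fun y => (L y).im * (2 * Real.pi)⁻¹ + Complex.arg (discC p) / (2 * Real.pi),
    ((Complex.imCLM.contDiff.comp_contDiffOn hLs).mul contDiffOn_const).add contDiffOn_const,
    fun y hy => ⟨?_, fun i => ?_⟩⟩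
  · show discC p * w ∈ Complex.slitPlane
    rw [hw, Complex.mul_conj, Complex.mem_slitPlane_iff]
    left
    rw [Complex.ofReal_re, Complex.normSq_eq_norm_sq]; positivity
  · rw [polar_eq_iff]
    refine ⟨?_, rfl⟩
    have h1 := Complex.norm_mul_exp_arg_mul_I (discC y * w)
    have h2 := Complex.norm_mul_exp_arg_mul_I (discC p)
    have h3 : ((‖discC p‖ : ℝ) : ℂ) ≠ 0 := by exact_mod_cast hpn
    simp only [Matrix.cons_val_zero, Matrix.cons_val, L, Complex.log_im]
    have h4 : (2 * Real.pi * (((discC y * w).arg * (2 * Real.pi)⁻¹ +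
        (discC p).arg / (2 * Real.pi) : ℝ) : ℂ) * Complex.I) =
        (discC y * w).arg * Complex.I + (discC p).arg * Complex.I := by
      have : (Real.pi : ℂ) ≠ 0 := by exact_mod_cast Real.pi_ne_zero
      push_cast; field_simp
    rw [h4, Complex.exp_add, ← norm_discC]
    rw [norm_mul, hw, RCLike.norm_conj, Complex.ofReal_mul] at h1
    apply mul_left_cancel₀ (mul_ne_zero h3 h3)
    have h5 : starRingEnd ℂ (discC p) * discC p = (‖discC p‖ : ℂ) * ‖discC p‖ := by
      rw [mul_comm, Complex.mul_conj, Complex.normSq_eq_norm_sq]; push_cast; ring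
    rw [hw]
    linear_combination (‖discC p‖ : ℂ) * Complex.exp ((discC p).arg * Complex.I) * h1 +
      (discC y * starRingEnd ℂ (discC p)) * h2 + discC y * h5
  · have hLy := hL y hy
    have h1 : HasFDerivAt (fun y => (L y).im * (2 * Real.pi)⁻¹ + Complex.arg (discC p) / (2 * Real.pi))
        _ y := ((Complex.imCLM.hasFDerivAt.comp y hLy).mul_const (2 * Real.pi)⁻¹).add_const _
    rw [pd, h1.fderiv]
    have hy0 := hs y hy
    obtain ⟨α, hα⟩ : ∃ α, α = y 0 / axisDist y ^ 2 := ⟨_, rfl⟩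
    obtain ⟨β, hβ⟩ : ∃ β, β = y 1 / axisDist y ^ 2 := ⟨_, rfl⟩
    have hn : (discC y)⁻¹ = (α : ℂ) - (β : ℂ) * Complex.I := by
      rw [Complex.inv_def, Complex.normSq_eq_norm_sq, norm_discC, discC, hα, hβ]
      simp; ring
    have ha : angForm y = ![-β * (2 * Real.pi)⁻¹, α * (2 * Real.pi)⁻¹, 0] := by
      rw [angForm, hα, hβ]
      ext j; fin_cases j <;> simp <;> field_simp
    rw [hn, ha]
    fin_cases i <;> simp [e] <;> ring

theorem pd_comp {m n : ℕ} {E : Type*} [NormedAddCommGroup E] [NormedSpace ℝ E]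
    {F : (Fin m → ℝ) → E} {u : (Fin n → ℝ) → Fin m → ℝ} {x : Fin n → ℝ}
    (hF : DifferentiableAt ℝ F (u x)) (hu : ∀ j, DifferentiableAt ℝ (fun y => u y j) x) (i : Fin n) :
    pd i (fun y => F (u y)) x = ∑ j, pd i (fun y => u y j) x • pd j F (u x) := by
  have hu' : HasFDerivAt u (ContinuousLinearMap.pi fun j => fderiv ℝ (fun y => u y j) x) x :=
    hasFDerivAt_pi.2 fun j => (hu j).hasFDerivAt
  have h1 : HasFDerivAt (fun y => F (u y)) _ x := hF.hasFDerivAt.comp x hu'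
  rw [pd, h1.fderiv, ContinuousLinearMap.comp_apply, fderiv_eq_sum_pd]
  rfl

/-! ### The metric of the tube away from the axis. -/

/-- The data of a tube: `q = π / ℓ`, the flat structure `(ℓ, τ + iκ)` of the boundary, and an
isotopy `G (x₀, x₁, s)` from the identity of the plane, constant for `s ≤ 1/2`. -/
structure TubeData where
  q : ℝ
  ℓ : ℝ
  τ : ℝ
  κ : ℝ
  G : (Fin 3 → ℝ) → ℂ
  q_pos : 0 < q
  q_lt : q < 1 / 2
  q_mul : q * ℓ = Real.pi
  κ_pos : 0 < κ
  smooth : ContDiff ℝ ∞ G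
  add_e_zero : ∀ v, G (v + e 0) = G v + 1
  add_e_one : ∀ v, G (v + e 1) = G v + Complex.I
  jac_pos : ∀ v, 0 < (starRingEnd ℂ (pd 0 G v) * pd 1 G v).im
  eq_of_le : ∀ v, v 2 ≤ 1 / 2 → G v = v 0 + v 1 * Complex.I

namespace TubeData

variable (T : TubeData)

theorem ℓ_pos : 0 < T.ℓ := by
  have := T.q_mul
  have h : 0 < T.q * T.ℓ := by rw [this]; exact Real.pi_pos
  exact pos_of_mul_pos_right h T.q_pos.le

theorem differentiable : Differentiable ℝ T.G := T.smooth.differentiable (by simp)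

/-- Derivative of the distance coordinate with respect to the Euclidean radius. -/
def speed (ρ : ℝ) : ℝ := slope T.q / Real.sqrt (1 + (slope T.q * ρ) ^ 2)

theorem speed_pos (ρ : ℝ) : 0 < T.speed ρ :=
  div_pos (slope_pos T.q_pos T.q_lt) (Real.sqrt_pos.2 (by positivity))

/-- The differential of the isotopy in Cartesian coordinates. -/
def twist (p : Fin 3 → ℝ) (i : Fin 3) : ℂ :=
  (angForm p i : ℂ) * pd 0 T.G (cyl p) + (if i = 2 then 1 else 0) * pd 1 T.G (cyl p) +
    (radForm p i : ℂ) * pd 2 T.G (cyl p)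

/-- The differential of the distance coordinate. -/
def formR (p : Fin 3 → ℝ) (i : Fin 3) : ℝ := T.speed (axisDist p) * radForm p i

/-- The differential of the first flat coordinate. -/
def formA (p : Fin 3 → ℝ) (i : Fin 3) : ℝ := T.ℓ * (T.twist p i).re + T.τ * (T.twist p i).im

/-- The differential of the second flat coordinate. -/
def formB (p : Fin 3 → ℝ) (i : Fin 3) : ℝ := T.κ * (T.twist p i).im

/-- The distance coordinate. -/
def height (p : Fin 3 → ℝ) : ℝ := radial T.q (axisDist p)

/-- The metric of the tube away from the axis. -/
def outerMetric (p : Fin 3 → ℝ) : Matrix (Fin 3) (Fin 3) ℝ := Matrix.of fun i j =>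
  T.formR p i * T.formR p j +
    profileF T.q (T.height p) ^ 2 * (T.formA p i * T.formA p j) +
    profileK T.q (T.height p) ^ 2 * (T.formB p i * T.formB p j)

theorem pd_add_zsmul (j : Fin 3) (n : ℤ) (v : Fin 3 → ℝ) :
    pd j T.G (v + (n : ℝ) • e 0) = pd j T.G v := by
  have : Function.Periodic (pd j T.G) (e 0) := fun v => pd_add_period T.add_e_zero j v
  rw [Int.cast_smul_eq_zsmul]
  exact this.zsmul n v

/-- The flat coordinates are built from the isotopy at a local angle. Another choice of angle adds
an integer, under which the derivatives of `G` are invariant. The differentials are therefore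
globally defined off the axis although the coordinates are not. -/
theorem exists_local_coordinates {p : Fin 3 → ℝ} (hp : axisDist p ≠ 0) :
    ∃ U : Set (Fin 3 → ℝ), IsOpen U ∧ p ∈ U ∧ (∀ y ∈ U, axisDist y ≠ 0) ∧
      ∃ c : Fin 3 → (Fin 3 → ℝ) → ℝ, (∀ a, ContDiffOn ℝ ∞ (c a) U) ∧ c 0 = T.height ∧
        ∀ y ∈ U, ∀ i, pd i (c 0) y = T.formR y i ∧ pd i (c 1) y = T.formA y i ∧
          pd i (c 2) y = T.formB y i := by
  obtain ⟨U, hU, hpU, hU0, a, ha, hay⟩ := exists_local_angle hp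
  have hdist : ContDiffOn ℝ ∞ axisDist U := fun y hy => (contDiffAt_axisDist (hU0 y hy)).contDiffWithinAt
  let u : (Fin 3 → ℝ) → Fin 3 → ℝ := fun y => ![a y, y 2, axisDist y]
  have hu : ContDiffOn ℝ ∞ u U := contDiffOn_pi.2 fun j => by
    fin_cases j
    · exact ha
    · exact (contDiff_apply ℝ ℝ 2).contDiffOn
    · exact hdist
  have hb : ContDiffOn ℝ ∞ (fun y => T.G (u y)) U := T.smooth.comp_contDiffOn hu
  have hd : ∀ {E : Type} [NormedAddCommGroup E] [NormedSpace ℝ E] {F : (Fin 3 → ℝ) → E},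
      ContDiffOn ℝ ∞ F U → ∀ y ∈ U, DifferentiableAt ℝ F y := fun hF y hy =>
    (hF.contDiffAt (hU.mem_nhds hy)).differentiableAt (by simp)
  have hcyl : ∀ y ∈ U, ∀ j, pd j T.G (u y) = pd j T.G (cyl y) := fun y hy j => by
    have hpos : 0 < axisDist y := (Real.sqrt_nonneg _).lt_of_ne' (hU0 y hy)
    obtain ⟨n, hn⟩ := eq_of_polar_eq (v := cyl y) (v' := u y) hpos hpos
      ((hay y hy).1.trans (polar_cyl y).symm)
    rw [hn, pd_add_zsmul]
  have hpb : ∀ y ∈ U, ∀ i, pd i (fun y => T.G (u y)) y = T.twist y i := fun y hy i => by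
    rw [pd_comp (T.differentiable _) (fun j => hd (contDiffOn_pi.1 hu j) y hy), Fin.sum_univ_three,
      hcyl y hy, hcyl y hy, hcyl y hy, twist]
    have e0 : pd i (fun y => u y 0) y = angForm y i := (hay y hy).2 i
    have e1 : pd i (fun y => u y 1) y = if i = 2 then 1 else 0 := pd_coord i 2 y
    have e2 : pd i (fun y => u y 2) y = radForm y i := pd_axisDist (hU0 y hy) i
    rw [e0, e1, e2]
    simp only [Complex.real_smul]
    split_ifs <;> simp
  have hre : ContDiffOn ℝ ∞ (fun y => (T.G (u y)).re) U := Complex.reCLM.contDiff.comp_contDiffOn hb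
  have him : ContDiffOn ℝ ∞ (fun y => (T.G (u y)).im) U := Complex.imCLM.contDiff.comp_contDiffOn hb
  let c : Fin 3 → (Fin 3 → ℝ) → ℝ := ![T.height, fun y => T.ℓ * (T.G (u y)).re + T.τ * (T.G (u y)).im,
    fun y => T.κ * (T.G (u y)).im]
  have hmul : ∀ {F : (Fin 3 → ℝ) → ℝ} {y : Fin 3 → ℝ} (m : ℝ), DifferentiableAt ℝ F y → ∀ i,
      pd i (fun z => m * F z) y = m * pd i F y := fun m hF i => by
    rw [pd_mul_real (differentiableAt_const _) hF, pd_const]; ring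
  refine ⟨U, hU, hpU, hU0, c, fun j => ?_, rfl, fun y hy i => ⟨?_, ?_, ?_⟩⟩
  · fin_cases j
    · exact (contDiff_radial T.q).comp_contDiffOn hdist
    · exact (contDiffOn_const.mul hre).add (contDiffOn_const.mul him)
    · exact contDiffOn_const.mul him
  · show pd i (fun y => radial T.q (axisDist y)) y = _
    rw [pd_comp_real (φ := radial T.q) ((contDiff_radial T.q).differentiable (by simp))
      (hd hdist y hy), (hasDerivAt_radial T.q _).deriv, pd_axisDist (hU0 y hy)]
    rfl
  · show pd i (fun y => T.ℓ * (T.G (u y)).re + T.τ * (T.G (u y)).im) y = _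
    rw [pd_add ((hd hre y hy).const_mul _) ((hd him y hy).const_mul _), hmul _ (hd hre y hy),
      hmul _ (hd him y hy), pd_re (hd hb y hy), pd_im (hd hb y hy), hpb y hy]
    rfl
  · show pd i (fun y => T.κ * (T.G (u y)).im) y = _
    rw [hmul _ (hd him y hy), pd_im (hd hb y hy), hpb y hy]
    rfl

/-- The Jacobian of the isotopy at fixed time. -/
def jacG (v : Fin 3 → ℝ) : ℝ := (starRingEnd ℂ (pd 0 T.G v) * pd 1 T.G v).im

/-- The determinant of the coordinate differentials. -/
theorem det_forms {p : Fin 3 → ℝ} (hp : axisDist p ≠ 0) :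
    (Matrix.of ![T.formR p, T.formA p, T.formB p]).det =
      T.speed (axisDist p) * (T.ℓ * T.κ) * T.jacG (cyl p) / (2 * Real.pi * axisDist p) := by
  have h1 : (Matrix.of ![T.formR p, T.formA p, T.formB p]).det = T.speed (axisDist p) *
      (T.ℓ * T.κ) * T.jacG (cyl p) * (radForm p 0 * angForm p 1 - radForm p 1 * angForm p 0) := by
    have r2 : radForm p 2 = 0 := rfl
    have a2 : angForm p 2 = 0 := rfl
    rw [Matrix.det_fin_three, jacG]
    simp [formR, formA, formB, twist, r2, a2]
    ring
  have h2 : radForm p 0 * angForm p 1 - radForm p 1 * angForm p 0 =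
      1 / (2 * Real.pi * axisDist p) := by
    have hpi := Real.pi_ne_zero
    simp only [radForm, angForm, Matrix.cons_val_zero, Matrix.cons_val_one]
    field_simp
    rw [axisDist_sq]; ring
  rw [h1, h2, mul_one_div]

theorem exists_frame {p : Fin 3 → ℝ} (hp : axisDist p ≠ 0) :
    ∃ U : Set (Fin 3 → ℝ), IsOpen U ∧ p ∈ U ∧ (∀ y ∈ U, axisDist y ≠ 0) ∧
      ∃ c : Fin 3 → (Fin 3 → ℝ) → ℝ, (∀ a, ContDiffOn ℝ ∞ (c a) U) ∧ c 0 = T.height ∧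
        (∀ y ∈ U, (jacMatrix c y).det =
          T.speed (axisDist y) * (T.ℓ * T.κ) * T.jacG (cyl y) / (2 * Real.pi * axisDist y)) ∧
        ∀ y ∈ U, ∀ i j, T.outerMetric y i j = pd i (c 0) y * pd j (c 0) y +
          profileF T.q (c 0 y) ^ 2 * (pd i (c 1) y * pd j (c 1) y) +
          profileK T.q (c 0 y) ^ 2 * (pd i (c 2) y * pd j (c 2) y) := by
  obtain ⟨U, hU, hpU, hU0, c, hc, hc0, hpd⟩ := T.exists_local_coordinates hp
  refine ⟨U, hU, hpU, hU0, c, hc, hc0, fun y hy => ?_, fun y hy i j => ?_⟩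
  · rw [← T.det_forms (hU0 y hy)]
    congr 1
    ext a i
    fin_cases a
    · exact (hpd y hy i).1
    · exact (hpd y hy i).2.1
    · exact (hpd y hy i).2.2
  · rw [outerMetric, Matrix.of_apply, (hpd y hy i).1, (hpd y hy i).2.1, (hpd y hy i).2.2,
      (hpd y hy j).1, (hpd y hy j).2.1, (hpd y hy j).2.2, hc0]

theorem axisDist_pos {p : Fin 3 → ℝ} (hp : axisDist p ≠ 0) : 0 < axisDist p :=
  (Real.sqrt_nonneg _).lt_of_ne' hp

theorem profileF_height_pos {p : Fin 3 → ℝ} (hp : axisDist p ≠ 0) :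
    0 < profileF T.q (T.height p) :=
  profileF_pos T.q_pos (log_lt_radial T.q_pos T.q_lt (axisDist_pos hp))

theorem det_pos {p : Fin 3 → ℝ} (hp : axisDist p ≠ 0) :
    0 < T.speed (axisDist p) * (T.ℓ * T.κ) * T.jacG (cyl p) / (2 * Real.pi * axisDist p) :=
  div_pos (mul_pos (mul_pos (T.speed_pos _) (mul_pos T.ℓ_pos T.κ_pos)) (T.jac_pos _))
    (mul_pos (by positivity) (axisDist_pos hp))

/-- `cyl` jumps where the argument does, so smoothness is obtained from the local coordinates
instead. -/
theorem contDiffAt_outerMetric {p : Fin 3 → ℝ} (hp : axisDist p ≠ 0) (i j : Fin 3) :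
    ContDiffAt ℝ ∞ (fun y => T.outerMetric y i j) p := by
  obtain ⟨U, hU, hpU, -, c, hc, -, -, hg⟩ := T.exists_frame hp
  have h : ContDiffOn ℝ ∞ (fun y => T.outerMetric y i j) U := by
    refine ContDiffOn.congr ?_ fun y hy => hg y hy i j
    have hp := fun a i => (hc a).pd hU i
    exact (((hp 0 i).mul (hp 0 j)).add ((((contDiff_profileF T.q).comp_contDiffOn (hc 0)).pow 2).mul
      ((hp 1 i).mul (hp 1 j)))).add ((((contDiff_profileK T.q).comp_contDiffOn (hc 0)).pow 2).mul
      ((hp 2 i).mul (hp 2 j)))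
  exact h.contDiffAt (hU.mem_nhds hpU)

theorem posDef_outerMetric {p : Fin 3 → ℝ} (hp : axisDist p ≠ 0) : (T.outerMetric p).PosDef := by
  obtain ⟨U, hU, hpU, -, c, hc, hc0, hdet, hg⟩ := T.exists_frame hp
  have h := warped_metric hg hpU
  have hd : (warpedFrame c (profileF T.q) (profileK T.q) p).det ≠ 0 := by
    rw [det_warpedFrame, hdet p hpU, hc0]
    exact mul_ne_zero (mul_ne_zero (T.profileF_height_pos hp).ne' (profileK_pos _ _).ne')
      (T.det_pos hp).ne'
  rw [h]
  have := Matrix.PosDef.conjTranspose_mul_self (warpedFrame c (profileF T.q) (profileK T.q) p)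
    (Matrix.mulVec_injective_of_isUnit ((Matrix.isUnit_iff_isUnit_det _).2 (isUnit_iff_ne_zero.2 hd)))
  simpa using this

theorem det_outerMetric {p : Fin 3 → ℝ} (hp : axisDist p ≠ 0) : (T.outerMetric p).det =
    (profileF T.q (T.height p) * profileK T.q (T.height p) * (T.speed (axisDist p) *
      (T.ℓ * T.κ) * T.jacG (cyl p) / (2 * Real.pi * axisDist p))) ^ 2 := by
  obtain ⟨U, hU, hpU, -, c, hc, hc0, hdet, hg⟩ := T.exists_frame hp
  rw [warped_metric hg hpU, Matrix.det_mul, Matrix.det_transpose, det_warpedFrame, hdet p hpU, hc0]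
  ring

/-- The isotopy only changes which functions serve as coordinates in the warped product, so the
curvature depends on the height alone. -/
theorem scalarCurvature_outerMetric {S : Set (Fin 3 → ℝ)} {p : Fin 3 → ℝ} (hp : axisDist p ≠ 0)
    (hS : S ∈ 𝓝 p) {g : MetricField 3} (hg : ∀ y, axisDist y ≠ 0 → g y = T.outerMetric y) :
    scalarCurvature S g p = -6 * curvatureRatio (profileF T.q) (profileK T.q) (T.height p) := by
  obtain ⟨U, hU, hpU, hU0, c, hc, hc0, hdet, hgU⟩ := T.exists_frame hp
  obtain ⟨V, hVS, hV, hpV⟩ := mem_nhds_iff.1 hS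
  have hm : U ∩ V ⊆ U := Set.inter_subset_left
  have := scalarCurvature_warped (S := S) (g := g) (c := c) (hU.inter hV)
    (Set.inter_subset_right.trans hVS) (fun a => (hc a).mono hm) (contDiff_profileF T.q)
    (contDiff_profileK T.q)
    (fun y hy => by rw [hc0]; exact (T.profileF_height_pos (hU0 y hy.1)).ne')
    (fun y _ => (profileK_pos _ _).ne')
    (fun y hy => by rw [hdet y hy.1]; exact (T.det_pos (hU0 y hy.1)).ne')
    (fun y hy i j => by rw [hg y (hU0 y hy.1)]; exact hgU y hy.1 i j) ⟨hpU, hpV⟩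
  rw [this, curvatureRatio, hc0]; ring

end TubeData

/-! ### Smoothness across the axis. -/

namespace TubeData

variable (T : TubeData)

/-- The metric of the tube near the axis. -/
def coreMetric (p : Fin 3 → ℝ) : Matrix (Fin 3) (Fin 3) ℝ :=
  let c := slope T.q
  let D := 1 + c ^ 2 * (p 0 ^ 2 + p 1 ^ 2)
  !![c ^ 2 * (1 + c ^ 2 * p 1 ^ 2) * D⁻¹, -(c ^ 4 * (p 0 * p 1)) * D⁻¹, -(c ^ 2 * (2 * T.q * T.τ) * p 1);
    -(c ^ 4 * (p 0 * p 1)) * D⁻¹, c ^ 2 * (1 + c ^ 2 * p 0 ^ 2) * D⁻¹, c ^ 2 * (2 * T.q * T.τ) * p 0;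
    -(c ^ 2 * (2 * T.q * T.τ) * p 1), c ^ 2 * (2 * T.q * T.τ) * p 0,
      c ^ 2 * (2 * T.q * T.τ) ^ 2 * (p 0 ^ 2 + p 1 ^ 2) + (2 * T.q * T.κ) ^ 2 * D]

/-- The metric of the tube. -/
def metric : MetricField 3 := fun p =>
  open Classical in if axisDist p = 0 then T.coreMetric p else T.outerMetric p

theorem metric_of_ne {p : Fin 3 → ℝ} (hp : axisDist p ≠ 0) : T.metric p = T.outerMetric p :=
  if_neg hp

/-- Here the isotopy is trivial and sinh(r − log q) = cρ with c the slope, so f = 2qcρ and k = 2q√(1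
+ c²ρ²). As qℓ = π, the length factor turns f da into cρ(dθ + 2qτ dz), where θ is the angle in
radians. The 1/ρ² singularities then cancel and rational entries remain. -/
theorem outerMetric_eq_coreMetric {p : Fin 3 → ℝ} (hp : axisDist p ≠ 0) (h1 : axisDist p < 1 / 2)
    (h2 : T.height p ≤ -(1 / 2)) : T.outerMetric p = T.coreMetric p := by
  have hG : ∀ y ∈ {v : Fin 3 → ℝ | v 2 < 1 / 2}, T.G y = y 0 + y 1 * Complex.I := fun y hy =>
    T.eq_of_le y (le_of_lt hy)
  have hopen : IsOpen {v : Fin 3 → ℝ | v 2 < 1 / 2} := isOpen_Iio.preimage (continuous_apply 2)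
  have hpG : ∀ i, pd i T.G (cyl p) =
      (if i = 0 then 1 else 0) + (if i = 1 then 1 else 0) * Complex.I := fun i => by
    have hd : ∀ j : Fin 3, DifferentiableAt ℝ (fun y : Fin 3 → ℝ => y j) (cyl p) := fun j => by
      fun_prop
    have hdC : ∀ j : Fin 3, DifferentiableAt ℝ (fun y : Fin 3 → ℝ => ((y j : ℝ) : ℂ)) (cyl p) :=
      fun j => Complex.ofRealCLM.differentiableAt.comp _ (hd j)
    have hI : (fun y : Fin 3 → ℝ => (y 0 : ℂ) + y 1 * Complex.I) =
        fun y => (y 0 : ℂ) + Complex.I * y 1 := by ext y; ring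
    rw [pd_congr hopen hG h1, hI, pd_add (hdC 0) ((hdC 1).const_mul _), pd_const_mul (hdC 1),
      pd_ofReal (hd 0), pd_ofReal (hd 1), pd_coord, pd_coord]
    split_ifs <;> simp
  have htw : ∀ i, T.twist p i = angForm p i + (if i = 2 then 1 else 0) * Complex.I := fun i => by
    rw [twist, hpG, hpG, hpG]; simp
  set c := slope T.q with hc
  set N := p 0 ^ 2 + p 1 ^ 2 with hN
  have hN2 : axisDist p ^ 2 = N := axisDist_sq p
  have hN0 : N ≠ 0 := by rw [← hN2]; exact pow_ne_zero 2 hp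
  have hs : Real.sqrt (1 + (c * axisDist p) ^ 2) ^ 2 = 1 + c ^ 2 * N := by
    rw [Real.sq_sqrt (by positivity), mul_pow, hN2]
  have hsp : T.speed (axisDist p) ^ 2 = c ^ 2 / (1 + c ^ 2 * N) := by
    rw [speed, div_pow, hs]
  have hF : profileF T.q (T.height p) = 2 * T.q * (c * axisDist p) := by
    rw [profileF, cutoffExp_of_le h2, height, exp_neg_radial T.q_pos, exp_radial T.q_pos]; ring
  have hK : profileK T.q (T.height p) = 2 * T.q * Real.sqrt (1 + (c * axisDist p) ^ 2) := by
    rw [profileK, cutoffExp_of_le h2, height, exp_neg_radial T.q_pos, exp_radial T.q_pos]; ring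
  let a : Fin 3 → ℝ := ![-p 1 / N, p 0 / N, 2 * T.q * T.τ]
  have hA : ∀ i, 2 * T.q * T.formA p i = a i := fun i => by
    have hpi := Real.pi_ne_zero
    have hq : T.q * T.ℓ = Real.pi := T.q_mul
    have h1 : (T.twist p i).re = angForm p i := by rw [htw]; split_ifs <;> simp
    have h2 : (T.twist p i).im = if i = 2 then 1 else 0 := by rw [htw]; split_ifs <;> simp
    rw [formA, h1, h2]
    fin_cases i
    · simp only [a, angForm, hN2]; simp; field_simp; linear_combination -p 1 * hq
    · simp only [a, angForm, hN2]; simp; field_simp; linear_combination p 0 * hq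
    · simp [a, angForm]
  have hB : ∀ i, T.formB p i = if i = 2 then T.κ else 0 := fun i => by
    rw [formB, htw]; split_ifs <;> simp
  let P : Fin 3 → ℝ := ![p 0, p 1, 0]
  have hR : ∀ i, radForm p i = P i / axisDist p := fun i => by
    fin_cases i <;> simp [radForm, P]
  have hD : 1 + c ^ 2 * N ≠ 0 := by positivity
  have key : ∀ i j, T.outerMetric p i j = c ^ 2 / (1 + c ^ 2 * N) * (P i * P j / N) +
      c ^ 2 * N * (a i * a j) + 4 * T.q ^ 2 * (1 + c ^ 2 * N) *
        ((if i = 2 then T.κ else 0) * if j = 2 then T.κ else 0) := fun i j => by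
    rw [outerMetric, Matrix.of_apply, formR, formR, hR, hR, hF, hK, hB, hB, ← hA, ← hA, ← hsp, ← hs,
      ← hN2]
    field_simp
    ring
  ext i j
  rw [key]
  have hN' : p 0 ^ 2 + p 1 ^ 2 ≠ 0 := hN0
  have hD' : 1 + c ^ 2 * (p 0 ^ 2 + p 1 ^ 2) ≠ 0 := hD
  fin_cases i <;> fin_cases j <;> simp [coreMetric, a, P, hN, ← hc] <;> field_simp <;> ring

/-- The metric agrees with `coreMetric` near the axis. -/
theorem exists_core : ∃ ε > 0, ∀ p, axisDist p < ε → T.metric p = T.coreMetric p := by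
  -- The core lies at log q < −log 2 < −1/2; this is where q < 1/2 keeps it below the transition of
  -- the profiles.
  have h0 : radial T.q 0 < -(1 / 2) := by
    have h1 : Real.log T.q < Real.log (1 / 2) := Real.log_lt_log T.q_pos T.q_lt
    have h2 : Real.log (1 / 2) = -Real.log 2 := by rw [one_div, Real.log_inv]
    have h3 := Real.log_two_gt_d9
    rw [radial, mul_zero, Real.arsinh_zero, add_zero]; linarith
  obtain ⟨ε, hε, hball⟩ := Metric.eventually_nhds_iff.1
    ((contDiff_radial T.q).continuous.continuousAt.eventually (gt_mem_nhds h0))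
  refine ⟨min ε (1 / 2), by positivity, fun p hp => ?_⟩
  rw [lt_min_iff] at hp
  by_cases h : axisDist p = 0
  · exact if_pos h
  · rw [T.metric_of_ne h]
    refine T.outerMetric_eq_coreMetric h hp.2 (hball ?_).le
    rw [Real.dist_eq, sub_zero, abs_of_pos (axisDist_pos h)]; exact hp.1

theorem contDiff_coreMetric (i j : Fin 3) : ContDiff ℝ ∞ fun p => T.coreMetric p i j := by
  have h0 : ContDiff ℝ ∞ fun p : Fin 3 → ℝ => p 0 := contDiff_apply ℝ ℝ 0
  have h1 : ContDiff ℝ ∞ fun p : Fin 3 → ℝ => p 1 := contDiff_apply ℝ ℝ 1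
  have hD : ContDiff ℝ ∞ fun p : Fin 3 → ℝ => 1 + slope T.q ^ 2 * (p 0 ^ 2 + p 1 ^ 2) := by fun_prop
  have hDi := hD.inv fun p => (by positivity : 1 + slope T.q ^ 2 * (p 0 ^ 2 + p 1 ^ 2) ≠ 0)
  have e0 : ContDiff ℝ ∞ fun p : Fin 3 → ℝ => slope T.q ^ 2 * (1 + slope T.q ^ 2 * p 1 ^ 2) := by
    fun_prop
  have e1 : ContDiff ℝ ∞ fun p : Fin 3 → ℝ => -(slope T.q ^ 4 * (p 0 * p 1)) := by fun_prop
  have e2 : ContDiff ℝ ∞ fun p : Fin 3 → ℝ => slope T.q ^ 2 * (1 + slope T.q ^ 2 * p 0 ^ 2) := by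
    fun_prop
  have e3 : ContDiff ℝ ∞ fun p : Fin 3 → ℝ => -(slope T.q ^ 2 * (2 * T.q * T.τ) * p 1) := by
    fun_prop
  have e4 : ContDiff ℝ ∞ fun p : Fin 3 → ℝ => slope T.q ^ 2 * (2 * T.q * T.τ) * p 0 := by
    fun_prop
  have e5 : ContDiff ℝ ∞ fun p : Fin 3 → ℝ => slope T.q ^ 2 * (2 * T.q * T.τ) ^ 2 *
      (p 0 ^ 2 + p 1 ^ 2) + (2 * T.q * T.κ) ^ 2 * (1 + slope T.q ^ 2 * (p 0 ^ 2 + p 1 ^ 2)) := by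
    fun_prop
  fin_cases i <;> fin_cases j
  exacts [e0.mul hDi, e1.mul hDi, e3, e1.mul hDi, e2.mul hDi, e4, e3, e4, e5]

theorem contDiffAt_metric (p : Fin 3 → ℝ) (i j : Fin 3) :
    ContDiffAt ℝ ∞ (fun y => T.metric y i j) p := by
  by_cases h : axisDist p = 0
  · obtain ⟨ε, hε, hcore⟩ := T.exists_core
    refine (T.contDiff_coreMetric i j).contDiffAt.congr_of_eventuallyEq ?_
    have : {y | axisDist y < ε} ∈ 𝓝 p :=
      (isOpen_Iio.preimage continuous_axisDist).mem_nhds (by simpa [h] using hε)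
    exact Filter.eventuallyEq_of_mem this fun y hy => by simp only [hcore y hy]
  · refine (T.contDiffAt_outerMetric h i j).congr_of_eventuallyEq ?_
    have : {y | axisDist y ≠ 0} ∈ 𝓝 p := (isOpen_ne.preimage continuous_axisDist).mem_nhds h
    exact Filter.eventuallyEq_of_mem this fun y hy => by simp only [T.metric_of_ne hy]

theorem posDef_metric (p : Fin 3 → ℝ) : (T.metric p).PosDef := by
  by_cases h : axisDist p = 0
  · have hsq := axisDist_sq p
    rw [h] at hsq
    have h0 : p 0 = 0 := by nlinarith [sq_nonneg (p 0), sq_nonneg (p 1)]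
    have h1 : p 1 = 0 := by nlinarith [sq_nonneg (p 0), sq_nonneg (p 1)]
    have hc := slope_pos T.q_pos T.q_lt
    have hq := T.q_pos
    have hκ := T.κ_pos
    have : T.metric p = Matrix.diagonal ![slope T.q ^ 2, slope T.q ^ 2, (2 * T.q * T.κ) ^ 2] := by
      rw [metric, if_pos h]
      ext i j
      fin_cases i <;> fin_cases j <;> simp [coreMetric, h0, h1]
    rw [this]
    refine Matrix.PosDef.diagonal fun i => ?_
    fin_cases i
    · show 0 < slope T.q ^ 2; positivity
    · show 0 < slope T.q ^ 2; positivity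
    · show 0 < (2 * T.q * T.κ) ^ 2; positivity
  · rw [T.metric_of_ne h]; exact T.posDef_outerMetric h

theorem metric_add_e_two (p : Fin 3 → ℝ) : T.metric (p + e 2) = T.metric p := by
  have h0 : (p + e 2 : Fin 3 → ℝ) 0 = p 0 := by simp [e]
  have h1 : (p + e 2 : Fin 3 → ℝ) 1 = p 1 := by simp [e]
  have hd : axisDist (p + e 2) = axisDist p := by rw [axisDist, axisDist, h0, h1]
  have hz : discC (p + e 2) = discC p := by rw [discC, discC, h0, h1]
  have hcyl : cyl (p + e 2) = cyl p + e 1 := by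
    rw [cyl, hz, hd, cyl]
    ext i; fin_cases i <;> simp [e]
  have hG : ∀ i, pd i T.G (cyl (p + e 2)) = pd i T.G (cyl p) := fun i => by
    rw [hcyl]; exact pd_add_period T.add_e_one i _
  have ha : angForm (p + e 2) = angForm p := by rw [angForm, angForm, hd, h0, h1]
  have hr : radForm (p + e 2) = radForm p := by rw [radForm, radForm, hd, h0, h1]
  simp only [metric, hd, coreMetric, h0, h1, outerMetric, formR, formA, formB, twist, ha, hr, hG,
    height]

theorem isSolidTorusMetric : IsSolidTorusMetric T.metric where
  isMetric := ⟨fun i j p _ => (T.contDiffAt_metric p i j).contDiffWithinAt,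
    fun p _ => T.posDef_metric p⟩
  periodic p _ := T.metric_add_e_two p

end TubeData

/-! ### The cusp collar of the boundary. -/

/-- The partial derivatives of `polar`. -/
def polarD (v : Fin 3 → ℝ) : Matrix (Fin 3) (Fin 3) ℝ :=
  !![-(2 * Real.pi * v 2 * Real.sin (2 * Real.pi * v 0)),
      2 * Real.pi * v 2 * Real.cos (2 * Real.pi * v 0), 0;
    0, 0, 1;
    Real.cos (2 * Real.pi * v 0), Real.sin (2 * Real.pi * v 0), 0]

theorem contDiff_polar (a : Fin 3) : ContDiff ℝ ∞ fun v => polar v a := by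
  have h0 : ContDiff ℝ ∞ fun v : Fin 3 → ℝ => v 0 := contDiff_apply ℝ ℝ 0
  have h2 : ContDiff ℝ ∞ fun v : Fin 3 → ℝ => v 2 := contDiff_apply ℝ ℝ 2
  fin_cases a
  · exact h2.mul (Real.contDiff_cos.comp (contDiff_const.mul h0))
  · exact h2.mul (Real.contDiff_sin.comp (contDiff_const.mul h0))
  · exact contDiff_apply ℝ ℝ 1

theorem pd_polar (v : Fin 3 → ℝ) (i a : Fin 3) : pd i (fun v => polar v a) v = polarD v i a := by
  have hc : HasDerivAt (fun t => Real.cos (2 * Real.pi * t))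
      (-Real.sin (2 * Real.pi * v 0) * (2 * Real.pi * 1)) (v 0) :=
    ((hasDerivAt_id (v 0)).const_mul (2 * Real.pi)).cos
  have hs : HasDerivAt (fun t => Real.sin (2 * Real.pi * t))
      (Real.cos (2 * Real.pi * v 0) * (2 * Real.pi * 1)) (v 0) :=
    ((hasDerivAt_id (v 0)).const_mul (2 * Real.pi)).sin
  have h : ∀ j, DifferentiableAt ℝ (fun v : Fin 3 → ℝ => v j) v := fun j => by fun_prop
  have h0 : pd i (fun v : Fin 3 → ℝ => v 2 * Real.cos (2 * Real.pi * v 0)) v = polarD v i 0 := by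
    rw [pd_mul_real (F := fun v : Fin 3 → ℝ => v 2)
      (G := fun v : Fin 3 → ℝ => Real.cos (2 * Real.pi * v 0)) (h 2) (by fun_prop),
      pd_comp_real (φ := fun t => Real.cos (2 * Real.pi * t)) (u := fun v : Fin 3 → ℝ => v 0)
        (by fun_prop) (h 0), hc.deriv, pd_coord, pd_coord]
    fin_cases i <;> simp [polarD]; ring
  have h1 : pd i (fun v : Fin 3 → ℝ => v 2 * Real.sin (2 * Real.pi * v 0)) v = polarD v i 1 := by
    rw [pd_mul_real (F := fun v : Fin 3 → ℝ => v 2)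
      (G := fun v : Fin 3 → ℝ => Real.sin (2 * Real.pi * v 0)) (h 2) (by fun_prop),
      pd_comp_real (φ := fun t => Real.sin (2 * Real.pi * t)) (u := fun v : Fin 3 → ℝ => v 0)
        (by fun_prop) (h 0), hs.deriv, pd_coord, pd_coord]
    fin_cases i <;> simp [polarD]; ring
  have h2 : pd i (fun v : Fin 3 → ℝ => v 1) v = polarD v i 2 := by
    rw [pd_coord]; fin_cases i <;> simp [polarD]
  fin_cases a
  exacts [h0, h1, h2]

/-- The radial and angular forms are dual to the polar frame; `X` is a tangent vector in cylindrical
coordinates. -/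
theorem polarD_forms {v : Fin 3 → ℝ} (hv : 0 < v 2) (X : Fin 3 → ℝ) :
    ∑ a, radForm (polar v) a * ∑ j, X j * polarD v j a = X 2 ∧
      ∑ a, angForm (polar v) a * ∑ j, X j * polarD v j a = X 0 := by
  have hd := axisDist_polar hv.le
  have hcs := Real.cos_sq_add_sin_sq (2 * Real.pi * v 0)
  have hpi := Real.pi_ne_zero
  constructor
  · simp only [Fin.sum_univ_three, radForm, hd]
    simp [polarD, polar]
    field_simp
    linear_combination X 2 * hcs
  · simp only [Fin.sum_univ_three, angForm, hd]
    simp [polarD, polar]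
    field_simp
    linear_combination 2 * Real.pi * v 2 * X 0 * hcs

namespace TubeData

variable (T : TubeData)

theorem twist_polarD {v : Fin 3 → ℝ} (hv : 0 < v 2) (X : Fin 3 → ℝ) :
    ∑ a, ((∑ j, X j * polarD v j a : ℝ) : ℂ) * T.twist (polar v) a = ∑ j, (X j : ℂ) * pd j T.G v := by
  obtain ⟨n, hn⟩ := cyl_polar hv
  obtain ⟨hr, ha⟩ := polarD_forms hv X
  have hz : ∑ j, X j * polarD v j 2 = X 1 := by simp [Fin.sum_univ_three, polarD]
  simp only [twist, hn, T.pd_add_zsmul]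
  have hr' := congrArg (fun t : ℝ => (t : ℂ)) hr
  have ha' := congrArg (fun t : ℝ => (t : ℂ)) ha
  have hz' := congrArg (fun t : ℝ => (t : ℂ)) hz
  simp only [Fin.sum_univ_three (f := fun a => radForm (polar v) a * _),
    Fin.sum_univ_three (f := fun a => angForm (polar v) a * _), Complex.ofReal_add,
    Complex.ofReal_mul] at hr' ha'
  rw [Fin.sum_univ_three, Fin.sum_univ_three (f := fun j => (X j : ℂ) * pd j T.G v)]
  have e0 : (0 : Fin 3) ≠ 2 := by decide
  have e1 : (1 : Fin 3) ≠ 2 := by decide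
  rw [if_neg e0, if_neg e1, if_pos rfl]
  linear_combination pd 2 T.G v * hr' + pd 0 T.G v * ha' + pd 1 T.G v * hz'

/-- The metric of the tube in cylindrical coordinates. -/
theorem outerMetric_polarD {v : Fin 3 → ℝ} (hv : 0 < v 2) (X Y : Fin 3 → ℝ) :
    ∑ a, ∑ b, T.outerMetric (polar v) a b * (∑ j, X j * polarD v j a) * (∑ j, Y j * polarD v j b) =
      (T.speed (v 2) * X 2) * (T.speed (v 2) * Y 2) + profileF T.q (radial T.q (v 2)) ^ 2 *
        ((T.ℓ * (∑ j, (X j : ℂ) * pd j T.G v).re + T.τ * (∑ j, (X j : ℂ) * pd j T.G v).im) *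
          (T.ℓ * (∑ j, (Y j : ℂ) * pd j T.G v).re + T.τ * (∑ j, (Y j : ℂ) * pd j T.G v).im)) +
      profileK T.q (radial T.q (v 2)) ^ 2 * ((T.κ * (∑ j, (X j : ℂ) * pd j T.G v).im) *
        (T.κ * (∑ j, (Y j : ℂ) * pd j T.G v).im)) := by
  rw [← T.twist_polarD hv X, ← T.twist_polarD hv Y, ← (polarD_forms hv X).1,
    ← (polarD_forms hv Y).1]
  generalize hV : (fun a => ∑ j, X j * polarD v j a) = V
  generalize hW : (fun a => ∑ j, Y j * polarD v j a) = W
  have hV' : ∀ a, ∑ j, X j * polarD v j a = V a := congrFun hV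
  have hW' : ∀ a, ∑ j, Y j * polarD v j a = W a := congrFun hW
  simp only [hV', hW', outerMetric, Matrix.of_apply, formR, formA, formB, height,
    axisDist_polar hv.le, Fin.sum_univ_three, Complex.add_re, Complex.add_im, Complex.re_ofReal_mul,
    Complex.im_ofReal_mul]
  ring

end TubeData

/-- The slab is convex with interior, so the one-sided derivative at r = 0 is unique and agrees with
that of any extension. -/
theorem partialD_slab {δ : ℝ} (hδ : 0 < δ) {F : (Fin 3 → ℝ) → ℝ} {y : Fin 3 → ℝ} (hy : y ∈ slab δ)
    (hF : DifferentiableAt ℝ F y) (i : Fin 3) : partialD (slab δ) F i y = pd i F y := by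
  have hs : slab δ = (fun y : Fin 3 → ℝ => y 2) ⁻¹' Set.Ioc (-δ) 0 := rfl
  have hconv : Convex ℝ (slab δ) := by
    rw [hs]
    exact (convex_Ioc (-δ) 0).linear_preimage (LinearMap.proj (R := ℝ) (φ := fun _ : Fin 3 => ℝ) 2)
  have hint : (interior (slab δ)).Nonempty := by
    have ho : IsOpen ((fun y : Fin 3 → ℝ => y 2) ⁻¹' Set.Ioo (-δ) 0) :=
      isOpen_Ioo.preimage (continuous_apply 2)
    refine ⟨fun _ => -δ / 2, interior_maximal (fun z hz => ?_) ho ?_⟩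
    · exact ⟨hz.1, hz.2.le⟩
    · constructor <;> linarith
  rw [partialD, fderivWithin_eq_fderiv (uniqueDiffOn_convex hconv hint y hy) hF, pd]

/-- The collar coordinates of the tube. -/
def tubeCollar (q : ℝ) (y : Fin 3 → ℝ) : Fin 3 → ℝ := polar ![y 0, y 1, radius q (y 2)]

theorem contDiff_collarCoord (q : ℝ) (j : Fin 3) :
    ContDiff ℝ ∞ fun y : Fin 3 → ℝ => (![y 0, y 1, radius q (y 2)] : Fin 3 → ℝ) j := by
  fin_cases j
  · exact contDiff_apply ℝ ℝ 0
  · exact contDiff_apply ℝ ℝ 1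
  · exact (contDiff_radius q).comp (contDiff_apply ℝ ℝ 2)

theorem contDiff_tubeCollar (q : ℝ) : ContDiff ℝ ∞ (tubeCollar q) :=
  contDiff_pi.2 fun a => (contDiff_polar a).comp (contDiff_pi.2 (contDiff_collarCoord q))

theorem hasDerivAt_radius (q r : ℝ) :
    HasDerivAt (radius q) (Real.cosh (r - Real.log q) / slope q) r := by
  have := (((hasDerivAt_id r).sub_const (Real.log q)).sinh).div_const (slope q)
  simpa [radius] using! this

theorem pd_tubeCollar (q : ℝ) (y : Fin 3 → ℝ) (i a : Fin 3) :
    pd i (fun y => tubeCollar q y a) y =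
      ∑ j, (![if i = 0 then 1 else 0, if i = 1 then 1 else 0,
        Real.cosh (y 2 - Real.log q) / slope q * if i = 2 then 1 else 0] : Fin 3 → ℝ) j *
        polarD ![y 0, y 1, radius q (y 2)] j a := by
  have h := pd_comp (F := fun v => polar v a) (u := fun y => ![y 0, y 1, radius q (y 2)]) (x := y)
    ((contDiff_polar a).differentiable (by simp) _)
    (fun j => (contDiff_collarCoord q j).differentiable (by simp) y) i
  refine h.trans (Finset.sum_congr rfl fun j _ => ?_)
  rw [pd_polar, smul_eq_mul]
  congr 1
  fin_cases j
  · exact pd_coord i 0 y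
  · exact pd_coord i 1 y
  · refine (pd_comp_real (φ := radius q) (u := fun y => y 2)
      ((contDiff_radius q).differentiable (by simp)) (by fun_prop) i).trans ?_
    rw [(hasDerivAt_radius q _).deriv, pd_coord]
    rfl

theorem boundaryMap_eq_polar (x : Fin 2 → ℝ) : boundaryMap x = polar ![x 0, x 1, 1] := by
  ext i; fin_cases i <;> simp [boundaryMap, polar]

theorem pd_boundaryMap (x : Fin 2 → ℝ) (i : Fin 2) (a : Fin 3) :
    pd i (fun y => boundaryMap y a) x =
      ∑ j, (![if i = 0 then 1 else 0, if i = 1 then 1 else 0, 0] : Fin 3 → ℝ) j *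
        polarD ![x 0, x 1, 1] j a := by
  have hd : ∀ j : Fin 3, DifferentiableAt ℝ
      (fun y : Fin 2 → ℝ => (![y 0, y 1, 1] : Fin 3 → ℝ) j) x := fun j => by
    fin_cases j
    · exact differentiableAt_apply 0 x
    · exact differentiableAt_apply 1 x
    · exact differentiableAt_const _
  have h := pd_comp (F := fun v => polar v a) (u := fun y : Fin 2 → ℝ => ![y 0, y 1, 1]) (x := x)
    ((contDiff_polar a).differentiable (by simp) _) hd i
  simp only [boundaryMap_eq_polar]
  refine h.trans (Finset.sum_congr rfl fun j _ => ?_)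
  rw [pd_polar, smul_eq_mul]
  congr 1
  fin_cases j
  · exact pd_coord i 0 x
  · exact pd_coord i 1 x
  · exact pd_const i 1 x

theorem radius_zero {q : ℝ} (hq : 0 < q) (hq1 : q < 1 / 2) : radius q 0 = 1 := by
  rw [← radial_one hq, radius_radial hq hq1]

theorem tubeCollar_boundary {q : ℝ} (hq : 0 < q) (hq1 : q < 1 / 2) (x : Fin 2 → ℝ) :
    tubeCollar q ![x 0, x 1, 0] = boundaryMap x := by
  rw [boundaryMap_eq_polar, tubeCollar]
  simp only [Matrix.cons_val_zero, Matrix.cons_val_one, Matrix.cons_val]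
  rw [radius_zero hq hq1]

theorem strictMono_radius {q : ℝ} (hq : 0 < q) (hq1 : q < 1 / 2) : StrictMono (radius q) :=
  fun a b h => (strictMono_radial hq hq1).lt_iff_lt.1 (by
    rwa [radial_radius hq hq1, radial_radius hq hq1])

theorem tubeCollar_add_e_zero (q : ℝ) (y : Fin 3 → ℝ) : tubeCollar q (y + e 0) = tubeCollar q y := by
  have h0 : (y + e 0 : Fin 3 → ℝ) 0 = y 0 + 1 := by simp [e]
  have h1 : (y + e 0 : Fin 3 → ℝ) 1 = y 1 := by simp [e]
  have h2 : (y + e 0 : Fin 3 → ℝ) 2 = y 2 := by simp [e]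
  rw [tubeCollar, tubeCollar, h0, h1, h2, polar, polar]
  simp only [Matrix.cons_val_zero, Matrix.cons_val_one, Matrix.cons_val]
  rw [mul_add, mul_one, Real.cos_add_two_pi, Real.sin_add_two_pi]

theorem tubeCollar_add_e_one (q : ℝ) (y : Fin 3 → ℝ) :
    tubeCollar q (y + e 1) = tubeCollar q y + e 2 := by
  have h0 : (y + e 1 : Fin 3 → ℝ) 0 = y 0 := by simp [e]
  have h1 : (y + e 1 : Fin 3 → ℝ) 1 = y 1 + 1 := by simp [e]
  have h2 : (y + e 1 : Fin 3 → ℝ) 2 = y 2 := by simp [e]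
  rw [tubeCollar, tubeCollar, h0, h1, h2, polar, polar]
  ext i; fin_cases i <;> simp [e]

namespace TubeData

variable (T : TubeData)

/-- The isotopy near the boundary, where it ends at `Φ`. -/
theorem sum_pd_G {Φ : (Fin 2 → ℝ) → ℂ} (hΦ : Differentiable ℝ Φ)
    (hG : ∀ v, 3 / 4 ≤ v 2 → T.G v = Φ ![v 0, v 1]) {v : Fin 3 → ℝ} (hv : 3 / 4 < v 2)
    (X : Fin 3 → ℝ) : ∑ j, (X j : ℂ) * pd j T.G v =
      X 0 * pd 0 Φ ![v 0, v 1] + X 1 * pd 1 Φ ![v 0, v 1] := by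
  have hopen : IsOpen {v : Fin 3 → ℝ | 3 / 4 < v 2} := isOpen_Ioi.preimage (continuous_apply 2)
  have hp : ∀ j, pd j T.G v = (if j = 0 then 1 else 0) * pd 0 Φ ![v 0, v 1] +
      (if j = 1 then 1 else 0) * pd 1 Φ ![v 0, v 1] := fun j => by
    have hd : ∀ k : Fin 2, DifferentiableAt ℝ
        (fun v : Fin 3 → ℝ => (![v 0, v 1] : Fin 2 → ℝ) k) v := fun k => by
      fin_cases k
      · exact differentiableAt_apply 0 v
      · exact differentiableAt_apply 1 v
    rw [pd_congr hopen (fun v hv => hG v (le_of_lt hv)) hv,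
      pd_comp (F := Φ) (u := fun v : Fin 3 → ℝ => ![v 0, v 1]) (hΦ _) hd, Fin.sum_univ_two]
    have e0 : pd j (fun v : Fin 3 → ℝ => (![v 0, v 1] : Fin 2 → ℝ) 0) v = if j = 0 then 1 else 0 :=
      pd_coord j 0 v
    have e1 : pd j (fun v : Fin 3 → ℝ => (![v 0, v 1] : Fin 2 → ℝ) 1) v = if j = 1 then 1 else 0 :=
      pd_coord j 1 v
    rw [e0, e1]
    split_ifs <;> simp
  rw [Fin.sum_univ_three, hp, hp, hp]
  simp

/-- Near the boundary the isotopy has reached Φ and both profiles are eʳ. In the coordinate r the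
metric is therefore dr² + e²ʳ times the pullback by Φ of the linear metric, which is h. -/
theorem isCuspCollar {Φ : (Fin 2 → ℝ) → ℂ} (hΦ : Differentiable ℝ Φ)
    (hG : ∀ v, 3 / 4 ≤ v 2 → T.G v = Φ ![v 0, v 1]) {h : MetricField 2}
    (hh : ∀ x i j, h x i j =
      (T.ℓ * (pd i Φ x).re + T.τ * (pd i Φ x).im) * (T.ℓ * (pd j Φ x).re + T.τ * (pd j Φ x).im) +
        T.κ * (pd i Φ x).im * (T.κ * (pd j Φ x).im)) :
    ∃ δ, IsCuspCollar h T.metric δ (tubeCollar T.q) := by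
  have hq := T.q_pos
  have hq1 := T.q_lt
  have hr0 := radius_zero hq hq1
  have hmono := strictMono_radius hq hq1
  obtain ⟨ε, hε, hball⟩ := Metric.eventually_nhds_iff.1
    ((contDiff_radius T.q).continuous.continuousAt.eventually
      (lt_mem_nhds (by rw [hr0]; norm_num : (3 / 4 : ℝ) < radius T.q 0)))
  -- The bound 1/4 keeps r where the cut-off vanishes, and ε keeps the radius above 3/4, where the
  -- isotopy is finished.
  set δ := min (1 / 4) ε with hδdef
  have hδ : 0 < δ := by positivity
  have hδ4 : δ ≤ 1 / 4 := min_le_left _ _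
  have hrad : ∀ r, -δ < r → r ≤ 0 → 3 / 4 < radius T.q r ∧ radius T.q r ≤ 1 := fun r h1 h2 => by
    refine ⟨hball ?_, ?_⟩
    · rw [Real.dist_eq, sub_zero, abs_of_nonpos h2]
      have : δ ≤ ε := min_le_right _ _
      linarith
    · rw [← hr0]; exact hmono.monotone h2
  have hrpos : ∀ y ∈ slab δ, 0 < (![y 0, y 1, radius T.q (y 2)] : Fin 3 → ℝ) 2 := fun y hy => by
    show 0 < radius T.q (y 2)
    linarith [(hrad _ hy.1 hy.2).1]
  have hdist : ∀ y ∈ slab δ, axisDist (tubeCollar T.q y) = radius T.q (y 2) := fun y hy =>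
    axisDist_polar (hrpos y hy).le
  have hsmooth := contDiff_tubeCollar T.q
  refine ⟨δ, hδ, hsmooth.contDiffOn, fun y hy => ?_, fun y _ => ⟨tubeCollar_add_e_zero _ _,
    tubeCollar_add_e_one _ _⟩, fun y hy y' hy' m hm => ?_, fun x => ?_,
    tubeCollar_boundary hq hq1, fun y hy => ?_⟩
  · show tubeCollar T.q y 0 ^ 2 + tubeCollar T.q y 1 ^ 2 ≤ 1
    rw [← axisDist_sq, hdist y hy]
    have := hrad _ hy.1 hy.2
    exact pow_le_one₀ (by linarith) this.2
  · have hm' : tubeCollar T.q y' = polar ![y 0, y 1 + m, radius T.q (y 2)] := by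
      rw [hm]
      ext i; fin_cases i <;> simp [tubeCollar, polar, e]
    obtain ⟨k, hk⟩ := eq_of_polar_eq (v := ![y 0, y 1 + m, radius T.q (y 2)])
      (v' := ![y' 0, y' 1, radius T.q (y' 2)]) (hrpos y hy) (hrpos y' hy') hm'
    have k0 : y' 0 = y 0 + k := by simpa [e] using congrFun hk 0
    have k1 : y' 1 = y 1 + m := by simpa [e] using congrFun hk 1
    have k2 : radius T.q (y' 2) = radius T.q (y 2) := by simpa [e] using congrFun hk 2
    refine ⟨k, ?_⟩
    ext i; fin_cases i
    · simpa [e] using k0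
    · simpa [e] using k1
    · simpa [e] using hmono.injective k2
  · have hopen : IsOpen {p | radius T.q (-δ) < axisDist p} :=
      isOpen_Ioi.preimage continuous_axisDist
    have hx : radius T.q (-δ) < axisDist (boundaryMap x) := by
      rw [boundaryMap_eq_polar, axisDist_polar (by simp)]
      show radius T.q (-δ) < 1
      rw [← hr0]; exact hmono (by linarith)
    have hlim : 3 / 4 ≤ radius T.q (-δ) := by
      refine ge_of_tendsto (f := radius T.q) (x := 𝓝[>] (-δ))
        ((contDiff_radius T.q).continuous.continuousWithinAt) ?_
      filter_upwards [Ioo_mem_nhdsGT (by linarith : -δ < 0)] with r hr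
      exact (hrad r hr.1 hr.2.le).1.le
    refine mem_nhdsWithin.2 ⟨_, hopen, hx, fun p hp => ?_⟩
    have hp1 : axisDist p ≤ 1 := Real.sqrt_le_one.2 hp.2
    have hp2 : radius T.q (-δ) < axisDist p := hp.1
    refine ⟨![cyl p 0, cyl p 1, T.height p], ⟨?_, ?_⟩, ?_⟩
    · show -δ < radial T.q (axisDist p)
      rw [← radial_radius hq hq1 (-δ)]
      exact strictMono_radial hq hq1 hp2
    · show radial T.q (axisDist p) ≤ 0
      rw [← radial_one hq]; exact (strictMono_radial hq hq1).monotone hp1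
    · show polar ![cyl p 0, cyl p 1, radius T.q (radial T.q (axisDist p))] = p
      rw [radius_radial hq hq1]
      conv_rhs => rw [← polar_cyl p]
      congr 1
  · have hne : axisDist (tubeCollar T.q y) ≠ 0 := by rw [hdist y hy]; exact (hrpos y hy).ne'
    have hpd : ∀ i a, partialD (slab δ) (fun y => tubeCollar T.q y a) i y = _ := fun i a =>
      (partialD_slab hδ hy ((contDiff_pi.1 hsmooth a).differentiable (by simp) y) i).trans
        (pd_tubeCollar T.q y i a)
    have hc : cutoffExp (y 2) = 0 := cutoffExp_of_ge (by linarith [hy.1])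
    have hF : profileF T.q (y 2) = Real.exp (y 2) := by rw [profileF, hc]; ring
    have hK : profileK T.q (y 2) = Real.exp (y 2) := by rw [profileK, hc]; ring
    have hs := slope_pos hq hq1
    -- `radius` inverts `radial`, so their derivatives are reciprocal and the radial part becomes
    -- dr².
    have hsp : T.speed (radius T.q (y 2)) * (Real.cosh (y 2 - Real.log T.q) / slope T.q) = 1 := by
      have h1 : 1 + (slope T.q * radius T.q (y 2)) ^ 2 = Real.cosh (y 2 - Real.log T.q) ^ 2 := by
        rw [radius, mul_div_cancel₀ _ hs.ne', Real.cosh_sq]; ring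
      have h2 := Real.cosh_pos (y 2 - Real.log T.q)
      rw [speed, h1, Real.sqrt_sq h2.le]
      field_simp
    have hexp : Real.exp (2 * y 2) = Real.exp (y 2) ^ 2 := by rw [sq, ← Real.exp_add]; ring_nf
    have hb := (hrad _ hy.1 hy.2).1
    ext i j
    rw [pullback, Matrix.of_apply, T.metric_of_ne hne]
    simp only [hpd]
    rw [tubeCollar, T.outerMetric_polarD (hrpos y hy), T.sum_pd_G hΦ hG hb, T.sum_pd_G hΦ hG hb]
    simp only [Matrix.cons_val_zero, Matrix.cons_val_one, Matrix.cons_val]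
    rw [radial_radius hq hq1, hF, hK, ← mul_assoc (T.speed _), ← mul_assoc (T.speed _), hsp]
    fin_cases i <;> fin_cases j <;> simp [cuspMetric, hh, hexp] <;> ring

theorem pullback_boundaryMap {Φ : (Fin 2 → ℝ) → ℂ} (hΦ : Differentiable ℝ Φ)
    (hG : ∀ v, 3 / 4 ≤ v 2 → T.G v = Φ ![v 0, v 1]) {h : MetricField 2}
    (hh : ∀ x i j, h x i j =
      (T.ℓ * (pd i Φ x).re + T.τ * (pd i Φ x).im) * (T.ℓ * (pd j Φ x).re + T.τ * (pd j Φ x).im) +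
        T.κ * (pd i Φ x).im * (T.κ * (pd j Φ x).im)) (x : Fin 2 → ℝ) :
    pullback Set.univ boundaryMap T.metric x = h x := by
  have hpos : (0 : ℝ) < (![x 0, x 1, 1] : Fin 3 → ℝ) 2 := one_pos
  have hb : (3 / 4 : ℝ) < (![x 0, x 1, 1] : Fin 3 → ℝ) 2 := by
    show (3 / 4 : ℝ) < 1; norm_num
  have hne : axisDist (boundaryMap x) ≠ 0 := by
    rw [boundaryMap_eq_polar, axisDist_polar hpos.le]; exact hpos.ne'
  have hx : (![x 0, x 1] : Fin 2 → ℝ) = x := by ext i; fin_cases i <;> rfl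
  have hc : cutoffExp 0 = 0 := cutoffExp_of_ge (by norm_num)
  have hF : profileF T.q 0 = 1 := by rw [profileF, hc, Real.exp_zero]; ring
  have hK : profileK T.q 0 = 1 := by rw [profileK, hc, Real.exp_zero]; ring
  ext i j
  rw [pullback, Matrix.of_apply, T.metric_of_ne hne]
  simp only [partialD_eq_pd Filter.univ_mem, pd_boundaryMap]
  rw [boundaryMap_eq_polar, T.outerMetric_polarD hpos, T.sum_pd_G hΦ hG hb, T.sum_pd_G hΦ hG hb]
  simp only [Matrix.cons_val_zero, Matrix.cons_val_one, Matrix.cons_val]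
  rw [radial_one T.q_pos, hF, hK, hx, hh]
  fin_cases i <;> fin_cases j <;> simp

end TubeData

/-! ### Integration over the solid torus in cylindrical coordinates. -/

/-- A cell of the cylindrical coordinates. -/
def polarCell : Set (Fin 3 → ℝ) :=
  {v | 0 < v 2 ∧ v 2 < 1 ∧ ∀ i : Fin 2, v (Fin.castSucc i) ∈ Set.Ico (0 : ℝ) 1}

theorem measurableSet_polarCell : MeasurableSet polarCell := by
  have h : polarCell = {v : Fin 3 → ℝ | 0 < v 2} ∩ ({v | v 2 < 1} ∩
      ⋂ i : Fin 2, (fun v : Fin 3 → ℝ => v (Fin.castSucc i)) ⁻¹' Set.Ico (0 : ℝ) 1) := by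
    ext v; simp [polarCell]
  rw [h]
  exact (measurableSet_lt measurable_const (measurable_pi_apply 2)).inter
    ((measurableSet_lt (measurable_pi_apply 2) measurable_const).inter
      (MeasurableSet.iInter fun i => (measurable_pi_apply _) measurableSet_Ico))

theorem polar_sub_int (v : Fin 3 → ℝ) (n : ℤ) : polar ![v 0 - n, v 1, v 2] = polar v := by
  have h : 2 * Real.pi * (v 0 - n) = 2 * Real.pi * v 0 - n * (2 * Real.pi) := by ring
  rw [polar, polar]
  simp only [Matrix.cons_val_zero, Matrix.cons_val_one, Matrix.cons_val]
  rw [h, Real.cos_sub_int_mul_two_pi, Real.sin_sub_int_mul_two_pi]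

theorem injOn_polar : Set.InjOn polar polarCell := fun v hv v' hv' h => by
  obtain ⟨n, hn⟩ := eq_of_polar_eq hv'.1 hv.1 h
  have h0 : v 0 = v' 0 + n := by simpa [e] using congrFun hn 0
  have h1 : 0 ≤ v 0 ∧ v 0 < 1 := hv.2.2 0
  have h2 : 0 ≤ v' 0 ∧ v' 0 < 1 := hv'.2.2 0
  have h3 : (n : ℝ) < 1 := by linarith
  have h4 : (-1 : ℝ) < n := by linarith
  have h5 : n < 1 := by exact_mod_cast h3
  have h6 : -1 < n := by exact_mod_cast h4
  have h7 : n = 0 := by omega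
  rw [hn, h7]; simp

theorem image_polar : polar '' polarCell =
    fundamentalDomain ∩ {p | 0 < axisDist p ∧ axisDist p < 1} := by
  ext p
  constructor
  · rintro ⟨v, hv, rfl⟩
    have hd := axisDist_polar hv.1.le
    have h1 : 0 ≤ v 1 ∧ v 1 < 1 := hv.2.2 1
    refine ⟨⟨?_, h1.1, h1.2⟩, ?_, ?_⟩
    · show polar v 0 ^ 2 + polar v 1 ^ 2 ≤ 1
      rw [← axisDist_sq, hd]; exact pow_le_one₀ hv.1.le hv.2.1.le
    · rw [hd]; exact hv.1
    · rw [hd]; exact hv.2.1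
  · rintro ⟨hp, h0, h1⟩
    refine ⟨![cyl p 0 - ⌊cyl p 0⌋, p 2, axisDist p], ⟨h0, h1, fun i => ?_⟩, ?_⟩
    · fin_cases i
      · exact ⟨Int.fract_nonneg (cyl p 0), Int.fract_lt_one (cyl p 0)⟩
      · exact hp.2
    · exact (polar_sub_int (cyl p) _).trans (polar_cyl p)

/-- The set is contained in the smooth image of a coordinate hyperplane. It is used for the axis and
for the boundary, both of which the polar cell omits. -/
theorem volume_axisDist_eq (c : ℝ) : MeasureTheory.volume {p | axisDist p = c} = 0 := by
  have h : {p | axisDist p = c} ⊆ polar '' {v | v 2 = c} := fun p hp => ⟨cyl p, hp, polar_cyl p⟩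
  refine MeasureTheory.measure_mono_null h ?_
  refine MeasureTheory.addHaar_image_eq_zero_of_differentiableOn_of_addHaar_eq_zero _
    ((contDiff_pi.2 contDiff_polar).differentiable (by simp)).differentiableOn ?_
  exact MeasureTheory.Measure.pi_hyperplane
    (fun _ : Fin 3 => (MeasureTheory.volume : MeasureTheory.Measure ℝ)) 2 c

theorem fundamentalDomain_ae_eq :
    fundamentalDomain =ᵐ[MeasureTheory.volume] polar '' polarCell := by
  have h0 := MeasureTheory.measure_eq_zero_iff_ae_notMem.1 (volume_axisDist_eq 0)
  have h1 := MeasureTheory.measure_eq_zero_iff_ae_notMem.1 (volume_axisDist_eq 1)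
  rw [image_polar]
  filter_upwards [h0, h1] with p hp0 hp1
  apply propext
  show p ∈ fundamentalDomain ↔ p ∈ fundamentalDomain ∩ {p | 0 < axisDist p ∧ axisDist p < 1}
  refine ⟨fun hp => ⟨hp, TubeData.axisDist_pos hp0, ?_⟩, fun hp => hp.1⟩
  exact lt_of_le_of_ne (Real.sqrt_le_one.2 hp.1) hp1

theorem det_fderiv_polar (v : Fin 3 → ℝ) :
    (fderiv ℝ polar v).det = 2 * Real.pi * v 2 := by
  have hd : ∀ a, DifferentiableAt ℝ (fun v => polar v a) v := fun a =>
    (contDiff_polar a).differentiable (by simp) v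
  have h : LinearMap.toMatrix' (fderiv ℝ polar v : (Fin 3 → ℝ) →ₗ[ℝ] Fin 3 → ℝ) =
      (polarD v).transpose := by
    ext a i
    rw [LinearMap.toMatrix'_apply, Matrix.transpose_apply, ← pd_polar, pd,
      (hasFDerivAt_pi.2 fun a => (hd a).hasFDerivAt).fderiv]
    rfl
  rw [ContinuousLinearMap.det, ← LinearMap.det_toMatrix', h, Matrix.det_transpose,
    Matrix.det_fin_three]
  simp [polarD]
  linear_combination 2 * Real.pi * v 2 * Real.cos_sq_add_sin_sq (2 * Real.pi * v 0)

theorem integrableOn_fundamentalDomain_iff (f : (Fin 3 → ℝ) → ℝ) :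
    MeasureTheory.IntegrableOn f fundamentalDomain ↔
      MeasureTheory.IntegrableOn (fun v => 2 * Real.pi * v 2 * f (polar v)) polarCell := by
  rw [MeasureTheory.integrableOn_congr_set_ae fundamentalDomain_ae_eq,
    MeasureTheory.integrableOn_image_iff_integrableOn_abs_det_fderiv_smul _ measurableSet_polarCell
      (fun v _ => (((contDiff_pi.2 contDiff_polar).differentiable
        (by simp)) v).hasFDerivAt.hasFDerivWithinAt) injOn_polar]
  refine MeasureTheory.integrableOn_congr_fun (fun v hv => ?_) measurableSet_polarCell
  have := hv.1
  simp only [det_fderiv_polar, smul_eq_mul]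
  rw [abs_of_nonneg (by positivity)]

theorem integral_fundamentalDomain (f : (Fin 3 → ℝ) → ℝ) :
    ∫ p in fundamentalDomain, f p = ∫ v in polarCell, 2 * Real.pi * v 2 * f (polar v) := by
  rw [MeasureTheory.setIntegral_congr_set fundamentalDomain_ae_eq,
    MeasureTheory.integral_image_eq_integral_abs_det_fderiv_smul _ measurableSet_polarCell
      (fun v _ => (((contDiff_pi.2 contDiff_polar).differentiable
        (by simp)) v).hasFDerivAt.hasFDerivWithinAt) injOn_polar]
  refine MeasureTheory.setIntegral_congr_fun measurableSet_polarCell fun v hv => ?_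
  have := hv.1
  simp only [det_fderiv_polar, smul_eq_mul]
  rw [abs_of_nonneg (by positivity)]

theorem integrableOn_polarCell {f : (Fin 3 → ℝ) → ℝ} (hf : Continuous f) :
    MeasureTheory.IntegrableOn f polarCell := by
  refine (hf.continuousOn.integrableOn_compact
    (isCompact_univ_pi fun _ : Fin 3 => isCompact_Icc (a := (0 : ℝ)) (b := 1))).mono_set ?_
  intro v hv i _
  fin_cases i
  · exact ⟨(hv.2.2 0).1, (hv.2.2 0).2.le⟩
  · exact ⟨(hv.2.2 1).1, (hv.2.2 1).2.le⟩
  · exact ⟨hv.1.le, hv.2.1.le⟩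

theorem integral_polarCell {f : (Fin 3 → ℝ) → ℝ} (hf : Continuous f) :
    ∫ v in polarCell, f v = ∫ r in (0 : ℝ)..1, cellInt fun x => f ![x 0, x 1, r] := by
  set E := MeasurableEquiv.piFinSuccAbove (fun _ : Fin 3 => ℝ) 2
  set S : Set (Fin 2 → ℝ) := {x | ∀ i, x i ∈ Set.Ico (0 : ℝ) 1}
  set F : ℝ × (Fin 2 → ℝ) → ℝ := fun p => f ![p.2 0, p.2 1, p.1]
  have hF : Continuous F := hf.comp (continuous_pi fun i => by fin_cases i <;> simp <;> fun_prop)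
  have hpre : E ⁻¹' (Set.Ioo 0 1 ×ˢ S) = polarCell := by
    ext v
    constructor
    · rintro ⟨h1, h2⟩
      refine ⟨h1.1, h1.2, fun i => ?_⟩
      fin_cases i
      · exact h2 0
      · exact h2 1
    · rintro ⟨h1, h2, h3⟩
      refine ⟨⟨h1, h2⟩, fun i => ?_⟩
      fin_cases i
      · exact h3 0
      · exact h3 1
  have hFE : ∀ v, F (E v) = f v := fun v => by
    show f _ = f v
    congr 1
    ext i; fin_cases i <;> rfl
  have h1 := (MeasureTheory.volume_preserving_piFinSuccAbove (fun _ : Fin 3 => ℝ)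
    2).setIntegral_preimage_emb E.measurableEmbedding F (Set.Ioo 0 1 ×ˢ S)
  have hint : MeasureTheory.IntegrableOn F (Set.Ioo 0 1 ×ˢ S) :=
    (hF.continuousOn.integrableOn_compact (isCompact_Icc.prod
      (isCompact_univ_pi fun _ : Fin 2 => isCompact_Icc (a := (0 : ℝ)) (b := 1)))).mono_set
      (Set.prod_mono Set.Ioo_subset_Icc_self fun x hx i _ => Set.Ico_subset_Icc_self (hx i))
  rw [MeasureTheory.Measure.volume_eq_prod] at hint
  rw [← hpre]
  calc ∫ v in E ⁻¹' (Set.Ioo 0 1 ×ˢ S), f v = ∫ v in E ⁻¹' (Set.Ioo 0 1 ×ˢ S), F (E v) := by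
        simp only [hFE]
    _ = ∫ p in Set.Ioo 0 1 ×ˢ S, F p := h1
    _ = ∫ r in Set.Ioo (0 : ℝ) 1, ∫ x in S, F (r, x) := by
        rw [MeasureTheory.Measure.volume_eq_prod]; exact MeasureTheory.setIntegral_prod F hint
    _ = ∫ r in Set.Ioo (0 : ℝ) 1, cellInt fun x => f ![x 0, x 1, r] := by
        refine MeasureTheory.setIntegral_congr_fun measurableSet_Ioo fun r _ => ?_
        exact setIntegral_square_eq_cellInt (hF.comp (by fun_prop : Continuous fun x => (r, x)))
          MeasureTheory.Ico_ae_eq_Ioc Set.Ico_subset_Icc_self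
    _ = _ := by
        rw [intervalIntegral.integral_of_le zero_le_one, MeasureTheory.integral_Ioc_eq_integral_Ioo]

/-- The quotients need not be continuous where a profile vanishes, as f does at the core.
Measurability is enough, since the integrand is dominated by a continuous function. -/
theorem measurable_curvatureRatio {f k : ℝ → ℝ} (hf : ContDiff ℝ ∞ f) (hk : ContDiff ℝ ∞ k) :
    Measurable (curvatureRatio f k) := by
  have hf1 := (contDiff_infty_iff_deriv.1 hf).2
  have hk1 := (contDiff_infty_iff_deriv.1 hk).2
  have hf2 := (contDiff_infty_iff_deriv.1 hf1).2.continuous.measurable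
  have hk2 := (contDiff_infty_iff_deriv.1 hk1).2.continuous.measurable
  have hf0 := hf.continuous.measurable
  have hk0 := hk.continuous.measurable
  exact (((hf2.div hf0).add (hk2.div hk0)).add
    ((hf1.continuous.measurable.mul hk1.continuous.measurable).div (hf0.mul hk0))).div_const 3

namespace TubeData

variable (T : TubeData)

theorem continuous_jacG : Continuous T.jacG := by
  have h : ∀ i, Continuous (pd i T.G) := fun i =>
    (ContDiff.pd (m := 0) T.smooth (by simp) i).continuous
  exact Complex.continuous_im.comp ((Complex.continuous_conj.comp (h 0)).mul (h 1))

theorem continuous_speed : Continuous T.speed :=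
  continuous_const.div (by fun_prop) fun ρ => (Real.sqrt_pos.2 (by positivity)).ne'

/-- Each slice of the isotopy has periods 1 and i, so its Jacobian has mean one. This makes the
integral independent of the isotopy. -/
theorem cellInt_jacG (r : ℝ) : cellInt (fun x => T.jacG ![x 0, x 1, r]) = 1 := by
  let Φ : (Fin 2 → ℝ) → ℂ := fun x => T.G ![x 0, x 1, r]
  have hu : ∀ j : Fin 3, ContDiff ℝ ∞ fun x : Fin 2 → ℝ => (![x 0, x 1, r] : Fin 3 → ℝ) j :=
    fun j => by
      fin_cases j
      · exact contDiff_apply ℝ ℝ 0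
      · exact contDiff_apply ℝ ℝ 1
      · exact contDiff_const
  have hΦ : ContDiff ℝ ∞ Φ := T.smooth.comp (contDiff_pi.2 hu)
  have hpd : ∀ (i : Fin 2) x, pd i Φ x = pd (Fin.castSucc i) T.G ![x 0, x 1, r] := fun i x => by
    have h := pd_comp (F := T.G) (u := fun x : Fin 2 → ℝ => ![x 0, x 1, r]) (x := x)
      (T.differentiable _) (fun j => (hu j).differentiable (by simp) x) i
    have e0 : pd i (fun x : Fin 2 → ℝ => (![x 0, x 1, r] : Fin 3 → ℝ) 0) x = if i = 0 then 1 else 0 :=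
      pd_coord i 0 x
    have e1 : pd i (fun x : Fin 2 → ℝ => (![x 0, x 1, r] : Fin 3 → ℝ) 1) x = if i = 1 then 1 else 0 :=
      pd_coord i 1 x
    have e2 : pd i (fun x : Fin 2 → ℝ => (![x 0, x 1, r] : Fin 3 → ℝ) 2) x = 0 := pd_const i r x
    rw [Fin.sum_univ_three, e0, e1, e2] at h
    refine h.trans ?_
    fin_cases i <;> simp
  have hj : (fun x => T.jacG ![x 0, x 1, r]) = jac Φ := by
    ext x; rw [jac, hpd, hpd]; rfl
  rw [hj, cellInt_jac (contDiff_infty.1 hΦ 2) (a := 1) (b := Complex.I)]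
  · simp
  · intro x
    show T.G _ = T.G _ + 1
    rw [← T.add_e_zero]
    congr 1; ext i; fin_cases i <;> simp [e]
  · intro x
    show T.G _ = T.G _ + Complex.I
    rw [← T.add_e_one]
    congr 1; ext i; fin_cases i <;> simp [e]

/-- The integrand in cylindrical coordinates. -/
theorem scalarIntegrand_polar {v : Fin 3 → ℝ} (h0 : 0 < v 2) (h1 : v 2 < 1) :
    2 * Real.pi * v 2 * scalarIntegrand T.metric (polar v) =
      |curvatureRatio (profileF T.q) (profileK T.q) (radial T.q (v 2))| ^ (3 / 2 : ℝ) *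
        (profileF T.q (radial T.q (v 2)) * profileK T.q (radial T.q (v 2))) *
        (T.speed (v 2) * (T.ℓ * T.κ) * T.jacG v) := by
  have hd := axisDist_polar h0.le
  have hne : axisDist (polar v) ≠ 0 := by rw [hd]; exact h0.ne'
  have hS : solidCylinder ∈ 𝓝 (polar v) := by
    have ho : IsOpen {p | axisDist p < 1} := isOpen_Iio.preimage continuous_axisDist
    refine Filter.mem_of_superset (ho.mem_nhds (by rw [Set.mem_ofPred_eq, hd]; exact h1)) fun p hp => ?_
    show p 0 ^ 2 + p 1 ^ 2 ≤ 1
    rw [← axisDist_sq]; exact pow_le_one₀ (Real.sqrt_nonneg _) (le_of_lt hp)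
  have hh : T.height (polar v) = radial T.q (v 2) := by rw [height, hd]
  have hj : T.jacG (cyl (polar v)) = T.jacG v := by
    obtain ⟨n, hn⟩ := cyl_polar h0
    rw [jacG, jacG, hn, T.pd_add_zsmul, T.pd_add_zsmul]
  have hF := T.profileF_height_pos hne
  have hdet := T.det_pos hne
  rw [scalarIntegrand, T.scalarCurvature_outerMetric hne hS fun y hy => T.metric_of_ne hy, volDensity,
    T.metric_of_ne hne, T.det_outerMetric hne,
    Real.sqrt_sq (mul_pos (mul_pos hF (profileK_pos _ _)) hdet).le, hh, hj, hd, abs_mul,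
    abs_neg, abs_of_pos (by norm_num : (0 : ℝ) < 6), mul_div_cancel_left₀ _ (by norm_num)]
  have hpi := Real.pi_ne_zero
  field_simp

/-- In cylindrical coordinates the integrand is dominated by C e²ʳ dr times ℓκ times the Jacobian of
a slice. Fubini with the radius outermost removes that Jacobian and leaves the integral of e²ʳ. -/
theorem integral_scalarIntegrand_le {C : ℝ}
    (hC : ∀ r, Real.log T.q < r → r ≤ 0 →
      |curvatureRatio (profileF T.q) (profileK T.q) r| ^ (3 / 2 : ℝ) *
        (profileF T.q r * profileK T.q r) ≤ C * Real.exp (2 * r)) :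
    MeasureTheory.IntegrableOn (scalarIntegrand T.metric) fundamentalDomain ∧
      ∫ p in fundamentalDomain, scalarIntegrand T.metric p ≤
        T.ℓ * T.κ / 2 * (1 - T.q ^ 2) * C := by
  have hq := T.q_pos
  have hq1 := T.q_lt
  set J : (Fin 3 → ℝ) → ℝ := fun v =>
    |curvatureRatio (profileF T.q) (profileK T.q) (radial T.q (v 2))| ^ (3 / 2 : ℝ) *
        (profileF T.q (radial T.q (v 2)) * profileK T.q (radial T.q (v 2))) *
        (T.speed (v 2) * (T.ℓ * T.κ) * T.jacG v) with hJ
  set B : (Fin 3 → ℝ) → ℝ := fun v =>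
    (C * Real.exp (2 * radial T.q (v 2)) * (T.speed (v 2) * (T.ℓ * T.κ))) * T.jacG v with hB
  have hrad : Continuous (radial T.q) := (contDiff_radial T.q).continuous
  have hr2 : Continuous fun v : Fin 3 → ℝ => radial T.q (v 2) := hrad.comp (continuous_apply 2)
  have hs2 : Continuous fun v : Fin 3 → ℝ => T.speed (v 2) := T.continuous_speed.comp (continuous_apply 2)
  have hBc : Continuous B :=
    ((continuous_const.mul (Real.continuous_exp.comp (continuous_const.mul hr2))).mul
      (hs2.mul continuous_const)).mul T.continuous_jacG
  have hFm := (contDiff_profileF T.q).continuous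
  have hKm := (contDiff_profileK T.q).continuous
  have hJm : Measurable J :=
    (((continuous_abs.measurable.comp ((measurable_curvatureRatio (contDiff_profileF T.q)
      (contDiff_profileK T.q)).comp hr2.measurable)).pow_const _).mul
      ((hFm.comp hr2).mul (hKm.comp hr2)).measurable).mul
      ((hs2.mul continuous_const).mul T.continuous_jacG).measurable
  have hlk : 0 < T.ℓ * T.κ := mul_pos T.ℓ_pos T.κ_pos
  have hle : ∀ v ∈ polarCell, 0 ≤ J v ∧ J v ≤ B v := fun v hv => by
    have hlog := log_lt_radial hq hq1 hv.1
    have hr0 : radial T.q (v 2) ≤ 0 := by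
      rw [← radial_one hq]; exact (strictMono_radial hq hq1).monotone hv.2.1.le
    have hw : 0 < T.speed (v 2) * (T.ℓ * T.κ) * T.jacG v :=
      mul_pos (mul_pos (T.speed_pos _) hlk) (T.jac_pos v)
    refine ⟨mul_nonneg (mul_nonneg (Real.rpow_nonneg (abs_nonneg _) _)
      (mul_pos (profileF_pos hq hlog) (profileK_pos _ _)).le) hw.le, ?_⟩
    calc J v ≤ C * Real.exp (2 * radial T.q (v 2)) * (T.speed (v 2) * (T.ℓ * T.κ) * T.jacG v) :=
          mul_le_mul_of_nonneg_right (hC _ hlog hr0) hw.le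
      _ = B v := by rw [hB]; ring
  have hBi := integrableOn_polarCell hBc
  have hJi : MeasureTheory.IntegrableOn J polarCell := by
    refine MeasureTheory.Integrable.mono' hBi hJm.aestronglyMeasurable ?_
    refine (MeasureTheory.ae_restrict_iff' measurableSet_polarCell).2
      (Filter.Eventually.of_forall fun v hv => ?_)
    rw [Real.norm_of_nonneg (hle v hv).1]; exact (hle v hv).2
  have heq : Set.EqOn (fun v => 2 * Real.pi * v 2 * scalarIntegrand T.metric (polar v)) J polarCell :=
    fun v hv => T.scalarIntegrand_polar hv.1 hv.2.1
  rw [integrableOn_fundamentalDomain_iff, integral_fundamentalDomain]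
  refine ⟨hJi.congr_fun heq.symm measurableSet_polarCell, ?_⟩
  rw [MeasureTheory.setIntegral_congr_fun measurableSet_polarCell heq]
  have hinner : ∀ r : ℝ, cellInt (fun x => B ![x 0, x 1, r]) =
      (T.ℓ * T.κ * C) * (Real.exp (2 * radial T.q r) *
        (slope T.q / Real.sqrt (1 + (slope T.q * r) ^ 2))) := fun r => by
    have h := T.cellInt_jacG r
    simp only [cellInt] at h ⊢
    have h1 : ∀ x y : ℝ, B ![(![x, y] : Fin 2 → ℝ) 0, (![x, y] : Fin 2 → ℝ) 1, r] =
        (C * Real.exp (2 * radial T.q r) * (T.speed r * (T.ℓ * T.κ))) *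
          T.jacG ![(![x, y] : Fin 2 → ℝ) 0, (![x, y] : Fin 2 → ℝ) 1, r] := fun x y => rfl
    simp only [h1, intervalIntegral.integral_const_mul]
    rw [h, speed]; ring
  calc ∫ v in polarCell, J v ≤ ∫ v in polarCell, B v :=
        MeasureTheory.setIntegral_mono_on hJi hBi measurableSet_polarCell fun v hv => (hle v hv).2
    _ = ∫ r in (0 : ℝ)..1, cellInt fun x => B ![x 0, x 1, r] := integral_polarCell hBc
    _ = T.ℓ * T.κ / 2 * (1 - T.q ^ 2) * C := by
        simp only [hinner, intervalIntegral.integral_const_mul]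
        rw [integral_exp_radial hq]; ring

end TubeData

/-! ### Assembly. -/

/-- The tube bounded by a given flat torus. -/
theorem exists_tubeData {ℓ τ κ : ℝ} (hℓ : 2 * Real.pi < ℓ) (hκ : 0 < κ) {Φ : (Fin 2 → ℝ) → ℂ}
    (hΦ : ContDiff ℝ ∞ Φ) (eΦ : LatticeEquivariant Φ) (hj : ∀ x, 0 < jac Φ x) :
    ∃ T : TubeData, T.ℓ = ℓ ∧ T.τ = τ ∧ T.κ = κ ∧ T.q = Real.pi / ℓ ∧
      ∀ v, 3 / 4 ≤ v 2 → T.G v = Φ ![v 0, v 1] := by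
  obtain ⟨Y, hY, eY, jY, hY0, hY1⟩ := exists_isotopy hΦ eΦ hj
  have hpi := Real.pi_pos
  have hℓ0 : 0 < ℓ := by linarith
  -- The time 4ρ − 2 is 0 at radius 1/2 and 1 at radius 3/4, so the isotopy starts away from the
  -- axis and ends before the boundary.
  let u : (Fin 3 → ℝ) → (Fin 2 → ℝ) × ℝ := fun v => (![v 0, v 1], 4 * v 2 - 2)
  have hu0 : ∀ k : Fin 2, ContDiff ℝ ∞ fun v : Fin 3 → ℝ => (![v 0, v 1] : Fin 2 → ℝ) k := fun k => by
    fin_cases k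
    · exact contDiff_apply ℝ ℝ 0
    · exact contDiff_apply ℝ ℝ 1
  have hu : ContDiff ℝ ∞ u := (contDiff_pi.2 hu0).prodMk
    ((contDiff_const.mul (contDiff_apply ℝ ℝ 2)).sub contDiff_const)
  let G : (Fin 3 → ℝ) → ℂ := fun v => Y ![v 0, v 1] (4 * v 2 - 2)
  have hG : ContDiff ℝ ∞ G := hY.comp hu
  have hslice : ∀ v (i : Fin 2), pd (Fin.castSucc i) G v =
      pd i (fun x => Y x (4 * v 2 - 2)) ![v 0, v 1] := fun v i => by
    have hw : ∀ j : Fin 3, DifferentiableAt ℝ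
        (fun x : Fin 2 → ℝ => (![x 0, x 1, v 2] : Fin 3 → ℝ) j) ![v 0, v 1] := fun j => by
      fin_cases j
      · exact differentiableAt_apply 0 _
      · exact differentiableAt_apply 1 _
      · exact differentiableAt_const _
    have h := pd_comp (F := G) (u := fun x : Fin 2 → ℝ => ![x 0, x 1, v 2]) (x := ![v 0, v 1])
      (hG.differentiable (by simp) _) hw i
    have e0 : pd i (fun x : Fin 2 → ℝ => (![x 0, x 1, v 2] : Fin 3 → ℝ) 0) ![v 0, v 1] =
      if i = 0 then 1 else 0 := pd_coord i 0 _
    have e1 : pd i (fun x : Fin 2 → ℝ => (![x 0, x 1, v 2] : Fin 3 → ℝ) 1) ![v 0, v 1] =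
      if i = 1 then 1 else 0 := pd_coord i 1 _
    have e2 : pd i (fun x : Fin 2 → ℝ => (![x 0, x 1, v 2] : Fin 3 → ℝ) 2) ![v 0, v 1] = 0 :=
      pd_const i (v 2) _
    have hv : (![(![v 0, v 1] : Fin 2 → ℝ) 0, (![v 0, v 1] : Fin 2 → ℝ) 1, v 2] : Fin 3 → ℝ) = v := by
      ext j; fin_cases j <;> rfl
    have hx : (fun x : Fin 2 → ℝ => G ![x 0, x 1, v 2]) = fun x => Y x (4 * v 2 - 2) := by
      ext x
      show Y ![x 0, x 1] (4 * v 2 - 2) = _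
      congr 1; ext j; fin_cases j <;> rfl
    rw [Fin.sum_univ_three, e0, e1, e2, hv, hx] at h
    rw [h]
    fin_cases i <;> simp
  have hmk : ∀ (v : Fin 3 → ℝ) (i : Fin 2), (![(v + e (Fin.castSucc i) : Fin 3 → ℝ) 0,
      (v + e (Fin.castSucc i) : Fin 3 → ℝ) 1] : Fin 2 → ℝ) = ![v 0, v 1] + e i := fun v i => by
    ext j; fin_cases i <;> fin_cases j <;> simp [e]
  have hmk2 : ∀ (v : Fin 3 → ℝ) (i : Fin 2), (v + e (Fin.castSucc i) : Fin 3 → ℝ) 2 = v 2 :=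
    fun v i => by fin_cases i <;> simp [e]
  refine ⟨⟨Real.pi / ℓ, ℓ, τ, κ, G, by positivity, ?_, div_mul_cancel₀ _ hℓ0.ne', hκ, hG, fun v => ?_,
    fun v => ?_, fun v => ?_, fun v hv => ?_⟩, rfl, rfl, rfl, rfl, fun v hv => ?_⟩
  · rw [div_lt_iff₀ hℓ0]; linarith
  · show Y _ (4 * (v + e (Fin.castSucc 0) : Fin 3 → ℝ) 2 - 2) = _
    rw [hmk2]
    exact (congrArg (fun x => Y x (4 * v 2 - 2)) (hmk v 0)).trans (eY _ _).1
  · show Y _ (4 * (v + e (Fin.castSucc 1) : Fin 3 → ℝ) 2 - 2) = _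
    rw [hmk2]
    exact (congrArg (fun x => Y x (4 * v 2 - 2)) (hmk v 1)).trans (eY _ _).2
  · have h := jY (4 * v 2 - 2) ![v 0, v 1]
    rw [jac, ← hslice, ← hslice] at h
    exact h
  · exact hY0 _ (by linarith) _
  · exact hY1 _ (by linarith) _

end TubeMetric

end

theorem mainTheorem4 :
    ∃ c : ℝ, 0 < c ∧
      ∀ (h : TubeMetric.MetricField 2) (A : ℝ) (γ : ℝ → Fin 2 → ℝ) (ℓ : ℝ),
        TubeMetric.IsFlatBoundaryMetric h →
        TubeMetric.boundaryArea h = A →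
        TubeMetric.IsMeridianGeodesic h γ →
        TubeMetric.loopLength h γ = ℓ →
        2 * Real.pi < ℓ →
        ∃ g : TubeMetric.MetricField 3,
          TubeMetric.IsSolidTorusMetric g ∧
          (∃ (δ : ℝ) (Ψ : (Fin 3 → ℝ) → (Fin 3 → ℝ)), TubeMetric.IsCuspCollar h g δ Ψ) ∧
          (∀ x, TubeMetric.pullback Set.univ TubeMetric.boundaryMap g x = h x) ∧
          MeasureTheory.IntegrableOn (TubeMetric.scalarIntegrand g)
            TubeMetric.fundamentalDomain ∧
          ∫ p in TubeMetric.fundamentalDomain, TubeMetric.scalarIntegrand g p ≤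
            A / 2 * (1 - Real.pi ^ 2 / ℓ ^ 2) * (1 + c * (Real.pi ^ 4 / ℓ ^ 4)) := by
  open TubeMetric in
  obtain ⟨K, hK, hbound⟩ := exists_profile_bound
  -- The universal constant is that of the profile bound, which involves neither the torus nor ℓ.
  refine ⟨K, hK, fun h A γ ℓ hh hA hγ hℓ hℓ2 => ?_⟩
  obtain ⟨τ, κ, Φ, -, hκ, harea, hΦ, eΦ, jΦ, hform⟩ := hh.exists_structure hγ
  rw [hℓ] at harea hform
  obtain ⟨T, rfl, rfl, rfl, hq, hG⟩ := exists_tubeData (τ := τ) hℓ2 hκ hΦ eΦ jΦ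
  have hd : Differentiable ℝ Φ := hΦ.differentiable (by simp)
  obtain ⟨δ, hδ⟩ := T.isCuspCollar hd hG hform
  obtain ⟨hint, hle⟩ := T.integral_scalarIntegrand_le fun r => hbound T.q r T.q_pos T.q_lt
  refine ⟨T.metric, T.isSolidTorusMetric, ⟨δ, _, hδ⟩, T.pullback_boundaryMap hd hG hform, hint, ?_⟩
  rw [← hA, harea, ← div_pow, ← div_pow, ← hq]
  exact hle
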